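/- **Setting.** Let $u(x,t)$, $x\in\mathbb R$, $t\ge 0$, be a classical solution of the Cauchy problem for the modified Camassa–Holm equation $$m_t+\big((u^2-u_x^2)m\big)_x=0\quad(t>0),\qquad m:=u-u_{xx},\qquad u(x,0)=u_0(x),$$ with $u(x,t)\to1$ as $x\to\pm\infty$ for every $t\ge0$. Here "classical" means that $u(\cdot,t)\in C^3(\mathbb R)$ for $t\ge 0$, that $u,u_x,u_{xx},u_{xxx}$ are continuous on $\mathbb R\times[0,\infty)$, and that for $t>0$ the derivative $m_t$ exists and the equation holds. Assume that $m-1=O((1+|x|)^{-4})$ uniformly for $t$ in every interval $[0,T]$, and that $m_0:=u_0-u_0''>0$ on $\mathbb R$. **Spectral data of $u_0$.** Let $\sigma_1,\sigma_2,\sigma_3$ be the Pauli matrices, and put $\theta(\mu)=\frac{i(\mu^2-1)}{4\mu}$ and $$\hat U(x,\mu)=\frac{i(\mu^2+1)(m_0(x)-1)}{2(\mu^2-1)}\begin{pmatrix}0&1\\-1&0\end{pmatrix}-\frac{i\mu(m_0(x)-1)}{\mu^2-1}\sigma_3 .$$ Let $\Phi_\pm(x,\mu)$ be the matrices whose columns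 are the bounded continuous solutions of $$\Phi_\pm(x,\mu)=I+\int_{\pm\infty}^x e^{\theta(\mu)\int_x^\xi m_0\,d\eta\,\sigma_3}\,\hat U(\xi,\mu)\Phi_\pm(\xi,\mu)\,e^{-\theta(\mu)\int_x^\xi m_0\,d\eta\,\sigma_3}\,d\xi ;$$ the columns $\Phi_-^{(1)},\Phi_+^{(2)}$ are considered for $\operatorname{Im}\mu\ge0$, the columns $\Phi_+^{(1)},\Phi_-^{(2)}$ for $\operatorname{Im}\mu\le0$, with $\mu\ne0,\pm1$. Put $p_0(x,\mu)=\theta(\mu)\big(x-\int_x^\infty(m_0-1)\,d\xi\big)$. The functions $a$ and $b$ are defined by $$\Phi_+=\Phi_-\,e^{-p_0\sigma_3}\begin{pmatrix}\bar a&b\\ \bar b&a\end{pmatrix}e^{p_0\sigma_3}\quad(\mu\in\mathbb R\setminus\{0,\pm1\}),\qquad a=\det\big(\Phi_-^{(1)}\ \Phi_+^{(2)}\big)\quad(\operatorname{Im}\mu>0).$$ Assume that $a$ has finitely many zeros $\mu_1,\dots,\mu_N$ in $\mathbb C^+=\{\operatorname{Im}\mu>0\}$, all simple. Put $r=b/\bar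 a$ on $\mathbb R\setminus\{0,\pm1\}$. Define $\delta_j$ by $\Phi_+^{(2)}(x,\mu_j)=\delta_je^{-2p_0(x,\mu_j)}\Phi_-^{(1)}(x,\mu_j)$, and put $\rho_j=a'(\mu_j)\delta_j$. Finally, let $\gamma=-2i\lim_{\mu\to1}(\mu-1)a(\mu)\in\mathbb R$, where $\mu\to1$ in $\mathbb C^+$. Put $c=0$ if $\gamma\neq0$, and $c=(a_1+b_1)/a_1$ if $\gamma=0$, where $a_1,b_1\in\mathbb R$ are the limiting values of $a$ (from $\mathbb C^+$) and of $b$ (along $\mathbb R$) at $\mu=1$. **RH problem.** Put $\hat p(y,t,\mu)=-\theta(\mu)\big(-y+\frac{8\mu^2}{(\mu^2+1)^2}t\big)$. For all $y\in\mathbb R$ and $t\ge0$ let the $2\times2$ matrix function $\hat M(y,t,\cdot)$ on $\mathbb C\setminus\mathbb R$ satisfy the following conditions. * The first column $\hat M^{(1)}$ is analytic off $\{\mu_j\}$, and the second column $\hat M^{(2)}$ is analytic off $\{\bar\mu_j\}$. * For $\mu\in\mathbb R\setminus\{0,\pm1\}$ the limits $\hat M_\pm$ from $\mathbb C^\pm$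 exist and $$\hat M_-=\hat M_+\,e^{-\hat p\sigma_3}\begin{pmatrix}1&-r\\ \bar r&1-|r|^2\end{pmatrix}e^{\hat p\sigma_3}.$$ * With $\hat\varkappa_j=\rho_je^{-2\hat p(y,t,\mu_j)}$, the columns have at most simple poles at the excluded points, and $\operatorname{Res}_{\mu_j}\hat M^{(1)}=\hat\varkappa_j^{-1}\hat M^{(2)}(\mu_j)$, $\operatorname{Res}_{\bar\mu_j}\hat M^{(2)}=\overline{\hat\varkappa_j}^{\,-1}\hat M^{(1)}(\bar\mu_j)$. * $\hat M\to I$ as $\mu\to\infty$. * $\hat M(\bar\mu)=\sigma_1\overline{\hat M(\mu)}\sigma_1$, $\hat M(-\mu)=\sigma_2\hat M(\mu)\sigma_2$, and $\hat M(\mu^{-1})=\sigma_1\hat M(\mu)\sigma_1$. * For some real $\hat\alpha=\hat\alpha(y,t)$, as $\mu\to 1$, respectively $\mu\to-1$, with $\operatorname{Im}\mu>0$, $$\hat M=\frac{i\hat\alpha}{2(\mu-1)}\begin{pmatrix}-c&1\\-c&1\end{pmatrix}+O(1),\qquad \hat M=-\frac{i\hat\alpha}{2(\mu+1)}\begin{pmatrix}c&1\\-c&-1\end{pmatrix}+O(1).$$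 **Proposition.** Put $\hat\mu_1(y,t)=\hat M_{11}(y,t,i)+\hat M_{21}(y,t,i)$ and $\hat\mu_2(y,t)=\hat M_{12}(y,t,i)+\hat M_{22}(y,t,i)$. For all $y\in\mathbb R$ and $t\ge0$ the quotient $\hat\mu_1/\hat\mu_2$ is a positive real number. For every $t\ge 0$ the map $$y\mapsto x(y,t)=y+\ln\frac{\hat\mu_1(y,t)}{\hat\mu_2(y,t)}$$ is a bijection of $\mathbb R$ onto $\mathbb R$. For all $y\in\mathbb R$ and $t>0$ the derivatives below exist, and $$u_x\big(x(y,t)+t,\,t\big)=\tfrac12\,\partial_t\partial_y\ln\frac{\hat\mu_1(y,t)}{\hat\mu_2(y,t)}=\tfrac12\,\partial_y\partial_t\ln\frac{\hat\mu_1(y,t)}{\hat\mu_2(y,t)} .$$ -/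

import Mathlib

open Set Filter Topology MeasureTheory Asymptotics

noncomputable section

namespace MCH

/-! ### The Cauchy problem -/

/-- The momentum `m = u - u_xx`. -/
def momentum (u : ℝ → ℝ → ℝ) (x t : ℝ) : ℝ :=
  u x t - iteratedDeriv 2 (fun z => u z t) x

/-- The space derivative `u_x`. -/
def dx (u : ℝ → ℝ → ℝ) (x t : ℝ) : ℝ := deriv (fun z => u z t) x

/-- `u` (as a function of `x` and `t ≥ 0`) is a classical solution of
`m_t + ((u² - u_x²) m)_x = 0`, `m = u - u_xx`, with `u(x,0) = u₀(x)`, on the background `1`: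
`u → 1` as `x → ±∞`, and `m - 1` decays like `(1+|x|)^(-4)`, locally uniformly in `t ≥ 0`. -/
structure IsCauchySolution (u₀ : ℝ → ℝ) (u : ℝ → ℝ → ℝ) : Prop where
  contDiff : ∀ t, 0 ≤ t → ContDiff ℝ 3 (fun x => u x t)
  continuousOn : ∀ k : ℕ, k ≤ 3 →
    ContinuousOn (fun q : ℝ × ℝ => iteratedDeriv k (fun x => u x q.2) q.1) (univ ×ˢ Ici 0)
  equation : ∀ x t, 0 < t →
    HasDerivAt (fun s => momentum u x s)
      (-(deriv (fun z => ((u z t) ^ 2 - (dx u z t) ^ 2) * momentum u z t) x)) t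
  initial : ∀ x, u x 0 = u₀ x
  tendsto_atTop : ∀ t, 0 ≤ t → Tendsto (fun x => u x t) atTop (𝓝 1)
  tendsto_atBot : ∀ t, 0 ≤ t → Tendsto (fun x => u x t) atBot (𝓝 1)
  decay : ∀ T : ℝ, 0 < T → ∃ C : ℝ, ∀ t ∈ Icc (0 : ℝ) T, ∀ x : ℝ,
    |momentum u x t - 1| ≤ C / (1 + |x|) ^ 4

/-! ### Jost solutions at a fixed time

Here `m : ℝ → ℝ` is the momentum at that time (in the moving frame), with `m → 1` at `±∞`. -/

/-- `e^{z σ₃}`. -/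
def expSigma3 (z : ℂ) : Matrix (Fin 2) (Fin 2) ℂ :=
  !![Complex.exp z, 0; 0, Complex.exp (-z)]

/-- `i (μ² - 1) / (4 μ)`. -/
def phaseCoeff (μ : ℂ) : ℂ := Complex.I * (μ ^ 2 - 1) / (4 * μ)

/-- The coefficient matrix `Û` of the spatial Lax equation, at a point where the momentum is `m`. -/
def lax (m : ℝ) (μ : ℂ) : Matrix (Fin 2) (Fin 2) ℂ :=
  (Complex.I * (μ ^ 2 + 1) * ((m : ℂ) - 1) / (2 * (μ ^ 2 - 1))) • !![0, 1; -1, 0]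
    - (Complex.I * μ * ((m : ℂ) - 1) / (μ ^ 2 - 1)) • !![1, 0; 0, -1]

/-- `i (μ² - 1) / (4 μ) ∫_x^ξ m(η) dη`. -/
def phaseDiff (m : ℝ → ℝ) (μ : ℂ) (x ξ : ℝ) : ℂ :=
  phaseCoeff μ * ((∫ η in x..ξ, m η : ℝ) : ℂ)

/-- The `j`-th column of `e^{E σ₃} Û(ξ) Φ(ξ) e^{-E σ₃}`, `E = phaseDiff m μ x ξ`, where `φ` is the
`j`-th column of `Φ`. -/
def volterraIntegrand (m : ℝ → ℝ) (μ : ℂ) (j : Fin 2) (φ : ℝ → Fin 2 → ℂ) (x ξ : ℝ) :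
    Fin 2 → ℂ :=
  expSigma3 (-(phaseDiff m μ x ξ)) j j •
    Matrix.mulVec (expSigma3 (phaseDiff m μ x ξ) * lax (m ξ) μ) (φ ξ)

/-- `φ` is the `j`-th column of the Jost solution `Φ̃₊`: the bounded continuous solution of the
Volterra equation normalized at `+∞`. -/
def IsJostPlus (m : ℝ → ℝ) (μ : ℂ) (j : Fin 2) (φ : ℝ → Fin 2 → ℂ) : Prop :=
  Continuous φ ∧ (∃ C : ℝ, ∀ x, ‖φ x‖ ≤ C) ∧
    ∀ x, φ x = Pi.single j 1 - ∫ ξ in Ioi x, volterraIntegrand m μ j φ x ξ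

/-- `φ` is the `j`-th column of the Jost solution `Φ̃₋`, normalized at `-∞`. -/
def IsJostMinus (m : ℝ → ℝ) (μ : ℂ) (j : Fin 2) (φ : ℝ → Fin 2 → ℂ) : Prop :=
  Continuous φ ∧ (∃ C : ℝ, ∀ x, ‖φ x‖ ≤ C) ∧
    ∀ x, φ x = Pi.single j 1 + ∫ ξ in Iic x, volterraIntegrand m μ j φ x ξ

/-- The phase `p(x,0,μ) = (i (μ² - 1) / (4 μ)) (x - ∫_x^∞ (m - 1))`. -/
def phaseZero (m : ℝ → ℝ) (x : ℝ) (μ : ℂ) : ℂ :=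
  phaseCoeff μ * ((x - ∫ ξ in Ioi x, (m ξ - 1) : ℝ) : ℂ)

/-- `a` (on the closed upper half-plane) and `b` (on the real line) are the spectral functions
of `m`. -/
structure IsSpectralPair (m : ℝ → ℝ) (a : ℂ → ℂ) (b : ℝ → ℂ) : Prop where
  /-- `Φ̃₊ = Φ̃₋ e^{-p σ₃} s e^{p σ₃}` on the real line, `s = (ā, b; b̄, a)`. -/
  scattering : ∀ μ : ℝ, μ ≠ 0 → μ ≠ 1 → μ ≠ -1 →
    ∃ Φp Φm : ℝ → Matrix (Fin 2) (Fin 2) ℂ,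
      (∀ j, IsJostPlus m μ j (fun x i => Φp x i j)) ∧
      (∀ j, IsJostMinus m μ j (fun x i => Φm x i j)) ∧
      ∀ x, Φp x = Φm x * expSigma3 (-(phaseZero m x μ)) *
        !![starRingEnd ℂ (a μ), b μ; starRingEnd ℂ (b μ), a μ] * expSigma3 (phaseZero m x μ)
  /-- In the upper half-plane `a = det (Φ̃₋⁽¹⁾, Φ̃₊⁽²⁾)`. -/
  upper : ∀ μ : ℂ, 0 < μ.im →
    ∃ φm φp : ℝ → Fin 2 → ℂ, IsJostMinus m μ 0 φm ∧ IsJostPlus m μ 1 φp ∧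
      ∀ x, a μ = Matrix.det !![φm x 0, φp x 0; φm x 1, φp x 1]

/-- The constant `c`: with `γ = -2i lim_{μ → 1} (μ - 1) a(μ)`, it is `0` if `γ ≠ 0`, and
`(a₁ + b₁) / a₁` with `a₁ = a(1)`, `b₁ = b(1)` (limiting values) if `γ = 0`. -/
def IsSingularityConstant (a : ℂ → ℂ) (b : ℝ → ℂ) (c : ℝ) : Prop :=
  ∃ γ : ℝ,
    Tendsto (fun μ : ℂ => -2 * Complex.I * ((μ - 1) * a μ)) (𝓝[{μ : ℂ | 0 < μ.im}] 1)
      (𝓝 (γ : ℂ)) ∧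
    ((γ ≠ 0 ∧ c = 0) ∨
      (γ = 0 ∧ ∃ a₁ b₁ : ℝ,
        Tendsto a (𝓝[{μ : ℂ | 0 < μ.im}] 1) (𝓝 (a₁ : ℂ)) ∧
        Tendsto b (𝓝[≠] 1) (𝓝 (b₁ : ℂ)) ∧
        c = (a₁ + b₁) / a₁))

/-! ### The Riemann–Hilbert problem -/

/-- Data of the basic RH problem. -/
structure RHData where
  r : ℝ → ℂ
  c : ℝ
  N : ℕ
  pole : Fin N → ℂ
  ρ : Fin N → ℂ

/-- The data are those associated with the initial data `u₀`. In particular the function `a`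
of `u₀` has finitely many zeros in the upper half-plane, all simple. -/
def RHData.IsAssociatedWith (D : RHData) (u₀ : ℝ → ℝ) : Prop :=
  let m : ℝ → ℝ := fun x => u₀ x - iteratedDeriv 2 u₀ x
  ∃ (a : ℂ → ℂ) (b : ℝ → ℂ),
    IsSpectralPair m a b ∧
    (∀ μ : ℝ, μ ≠ 0 → μ ≠ 1 → μ ≠ -1 → D.r μ = b μ / starRingEnd ℂ (a μ)) ∧
    IsSingularityConstant a b D.c ∧
    Function.Injective D.pole ∧
    (∀ μ : ℂ, μ ∈ range D.pole ↔ 0 < μ.im ∧ a μ = 0) ∧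
    ∀ j, deriv a (D.pole j) ≠ 0 ∧
      ∃ δ : ℂ, D.ρ j = deriv a (D.pole j) * δ ∧
        ∃ φm φp : ℝ → Fin 2 → ℂ,
          IsJostMinus m (D.pole j) 0 φm ∧ IsJostPlus m (D.pole j) 1 φp ∧
          ∀ x, φp x = (δ * Complex.exp (-2 * phaseZero m x (D.pole j))) • φm x

/-- `p̂(y,t,μ) = -(i (μ² - 1) / (4 μ)) (-y + 8 μ² t / (μ² + 1)²)`. -/
def phaseHat (y t : ℝ) (μ : ℂ) : ℂ :=
  -(phaseCoeff μ) * (-(y : ℂ) + 8 * μ ^ 2 / (μ ^ 2 + 1) ^ 2 * (t : ℂ))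

/-- The jump matrix `e^{-p̂ σ₃} J₀ e^{p̂ σ₃}`. -/
def RHData.jump (D : RHData) (y t μ : ℝ) : Matrix (Fin 2) (Fin 2) ℂ :=
  expSigma3 (-(phaseHat y t μ)) *
    !![1, -(D.r μ); starRingEnd ℂ (D.r μ), 1 - D.r μ * starRingEnd ℂ (D.r μ)] *
    expSigma3 (phaseHat y t μ)

/-- `ϰ̂_j(y,t) = ρ_j e^{-2 p̂(y,t,μ_j)}`. -/
def RHData.kappa (D : RHData) (y t : ℝ) (j : Fin D.N) : ℂ :=
  D.ρ j * Complex.exp (-2 * phaseHat y t (D.pole j))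

/-- The points `μ_j` and their conjugates. -/
def RHData.poles (D : RHData) : Set ℂ :=
  range D.pole ∪ range (fun j => starRingEnd ℂ (D.pole j))

def sigma1 : Matrix (Fin 2) (Fin 2) ℂ := !![0, 1; 1, 0]

def sigma2 : Matrix (Fin 2) (Fin 2) ℂ := !![0, -Complex.I; Complex.I, 0]

/-- `M = M̂(y,t,·)` solves the basic RH problem with data `D` and parameters `y`, `t`. Only the
values of `M` off the real line matter. -/
structure RHData.IsSolution (D : RHData) (y t : ℝ) (M : ℂ → Matrix (Fin 2) (Fin 2) ℂ) :
    Prop where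
  /-- The first column is analytic off the real line and the points `μ_j`. -/
  analytic_fst : ∀ i, DifferentiableOn ℂ (fun μ => M μ i 0) ({μ | μ.im ≠ 0} \ range D.pole)
  /-- The second column is analytic off the real line and the points conjugate to the `μ_j`. -/
  analytic_snd : ∀ i, DifferentiableOn ℂ (fun μ => M μ i 1)
    ({μ | μ.im ≠ 0} \ range (fun j => starRingEnd ℂ (D.pole j)))
  /-- Jump condition between the limiting values from the two half-planes. At `μ = 0` nothing has
  to be required: `M → I` there by the normalization and the third symmetry. -/
  jump : ∀ μ : ℝ, μ ≠ 0 → μ ≠ 1 → μ ≠ -1 →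
    ∃ Mplus Mminus : Matrix (Fin 2) (Fin 2) ℂ,
      Tendsto M (𝓝[{z : ℂ | 0 < z.im}] (μ : ℂ)) (𝓝 Mplus) ∧
      Tendsto M (𝓝[{z : ℂ | z.im < 0}] (μ : ℂ)) (𝓝 Mminus) ∧
      Mminus = Mplus * D.jump y t μ
  residue_fst : ∀ j i,
    Tendsto (fun μ => (μ - D.pole j) * M μ i 0) (𝓝[≠] (D.pole j))
      (𝓝 ((D.kappa y t j)⁻¹ * M (D.pole j) i 1))
  residue_snd : ∀ j i,
    Tendsto (fun μ => (μ - starRingEnd ℂ (D.pole j)) * M μ i 1)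
      (𝓝[≠] (starRingEnd ℂ (D.pole j)))
      (𝓝 ((starRingEnd ℂ (D.kappa y t j))⁻¹ * M (starRingEnd ℂ (D.pole j)) i 0))
  normalization : Tendsto M (Bornology.cobounded ℂ ⊓ 𝓟 {μ | μ.im ≠ 0}) (𝓝 1)
  symm_conj : ∀ μ : ℂ, μ.im ≠ 0 → μ ∉ D.poles →
    M (starRingEnd ℂ μ) = sigma1 * (M μ).map (starRingEnd ℂ) * sigma1
  symm_neg : ∀ μ : ℂ, μ.im ≠ 0 → μ ∉ D.poles → M (-μ) = sigma2 * M μ * sigma2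
  symm_inv : ∀ μ : ℂ, μ.im ≠ 0 → μ ∉ D.poles → M μ⁻¹ = sigma1 * M μ * sigma1
  /-- Singularity conditions at `μ = 1` and `μ = -1`, with an unspecified real `α`. -/
  singularity : ∃ α : ℝ,
    (∀ i j, (fun μ : ℂ => M μ i j -
        ((Complex.I * α / (2 * (μ - 1))) • !![-(D.c : ℂ), 1; -(D.c : ℂ), 1]) i j)
      =O[𝓝[{μ : ℂ | 0 < μ.im}] 1] (fun _ => (1 : ℂ))) ∧
    (∀ i j, (fun μ : ℂ => M μ i j +
        ((Complex.I * α / (2 * (μ + 1))) • !![(D.c : ℂ), 1; -(D.c : ℂ), -1]) i j)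
      =O[𝓝[{μ : ℂ | 0 < μ.im}] (-1)] (fun _ => (1 : ℂ)))

/-! ### The quantities read off at `μ = i` -/

/-- `μ̂₁ = M̂₁₁(i) + M̂₂₁(i)`. -/
def muHat₁ (M : ℝ → ℝ → ℂ → Matrix (Fin 2) (Fin 2) ℂ) (y t : ℝ) : ℂ :=
  M y t Complex.I 0 0 + M y t Complex.I 1 0

/-- `μ̂₂ = M̂₁₂(i) + M̂₂₂(i)`. -/
def muHat₂ (M : ℝ → ℝ → ℂ → Matrix (Fin 2) (Fin 2) ℂ) (y t : ℝ) : ℂ :=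
  M y t Complex.I 0 1 + M y t Complex.I 1 1

/-- `ln (μ̂₁ / μ̂₂)`, meaningful where the quotient is a positive real number. -/
def logRatio (M : ℝ → ℝ → ℂ → Matrix (Fin 2) (Fin 2) ℂ) (y t : ℝ) : ℝ :=
  Real.log (muHat₁ M y t / muHat₂ M y t).re

/-- `x(y,t) = y + ln (μ̂₁ / μ̂₂)`. -/
def xOf (M : ℝ → ℝ → ℂ → Matrix (Fin 2) (Fin 2) ℂ) (y t : ℝ) : ℝ :=
  y + logRatio M y t

end MCH

end

/-! The logarithm in the statement is a Lagrangian coordinate in disguise. The momentum m is a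
conserved density with flux (u² - u_x²) m, so the label Y(x,t) = x - t - ∫_x^∞ (m - 1) is constant
along the flow of u² - u_x². Since m stays positive, Y(·,t) has an inverse X(·,t), with X_y = 1/m
and X_t = u² - u_x². The heart of the proof is the identity μ̂₁/μ̂₂ = exp(X(y,t) - t - y)
(`IsCauchySolution.ratio_eq`). It gives x(y,t) = X(y,t) - t, hence positivity and bijectivity. With
q = 1 - 1/m evaluated at X, the logarithm has y-derivative -q and t-derivative u² - u_x² - 1; along
the flow q_t = -2 u_x, and the y-derivative of u² - u_x² is 2 u_x m · (1/m) = 2 u_x, so both mixed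
derivatives equal 2 u_x.

The identity comes from the Lax pair written in the coordinate y, where dy = m dx and q is the
potential. Let J = (J₁, J₂) be the Jost solution normalized at -∞, (K₂, K₁) the one normalized at
+∞, and a = J₁K₁ - J₂K₂. At μ = i the off-diagonal coefficient of the spatial equation vanishes and
both solutions are explicit exponentials of integrals of q (`IsPotential.jost_I`). If M̂ is the
matrix with columns J/a and (K₂, K₁), the quotient at μ = i is exp ∫_y^∞ q, and
`IsCauchySolution.position_sub_eq` turns this into exp(X - t - y).

That M̂ is this matrix rests on two facts. First, the Jost solutions at time t have the scattering
data of u₀, with only the phase p̂ depending on time (`IsEvolution.isScattering`). The time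
derivative of J is found by differentiating its Volterra equation: the expression suggested by the
temporal Lax equation solves the linearized equation because of zero curvature, and bounded
solutions are unique (`IsEvolution.hasDerivAt_jost`). Suitably rescaled Jost solutions then obey one
common linear equation in t, so linear relations between them persist.

Second, the RH problem has no other solution (`RHData.IsSolution.eq_jost`). The quotient E of M̂ by
the Jost matrix has no jump and no poles at the μ_j. The residue condition cancels the poles, and
the condition at μ = 1 brings the possible double poles at ±1 down to simple ones. Reflection and
Liouville's theorem (`eq_rational_of_symmetries`) make each real combination of entries of E an
explicit rational function with one unknown constant. The constants vanish by the symmetry μ ↦ -1/μ,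
by its fixed point i, and by comparing determinants at μ = 1.

The Volterra theory needs q of class C¹ with an integrable first moment, with bounds locally uniform
in t. These come from the decay of m, a maximum principle for u - u_xx, and a lower bound for m
obtained by a first-touching-time argument (`IsCauchySolution.exists_decay`,
`IsCauchySolution.exists_momentum_ge`). -/

noncomputable section
namespace MCH

/-! ### Linear Volterra equations on a half-line -/

section Volterra

variable {E : Type*} [NormedAddCommGroup E] [NormedSpace ℂ E]

/-- An integral of holomorphic functions with an integrable majorant is holomorphic. -/
theorem differentiableOn_integral_of_norm_le {α : Type*} [MeasurableSpace α] {ν : Measure α}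
    [CompleteSpace E] {U : Set ℂ} (hU : IsOpen U) {f : ℂ → α → E} {G : α → ℝ}
    (hmeas : ∀ z ∈ U, AEStronglyMeasurable (f z) ν)
    (hdiff : ∀ᵐ s ∂ν, DifferentiableOn ℂ (fun z => f z s) U)
    (hbound : ∀ᵐ s ∂ν, ∀ z ∈ U, ‖f z s‖ ≤ G s) (hG : Integrable G ν) :
    DifferentiableOn ℂ (fun z => ∫ s, f z s ∂ν) U := by
  intro z₀ hz₀
  obtain ⟨r, hr, hball⟩ := Metric.isOpen_iff.1 hU z₀ hz₀
  have hr2 : 0 < r / 2 := by positivity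
  have hsub : ∀ z ∈ Metric.ball z₀ (r / 2), Metric.closedBall z (r / 4) ⊆ U := by
    intro z hz w hw
    apply hball
    rw [Metric.mem_closedBall] at hw
    rw [Metric.mem_ball] at *
    linarith [dist_triangle w z z₀]
  have hU0 : ∀ z ∈ Metric.ball z₀ (r / 2), z ∈ U := fun z hz =>
    hsub z hz (Metric.mem_closedBall_self (by positivity))
  have hderiv : ∀ᵐ s ∂ν, ∀ z ∈ Metric.ball z₀ (r / 2),
      HasDerivAt (fun z => f z s) (deriv (fun z => f z s) z) z := by
    filter_upwards [hdiff] with s hs z hz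
    exact (hs.differentiableAt (hU.mem_nhds (hU0 z hz))).hasDerivAt
  have hderivbound : ∀ᵐ s ∂ν, ∀ z ∈ Metric.ball z₀ (r / 2),
      ‖deriv (fun z => f z s) z‖ ≤ G s / (r / 4) := by
    filter_upwards [hdiff, hbound] with s hs hb z hz
    refine Complex.norm_deriv_le_of_forall_mem_sphere_norm_le (by positivity) ?_ ?_
    · refine DifferentiableOn.diffContOnCl ?_
      rw [closure_ball _ (by positivity)]
      exact hs.mono (hsub z hz)
    · intro w hw
      exact hb w (hsub z hz (Metric.sphere_subset_closedBall hw))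
  -- Measurability in s is known for each fixed z only, so the derivative is obtained as a pointwise
  -- limit of difference quotients along a sequence ε n → 0.
  have hmeas' : AEStronglyMeasurable (fun s => deriv (fun z => f z s) z₀) ν := by
    set ε : ℕ → ℂ := fun n => ((r / 4 / (n + 1) : ℝ) : ℂ) with hε
    have hε0 : ∀ n, ε n ≠ 0 := fun n => by
      have : r / 4 / ((n : ℝ) + 1) ≠ 0 := by positivity
      exact Complex.ofReal_ne_zero.2 this
    have hεmem : ∀ n, z₀ + ε n ∈ U := by
      intro n
      apply hball
      rw [Metric.mem_ball, dist_eq_norm, add_sub_cancel_left, hε, Complex.norm_real,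
        Real.norm_of_nonneg (by positivity), div_lt_iff₀ (by positivity)]
      have : (0 : ℝ) ≤ n := Nat.cast_nonneg n
      nlinarith
    have hεlim : Tendsto ε atTop (𝓝[≠] 0) := by
      refine tendsto_nhdsWithin_iff.2 ⟨?_, Eventually.of_forall hε0⟩
      have h1 : Tendsto (fun n : ℕ => r / 4 * (1 / ((n : ℝ) + 1))) atTop (𝓝 (r / 4 * 0)) :=
        tendsto_one_div_add_atTop_nhds_zero_nat.const_mul _
      rw [mul_zero] at h1
      have := (Complex.continuous_ofReal.tendsto 0).comp h1
      refine (this.congr fun n => ?_)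
      simp only [Function.comp, hε]; congr 1; ring
    refine aestronglyMeasurable_of_tendsto_ae atTop
      (f := fun n s => (ε n)⁻¹ • (f (z₀ + ε n) s - f z₀ s))
      (fun n => ((hmeas _ (hεmem n)).sub (hmeas _ hz₀)).const_smul _) ?_
    filter_upwards [hderiv] with s hs
    exact ((hasDerivAt_iff_tendsto_slope_zero.1
      (hs z₀ (Metric.mem_ball_self hr2))).comp hεlim)
  refine ((hasDerivAt_integral_of_dominated_loc_of_deriv_le (F := f)
    (Metric.ball_mem_nhds z₀ hr2) ?_ ?_ hmeas' hderivbound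
    (hG.div_const _) hderiv).2).differentiableAt.differentiableWithinAt
  · filter_upwards [hU.mem_nhds hz₀] with z hz using hmeas z hz
  · refine hG.mono' (hmeas _ hz₀) ?_
    filter_upwards [hbound] with s hs using hs z₀ hz₀

/-- A continuous integrable majorant of a Volterra kernel. -/
structure IsMajorant (g : ℝ → ℝ) : Prop where
  cont : Continuous g
  int : Integrable g
  nonneg : ∀ x, 0 ≤ g x

/-- The weight `exp (2 ∫_{-∞}^x g)`, for which the Volterra operator is a contraction. -/
def weight (g : ℝ → ℝ) (x : ℝ) : ℝ := Real.exp (2 * ∫ ξ in Iic x, g ξ)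

theorem hasDerivAt_integral_Iic {F : Type*} [NormedAddCommGroup F] [NormedSpace ℝ F]
    [CompleteSpace F] {g : ℝ → F} (hc : Continuous g)
    (hi : ∀ x, IntegrableOn g (Iic x)) (x : ℝ) :
    HasDerivAt (fun x => ∫ ξ in Iic x, g ξ) (g x) x := by
  have h : (fun x => ∫ ξ in Iic x, g ξ) =
      fun x => (∫ ξ in Iic (0 : ℝ), g ξ) + ∫ ξ in (0:ℝ)..x, g ξ := by
    funext x
    rw [← intervalIntegral.integral_Iic_sub_Iic (hi _) (hi _)]
    abel
  rw [h]
  exact (intervalIntegral.integral_hasDerivAt_right (hc.intervalIntegrable _ _)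
    (hc.stronglyMeasurableAtFilter _ _) hc.continuousAt).const_add _

theorem tendsto_integral_Iic_atBot {F : Type*} [NormedAddCommGroup F] [NormedSpace ℝ F]
    {g : ℝ → F} (hi : Integrable g) :
    Tendsto (fun x => ∫ ξ in Iic x, g ξ) atBot (𝓝 0) := by
  have h : ∀ x, ∫ ξ in Iic x, g ξ = (∫ ξ in Iic (0 : ℝ), g ξ) - ∫ ξ in x..(0:ℝ), g ξ := by
    intro x
    rw [← intervalIntegral.integral_Iic_sub_Iic hi.integrableOn hi.integrableOn]
    abel
  refine Tendsto.congr (fun x => (h x).symm) ?_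
  have := (intervalIntegral_tendsto_integral_Iic (0:ℝ) (hi.integrableOn (s := Iic 0))
    tendsto_id).const_sub (∫ ξ in Iic (0 : ℝ), g ξ)
  simpa using this

namespace IsMajorant

variable {g : ℝ → ℝ}

theorem hasDerivAt_weight (hg : IsMajorant g) (x : ℝ) :
    HasDerivAt (weight g) (2 * (g x * weight g x)) x := by
  have := ((hasDerivAt_integral_Iic hg.cont (fun _ => hg.int.integrableOn) x).const_mul 2).exp
  refine this.congr_deriv ?_
  simp only [weight]; ring

theorem continuous_weight (hg : IsMajorant g) : Continuous (weight g) :=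
  continuous_iff_continuousAt.2 fun x => (hg.hasDerivAt_weight x).continuousAt

theorem one_le_weight (hg : IsMajorant g) (x : ℝ) : 1 ≤ weight g x := by
  rw [weight, Real.one_le_exp_iff]
  have := integral_nonneg (μ := volume.restrict (Iic x)) (f := g) (fun x => hg.nonneg x)
  linarith

theorem weight_pos (x : ℝ) : 0 < weight g x := Real.exp_pos _

theorem weight_le (hg : IsMajorant g) (x : ℝ) : weight g x ≤ Real.exp (2 * ∫ ξ, g ξ) := by
  rw [weight, Real.exp_le_exp]
  have := setIntegral_le_integral (s := Iic x) hg.int (Eventually.of_forall hg.nonneg)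
  linarith

theorem tendsto_weight (hg : IsMajorant g) : Tendsto (weight g) atBot (𝓝 1) := by
  have := ((tendsto_integral_Iic_atBot hg.int).const_mul 2).rexp
  rw [mul_zero, Real.exp_zero] at this
  exact this

theorem integrable_mul_weight (hg : IsMajorant g) : Integrable (fun x => g x * weight g x) := by
  refine (hg.int.mul_const (Real.exp (2 * ∫ ξ, g ξ))).mono'
    (hg.cont.mul hg.continuous_weight).aestronglyMeasurable (Eventually.of_forall fun x => ?_)
  rw [Real.norm_of_nonneg (mul_nonneg (hg.nonneg x) (weight_pos x).le)]
  exact mul_le_mul_of_nonneg_left (hg.weight_le x) (hg.nonneg x)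

/-- The factor 2 in the exponent makes the derivative of the weight w equal to 2 g w, so integrating
g w returns at most half of w. This is the source of the contraction factor 1/2. -/
theorem integral_mul_weight (hg : IsMajorant g) (x : ℝ) :
    ∫ ξ in Iic x, g ξ * weight g ξ = (weight g x - 1) / 2 := by
  have := integral_Iic_of_hasDerivAt_of_tendsto' (a := x)
    (fun y _ => (hg.hasDerivAt_weight y))
    ((hg.integrable_mul_weight.const_mul 2).integrableOn) hg.tendsto_weight
  rw [integral_const_mul] at this
  linarith

end IsMajorant

/-- The kernel `k x ξ` (with `ξ ≤ x ≤ x₀`) is continuous and majorized by `g ξ`. -/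
structure IsVolterraKernel (x₀ : ℝ) (g : ℝ → ℝ) (k : ℝ → ℝ → E →L[ℂ] E) : Prop where
  cont : Continuous (fun p : ℝ × ℝ => k p.1 p.2)
  bound : ∀ x ξ, ξ ≤ x → x ≤ x₀ → ‖k x ξ‖ ≤ g ξ

/-- The terms of the Neumann series of the Volterra equation `φ = h + ∫_{-∞}^x k φ`. -/
def volterraTerm (k : ℝ → ℝ → E →L[ℂ] E) (h : ℝ → E) : ℕ → ℝ → E
  | 0 => h
  | n + 1 => fun x => ∫ ξ in Iic x, k x ξ (volterraTerm k h n ξ)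

/-- The solution of the Volterra equation `φ = h + ∫_{-∞}^x k φ`. -/
def volterraSum (k : ℝ → ℝ → E →L[ℂ] E) (h : ℝ → E) (x : ℝ) : E :=
  ∑' n, volterraTerm k h n x

namespace IsVolterraKernel

variable {x₀ : ℝ} {g : ℝ → ℝ} {k : ℝ → ℝ → E →L[ℂ] E} {φ h : ℝ → E} {B : ℝ}

theorem aestronglyMeasurable (hk : IsVolterraKernel x₀ g k) (hφ : ContinuousOn φ (Iic x₀))
    {x : ℝ} (hx : x ≤ x₀) :
    AEStronglyMeasurable (fun ξ => k x ξ (φ ξ)) (volume.restrict (Iic x)) := by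
  refine ContinuousOn.aestronglyMeasurable ?_ measurableSet_Iic
  have h1 : ContinuousOn (fun ξ => k x ξ) (Iic x) :=
    (hk.cont.comp (continuous_const.prodMk continuous_id)).continuousOn
  exact h1.clm_apply (hφ.mono (Iic_subset_Iic.2 hx))

theorem norm_apply_le (hk : IsVolterraKernel x₀ g k)
    (hb : ∀ ξ ≤ x₀, ‖φ ξ‖ ≤ B * weight g ξ) {x ξ : ℝ} (hx : x ≤ x₀) (hξ : ξ ≤ x) :
    ‖k x ξ (φ ξ)‖ ≤ B * (g ξ * weight g ξ) := by
  calc ‖k x ξ (φ ξ)‖ ≤ ‖k x ξ‖ * ‖φ ξ‖ := (k x ξ).le_opNorm _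
    _ ≤ g ξ * (B * weight g ξ) := by
        have h1 := hk.bound x ξ hξ hx
        exact mul_le_mul h1 (hb ξ (hξ.trans hx)) (norm_nonneg _) ((norm_nonneg _).trans h1)
    _ = _ := by ring

theorem integrableOn (hk : IsVolterraKernel x₀ g k) (hg : IsMajorant g)
    (hφ : ContinuousOn φ (Iic x₀)) (hb : ∀ ξ ≤ x₀, ‖φ ξ‖ ≤ B * weight g ξ) {x : ℝ} (hx : x ≤ x₀) :
    IntegrableOn (fun ξ => k x ξ (φ ξ)) (Iic x) := by
  refine ((hg.integrable_mul_weight.const_mul B).integrableOn).mono'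
    (hk.aestronglyMeasurable hφ hx) ?_
  exact (ae_restrict_iff' measurableSet_Iic).2
    (Eventually.of_forall fun ξ hξ => hk.norm_apply_le hb hx hξ)

/-- In the norm weighted by `weight g` the Volterra operator has norm at most 1/2, whatever the size
of the integral of g. Hence there is no smallness assumption anywhere. -/
theorem norm_integral_le (hk : IsVolterraKernel x₀ g k) (hg : IsMajorant g)
    (hB : 0 ≤ B) (hb : ∀ ξ ≤ x₀, ‖φ ξ‖ ≤ B * weight g ξ) {x : ℝ} (hx : x ≤ x₀) :
    ‖∫ ξ in Iic x, k x ξ (φ ξ)‖ ≤ B / 2 * weight g x := by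
  have h1 : ‖∫ ξ in Iic x, k x ξ (φ ξ)‖ ≤ ∫ ξ in Iic x, B * (g ξ * weight g ξ) := by
    refine norm_integral_le_of_norm_le (hg.integrable_mul_weight.const_mul B).integrableOn ?_
    exact (ae_restrict_iff' measurableSet_Iic).2
      (Eventually.of_forall fun ξ hξ => hk.norm_apply_le hb hx hξ)
  rw [integral_const_mul, hg.integral_mul_weight] at h1
  nlinarith [hg.one_le_weight x]

theorem continuousOn_integral (hk : IsVolterraKernel x₀ g k) (hg : IsMajorant g)
    (hφ : ContinuousOn φ (Iic x₀)) (hb : ∀ ξ ≤ x₀, ‖φ ξ‖ ≤ B * weight g ξ) :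
    ContinuousOn (fun x => ∫ ξ in Iic x, k x ξ (φ ξ)) (Iic x₀) := by
  have hB : 0 ≤ B := by
    have := (norm_nonneg _).trans (hb x₀ le_rfl)
    exact nonneg_of_mul_nonneg_left this (IsMajorant.weight_pos x₀)
  intro x hx
  have h0 : ∀ x, ∫ ξ in Iic x, k x ξ (φ ξ) = ∫ ξ, (Iic x).indicator (fun ξ => k x ξ (φ ξ)) ξ :=
    fun x => (integral_indicator measurableSet_Iic).symm
  simp_rw [h0]
  refine continuousWithinAt_of_dominated (bound := fun ξ => B * (g ξ * weight g ξ)) ?_ ?_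
    (hg.integrable_mul_weight.const_mul B) ?_
  · filter_upwards [self_mem_nhdsWithin] with x' hx'
    exact (aestronglyMeasurable_indicator_iff measurableSet_Iic).2
      (hk.aestronglyMeasurable hφ hx')
  · filter_upwards [self_mem_nhdsWithin] with x' hx'
    refine Eventually.of_forall fun ξ => ?_
    by_cases hξ : ξ ∈ Iic x'
    · rw [indicator_of_mem hξ]; exact hk.norm_apply_le hb hx' hξ
    · rw [indicator_of_notMem hξ, norm_zero]
      exact mul_nonneg hB (mul_nonneg (hg.nonneg _) (IsMajorant.weight_pos _).le)
  -- With the domain encoded by an indicator, the integrand is continuous in the upper limit except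
  -- at ξ = x, a null set.
  · have : ∀ᵐ ξ : ℝ, ξ ≠ x := by simp [ae_iff]
    filter_upwards [this] with ξ hξ
    refine ContinuousAt.continuousWithinAt ?_
    rcases lt_or_gt_of_ne hξ with hlt | hgt
    · have : (fun x' => k x' ξ (φ ξ)) =ᶠ[𝓝 x]
          (fun x' => (Iic x').indicator (fun ξ => k x' ξ (φ ξ)) ξ) := by
        filter_upwards [Ioi_mem_nhds hlt] with x' hx'
        rw [indicator_of_mem (mem_Iic.2 (le_of_lt hx'))]
      refine ContinuousAt.congr ?_ this
      exact ((hk.cont.comp (continuous_id.prodMk continuous_const)).clm_apply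
        continuous_const).continuousAt
    · have : (fun _ => 0) =ᶠ[𝓝 x]
          (fun x' => (Iic x').indicator (fun ξ => k x' ξ (φ ξ)) ξ) := by
        filter_upwards [Iio_mem_nhds hgt] with x' hx'
        rw [indicator_of_notMem (by simpa using hx')]
      exact ContinuousAt.congr continuousAt_const this

theorem volterraTerm_spec (hk : IsVolterraKernel x₀ g k) (hg : IsMajorant g)
    (hh : ContinuousOn h (Iic x₀)) (hB : ∀ ξ ≤ x₀, ‖h ξ‖ ≤ B) (n : ℕ) :
    ContinuousOn (volterraTerm k h n) (Iic x₀) ∧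
      ∀ x ≤ x₀, ‖volterraTerm k h n x‖ ≤ B * (1 / 2) ^ n * weight g x := by
  have hB0 : 0 ≤ B := (norm_nonneg _).trans (hB x₀ le_rfl)
  induction n with
  | zero =>
    refine ⟨hh, fun x hx => ?_⟩
    rw [pow_zero, mul_one]
    exact (hB x hx).trans (le_mul_of_one_le_right hB0 (hg.one_le_weight x))
  | succ n ih =>
    refine ⟨hk.continuousOn_integral hg ih.1 ih.2, fun x hx => ?_⟩
    have := hk.norm_integral_le hg (by positivity) ih.2 hx
    rw [pow_succ, volterraTerm]
    convert this using 2
    ring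

theorem summable_bound (B : ℝ) (x : ℝ) : Summable fun n : ℕ => B * (1 / 2) ^ n * weight g x :=
  ((summable_geometric_of_lt_one (by norm_num) (by norm_num)).mul_left B).mul_right _

theorem tsum_bound (B : ℝ) (x : ℝ) :
    ∑' n : ℕ, B * (1 / 2) ^ n * weight g x = 2 * B * weight g x := by
  rw [tsum_mul_right, tsum_mul_left, tsum_geometric_two]; ring

theorem summable_volterraTerm [CompleteSpace E] (hk : IsVolterraKernel x₀ g k) (hg : IsMajorant g)
    (hh : ContinuousOn h (Iic x₀)) (hB : ∀ ξ ≤ x₀, ‖h ξ‖ ≤ B) {x : ℝ} (hx : x ≤ x₀) :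
    Summable fun n => volterraTerm k h n x :=
  Summable.of_norm_bounded (summable_bound B x)
    fun n => (hk.volterraTerm_spec hg hh hB n).2 x hx

theorem norm_volterraSum_le (hk : IsVolterraKernel x₀ g k) (hg : IsMajorant g)
    (hh : ContinuousOn h (Iic x₀)) (hB : ∀ ξ ≤ x₀, ‖h ξ‖ ≤ B) {x : ℝ} (hx : x ≤ x₀) :
    ‖volterraSum k h x‖ ≤ 2 * B * weight g x := by
  rw [← tsum_bound]
  exact tsum_of_norm_bounded (summable_bound B x).hasSum
    fun n => (hk.volterraTerm_spec hg hh hB n).2 x hx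

theorem norm_volterraSum_le' (hk : IsVolterraKernel x₀ g k) (hg : IsMajorant g)
    (hh : ContinuousOn h (Iic x₀)) (hB : ∀ ξ ≤ x₀, ‖h ξ‖ ≤ B) {x : ℝ} (hx : x ≤ x₀) :
    ‖volterraSum k h x‖ ≤ 2 * B * Real.exp (2 * ∫ ξ, g ξ) := by
  have hB0 : 0 ≤ B := (norm_nonneg _).trans (hB x₀ le_rfl)
  exact (hk.norm_volterraSum_le hg hh hB hx).trans
    (mul_le_mul_of_nonneg_left (hg.weight_le x) (by positivity))

theorem continuousOn_volterraSum [CompleteSpace E] (hk : IsVolterraKernel x₀ g k) (hg : IsMajorant g)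
    (hh : ContinuousOn h (Iic x₀)) (hB : ∀ ξ ≤ x₀, ‖h ξ‖ ≤ B) :
    ContinuousOn (volterraSum k h) (Iic x₀) := by
  have hB0 : 0 ≤ B := (norm_nonneg _).trans (hB x₀ le_rfl)
  refine continuousOn_tsum (fun n => (hk.volterraTerm_spec hg hh hB n).1)
    (u := fun n => B * (1 / 2) ^ n * Real.exp (2 * ∫ ξ, g ξ))
    (((summable_geometric_of_lt_one (by norm_num) (by norm_num)).mul_left B).mul_right _) ?_
  intro n x hx
  exact ((hk.volterraTerm_spec hg hh hB n).2 x hx).trans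
    (mul_le_mul_of_nonneg_left (hg.weight_le x) (by positivity))

theorem volterraSum_eq [CompleteSpace E] (hk : IsVolterraKernel x₀ g k) (hg : IsMajorant g)
    (hh : ContinuousOn h (Iic x₀)) (hB : ∀ ξ ≤ x₀, ‖h ξ‖ ≤ B) {x : ℝ} (hx : x ≤ x₀) :
    volterraSum k h x = h x + ∫ ξ in Iic x, k x ξ (volterraSum k h ξ) := by
  have hB0 : 0 ≤ B := (norm_nonneg _).trans (hB x₀ le_rfl)
  have hs := hk.summable_volterraTerm hg hh hB hx
  rw [volterraSum, hs.tsum_eq_zero_add]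
  congr 1
  refine HasSum.tsum_eq ?_
  have := hasSum_integral_of_dominated_convergence (μ := volume.restrict (Iic x))
    (F := fun n ξ => k x ξ (volterraTerm k h n ξ)) (f := fun ξ => k x ξ (volterraSum k h ξ))
    (fun n ξ => B * (1 / 2) ^ n * (g ξ * weight g ξ)) ?_ ?_ ?_ ?_ ?_
  · exact this
  · exact fun n => hk.aestronglyMeasurable (hk.volterraTerm_spec hg hh hB n).1 hx
  · intro n
    exact (ae_restrict_iff' measurableSet_Iic).2
      (Eventually.of_forall fun ξ hξ =>
        hk.norm_apply_le (hk.volterraTerm_spec hg hh hB n).2 hx hξ)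
  · exact Eventually.of_forall fun ξ =>
      ((summable_geometric_of_lt_one (by norm_num) (by norm_num)).mul_left B).mul_right _
  · simp_rw [tsum_mul_right]
    exact (hg.integrable_mul_weight.const_mul _).integrableOn
  · refine (ae_restrict_iff' measurableSet_Iic).2 (Eventually.of_forall fun ξ hξ => ?_)
    exact ((hk.summable_volterraTerm hg hh hB (le_trans hξ hx)).hasSum).mapL (k x ξ)

/-- A bounded continuous solution of a homogeneous Volterra equation vanishes. -/
theorem eq_zero (hk : IsVolterraKernel x₀ g k) (hg : IsMajorant g)
    (hb : ∃ C, ∀ ξ ≤ x₀, ‖φ ξ‖ ≤ C)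
    (heq : ∀ x ≤ x₀, φ x = ∫ ξ in Iic x, k x ξ (φ ξ)) {x : ℝ} (hx : x ≤ x₀) : φ x = 0 := by
  obtain ⟨C, hC⟩ := hb
  have hC0 : 0 ≤ C := (norm_nonneg _).trans (hC x₀ le_rfl)
  have key : ∀ n : ℕ, ∀ x ≤ x₀, ‖φ x‖ ≤ C * (1 / 2) ^ n * weight g x := by
    intro n
    induction n with
    | zero =>
      intro x hx
      rw [pow_zero, mul_one]
      exact (hC x hx).trans (le_mul_of_one_le_right hC0 (hg.one_le_weight x))
    | succ n ih =>
      intro x hx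
      have := hk.norm_integral_le hg (by positivity) ih hx
      rw [← heq x hx] at this
      rw [pow_succ]
      convert this using 2
      ring
  have hlim : Tendsto (fun n : ℕ => C * (1 / 2) ^ n * weight g x) atTop (𝓝 0) :=
    (summable_bound C x).tendsto_atTop_zero
  exact norm_le_zero_iff.1 (ge_of_tendsto' hlim fun n => key n x hx)

/-- Uniqueness of the bounded continuous solution of a Volterra equation. -/
theorem eq_volterraSum [CompleteSpace E] (hk : IsVolterraKernel x₀ g k) (hg : IsMajorant g)
    (hh : ContinuousOn h (Iic x₀)) (hB : ∃ B, ∀ ξ ≤ x₀, ‖h ξ‖ ≤ B)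
    (hφ : ContinuousOn φ (Iic x₀)) (hb : ∃ C, ∀ ξ ≤ x₀, ‖φ ξ‖ ≤ C)
    (heq : ∀ x ≤ x₀, φ x = h x + ∫ ξ in Iic x, k x ξ (φ ξ)) {x : ℝ} (hx : x ≤ x₀) :
    φ x = volterraSum k h x := by
  obtain ⟨B, hB⟩ := hB
  obtain ⟨C, hC⟩ := hb
  have hC0 : 0 ≤ C := (norm_nonneg _).trans (hC x₀ le_rfl)
  rw [← sub_eq_zero]
  refine hk.eq_zero (φ := fun x => φ x - volterraSum k h x) hg
    ⟨C + 2 * B * Real.exp (2 * ∫ ξ, g ξ), fun ξ hξ => (norm_sub_le _ _).trans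
      (add_le_add (hC ξ hξ) (hk.norm_volterraSum_le' hg hh hB hξ))⟩ (fun x hx => ?_) hx
  simp only [map_sub]
  rw [integral_sub]
  · rw [eq_sub_of_add_eq' (heq x hx).symm,
      eq_sub_of_add_eq' (hk.volterraSum_eq hg hh hB hx).symm]
    abel
  · refine hk.integrableOn hg hφ (B := C) (fun ξ hξ => ?_) hx
    exact (hC ξ hξ).trans (le_mul_of_one_le_right hC0 (hg.one_le_weight ξ))
  · exact hk.integrableOn hg (hk.continuousOn_volterraSum hg hh hB)
      (fun ξ hξ => hk.norm_volterraSum_le hg hh hB hξ) hx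

end IsVolterraKernel

section Limits

variable {ι : Type*} {l : Filter ι} {x₀ : ℝ} {g : ℝ → ℝ}
  {k : ι → ℝ → ℝ → E →L[ℂ] E} {k' : ℝ → ℝ → E →L[ℂ] E} {φ h : ι → ℝ → E} {h' : ℝ → E} {B : ℝ}

/-- Only the limit F of the products is prescribed, not limits of k and φ separately. This freedom
is needed as μ → ∞, where the kernel oscillates and the iterates still tend to zero. -/
theorem tendsto_integral_kernel [l.IsCountablyGenerated] (hg : IsMajorant g) (hk : ∀ᶠ i in l, IsVolterraKernel x₀ g (k i))
    (hφ : ∀ᶠ i in l, ContinuousOn (φ i) (Iic x₀) ∧ ∀ ξ ≤ x₀, ‖φ i ξ‖ ≤ B * weight g ξ)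
    {x : ℝ} (hx : x ≤ x₀) {F : ℝ → E}
    (hlim : ∀ ξ < x, Tendsto (fun i => k i x ξ (φ i ξ)) l (𝓝 (F ξ))) :
    Tendsto (fun i => ∫ ξ in Iic x, k i x ξ (φ i ξ)) l (𝓝 (∫ ξ in Iic x, F ξ)) := by
  refine tendsto_integral_filter_of_dominated_convergence (fun ξ => B * (g ξ * weight g ξ))
    ?_ ?_ (hg.integrable_mul_weight.const_mul B).integrableOn ?_
  · filter_upwards [hk, hφ] with i hi hi' using hi.aestronglyMeasurable hi'.1 hx
  · filter_upwards [hk, hφ] with i hi hi'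
    exact (ae_restrict_iff' measurableSet_Iic).2
      (Eventually.of_forall fun ξ hξ => hi.norm_apply_le hi'.2 hx hξ)
  · have : ∀ᵐ ξ : ℝ, ξ ≠ x := by simp [ae_iff]
    refine (ae_restrict_iff' measurableSet_Iic).2 (this.mono fun ξ hξ hξ' => ?_)
    exact hlim ξ (lt_of_le_of_ne hξ' hξ)

theorem tendsto_volterraTerm [l.IsCountablyGenerated] (hg : IsMajorant g)
    (hk : ∀ᶠ i in l, IsVolterraKernel x₀ g (k i))
    (hh : ∀ᶠ i in l, ContinuousOn (h i) (Iic x₀) ∧ ∀ ξ ≤ x₀, ‖h i ξ‖ ≤ B)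
    (hlimk : ∀ x ≤ x₀, ∀ ξ < x, Tendsto (fun i => k i x ξ) l (𝓝 (k' x ξ)))
    (hlimh : ∀ x ≤ x₀, Tendsto (fun i => h i x) l (𝓝 (h' x))) (n : ℕ) :
    ∀ x ≤ x₀, Tendsto (fun i => volterraTerm (k i) (h i) n x) l (𝓝 (volterraTerm k' h' n x)) := by
  induction n with
  | zero => exact hlimh
  | succ n ih =>
    intro x hx
    refine tendsto_integral_kernel (B := B * (1 / 2) ^ n) hg hk ?_ hx ?_
    · filter_upwards [hk, hh] with i hi hi' using hi.volterraTerm_spec hg hi'.1 hi'.2 n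
    · intro ξ hξ
      exact (isBoundedBilinearMap_apply.continuous.tendsto (k' x ξ, volterraTerm k' h' n ξ)).comp
        ((hlimk x hx ξ hξ).prodMk_nhds (ih ξ (hξ.le.trans hx)))

/-- The geometric bound on the Neumann terms is uniform along the filter, so limits may be taken
term by term. The limits f n need not be the Neumann terms of any limiting kernel. -/
theorem tendsto_volterraSum_of_term [CompleteSpace E] (hg : IsMajorant g)
    (hk : ∀ᶠ i in l, IsVolterraKernel x₀ g (k i))
    (hh : ∀ᶠ i in l, ContinuousOn (h i) (Iic x₀) ∧ ∀ ξ ≤ x₀, ‖h i ξ‖ ≤ B) {x : ℝ} (hx : x ≤ x₀)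
    {f : ℕ → E} (hlim : ∀ n, Tendsto (fun i => volterraTerm (k i) (h i) n x) l (𝓝 (f n))) :
    Tendsto (fun i => volterraSum (k i) (h i) x) l (𝓝 (∑' n, f n)) := by
  refine tendsto_tsum_of_dominated_convergence (bound := fun n => B * (1 / 2) ^ n * weight g x)
    (IsVolterraKernel.summable_bound B x) hlim ?_
  filter_upwards [hk, hh] with i hi hi' n using (hi.volterraTerm_spec hg hi'.1 hi'.2 n).2 x hx

/-- Continuous dependence of the solution of a Volterra equation on the data. -/
theorem tendsto_volterraSum [CompleteSpace E] [l.IsCountablyGenerated] (hg : IsMajorant g)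
    (hk : ∀ᶠ i in l, IsVolterraKernel x₀ g (k i))
    (hh : ∀ᶠ i in l, ContinuousOn (h i) (Iic x₀) ∧ ∀ ξ ≤ x₀, ‖h i ξ‖ ≤ B)
    (hlimk : ∀ x ≤ x₀, ∀ ξ < x, Tendsto (fun i => k i x ξ) l (𝓝 (k' x ξ)))
    (hlimh : ∀ x ≤ x₀, Tendsto (fun i => h i x) l (𝓝 (h' x))) {x : ℝ} (hx : x ≤ x₀) :
    Tendsto (fun i => volterraSum (k i) (h i) x) l (𝓝 (volterraSum k' h' x)) :=
  tendsto_volterraSum_of_term hg hk hh hx fun n =>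
    tendsto_volterraTerm hg hk hh hlimk hlimh n x hx

/-- Analytic dependence of the solution of a Volterra equation on a parameter. -/
theorem differentiableOn_volterraSum [CompleteSpace E] {U : Set ℂ} (hU : IsOpen U) {k : ℂ → ℝ → ℝ → E →L[ℂ] E}
    {h : ℝ → E} (hg : IsMajorant g) (hk : ∀ z ∈ U, IsVolterraKernel x₀ g (k z))
    (hh : ContinuousOn h (Iic x₀)) (hB : ∀ ξ ≤ x₀, ‖h ξ‖ ≤ B)
    (hdiff : ∀ x ξ, DifferentiableOn ℂ (fun z => k z x ξ) U) {x : ℝ} (hx : x ≤ x₀) :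
    DifferentiableOn ℂ (fun z => volterraSum (k z) h x) U := by
  have key : ∀ n, ∀ x ≤ x₀, DifferentiableOn ℂ (fun z => volterraTerm (k z) h n x) U := by
    intro n
    induction n with
    | zero => exact fun x _ => differentiableOn_const _
    | succ n ih =>
      intro x hx
      refine differentiableOn_integral_of_norm_le hU
        (G := fun ξ => B * (1 / 2) ^ n * (g ξ * weight g ξ)) ?_ ?_ ?_
        (hg.integrable_mul_weight.const_mul _).integrableOn
      · exact fun z hz =>
          (hk z hz).aestronglyMeasurable ((hk z hz).volterraTerm_spec hg hh hB n).1 hx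
      · exact (ae_restrict_iff' measurableSet_Iic).2 (Eventually.of_forall fun ξ hξ =>
          (hdiff x ξ).clm_apply (ih ξ (le_trans hξ hx)))
      · exact (ae_restrict_iff' measurableSet_Iic).2 (Eventually.of_forall fun ξ hξ z hz =>
          (hk z hz).norm_apply_le ((hk z hz).volterraTerm_spec hg hh hB n).2 hx hξ)
  exact Complex.differentiableOn_tsum_of_summable_norm (IsVolterraKernel.summable_bound B x)
    (fun n => key n x hx) hU fun n z hz => ((hk z hz).volterraTerm_spec hg hh hB n).2 x hx

end Limits

/-- A symmetry of the data of a Volterra equation is inherited by its solution. -/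
theorem map_volterraSum (S : E ≃L[ℝ] E) {k k' : ℝ → ℝ → E →L[ℂ] E} {h h' : ℝ → E}
    (hk : ∀ x ξ e, k' x ξ (S e) = S (k x ξ e)) (hh : ∀ x, h' x = S (h x)) (x : ℝ) :
    volterraSum k' h' x = S (volterraSum k h x) := by
  have key : ∀ n x, volterraTerm k' h' n x = S (volterraTerm k h n x) := by
    intro n
    induction n with
    | zero => exact hh
    | succ n ih =>
      intro x
      simp only [volterraTerm]
      rw [← S.integral_comp_comm]
      simp_rw [ih, hk]
  simp only [volterraSum, key]
  exact S.map_tsum.symm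

end Volterra

end MCH
end

noncomputable section
namespace MCH

/-! ### The Jost solution normalized at `-∞` -/

/-- The operator on `ℂ × ℂ` with matrix `(a, b; c, d)`. -/
def mat2 (a b c d : ℂ) : ℂ × ℂ →L[ℂ] ℂ × ℂ :=
  (a • ContinuousLinearMap.fst ℂ ℂ ℂ + b • ContinuousLinearMap.snd ℂ ℂ ℂ).prod
    (c • ContinuousLinearMap.fst ℂ ℂ ℂ + d • ContinuousLinearMap.snd ℂ ℂ ℂ)

@[simp] theorem mat2_apply (a b c d : ℂ) (e : ℂ × ℂ) :
    mat2 a b c d e = (a * e.1 + b * e.2, c * e.1 + d * e.2) := rfl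

theorem norm_mat2_le (a b c d : ℂ) : ‖mat2 a b c d‖ ≤ max (‖a‖ + ‖b‖) (‖c‖ + ‖d‖) := by
  refine ContinuousLinearMap.opNorm_le_bound _ (by positivity) fun e => ?_
  have h1 : ‖e.1‖ ≤ ‖e‖ := norm_fst_le e
  have h2 : ‖e.2‖ ≤ ‖e‖ := norm_snd_le e
  have key : ∀ a b : ℂ, ‖a * e.1 + b * e.2‖ ≤ (‖a‖ + ‖b‖) * ‖e‖ := fun a b => by
    refine (norm_add_le _ _).trans ?_
    rw [norm_mul, norm_mul, add_mul]
    gcongr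
  rw [mat2_apply, Prod.norm_def]
  refine max_le ((key a b).trans ?_) ((key c d).trans ?_)
  · exact mul_le_mul_of_nonneg_right (le_max_left _ _) (norm_nonneg _)
  · exact mul_le_mul_of_nonneg_right (le_max_right _ _) (norm_nonneg _)

/-- Linearity in the four entries reduces convergence and differentiability of the operator to those
of its entries. -/
theorem mat2_eq (a b c d : ℂ) :
    mat2 a b c d = a • mat2 1 0 0 0 + b • mat2 0 1 0 0 + c • mat2 0 0 1 0 + d • mat2 0 0 0 1 := by
  ext <;> simp [mat2_apply]

theorem continuous_mat2 : Continuous fun p : ℂ × ℂ × ℂ × ℂ => mat2 p.1 p.2.1 p.2.2.1 p.2.2.2 := by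
  simp_rw [fun p : ℂ × ℂ × ℂ × ℂ => mat2_eq p.1 p.2.1 p.2.2.1 p.2.2.2]
  fun_prop

theorem tendsto_mat2 {ι : Type*} {l : Filter ι} {a b c d : ι → ℂ} {a' b' c' d' : ℂ}
    (ha : Tendsto a l (𝓝 a')) (hb : Tendsto b l (𝓝 b')) (hc : Tendsto c l (𝓝 c'))
    (hd : Tendsto d l (𝓝 d')) :
    Tendsto (fun i => mat2 (a i) (b i) (c i) (d i)) l (𝓝 (mat2 a' b' c' d')) := by
  rw [mat2_eq]
  simp_rw [fun i => mat2_eq (a i) (b i) (c i) (d i)]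
  exact (((ha.smul_const _).add (hb.smul_const _)).add (hc.smul_const _)).add (hd.smul_const _)

theorem differentiableOn_mat2 {U : Set ℂ} {a b c d : ℂ → ℂ} (ha : DifferentiableOn ℂ a U)
    (hb : DifferentiableOn ℂ b U) (hc : DifferentiableOn ℂ c U) (hd : DifferentiableOn ℂ d U) :
    DifferentiableOn ℂ (fun z => mat2 (a z) (b z) (c z) (d z)) U := by
  simp_rw [fun z => mat2_eq (a z) (b z) (c z) (d z)]
  exact (((ha.smul_const _).add (hb.smul_const _)).add (hc.smul_const _)).add (hd.smul_const _)

/-- The off-diagonal coefficient of the spatial Lax operator. -/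
def coefA (μ : ℂ) : ℂ := Complex.I * (μ ^ 2 + 1) / (2 * (μ ^ 2 - 1))

/-- The diagonal coefficient of the spatial Lax operator. -/
def coefB (μ : ℂ) : ℂ := Complex.I * μ / (μ ^ 2 - 1)

/-- The closed upper half-plane without the singular points of the Lax operator. -/
def spectralDomain : Set ℂ := {μ | 0 ≤ μ.im ∧ μ ≠ 0 ∧ μ ≠ 1 ∧ μ ≠ -1}

theorem sq_sub_one_ne_zero {μ : ℂ} (h1 : μ ≠ 1) (h2 : μ ≠ -1) : μ ^ 2 - 1 ≠ 0 := by
  intro h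
  rcases sq_eq_one_iff.1 (sub_eq_zero.1 h) with h | h
  exacts [h1 h, h2 h]

theorem ne_of_im_pos {μ : ℂ} (h : 0 < μ.im) : μ ≠ 0 ∧ μ ≠ 1 ∧ μ ≠ -1 := by
  refine ⟨?_, ?_, ?_⟩ <;> rintro rfl <;> simp at h

theorem mem_spectralDomain_of_im_pos {μ : ℂ} (h : 0 < μ.im) : μ ∈ spectralDomain :=
  ⟨h.le, ne_of_im_pos h⟩

theorem mem_spectralDomain_ofReal {x : ℝ} (h0 : x ≠ 0) (h1 : x ≠ 1) (h2 : x ≠ -1) :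
    (x : ℂ) ∈ spectralDomain :=
  ⟨by simp, by exact_mod_cast h0, by exact_mod_cast h1, by exact_mod_cast h2⟩

theorem phaseCoeff_eq {μ : ℂ} (h : μ ≠ 0) : phaseCoeff μ = Complex.I / 4 * (μ - μ⁻¹) := by
  rw [phaseCoeff]; field_simp

/-- With θ = (i/4)(μ - 1/μ), the inversion μ ↦ 1/μ reverses the sign of the imaginary part, so both
terms contribute with the same sign. This is why the exponential in the kernel is bounded for ξ ≤ x
in the closed upper half-plane. -/
theorem phaseCoeff_re_nonpos {μ : ℂ} (h : 0 ≤ μ.im) (h0 : μ ≠ 0) : (phaseCoeff μ).re ≤ 0 := by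
  rw [phaseCoeff_eq h0]
  have h2 : (μ⁻¹).im ≤ 0 := by
    rw [Complex.inv_im]
    exact div_nonpos_of_nonpos_of_nonneg (by linarith) (Complex.normSq_nonneg _)
  have : (Complex.I / 4 * (μ - μ⁻¹)).re = -(μ.im - (μ⁻¹).im) / 4 := by
    have : Complex.I / 4 * (μ - μ⁻¹) = ((1 / 4 : ℝ) : ℂ) * (Complex.I * (μ - μ⁻¹)) := by
      push_cast; ring
    rw [this, Complex.re_ofReal_mul, Complex.I_mul_re, Complex.sub_im]
    ring
  rw [this]
  linarith

theorem continuousAt_coefA {μ : ℂ} (h1 : μ ≠ 1) (h2 : μ ≠ -1) : ContinuousAt coefA μ := by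
  unfold coefA
  refine ContinuousAt.div (by fun_prop) (by fun_prop) ?_
  exact mul_ne_zero two_ne_zero (sq_sub_one_ne_zero h1 h2)

theorem continuousAt_coefB {μ : ℂ} (h1 : μ ≠ 1) (h2 : μ ≠ -1) : ContinuousAt coefB μ := by
  unfold coefB
  exact ContinuousAt.div (by fun_prop) (by fun_prop) (sq_sub_one_ne_zero h1 h2)

theorem continuousAt_phaseCoeff {μ : ℂ} (h0 : μ ≠ 0) : ContinuousAt phaseCoeff μ := by
  unfold phaseCoeff
  exact ContinuousAt.div (by fun_prop) (by fun_prop) (by simpa using h0)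

/-- The kernel of the Volterra equation for the Jost solution, in the coordinate `y` with
`dy = m dx`, where `q = 1 - 1/m`. -/
def jostKernel (q : ℝ → ℝ) (μ : ℂ) (x ξ : ℝ) : ℂ × ℂ →L[ℂ] ℂ × ℂ :=
  mat2 (-(q ξ * coefB μ)) (q ξ * coefA μ)
    (-(Complex.exp (2 * phaseCoeff μ * (x - ξ)) * q ξ * coefA μ))
    (Complex.exp (2 * phaseCoeff μ * (x - ξ)) * q ξ * coefB μ)

/-- The Jost solution normalized by `(1, 0)` at `-∞`. -/
def jost (q : ℝ → ℝ) (μ : ℂ) (x : ℝ) : ℂ × ℂ := volterraSum (jostKernel q μ) (fun _ => (1, 0)) x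

/-- The class of potentials: `C¹` with an integrable first moment. -/
structure IsPotential (q : ℝ → ℝ) : Prop where
  contDiff : ContDiff ℝ 1 q
  decay : ∃ C, ∀ y, (1 + |y|) * |q y| ≤ C * (1 + y ^ 2)⁻¹

theorem isMajorant_const_mul {C : ℝ} (hC : 0 ≤ C) : IsMajorant fun y => C * (1 + y ^ 2)⁻¹ where
  cont := by
    refine continuous_const.mul (Continuous.inv₀ (by fun_prop) fun y => ?_)
    positivity
  int := integrable_inv_one_add_sq.const_mul C
  nonneg y := by positivity

theorem norm_exp_phase_le {μ : ℂ} (h : 0 ≤ μ.im) (h0 : μ ≠ 0) {x ξ : ℝ} (hξ : ξ ≤ x) :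
    ‖Complex.exp (2 * phaseCoeff μ * (x - ξ))‖ ≤ 1 := by
  rw [Complex.norm_exp, Real.exp_le_one_iff]
  have : 2 * phaseCoeff μ * (x - ξ) = ((2 * (x - ξ) : ℝ) : ℂ) * phaseCoeff μ := by
    push_cast; ring
  rw [this, Complex.re_ofReal_mul]
  exact mul_nonpos_of_nonneg_of_nonpos (by linarith) (phaseCoeff_re_nonpos h h0)

/-- An arbitrary larger majorant g is allowed so that a single one can serve a whole neighbourhood
of spectral parameters, or all times in a bounded interval. -/
theorem isVolterraKernel_jost {q : ℝ → ℝ} (hq : Continuous q) {μ : ℂ} (h : 0 ≤ μ.im) (h0 : μ ≠ 0)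
    {g : ℝ → ℝ} (hg : ∀ ξ, (‖coefA μ‖ + ‖coefB μ‖) * |q ξ| ≤ g ξ) (x₀ : ℝ) :
    IsVolterraKernel x₀ g (jostKernel q μ) where
  cont := by
    have hq' : Continuous fun p : ℝ × ℝ => (q p.2 : ℂ) :=
      Complex.continuous_ofReal.comp (hq.comp continuous_snd)
    have he : Continuous fun p : ℝ × ℝ => Complex.exp (2 * phaseCoeff μ * (p.1 - p.2)) := by
      fun_prop
    exact continuous_mat2.comp (((hq'.mul continuous_const).neg).prodMk
      ((hq'.mul continuous_const).prodMk (((he.mul hq').mul continuous_const).neg.prodMk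
        ((he.mul hq').mul continuous_const))))
  bound x ξ hξ _ := by
    have he := norm_exp_phase_le h h0 hξ
    refine (norm_mat2_le _ _ _ _).trans (le_trans ?_ (hg ξ))
    have hq0 : ‖(q ξ : ℂ)‖ = |q ξ| := by simp
    simp only [norm_neg, norm_mul, hq0]
    refine max_le (le_of_eq (by ring)) ?_
    have h1 : ∀ r : ℝ, 0 ≤ r → ‖Complex.exp (2 * phaseCoeff μ * (x - ξ))‖ * |q ξ| * r ≤ |q ξ| * r :=
      fun r hr => by
        rw [mul_assoc]
        exact mul_le_of_le_one_left (by positivity) he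
    have h2 := h1 _ (norm_nonneg (coefA μ))
    have h3 := h1 _ (norm_nonneg (coefB μ))
    nlinarith

namespace IsPotential

variable {q : ℝ → ℝ}

theorem continuous (hq : IsPotential q) : Continuous q := hq.contDiff.continuous

theorem exists_bound (hq : IsPotential q) : ∃ C, 0 ≤ C ∧ ∀ y, (1 + |y|) * |q y| ≤ C * (1 + y ^ 2)⁻¹ := by
  obtain ⟨C, hC⟩ := hq.decay
  refine ⟨|C|, abs_nonneg _, fun y => (hC y).trans ?_⟩
  exact mul_le_mul_of_nonneg_right (le_abs_self C) (by positivity)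

theorem isMajorant_abs (hq : IsPotential q) : IsMajorant fun y => |q y| where
  cont := hq.continuous.abs
  int := by
    obtain ⟨C, hC0, hC⟩ := hq.exists_bound
    refine (isMajorant_const_mul hC0).int.mono' hq.continuous.abs.aestronglyMeasurable
      (Eventually.of_forall fun y => ?_)
    rw [Real.norm_eq_abs, abs_abs]
    nlinarith [hC y, abs_nonneg y, abs_nonneg (q y), mul_nonneg (abs_nonneg y) (abs_nonneg (q y))]
  nonneg y := abs_nonneg _

theorem integrable (hq : IsPotential q) : Integrable q := by
  rw [← integrable_norm_iff hq.continuous.aestronglyMeasurable]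
  exact hq.isMajorant_abs.int

theorem isMajorant (hq : IsPotential q) {K : ℝ} (hK : 0 ≤ K) : IsMajorant fun y => K * |q y| where
  cont := continuous_const.mul hq.continuous.abs
  int := hq.isMajorant_abs.int.const_mul K
  nonneg y := by positivity

/-- The first moment of q is what controls the regularized kernel at μ = 1, which grows linearly in
x - ξ. -/
theorem isMajorant_moment (hq : IsPotential q) {K : ℝ} (hK : 0 ≤ K) :
    IsMajorant fun y => K * ((1 + |y|) * |q y|) where
  cont := continuous_const.mul ((continuous_const.add continuous_abs).mul hq.continuous.abs)
  int := by
    obtain ⟨C, hC0, hC⟩ := hq.exists_bound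
    refine Integrable.const_mul ?_ K
    refine (isMajorant_const_mul hC0).int.mono'
      ((continuous_const.add continuous_abs).mul hq.continuous.abs).aestronglyMeasurable
      (Eventually.of_forall fun y => ?_)
    rw [Real.norm_of_nonneg (by positivity)]
    exact hC y
  nonneg y := by positivity

theorem kernel (hq : IsPotential q) {μ : ℂ} (h : 0 ≤ μ.im) (h0 : μ ≠ 0) (x₀ : ℝ) :
    IsVolterraKernel x₀ (fun y => (‖coefA μ‖ + ‖coefB μ‖) * |q y|) (jostKernel q μ) :=
  isVolterraKernel_jost hq.continuous h h0 (fun _ => le_rfl) x₀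

theorem majorant (hq : IsPotential q) (μ : ℂ) :
    IsMajorant fun y => (‖coefA μ‖ + ‖coefB μ‖) * |q y| := hq.isMajorant (by positivity)

/-- The reflected potential. -/
theorem reflect (hq : IsPotential q) : IsPotential fun y => q (-y) where
  contDiff := hq.contDiff.comp contDiff_neg
  decay := by
    obtain ⟨C, hC⟩ := hq.decay
    refine ⟨C, fun y => ?_⟩
    have := hC (-y)
    rwa [abs_neg, neg_sq] at this

theorem continuous_jost (hq : IsPotential q) {μ : ℂ} (h : 0 ≤ μ.im) (h0 : μ ≠ 0) :
    Continuous (jost q μ) := by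
  rw [continuous_iff_continuousAt]
  intro x
  exact ((hq.kernel h h0 (x + 1)).continuousOn_volterraSum (hq.majorant μ) (h := fun _ => (1, 0))
    (B := 1) continuousOn_const (by simp)).continuousAt (Iic_mem_nhds (by linarith))

theorem norm_jost_le (hq : IsPotential q) {μ : ℂ} (h : 0 ≤ μ.im) (h0 : μ ≠ 0) :
    ∃ C, ∀ x, ‖jost q μ x‖ ≤ C :=
  ⟨_, fun x => (hq.kernel h h0 x).norm_volterraSum_le' (hq.majorant μ) (h := fun _ => (1, 0))
    (B := 1) continuousOn_const (by simp) le_rfl⟩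

theorem jost_eq (hq : IsPotential q) {μ : ℂ} (h : 0 ≤ μ.im) (h0 : μ ≠ 0) (x : ℝ) :
    jost q μ x = (1, 0) + ∫ ξ in Iic x, jostKernel q μ x ξ (jost q μ ξ) :=
  (hq.kernel h h0 x).volterraSum_eq (hq.majorant μ) (h := fun _ => (1, 0))
    (B := 1) continuousOn_const (by simp) le_rfl

/-- This uniqueness is used for identifying the explicit solution at μ = i and for transporting the
Jost solutions of the original variable x to the coordinate y. -/
theorem eq_jost (hq : IsPotential q) {μ : ℂ} (h : 0 ≤ μ.im) (h0 : μ ≠ 0) {φ : ℝ → ℂ × ℂ} {x₀ : ℝ}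
    (hφ : ContinuousOn φ (Iic x₀)) (hb : ∃ C, ∀ ξ ≤ x₀, ‖φ ξ‖ ≤ C)
    (heq : ∀ x ≤ x₀, φ x = (1, 0) + ∫ ξ in Iic x, jostKernel q μ x ξ (φ ξ)) {x : ℝ}
    (hx : x ≤ x₀) : φ x = jost q μ x :=
  (hq.kernel h h0 x₀).eq_volterraSum (hq.majorant μ) (h := fun _ => (1, 0))
    continuousOn_const ⟨1, by simp⟩ hφ hb heq hx

theorem integrableOn_kernel (hq : IsPotential q) {μ : ℂ} (h : 0 ≤ μ.im) (h0 : μ ≠ 0) {φ : ℝ → ℂ × ℂ}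
    (hφ : Continuous φ) (hb : ∃ C, ∀ ξ, ‖φ ξ‖ ≤ C) (x : ℝ) :
    IntegrableOn (fun ξ => jostKernel q μ x ξ (φ ξ)) (Iic x) := by
  obtain ⟨C, hC⟩ := hb
  refine (hq.kernel h h0 x).integrableOn (hq.majorant μ) hφ.continuousOn (B := C) (fun ξ _ => ?_) le_rfl
  exact (hC ξ).trans (le_mul_of_one_le_right ((norm_nonneg _).trans (hC ξ))
    ((hq.majorant μ).one_le_weight ξ))

theorem jost_fst (hq : IsPotential q) {μ : ℂ} (h : 0 ≤ μ.im) (h0 : μ ≠ 0) (x : ℝ) :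
    (jost q μ x).1 = 1 +
      ∫ ξ in Iic x, q ξ * (coefA μ * (jost q μ ξ).2 - coefB μ * (jost q μ ξ).1) := by
  conv_lhs => rw [hq.jost_eq h h0 x]
  rw [Prod.fst_add, fst_integral (hq.integrableOn_kernel h h0 (hq.continuous_jost h h0)
    (hq.norm_jost_le h h0) x)]
  congr 1
  refine integral_congr_ae (Eventually.of_forall fun ξ => ?_)
  simp only [jostKernel, mat2_apply]
  ring

theorem jost_snd (hq : IsPotential q) {μ : ℂ} (h : 0 ≤ μ.im) (h0 : μ ≠ 0) (x : ℝ) :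
    (jost q μ x).2 = ∫ ξ in Iic x, Complex.exp (2 * phaseCoeff μ * (x - ξ)) *
      (q ξ * (coefB μ * (jost q μ ξ).2 - coefA μ * (jost q μ ξ).1)) := by
  conv_lhs => rw [hq.jost_eq h h0 x]
  rw [Prod.snd_add, snd_integral (hq.integrableOn_kernel h h0 (hq.continuous_jost h h0)
    (hq.norm_jost_le h h0) x), zero_add]
  refine integral_congr_ae (Eventually.of_forall fun ξ => ?_)
  simp only [jostKernel, mat2_apply]
  ring

theorem tendsto_jost_atBot (hq : IsPotential q) {μ : ℂ} (h : 0 ≤ μ.im) (h0 : μ ≠ 0) :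
    Tendsto (jost q μ) atBot (𝓝 (1, 0)) := by
  obtain ⟨C, hC⟩ := hq.norm_jost_le h h0
  have h1 : ∀ x, ‖jost q μ x - (1, 0)‖ ≤
      ∫ ξ in Iic x, (‖coefA μ‖ + ‖coefB μ‖) * |q ξ| * C := by
    intro x
    rw [hq.jost_eq h h0 x, add_sub_cancel_left]
    refine norm_integral_le_of_norm_le ((hq.majorant μ).int.mul_const C).integrableOn ?_
    refine (ae_restrict_iff' measurableSet_Iic).2 (Eventually.of_forall fun ξ hξ => ?_)
    refine ((jostKernel q μ x ξ).le_opNorm _).trans ?_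
    exact mul_le_mul ((hq.kernel h h0 x).bound x ξ hξ le_rfl) (hC ξ) (norm_nonneg _) (by positivity)
  rw [tendsto_iff_norm_sub_tendsto_zero]
  exact squeeze_zero (fun _ => norm_nonneg _) h1
    (tendsto_integral_Iic_atBot ((hq.majorant μ).int.mul_const C))

end IsPotential

theorem norm_exp_neg_phase_le {μ : ℂ} (h : 0 ≤ μ.im) (h0 : μ ≠ 0) {x ξ : ℝ} (hξ : ξ ≤ x) :
    ‖Complex.exp (-(2 * phaseCoeff μ * ξ))‖ ≤ ‖Complex.exp (-(2 * phaseCoeff μ * x))‖ := by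
  have := norm_exp_phase_le h h0 hξ
  have h1 : Complex.exp (-(2 * phaseCoeff μ * ξ)) =
      Complex.exp (-(2 * phaseCoeff μ * x)) * Complex.exp (2 * phaseCoeff μ * (x - ξ)) := by
    rw [← Complex.exp_add]; congr 1; ring
  rw [h1, norm_mul]
  exact mul_le_of_le_one_right (norm_nonneg _) this

/-- Integral form of the equation `g' = 2 θ g + r` for solutions vanishing at `-∞`. -/
theorem eq_integral_exp_of_hasDerivAt {μ : ℂ} (h : 0 ≤ μ.im) (h0 : μ ≠ 0) {g r : ℝ → ℂ}
    (hg : ∀ x, HasDerivAt g (2 * phaseCoeff μ * g x + r x) x) (hr : Continuous r)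
    (hri : Integrable r) (hlim : Tendsto g atBot (𝓝 0)) (x : ℝ) :
    g x = ∫ ξ in Iic x, Complex.exp (2 * phaseCoeff μ * (x - ξ)) * r ξ := by
  have hexp : ∀ ξ : ℝ, HasDerivAt (fun ξ : ℝ => Complex.exp (-(2 * phaseCoeff μ * ξ)))
      (-(2 * phaseCoeff μ) * Complex.exp (-(2 * phaseCoeff μ * ξ))) ξ := by
    intro ξ
    have h1 : HasDerivAt (fun ξ : ℝ => -(2 * phaseCoeff μ * (ξ : ℂ))) (-(2 * phaseCoeff μ)) ξ := by
      have := ((Complex.ofRealCLM.hasDerivAt (x := ξ)).const_mul (2 * phaseCoeff μ)).fun_neg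
      simpa using this
    refine h1.cexp.congr_deriv (by ring)
  have hd : ∀ ξ ∈ Iic x, HasDerivAt (fun ξ : ℝ => Complex.exp (-(2 * phaseCoeff μ * ξ)) * g ξ)
      (Complex.exp (-(2 * phaseCoeff μ * ξ)) * r ξ) ξ := fun ξ _ =>
    ((hexp ξ).mul (hg ξ)).congr_deriv (by ring)
  have hInt : IntegrableOn (fun ξ : ℝ => Complex.exp (-(2 * phaseCoeff μ * ξ)) * r ξ) (Iic x) := by
    refine ((hri.norm.const_mul ‖Complex.exp (-(2 * phaseCoeff μ * x))‖).integrableOn).mono'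
      (Continuous.aestronglyMeasurable (by fun_prop)) ?_
    refine (ae_restrict_iff' measurableSet_Iic).2 (Eventually.of_forall fun ξ hξ => ?_)
    rw [norm_mul]
    exact mul_le_mul_of_nonneg_right (norm_exp_neg_phase_le h h0 hξ) (norm_nonneg _)
  have hl : Tendsto (fun ξ : ℝ => Complex.exp (-(2 * phaseCoeff μ * ξ)) * g ξ) atBot (𝓝 0) := by
    refine squeeze_zero_norm' ?_ (a := fun ξ => ‖Complex.exp (-(2 * phaseCoeff μ * x))‖ * ‖g ξ‖) ?_
    · filter_upwards [eventually_le_atBot x] with ξ hξ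
      rw [norm_mul]
      exact mul_le_mul_of_nonneg_right (norm_exp_neg_phase_le h h0 hξ) (norm_nonneg _)
    · simpa using hlim.norm.const_mul ‖Complex.exp (-(2 * phaseCoeff μ * x))‖
  have key := integral_Iic_of_hasDerivAt_of_tendsto' hd hInt hl
  have h2 : ∀ ξ : ℝ, Complex.exp (2 * phaseCoeff μ * (x - ξ)) * r ξ =
      Complex.exp (2 * phaseCoeff μ * x) * (Complex.exp (-(2 * phaseCoeff μ * ξ)) * r ξ) := by
    intro ξ
    rw [← mul_assoc, ← Complex.exp_add]; congr 2; ring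
  simp_rw [h2]
  rw [integral_const_mul, key, sub_zero, ← mul_assoc, ← Complex.exp_add, add_neg_cancel,
    Complex.exp_zero, one_mul]

/-- Differential form of the equation `g' = 2 θ g + r`. -/
theorem hasDerivAt_integral_exp {μ : ℂ} (h : 0 ≤ μ.im) (h0 : μ ≠ 0) {r : ℝ → ℂ}
    (hr : Continuous r) (hri : Integrable r) (x : ℝ) :
    HasDerivAt (fun x : ℝ => ∫ ξ in Iic x, Complex.exp (2 * phaseCoeff μ * (x - ξ)) * r ξ)
      (2 * phaseCoeff μ * (∫ ξ in Iic x, Complex.exp (2 * phaseCoeff μ * (x - ξ)) * r ξ) + r x)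
      x := by
  have h2 : ∀ x : ℝ, ∫ ξ in Iic x, Complex.exp (2 * phaseCoeff μ * (x - ξ)) * r ξ =
      Complex.exp (2 * phaseCoeff μ * x) *
        ∫ ξ in Iic x, Complex.exp (-(2 * phaseCoeff μ * ξ)) * r ξ := by
    intro x
    rw [← integral_const_mul]
    congr 1
    funext ξ
    rw [← mul_assoc, ← Complex.exp_add]; congr 2; ring
  have hInt : ∀ x : ℝ,
      IntegrableOn (fun ξ : ℝ => Complex.exp (-(2 * phaseCoeff μ * ξ)) * r ξ) (Iic x) := by
    intro x
    refine ((hri.norm.const_mul ‖Complex.exp (-(2 * phaseCoeff μ * x))‖).integrableOn).mono'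
      (Continuous.aestronglyMeasurable (by fun_prop)) ?_
    refine (ae_restrict_iff' measurableSet_Iic).2 (Eventually.of_forall fun ξ hξ => ?_)
    rw [norm_mul]
    exact mul_le_mul_of_nonneg_right (norm_exp_neg_phase_le h h0 hξ) (norm_nonneg _)
  simp_rw [h2]
  have h1 : HasDerivAt (fun ξ : ℝ => 2 * phaseCoeff μ * (ξ : ℂ)) (2 * phaseCoeff μ) x := by
    have := ((Complex.ofRealCLM.hasDerivAt (x := x)).const_mul (2 * phaseCoeff μ))
    simpa using this
  refine (h1.cexp.mul (hasDerivAt_integral_Iic (by fun_prop) hInt x)).congr_deriv ?_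
  have h3 : Complex.exp (2 * phaseCoeff μ * x) * (Complex.exp (-(2 * phaseCoeff μ * x)) * r x) = r x := by
    rw [← mul_assoc, ← Complex.exp_add, add_neg_cancel, Complex.exp_zero, one_mul]
  rw [h3]; ring

namespace IsPotential

variable {q : ℝ → ℝ}

theorem integrable_mul_bounded (hq : IsPotential q) {f : ℝ → ℂ} (hf : Continuous f)
    (hb : ∃ C, ∀ x, ‖f x‖ ≤ C) : Integrable fun x => (q x : ℂ) * f x := by
  obtain ⟨C, hC⟩ := hb
  refine (hq.isMajorant_abs.int.mul_const C).mono'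
    ((Complex.continuous_ofReal.comp hq.continuous).mul hf).aestronglyMeasurable
    (Eventually.of_forall fun x => ?_)
  rw [norm_mul, Complex.norm_real, Real.norm_eq_abs]
  exact mul_le_mul_of_nonneg_left (hC x) (abs_nonneg _)

theorem jost_bounds (hq : IsPotential q) {μ : ℂ} (h : 0 ≤ μ.im) (h0 : μ ≠ 0) (a b : ℂ) :
    Continuous (fun ξ => a * (jost q μ ξ).2 - b * (jost q μ ξ).1) ∧
      ∃ C, ∀ ξ, ‖a * (jost q μ ξ).2 - b * (jost q μ ξ).1‖ ≤ C := by
  have hc := hq.continuous_jost h h0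
  obtain ⟨C, hC⟩ := hq.norm_jost_le h h0
  refine ⟨by fun_prop, ‖a‖ * C + ‖b‖ * C, fun ξ => (norm_sub_le _ _).trans ?_⟩
  rw [norm_mul, norm_mul]
  have h1 := (norm_fst_le (jost q μ ξ)).trans (hC ξ)
  have h2 := (norm_snd_le (jost q μ ξ)).trans (hC ξ)
  gcongr

theorem hasDerivAt_jost_fst (hq : IsPotential q) {μ : ℂ} (h : 0 ≤ μ.im) (h0 : μ ≠ 0) (x : ℝ) :
    HasDerivAt (fun x => (jost q μ x).1)
      (q x * (coefA μ * (jost q μ x).2 - coefB μ * (jost q μ x).1)) x := by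
  have hb := hq.jost_bounds h h0 (coefA μ) (coefB μ)
  have h1 : (fun x => (jost q μ x).1) = _ := funext (hq.jost_fst h h0)
  rw [h1]
  exact (hasDerivAt_integral_Iic ((Complex.continuous_ofReal.comp hq.continuous).mul hb.1)
    (fun _ => (hq.integrable_mul_bounded hb.1 hb.2).integrableOn) x).const_add 1

theorem hasDerivAt_jost_snd (hq : IsPotential q) {μ : ℂ} (h : 0 ≤ μ.im) (h0 : μ ≠ 0) (x : ℝ) :
    HasDerivAt (fun x => (jost q μ x).2)
      (2 * phaseCoeff μ * (jost q μ x).2 +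
        q x * (coefB μ * (jost q μ x).2 - coefA μ * (jost q μ x).1)) x := by
  have hb := hq.jost_bounds h h0 (coefB μ) (coefA μ)
  have h1 : (fun x => (jost q μ x).2) = _ := funext (hq.jost_snd h h0)
  have := hasDerivAt_integral_exp h h0 ((Complex.continuous_ofReal.comp hq.continuous).mul hb.1)
    (hq.integrable_mul_bounded hb.1 hb.2) x
  simp only [Function.comp_def, Pi.mul_apply] at this
  rw [← hq.jost_snd h h0 x] at this
  rw [h1]
  exact this

/-- A bounded solution of the (inhomogeneous) spatial equation with a limit at `-∞` solves the
Volterra equation. -/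
theorem eq_integral_of_ode (hq : IsPotential q) {μ : ℂ} (h : 0 ≤ μ.im) (h0 : μ ≠ 0)
    {f g r s : ℝ → ℂ} {f₀ : ℂ} (hri : Integrable r) (hs : Continuous s)
    (hsi : Integrable s)
    (hf : ∀ x, HasDerivAt f (q x * (coefA μ * g x - coefB μ * f x) + r x) x)
    (hg : ∀ x, HasDerivAt g (2 * phaseCoeff μ * g x + (q x * (coefB μ * g x - coefA μ * f x) + s x)) x)
    (hb : ∃ C, ∀ x, ‖(f x, g x)‖ ≤ C)
    (hfl : Tendsto f atBot (𝓝 f₀)) (hgl : Tendsto g atBot (𝓝 0)) (x : ℝ) :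
    (f x, g x) = (f₀, 0) + (∫ ξ in Iic x, r ξ, ∫ ξ in Iic x,
      Complex.exp (2 * phaseCoeff μ * (x - ξ)) * s ξ) +
      ∫ ξ in Iic x, jostKernel q μ x ξ (f ξ, g ξ) := by
  have hfc : Continuous f := continuous_iff_continuousAt.2 fun x => (hf x).continuousAt
  have hgc : Continuous g := continuous_iff_continuousAt.2 fun x => (hg x).continuousAt
  have hqc : Continuous fun x => (q x : ℂ) := Complex.continuous_ofReal.comp hq.continuous
  obtain ⟨C, hC⟩ := hb
  have hbound : ∀ a b : ℂ, ∃ C, ∀ x, ‖a * g x - b * f x‖ ≤ C := fun a b => by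
    refine ⟨‖a‖ * C + ‖b‖ * C, fun ξ => (norm_sub_le _ _).trans ?_⟩
    rw [norm_mul, norm_mul]
    have h1 := (norm_fst_le (f ξ, g ξ)).trans (hC ξ)
    have h2 := (norm_snd_le (f ξ, g ξ)).trans (hC ξ)
    gcongr
  have hi1 := hq.integrable_mul_bounded (f := fun x => coefA μ * g x - coefB μ * f x)
    (by fun_prop) (hbound _ _)
  have hi2 := hq.integrable_mul_bounded (f := fun x => coefB μ * g x - coefA μ * f x)
    (by fun_prop) (hbound _ _)
  have e1 := integral_Iic_of_hasDerivAt_of_tendsto' (a := x) (fun y _ => hf y)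
    (hi1.add hri).integrableOn hfl
  have e2 := eq_integral_exp_of_hasDerivAt h h0 hg (by fun_prop) (hi2.add hsi) hgl x
  have hexpi : ∀ {u : ℝ → ℂ}, Continuous u → Integrable u →
      IntegrableOn (fun ξ : ℝ => Complex.exp (2 * phaseCoeff μ * (x - ξ)) * u ξ) (Iic x) := by
    intro u hu hui
    refine hui.norm.integrableOn.mono' (Continuous.aestronglyMeasurable (by fun_prop)) ?_
    refine (ae_restrict_iff' measurableSet_Iic).2 (Eventually.of_forall fun ξ hξ => ?_)
    rw [norm_mul]
    exact mul_le_of_le_one_left (norm_nonneg _) (norm_exp_phase_le h h0 hξ)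
  rw [integral_add hi1.integrableOn hri.integrableOn] at e1
  simp_rw [mul_add] at e2
  rw [integral_add] at e2
  · have hi := hq.integrableOn_kernel h h0 (φ := fun x => (f x, g x)) (hfc.prodMk hgc) ⟨C, hC⟩ x
    refine Prod.ext ?_ ?_
    · rw [Prod.fst_add, Prod.fst_add, fst_integral hi]
      have : ∀ ξ, (jostKernel q μ x ξ (f ξ, g ξ)).1 = q ξ * (coefA μ * g ξ - coefB μ * f ξ) :=
        fun ξ => by simp only [jostKernel, mat2_apply]; ring
      simp_rw [this]
      linear_combination -e1
    · rw [Prod.snd_add, Prod.snd_add, snd_integral hi]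
      have : ∀ ξ, (jostKernel q μ x ξ (f ξ, g ξ)).2 = Complex.exp (2 * phaseCoeff μ * (x - ξ)) *
          (q ξ * (coefB μ * g ξ - coefA μ * f ξ)) :=
        fun ξ => by simp only [jostKernel, mat2_apply]; ring
      simp_rw [this]
      rw [e2]
      ring
  · exact hexpi (by fun_prop) hi2
  · exact hexpi hs hsi

end IsPotential

end MCH
end

noncomputable section
namespace MCH

/-! ### Dependence of the Jost solution on the spectral parameter -/

namespace IsPotential

variable {q : ℝ → ℝ}

theorem eventually_coef_le {μ₀ : ℂ} (h1 : μ₀ ≠ 1) (h2 : μ₀ ≠ -1) :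
    ∀ᶠ μ in 𝓝 μ₀, ‖coefA μ‖ + ‖coefB μ‖ ≤ ‖coefA μ₀‖ + ‖coefB μ₀‖ + 1 := by
  have hc : ContinuousAt (fun μ => ‖coefA μ‖ + ‖coefB μ‖) μ₀ :=
    (continuousAt_coefA h1 h2).norm.add (continuousAt_coefB h1 h2).norm
  exact (hc.tendsto.eventually (gt_mem_nhds (lt_add_one _))).mono fun μ hμ => le_of_lt hμ

theorem tendsto_jostKernel {ι : Type*} {l : Filter ι} {Q : ι → ℝ → ℝ} {z : ι → ℂ} {μ₀ : ℂ}
    (hμ : μ₀ ∈ spectralDomain) (hz : Tendsto z l (𝓝 μ₀)) {ξ : ℝ}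
    (hQ : Tendsto (fun i => Q i ξ) l (𝓝 (q ξ))) (x : ℝ) :
    Tendsto (fun i => jostKernel (Q i) (z i) x ξ) l (𝓝 (jostKernel q μ₀ x ξ)) := by
  have hA := (continuousAt_coefA hμ.2.2.1 hμ.2.2.2).tendsto.comp hz
  have hB := (continuousAt_coefB hμ.2.2.1 hμ.2.2.2).tendsto.comp hz
  have hθ := (continuousAt_phaseCoeff hμ.2.1).tendsto.comp hz
  have hQ' := (Complex.continuous_ofReal.tendsto (q ξ)).comp hQ
  have he : Tendsto (fun i => Complex.exp (2 * phaseCoeff (z i) * (x - ξ))) l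
      (𝓝 (Complex.exp (2 * phaseCoeff μ₀ * (x - ξ)))) :=
    ((hθ.const_mul 2).mul_const _).cexp
  exact tendsto_mat2 (hQ'.mul hB).neg (hQ'.mul hA) ((he.mul hQ').mul hA).neg ((he.mul hQ').mul hB)

/-- Continuity of the Jost solution with respect to the spectral parameter. -/
theorem continuousOn_jost (hq : IsPotential q) (x : ℝ) :
    ContinuousOn (fun μ => jost q μ x) spectralDomain := by
  intro μ₀ hμ₀
  refine tendsto_volterraSum (x₀ := x) (B := 1)
    (hq.isMajorant (K := ‖coefA μ₀‖ + ‖coefB μ₀‖ + 1) (by positivity)) ?_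
    (Eventually.of_forall fun _ => ⟨continuousOn_const, by simp⟩) ?_
    (fun _ _ => tendsto_const_nhds) le_rfl
  · filter_upwards [nhdsWithin_le_nhds (eventually_coef_le hμ₀.2.2.1 hμ₀.2.2.2),
      self_mem_nhdsWithin] with μ hμ hμ'
    exact isVolterraKernel_jost hq.continuous hμ'.1 hμ'.2.1
      (fun ξ => mul_le_mul_of_nonneg_right hμ (abs_nonneg _)) x
  · exact fun x _ ξ _ => tendsto_jostKernel hμ₀ (tendsto_id.mono_left nhdsWithin_le_nhds)
      tendsto_const_nhds x

theorem differentiableOn_coefA : DifferentiableOn ℂ coefA {μ | 0 < μ.im} := by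
  intro μ hμ
  have h := ne_of_im_pos hμ
  unfold coefA
  refine DifferentiableWithinAt.div (by fun_prop) (by fun_prop) ?_
  exact mul_ne_zero two_ne_zero (sq_sub_one_ne_zero h.2.1 h.2.2)

theorem differentiableOn_coefB : DifferentiableOn ℂ coefB {μ | 0 < μ.im} := by
  intro μ hμ
  have h := ne_of_im_pos hμ
  unfold coefB
  exact DifferentiableWithinAt.div (by fun_prop) (by fun_prop) (sq_sub_one_ne_zero h.2.1 h.2.2)

theorem differentiableOn_phaseCoeff : DifferentiableOn ℂ phaseCoeff {μ | 0 < μ.im} := by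
  intro μ hμ
  have h := ne_of_im_pos hμ
  unfold phaseCoeff
  exact DifferentiableWithinAt.div (by fun_prop) (by fun_prop) (by simpa using h.1)

theorem isOpen_upper : IsOpen {μ : ℂ | 0 < μ.im} := isOpen_lt continuous_const Complex.continuous_im

/-- Analyticity of the Jost solution with respect to the spectral parameter. -/
theorem differentiableOn_jost (hq : IsPotential q) (x : ℝ) :
    DifferentiableOn ℂ (fun μ => jost q μ x) {μ | 0 < μ.im} := by
  intro μ₀ hμ₀
  have h := ne_of_im_pos hμ₀
  obtain ⟨U, hU, hUo, hμU⟩ := eventually_nhds_iff.1 (eventually_coef_le h.2.1 h.2.2)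
  have hV : IsOpen (U ∩ {μ : ℂ | 0 < μ.im}) := hUo.inter isOpen_upper
  have key := differentiableOn_volterraSum hV (k := jostKernel q) (h := fun _ => (1, 0)) (x₀ := x)
    (B := 1) (hq.isMajorant (K := ‖coefA μ₀‖ + ‖coefB μ₀‖ + 1) (by positivity))
    (fun μ hμ => isVolterraKernel_jost hq.continuous (le_of_lt hμ.2) (ne_of_im_pos hμ.2).1
      (fun ξ => mul_le_mul_of_nonneg_right (hU μ hμ.1) (abs_nonneg _)) x)
    continuousOn_const (by simp) ?_ le_rfl
  · exact (key.differentiableAt (hV.mem_nhds ⟨hμU, hμ₀⟩)).differentiableWithinAt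
  · intro x ξ
    have hA := differentiableOn_coefA
    have hB := differentiableOn_coefB
    have he : DifferentiableOn ℂ (fun μ => Complex.exp (2 * phaseCoeff μ * (x - ξ)))
        {μ | 0 < μ.im} := ((differentiableOn_phaseCoeff.const_mul 2).mul_const _).cexp
    exact (differentiableOn_mat2 (hB.const_mul _).neg (hA.const_mul _)
      ((he.mul_const _).mul hA).neg ((he.mul_const _).mul hB)).mono inter_subset_right

/-! #### Symmetries -/

/-- Conjugation by the third Pauli matrix. -/
def signFlip : (ℂ × ℂ) ≃L[ℝ] ℂ × ℂ :=
  (ContinuousLinearEquiv.refl ℝ ℂ).prodCongr (ContinuousLinearEquiv.neg ℝ)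

/-- Complex conjugation followed by a sign change of the second component. -/
def conjFlip : (ℂ × ℂ) ≃L[ℝ] ℂ × ℂ :=
  Complex.conjCLE.prodCongr (Complex.conjCLE.trans (ContinuousLinearEquiv.neg ℝ))

@[simp] theorem signFlip_apply (e : ℂ × ℂ) : signFlip e = (e.1, -e.2) := rfl

@[simp] theorem conjFlip_apply (e : ℂ × ℂ) :
    conjFlip e = (starRingEnd ℂ e.1, -starRingEnd ℂ e.2) := rfl

theorem coefA_neg_inv {μ : ℂ} (h : μ ∈ spectralDomain) : coefA (-μ⁻¹) = -coefA μ := by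
  obtain ⟨-, h0, h1, h2⟩ := h
  have h3 := sq_sub_one_ne_zero h1 h2
  have h4 : 1 - μ ^ 2 ≠ 0 := fun h => h3 (by linear_combination -h)
  have e : (-μ⁻¹) ^ 2 - 1 = (1 - μ ^ 2) / μ ^ 2 := by field_simp
  have e' : (-μ⁻¹) ^ 2 + 1 = (1 + μ ^ 2) / μ ^ 2 := by field_simp
  rw [coefA, coefA, e, e', ← neg_sub (μ ^ 2) 1]
  field_simp
  ring

theorem coefB_neg_inv {μ : ℂ} (h : μ ∈ spectralDomain) : coefB (-μ⁻¹) = coefB μ := by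
  obtain ⟨-, h0, h1, h2⟩ := h
  have h3 := sq_sub_one_ne_zero h1 h2
  have e : (-μ⁻¹) ^ 2 - 1 = -(μ ^ 2 - 1) / μ ^ 2 := by field_simp; ring
  rw [coefB, coefB, e]
  field_simp

theorem phaseCoeff_neg_inv {μ : ℂ} (h0 : μ ≠ 0) : phaseCoeff (-μ⁻¹) = phaseCoeff μ := by
  rw [phaseCoeff, phaseCoeff]
  field_simp
  ring

/-- Under μ ↦ -1/μ the phase θ and the diagonal coefficient are invariant while the off-diagonal one
changes sign; conjugation by σ₃ undoes this. -/
theorem jost_neg_inv {μ : ℂ} (h : μ ∈ spectralDomain) (x : ℝ) :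
    jost q (-μ⁻¹) x = ((jost q μ x).1, -(jost q μ x).2) := by
  refine map_volterraSum signFlip (fun x ξ e => ?_) (fun _ => by simp) x
  simp only [jostKernel, coefA_neg_inv h, coefB_neg_inv h, phaseCoeff_neg_inv h.2.1, mat2_apply,
    signFlip_apply, Prod.mk.injEq]
  constructor <;> ring

theorem coefA_neg_conj (μ : ℂ) : coefA (-starRingEnd ℂ μ) = starRingEnd ℂ (-coefA μ) := by
  simp [coefA, div_eq_mul_inv, map_ofNat]

theorem coefB_neg_conj (μ : ℂ) : coefB (-starRingEnd ℂ μ) = starRingEnd ℂ (coefB μ) := by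
  simp [coefB, div_eq_mul_inv]

theorem phaseCoeff_neg_conj (μ : ℂ) : phaseCoeff (-starRingEnd ℂ μ) = starRingEnd ℂ (phaseCoeff μ) := by
  simp [phaseCoeff, div_eq_mul_inv, map_ofNat]

/-- Reality of the potential: the reflection μ ↦ -μ̄ preserves the upper half-plane and conjugates θ
and the diagonal coefficient, with an extra sign on the off-diagonal one. -/
theorem jost_neg_conj (μ : ℂ) (x : ℝ) :
    jost q (-starRingEnd ℂ μ) x =
      (starRingEnd ℂ (jost q μ x).1, -starRingEnd ℂ (jost q μ x).2) := by
  refine map_volterraSum conjFlip (fun x ξ e => ?_) (fun _ => by simp) x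
  simp only [jostKernel, coefA_neg_conj, coefB_neg_conj, phaseCoeff_neg_conj, mat2_apply,
    conjFlip_apply, Prod.mk.injEq]
  have he : starRingEnd ℂ (Complex.exp (2 * phaseCoeff μ * (x - ξ))) =
      Complex.exp (2 * starRingEnd ℂ (phaseCoeff μ) * (x - ξ)) := by
    rw [← Complex.exp_conj]; simp [map_ofNat]
  simp only [map_add, map_mul, map_neg, Complex.conj_ofReal, he]
  constructor <;> ring

/-! #### Special values -/

/-- On the real line the Jost solution `(f, g)` satisfies `|f|² - |g|² = 1`. -/
theorem jost_det_real (hq : IsPotential q) {μ : ℝ} (h0 : μ ≠ 0) (x : ℝ) :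
    (jost q μ x).1 * starRingEnd ℂ (jost q μ x).1 -
      (jost q μ x).2 * starRingEnd ℂ (jost q μ x).2 = 1 := by
  have him : 0 ≤ (μ : ℂ).im := by simp
  have h0' : (μ : ℂ) ≠ 0 := by exact_mod_cast h0
  -- For real μ the three coefficients are purely imaginary, so |f|² - |g|² is constant in x; its
  -- value is read off at -∞.
  have hA : starRingEnd ℂ (coefA μ) = -coefA μ := by simp [coefA, div_eq_mul_inv, map_ofNat]
  have hB : starRingEnd ℂ (coefB μ) = -coefB μ := by simp [coefB, div_eq_mul_inv]
  have hθ : starRingEnd ℂ (phaseCoeff μ) = -phaseCoeff μ := by simp [phaseCoeff, div_eq_mul_inv, map_ofNat]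
  have hd : ∀ x, HasDerivAt (fun x => (jost q μ x).1 * starRingEnd ℂ (jost q μ x).1 -
      (jost q μ x).2 * starRingEnd ℂ (jost q μ x).2) 0 x := by
    intro x
    have h1 := hq.hasDerivAt_jost_fst him h0' x
    have h2 := hq.hasDerivAt_jost_snd him h0' x
    refine ((h1.mul h1.star).sub (h2.mul h2.star)).congr_deriv ?_
    simp only [← starRingEnd_apply, map_add, map_mul, map_sub, Complex.conj_ofReal, hA, hB, hθ,
      map_ofNat]
    ring
  have hconst : ∀ x y, (fun x => (jost q μ x).1 * starRingEnd ℂ (jost q μ x).1 -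
      (jost q μ x).2 * starRingEnd ℂ (jost q μ x).2) x = (fun x => (jost q μ x).1 *
      starRingEnd ℂ (jost q μ x).1 - (jost q μ x).2 * starRingEnd ℂ (jost q μ x).2) y :=
    is_const_of_deriv_eq_zero (fun x => (hd x).differentiableAt) fun x => (hd x).deriv
  have hl := hq.tendsto_jost_atBot him h0'
  have hl1 := (continuous_fst.tendsto ((1 : ℂ), (0 : ℂ))).comp hl
  have hl2 := (continuous_snd.tendsto ((1 : ℂ), (0 : ℂ))).comp hl
  have hlim := (hl1.mul ((Complex.continuous_conj.tendsto _).comp hl1)).sub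
    (hl2.mul ((Complex.continuous_conj.tendsto _).comp hl2))
  simp only [map_one, mul_one, map_zero, mul_zero, sub_zero] at hlim
  refine tendsto_nhds_unique (tendsto_const_nhds.congr fun y => ?_) hlim
  exact hconst x y

/-- At μ = i the off-diagonal coefficient is 0 and the diagonal one is 1/2, so the system decouples
into g = 0 and f' = -q f / 2. -/
theorem jost_I (hq : IsPotential q) (x : ℝ) :
    jost q Complex.I x = (Complex.exp (-(1 / 2) * ((∫ ξ in Iic x, q ξ : ℝ) : ℂ)), 0) := by
  have hI : (0 : ℝ) ≤ Complex.I.im := by simp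
  have hA : coefA Complex.I = 0 := by simp [coefA]
  have hB : coefB Complex.I = 1 / 2 := by
    simp only [coefB, Complex.I_mul_I, Complex.I_sq]; norm_num
  have hd : ∀ x, HasDerivAt (fun x : ℝ => Complex.exp (-(1 / 2) * ((∫ ξ in Iic x, q ξ : ℝ) : ℂ)))
      (q x * (coefA Complex.I * 0 - coefB Complex.I *
        Complex.exp (-(1 / 2) * ((∫ ξ in Iic x, q ξ : ℝ) : ℂ))) + 0) x := by
    intro x
    have := (((hasDerivAt_integral_Iic hq.continuous
      (fun _ => hq.integrable.integrableOn) x).ofReal_comp).const_mul (-(1 / 2) : ℂ)).cexp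
    refine this.congr_deriv ?_
    rw [hB]; ring
  have hl : Tendsto (fun x : ℝ => Complex.exp (-(1 / 2) * ((∫ ξ in Iic x, q ξ : ℝ) : ℂ))) atBot
      (𝓝 1) := by
    have := (((Complex.continuous_ofReal.tendsto 0).comp
      (tendsto_integral_Iic_atBot hq.integrable)).const_mul (-(1 / 2) : ℂ)).cexp
    simpa using this
  have hb : ∃ C, ∀ x : ℝ, ‖(Complex.exp (-(1 / 2) * ((∫ ξ in Iic x, q ξ : ℝ) : ℂ)), (0 : ℂ))‖ ≤ C := by
    refine ⟨Real.exp (1 / 2 * ∫ ξ, |q ξ|), fun x => ?_⟩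
    rw [Prod.norm_def, norm_zero, max_eq_left (norm_nonneg _), Complex.norm_exp, Real.exp_le_exp]
    have e : (-(1 / 2) * ((∫ ξ in Iic x, q ξ : ℝ) : ℂ)).re = -(1 / 2) * ∫ ξ in Iic x, q ξ := by
      rw [← Complex.ofReal_re (-(1 / 2) * ∫ ξ in Iic x, q ξ)]; push_cast; rfl
    rw [e]
    have h1 : |∫ ξ in Iic x, q ξ| ≤ ∫ ξ in Iic x, |q ξ| :=
      norm_integral_le_integral_norm (μ := volume.restrict (Iic x)) q
    have h2 : ∫ ξ in Iic x, |q ξ| ≤ ∫ ξ, |q ξ| :=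
      setIntegral_le_integral hq.isMajorant_abs.int (Eventually.of_forall fun _ => abs_nonneg _)
    have := neg_abs_le (∫ ξ in Iic x, q ξ)
    linarith
  have key := hq.eq_integral_of_ode hI Complex.I_ne_zero (r := fun _ => 0) (s := fun _ => 0)
    (g := fun _ => 0) (integrable_zero _ _ _) continuous_const (integrable_zero _ _ _) hd
    (fun x => (hasDerivAt_const x (0 : ℂ)).congr_deriv (by rw [hA]; ring)) hb hl tendsto_const_nhds
  refine (hq.eq_jost hI Complex.I_ne_zero (x₀ := x)
    (φ := fun x => (Complex.exp (-(1 / 2) * ((∫ ξ in Iic x, q ξ : ℝ) : ℂ)), 0)) ?_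
    ⟨hb.choose, fun ξ _ => hb.choose_spec ξ⟩ (fun y _ => ?_) le_rfl).symm
  · exact (Continuous.prodMk (continuous_iff_continuousAt.2 fun x => (hd x).continuousAt)
      continuous_const).continuousOn
  · have := key y
    simp only [mul_zero, integral_zero, Prod.mk_zero_zero, add_zero] at this
    exact this

/-! #### Large values of the spectral parameter -/

/-- The Riemann–Lebesgue lemma, valid up to the imaginary axis. A tail of small mass is cut off at
R, and on [R, x] one integration by parts gains a factor 1/|κ|; this is where q of class C¹ is used.
-/
theorem tendsto_integral_exp_zero (hq : IsPotential q) {ι : Type*} {l : Filter ι} {κ : ι → ℂ}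
    (hre : ∀ᶠ i in l, (κ i).re ≤ 0) (hκ : Tendsto (fun i => ‖κ i‖) l atTop) (x : ℝ) :
    Tendsto (fun i => ∫ ξ in Iic x, Complex.exp (κ i * (x - ξ)) * q ξ) l (𝓝 0) := by
  rw [Metric.tendsto_nhds]
  intro ε hε
  have hqi := hq.isMajorant_abs.int
  obtain ⟨R, hR, hRx⟩ : ∃ R, ∫ ξ in Iic R, |q ξ| < ε / 2 ∧ R ≤ x :=
    (((tendsto_integral_Iic_atBot hqi).eventually (gt_mem_nhds (by positivity : (0 : ℝ) < ε / 2))).and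
      (eventually_le_atBot x)).exists
  have hq' : Continuous (deriv q) := hq.contDiff.continuous_deriv le_rfl
  set K := |q x| + |q R| + ∫ ξ in R..x, |deriv q ξ| with hK
  have hK0 : 0 ≤ K := by
    have : 0 ≤ ∫ ξ in R..x, |deriv q ξ| :=
      intervalIntegral.integral_nonneg hRx fun _ _ => abs_nonneg _
    positivity
  filter_upwards [hre, hκ.eventually_gt_atTop (2 * K / ε), hκ.eventually_gt_atTop 0] with i hi hi' hi0
  have hκ0 : κ i ≠ 0 := norm_pos_iff.1 hi0
  have hexp : ∀ ξ ≤ x, ‖Complex.exp (κ i * (x - ξ))‖ ≤ 1 := by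
    intro ξ hξ
    rw [Complex.norm_exp, Real.exp_le_one_iff, ← Complex.ofReal_sub, Complex.re_mul_ofReal]
    exact mul_nonpos_of_nonpos_of_nonneg hi (by linarith)
  have hc : Continuous fun ξ : ℝ => Complex.exp (κ i * (x - ξ)) * (q ξ : ℂ) := by
    have := hq.continuous
    fun_prop
  have hInt : IntegrableOn (fun ξ : ℝ => Complex.exp (κ i * (x - ξ)) * (q ξ : ℂ)) (Iic x) := by
    refine hqi.integrableOn.mono' hc.aestronglyMeasurable ?_
    refine (ae_restrict_iff' measurableSet_Iic).2 (Eventually.of_forall fun ξ hξ => ?_)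
    rw [norm_mul, Complex.norm_real, Real.norm_eq_abs]
    exact mul_le_of_le_one_left (abs_nonneg _) (hexp ξ hξ)
  have hsplit : ∫ ξ in Iic x, Complex.exp (κ i * (x - ξ)) * (q ξ : ℂ) =
      (∫ ξ in Iic R, Complex.exp (κ i * (x - ξ)) * (q ξ : ℂ)) +
        ∫ ξ in R..x, Complex.exp (κ i * (x - ξ)) * (q ξ : ℂ) := by
    rw [← intervalIntegral.integral_Iic_sub_Iic (hInt.mono_set (Iic_subset_Iic.2 hRx)) hInt]
    ring
  have htail : ‖∫ ξ in Iic R, Complex.exp (κ i * (x - ξ)) * (q ξ : ℂ)‖ ≤ ∫ ξ in Iic R, |q ξ| := by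
    refine norm_integral_le_of_norm_le hqi.integrableOn ?_
    refine (ae_restrict_iff' measurableSet_Iic).2 (Eventually.of_forall fun ξ hξ => ?_)
    rw [norm_mul, Complex.norm_real, Real.norm_eq_abs]
    exact mul_le_of_le_one_left (abs_nonneg _) (hexp ξ (le_trans hξ hRx))
  have hparts : ‖∫ ξ in R..x, Complex.exp (κ i * (x - ξ)) * (q ξ : ℂ)‖ ≤ K / ‖κ i‖ := by
    have hv : ∀ ξ ∈ uIcc R x, HasDerivAt (fun ξ : ℝ => -Complex.exp (κ i * (x - ξ)) / κ i)
        (Complex.exp (κ i * (x - ξ))) ξ := by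
      intro ξ _
      have h1 : HasDerivAt (fun ξ : ℝ => κ i * ((x : ℂ) - (ξ : ℂ))) (κ i * (0 - 1)) ξ := by
        have := (Complex.ofRealCLM.hasDerivAt (x := ξ)).const_sub (x : ℂ)
        have := this.const_mul (κ i)
        simpa using this
      have := (h1.cexp.neg).div_const (κ i)
      refine this.congr_deriv ?_
      field_simp
      ring
    have hu : ∀ ξ ∈ uIcc R x, HasDerivAt (fun ξ : ℝ => (q ξ : ℂ)) ((deriv q ξ : ℝ) : ℂ) ξ :=
      fun ξ _ => ((hq.contDiff.differentiable one_ne_zero ξ).hasDerivAt).ofReal_comp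
    have hbp := intervalIntegral.integral_mul_deriv_eq_deriv_mul hu hv
      (Continuous.intervalIntegrable (by fun_prop) _ _)
      (Continuous.intervalIntegrable (by fun_prop) _ _)
    have hcomm : ∫ ξ in R..x, Complex.exp (κ i * (x - ξ)) * (q ξ : ℂ) =
        ∫ ξ in R..x, (q ξ : ℂ) * Complex.exp (κ i * (x - ξ)) := by
      congr 1; funext ξ; ring
    rw [hcomm, hbp]
    have hb : ∀ ξ ≤ x, ‖-Complex.exp (κ i * (x - ξ)) / κ i‖ ≤ 1 / ‖κ i‖ := by
      intro ξ hξ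
      rw [norm_div, norm_neg]
      exact div_le_div_of_nonneg_right (hexp ξ hξ) (norm_nonneg _)
    have n1 : ‖(q x : ℂ) * (-Complex.exp (κ i * (x - x)) / κ i)‖ ≤ |q x| / ‖κ i‖ := by
      rw [norm_mul, Complex.norm_real, Real.norm_eq_abs, div_eq_mul_one_div |q _|]
      exact mul_le_mul_of_nonneg_left (hb x le_rfl) (abs_nonneg _)
    have n2 : ‖(q R : ℂ) * (-Complex.exp (κ i * (x - R)) / κ i)‖ ≤ |q R| / ‖κ i‖ := by
      rw [norm_mul, Complex.norm_real, Real.norm_eq_abs, div_eq_mul_one_div |q _|]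
      exact mul_le_mul_of_nonneg_left (hb R hRx) (abs_nonneg _)
    have n3 : ‖∫ ξ in R..x, ((deriv q ξ : ℝ) : ℂ) * (-Complex.exp (κ i * (x - ξ)) / κ i)‖ ≤
        (∫ ξ in R..x, |deriv q ξ|) / ‖κ i‖ := by
      rw [← intervalIntegral.integral_div]
      refine intervalIntegral.norm_integral_le_of_norm_le hRx
        (Eventually.of_forall fun ξ hξ => ?_) (Continuous.intervalIntegrable (by fun_prop) _ _)
      rw [norm_mul, Complex.norm_real, Real.norm_eq_abs, div_eq_mul_one_div |deriv q ξ|]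
      exact mul_le_mul_of_nonneg_left (hb ξ hξ.2) (abs_nonneg _)
    refine (norm_sub_le _ _).trans ((add_le_add (norm_sub_le _ _) le_rfl).trans ?_)
    rw [hK, add_div, add_div]
    exact add_le_add (add_le_add n1 n2) n3
  have hKκ : K / ‖κ i‖ < ε / 2 := by
    rw [div_lt_iff₀ hi0]
    rw [div_lt_iff₀ hε] at hi'
    linarith
  rw [dist_zero_right, hsplit]
  calc _ ≤ _ := norm_add_le _ _
    _ < ε / 2 + ε / 2 := add_lt_add (htail.trans_lt hR) (hparts.trans_lt hKκ)
    _ = ε := by ring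

theorem tendsto_inv_cobounded : Tendsto (fun μ : ℂ => μ⁻¹) (Bornology.cobounded ℂ) (𝓝 0) :=
  tendsto_inv₀_cobounded

theorem tendsto_coefA_cobounded : Tendsto coefA (Bornology.cobounded ℂ) (𝓝 (Complex.I / 2)) := by
  have h := tendsto_inv_cobounded
  have h1 : Tendsto (fun μ : ℂ => Complex.I * (1 + μ⁻¹ ^ 2) / (2 * (1 - μ⁻¹ ^ 2)))
      (Bornology.cobounded ℂ) (𝓝 (Complex.I * (1 + 0 ^ 2) / (2 * (1 - 0 ^ 2)))) :=
    (((h.pow 2).const_add 1).const_mul _).div (((h.pow 2).const_sub 1).const_mul 2) (by norm_num)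
  simp only [ne_eq, OfNat.ofNat_ne_zero, not_false_eq_true, zero_pow, add_zero, mul_one,
    sub_zero] at h1
  refine h1.congr' ?_
  filter_upwards [Bornology.eventually_ne_cobounded (0 : ℂ)] with μ hμ
  rw [coefA]
  have : μ ^ 2 - 1 = μ ^ 2 * (1 - μ⁻¹ ^ 2) := by field_simp
  have e : μ ^ 2 + 1 = μ ^ 2 * (1 + μ⁻¹ ^ 2) := by field_simp
  rw [this, e]
  rw [show Complex.I * (μ ^ 2 * (1 + μ⁻¹ ^ 2)) = μ ^ 2 * (Complex.I * (1 + μ⁻¹ ^ 2)) by ring,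
    show 2 * (μ ^ 2 * (1 - μ⁻¹ ^ 2)) = μ ^ 2 * (2 * (1 - μ⁻¹ ^ 2)) by ring,
    mul_div_mul_left _ _ (pow_ne_zero 2 hμ)]

theorem tendsto_coefB_cobounded : Tendsto coefB (Bornology.cobounded ℂ) (𝓝 0) := by
  have h := tendsto_inv_cobounded
  have h1 : Tendsto (fun μ : ℂ => Complex.I * μ⁻¹ / (1 - μ⁻¹ ^ 2))
      (Bornology.cobounded ℂ) (𝓝 (Complex.I * 0 / (1 - 0 ^ 2))) :=
    (h.const_mul _).div ((h.pow 2).const_sub 1) (by norm_num)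
  simp only [mul_zero, zero_div] at h1
  refine h1.congr' ?_
  filter_upwards [Bornology.eventually_ne_cobounded (0 : ℂ)] with μ hμ
  rw [coefB]
  have : μ ^ 2 - 1 = μ ^ 2 * (1 - μ⁻¹ ^ 2) := by field_simp
  rw [this, show Complex.I * μ = μ ^ 2 * (Complex.I * μ⁻¹) by field_simp,
    mul_div_mul_left _ _ (pow_ne_zero 2 hμ)]

theorem tendsto_phaseCoeff_cobounded :
    Tendsto (fun μ => ‖2 * phaseCoeff μ‖) (Bornology.cobounded ℂ) atTop := by
  have h : Tendsto (fun μ : ℂ => ‖μ‖ / 2 + (-1 / 2)) (Bornology.cobounded ℂ) atTop :=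
    tendsto_atTop_add_const_right _ _
      (Tendsto.atTop_div_const (by norm_num) tendsto_norm_cobounded_atTop)
  refine tendsto_atTop_mono' _ ?_ h
  filter_upwards [tendsto_norm_cobounded_atTop.eventually_ge_atTop (1 : ℝ)] with μ hμ
  have h0 : μ ≠ 0 := norm_pos_iff.1 (by linarith)
  rw [phaseCoeff_eq h0, show 2 * (Complex.I / 4 * (μ - μ⁻¹)) = Complex.I / 2 * (μ - μ⁻¹) by ring,
    norm_mul]
  have h1 : ‖Complex.I / 2‖ = 1 / 2 := by simp
  have h2 : ‖μ⁻¹‖ ≤ 1 := by rw [norm_inv]; exact inv_le_one_of_one_le₀ hμ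
  have := norm_sub_norm_le μ μ⁻¹
  rw [h1]
  linarith

/-- The off-diagonal coefficient tends to i/2 and not to 0, so the kernel itself does not vanish as
μ → ∞. The diagonal coefficient does vanish, and the off-diagonal part of the first Neumann iterate
tends to 0 by oscillation; all later iterates then follow by dominated convergence. -/
theorem tendsto_jost_cobounded (hq : IsPotential q) (x : ℝ) :
    Tendsto (fun μ => jost q μ x) (Bornology.cobounded ℂ ⊓ 𝓟 {μ | 0 < μ.im}) (𝓝 (1, 0)) := by
  set l := Bornology.cobounded ℂ ⊓ 𝓟 {μ : ℂ | 0 < μ.im} with hl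
  have hlc : l.IsCountablyGenerated := by
    have : (Bornology.cobounded ℂ).IsCountablyGenerated := by
      rw [← comap_norm_atTop]; infer_instance
    infer_instance
  have hle : l ≤ Bornology.cobounded ℂ := inf_le_left
  have him : ∀ᶠ μ in l, 0 < μ.im := mem_inf_of_right (mem_principal_self _)
  have hA := tendsto_coefA_cobounded.mono_left hle
  have hB := tendsto_coefB_cobounded.mono_left hle
  have hbound : ∀ᶠ μ in l, ‖coefA μ‖ + ‖coefB μ‖ ≤ 1 := by
    have := hA.norm.add hB.norm
    rw [show ‖Complex.I / 2‖ + ‖(0 : ℂ)‖ = 1 / 2 by simp] at this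
    exact (this.eventually (gt_mem_nhds (by norm_num : (1 / 2 : ℝ) < 1))).mono fun _ h => le_of_lt h
  have hk : ∀ᶠ μ in l, IsVolterraKernel x (fun y => 1 * |q y|) (jostKernel q μ) := by
    filter_upwards [him, hbound] with μ hμ hμ'
    exact isVolterraKernel_jost hq.continuous hμ.le (ne_of_im_pos hμ).1
      (fun ξ => mul_le_mul_of_nonneg_right hμ' (abs_nonneg _)) x
  have hg := hq.isMajorant (K := 1) zero_le_one
  have hh : ∀ᶠ μ : ℂ in l, ContinuousOn (fun _ : ℝ => ((1 : ℂ), (0 : ℂ))) (Iic x) ∧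
      ∀ ξ ≤ x, ‖((1 : ℂ), (0 : ℂ))‖ ≤ 1 := Eventually.of_forall fun _ => ⟨continuousOn_const, by simp⟩
  have hterm : ∀ n : ℕ, ∀ y ≤ x,
      Tendsto (fun μ => volterraTerm (jostKernel q μ) (fun _ => ((1 : ℂ), (0 : ℂ))) (n + 1) y) l
        (𝓝 0) := by
    intro n
    induction n with
    | zero =>
      intro y hy
      have hre : ∀ᶠ μ in l, (2 * phaseCoeff μ).re ≤ 0 := by
        filter_upwards [him] with μ hμ
        have := phaseCoeff_re_nonpos hμ.le (ne_of_im_pos hμ).1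
        rw [show (2 * phaseCoeff μ) = ((2 : ℝ) : ℂ) * phaseCoeff μ by norm_num, Complex.re_ofReal_mul]
        linarith
      have hRL := hq.tendsto_integral_exp_zero hre (tendsto_phaseCoeff_cobounded.mono_left hle) y
      have h1 : Tendsto (fun μ => (-coefB μ * ∫ ξ in Iic y, (q ξ : ℂ),
          -coefA μ * ∫ ξ in Iic y, Complex.exp (2 * phaseCoeff μ * (y - ξ)) * q ξ)) l
          (𝓝 (-0 * ∫ ξ in Iic y, (q ξ : ℂ), -(Complex.I / 2) * 0)) :=
        (hB.neg.mul_const _).prodMk_nhds (hA.neg.mul hRL)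
      simp only [neg_zero, zero_mul, mul_zero] at h1
      refine h1.congr' ?_
      filter_upwards [hk, him] with μ hμ hμ'
      have hi := hμ.integrableOn hg (φ := fun _ => ((1 : ℂ), (0 : ℂ))) (B := 1)
        continuousOn_const (fun ξ _ => by simpa using hg.one_le_weight ξ) hy
      simp only [volterraTerm]
      refine Prod.ext ?_ ?_
      · rw [fst_integral hi]
        simp only
        rw [← integral_const_mul]
        congr 1; funext ξ; simp only [jostKernel, mat2_apply]; ring
      · rw [snd_integral hi]
        simp only
        rw [← integral_const_mul]
        congr 1; funext ξ; simp only [jostKernel, mat2_apply]; ring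
    | succ n ih =>
      intro y hy
      have := tendsto_integral_kernel (B := 1 * (1 / 2) ^ (n + 1)) hg hk (l := l)
        (φ := fun μ => volterraTerm (jostKernel q μ) (fun _ => ((1 : ℂ), (0 : ℂ))) (n + 1)) ?_ hy
        (F := fun _ => 0) ?_
      · rw [integral_zero] at this
        exact this
      · filter_upwards [hk, hh] with i hi hi' using hi.volterraTerm_spec hg hi'.1 hi'.2 (n + 1)
      · intro ξ hξ
        refine squeeze_zero_norm' (a := fun μ => 1 * |q ξ| *
          ‖volterraTerm (jostKernel q μ) (fun _ => ((1 : ℂ), (0 : ℂ))) (n + 1) ξ‖) ?_ ?_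
        · filter_upwards [hk] with μ hμ
          refine ((jostKernel q μ y ξ).le_opNorm _).trans ?_
          exact mul_le_mul_of_nonneg_right (hμ.bound y ξ hξ.le hy) (norm_nonneg _)
        · simpa using (ih ξ (hξ.le.trans hy)).norm.const_mul (1 * |q ξ|)
  have := tendsto_volterraSum_of_term (f := fun n => if n = 0 then ((1 : ℂ), (0 : ℂ)) else 0) hg hk
    hh le_rfl (fun n => ?_)
  · rw [tsum_ite_eq] at this
    exact this
  · rcases n with _ | n
    · simpa [volterraTerm] using tendsto_const_nhds
    · simpa using hterm n x le_rfl

end IsPotential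

end MCH
end

noncomputable section
namespace MCH

/-! ### The Jost solution at the edge `μ = 1` -/

/-- The mean value inequality on the left half-plane, which is convex and on which the derivative of
exp is bounded by 1. -/
theorem norm_one_sub_exp_le {z : ℂ} (hz : z.re ≤ 0) : ‖1 - Complex.exp z‖ ≤ ‖z‖ := by
  have hconv : Convex ℝ {w : ℂ | w.re ≤ 0} := convex_halfSpace_re_le 0
  have := hconv.norm_image_sub_le_of_norm_deriv_le (f := Complex.exp) (C := 1) (x := z) (y := 0)
    (fun w _ => Complex.differentiableAt_exp) (fun w hw => ?_) hz (by simp)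
  · simpa using this
  · rw [Complex.deriv_exp, Complex.norm_exp, Real.exp_le_one_iff]
    exact hw

/-- The Volterra kernel for `(f - g, (μ - 1) (f + g))`, where `(f, g)` is the Jost solution. -/
def edgeKernel (q : ℝ → ℝ) (μ : ℂ) (x ξ : ℝ) : ℂ × ℂ →L[ℂ] ℂ × ℂ :=
  mat2 (-(q ξ / 2 * (Complex.I * (μ + 1) / 2) *
      ((1 - Complex.exp (2 * phaseCoeff μ * (x - ξ))) / (μ - 1))))
    (q ξ / 2 * (Complex.I / (2 * (μ + 1))) * (1 + Complex.exp (2 * phaseCoeff μ * (x - ξ))))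
    (-(q ξ / 2 * (Complex.I * (μ + 1) / 2) * (1 + Complex.exp (2 * phaseCoeff μ * (x - ξ)))))
    (q ξ / 2 * ((μ - 1) * (Complex.I / (2 * (μ + 1)))) *
      (1 - Complex.exp (2 * phaseCoeff μ * (x - ξ))))

/-- The limit of `edgeKernel` at `μ = 1`. -/
def edgeKernelOne (q : ℝ → ℝ) (x ξ : ℝ) : ℂ × ℂ →L[ℂ] ℂ × ℂ :=
  mat2 (-(q ξ / 2 * (x - ξ))) (q ξ * (Complex.I / 4)) (-(q ξ * Complex.I)) 0

/-- The change of unknowns that regularizes the equation at `μ = 1`. -/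
def edgeMap (μ : ℂ) : ℂ × ℂ →L[ℂ] ℂ × ℂ := mat2 1 (-1) (μ - 1) (μ - 1)

/-- The sum of the two Lax coefficients has a simple pole at μ = 1 and their difference a simple
zero. In the unknowns f - g and (μ - 1)(f + g) the pole therefore survives only in the quotient (1 -
e^{2θ(x-ξ)})/(μ - 1), which is regular since θ vanishes at μ = 1. -/
theorem edgeMap_jostKernel {μ : ℂ} (h1 : μ ≠ 1) (h2 : μ ≠ -1) (q : ℝ → ℝ) (x ξ : ℝ) (e : ℂ × ℂ) :
    edgeMap μ (jostKernel q μ x ξ e) = edgeKernel q μ x ξ (edgeMap μ e) := by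
  have h1' : μ - 1 ≠ 0 := sub_ne_zero.2 h1
  have h2' : μ + 1 ≠ 0 := fun h => h2 (eq_neg_of_add_eq_zero_left h)
  have h3 : μ ^ 2 - 1 = (μ - 1) * (μ + 1) := by ring
  simp only [edgeMap, jostKernel, edgeKernel, mat2_apply, coefA, coefB, h3]
  generalize Complex.exp (2 * phaseCoeff μ * (x - ξ)) = w
  refine Prod.ext ?_ ?_
  · simp only
    field_simp
    ring
  · simp only
    field_simp
    ring

/-- The punctured neighbourhoods of `1` in the closed upper half-plane. -/
def edgeFilter : Filter ℂ := 𝓝[{μ : ℂ | 0 ≤ μ.im ∧ μ ≠ 1}] 1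

instance : edgeFilter.IsCountablyGenerated := by unfold edgeFilter; infer_instance

theorem eventually_edgeFilter :
    ∀ᶠ μ in edgeFilter, 0 ≤ μ.im ∧ μ ≠ 1 ∧ ‖μ - 1‖ ≤ 1 / 2 ∧ μ ≠ 0 ∧ μ ≠ -1 := by
  have h : ∀ᶠ μ in edgeFilter, ‖μ - 1‖ ≤ 1 / 2 := by
    filter_upwards [nhdsWithin_le_nhds (Metric.closedBall_mem_nhds (1 : ℂ)
      (by norm_num : (0 : ℝ) < 1 / 2))] with μ hμ
    rwa [mem_closedBall_iff_norm] at hμ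
  filter_upwards [h, self_mem_nhdsWithin (s := {μ : ℂ | 0 ≤ μ.im ∧ μ ≠ 1})] with μ hμ hμ'
  refine ⟨hμ'.1, hμ'.2, hμ, ?_, ?_⟩
  · rintro rfl
    norm_num at hμ
  · rintro rfl
    norm_num at hμ

theorem edgeFilter_le : edgeFilter ≤ 𝓝 1 := nhdsWithin_le_nhds

theorem two_phaseCoeff_div {μ : ℂ} (h0 : μ ≠ 0) (s : ℂ) :
    2 * phaseCoeff μ * s = (μ - 1) * (Complex.I * (μ + 1) / (2 * μ) * s) := by
  rw [phaseCoeff]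
  field_simp
  ring

theorem isVolterraKernel_edge {q : ℝ → ℝ} (hq : IsPotential q) {μ : ℂ} (him : 0 ≤ μ.im)
    (h1 : μ ≠ 1) (hμ : ‖μ - 1‖ ≤ 1 / 2) (h0 : μ ≠ 0) (x₀ : ℝ) :
    IsVolterraKernel x₀ (fun ξ => 3 * (1 + |x₀|) * ((1 + |ξ|) * |q ξ|)) (edgeKernel q μ) where
  cont := by
    have hq' : Continuous fun p : ℝ × ℝ => (q p.2 : ℂ) :=
      Complex.continuous_ofReal.comp (hq.continuous.comp continuous_snd)
    have he : Continuous fun p : ℝ × ℝ => Complex.exp (2 * phaseCoeff μ * (p.1 - p.2)) := by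
      fun_prop
    refine continuous_mat2.comp (Continuous.prodMk ?_ (Continuous.prodMk ?_
      (Continuous.prodMk ?_ ?_)))
    · exact (((hq'.div_const _).mul_const _).mul ((continuous_const.sub he).div_const _)).neg
    · exact ((hq'.div_const _).mul_const _).mul (continuous_const.add he)
    · exact (((hq'.div_const _).mul_const _).mul (continuous_const.add he)).neg
    · exact ((hq'.div_const _).mul_const _).mul (continuous_const.sub he)
  bound x ξ hξ hx := by
    have h1' : μ - 1 ≠ 0 := sub_ne_zero.2 h1
    have hs : (0 : ℝ) ≤ x - ξ := by linarith
    have hsb : x - ξ ≤ |x₀| + |ξ| := by linarith [le_abs_self x₀, neg_abs_le ξ]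
    have nμ : 1 / 2 ≤ ‖μ‖ := by
      have := norm_sub_norm_le (1 : ℂ) (1 - μ)
      rw [norm_sub_rev 1 μ, norm_one, sub_sub_cancel] at this
      linarith
    have nμ1 : ‖μ + 1‖ ≤ 5 / 2 := by
      have := norm_add_le (μ - 1) 2
      rw [show μ - 1 + 2 = μ + 1 by ring, Complex.norm_ofNat] at this
      linarith
    have nμ2 : 3 / 2 ≤ ‖μ + 1‖ := by
      have := norm_sub_norm_le (2 : ℂ) (1 - μ)
      rw [norm_sub_rev 1 μ, Complex.norm_ofNat, show (2 : ℂ) - (1 - μ) = μ + 1 by ring] at this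
      linarith
    have he := norm_exp_phase_le him h0 hξ
    set w := Complex.exp (2 * phaseCoeff μ * (x - ξ)) with hw
    -- Here 2θ/(μ - 1) = i(μ + 1)/(2μ), of modulus at most (5/2)/(2 · 1/2) in the disc of radius
    -- 1/2.
    have hwF : ‖(1 - w) / (μ - 1)‖ ≤ 5 / 2 * (x - ξ) := by
      have hre : (2 * phaseCoeff μ * (x - ξ)).re ≤ 0 := by
        rw [hw, Complex.norm_exp, Real.exp_le_one_iff] at he
        exact he
      have h3 := norm_one_sub_exp_le hre
      rw [norm_div, div_le_iff₀ (norm_pos_iff.2 h1')]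
      refine h3.trans ?_
      rw [two_phaseCoeff_div h0, norm_mul, mul_comm]
      refine mul_le_mul_of_nonneg_right ?_ (norm_nonneg _)
      rw [norm_mul, norm_div, norm_mul, norm_mul, Complex.norm_I, one_mul, Complex.norm_ofNat,
        ← Complex.ofReal_sub, Complex.norm_real, Real.norm_of_nonneg hs]
      refine mul_le_mul_of_nonneg_right ?_ hs
      rw [div_le_iff₀ (by positivity)]
      linarith
    have n1 : ‖1 + w‖ ≤ 2 := (norm_add_le _ _).trans (by rw [norm_one]; linarith)
    have n2 : ‖1 - w‖ ≤ 2 := (norm_sub_le _ _).trans (by rw [norm_one]; linarith)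
    have na : ‖Complex.I * (μ + 1) / 2‖ ≤ 5 / 4 := by
      rw [norm_div, norm_mul, Complex.norm_I, one_mul, Complex.norm_ofNat]
      linarith
    have nb : ‖Complex.I / (2 * (μ + 1))‖ ≤ 1 / 3 := by
      rw [norm_div, norm_mul, Complex.norm_I, Complex.norm_ofNat, div_le_div_iff₀ (by positivity)
        (by norm_num)]
      linarith
    have nq : ‖(q ξ : ℂ) / 2‖ = |q ξ| / 2 := by
      rw [norm_div, Complex.norm_real, Complex.norm_ofNat, Real.norm_eq_abs]
    have hfin : |q ξ| * (3 + 3 * (x - ξ)) ≤ 3 * (1 + |x₀|) * ((1 + |ξ|) * |q ξ|) := by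
      have h4 : 3 + 3 * (x - ξ) ≤ 3 * (1 + |x₀|) * (1 + |ξ|) := by
        nlinarith [abs_nonneg x₀, abs_nonneg ξ, mul_nonneg (abs_nonneg x₀) (abs_nonneg ξ)]
      calc |q ξ| * (3 + 3 * (x - ξ)) ≤ |q ξ| * (3 * (1 + |x₀|) * (1 + |ξ|)) :=
            mul_le_mul_of_nonneg_left h4 (abs_nonneg _)
        _ = _ := by ring
    refine (norm_mat2_le _ _ _ _).trans (le_trans ?_ hfin)
    have hq0 := abs_nonneg (q ξ)
    rw [norm_neg, norm_neg]
    simp only [norm_mul, nq] at *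
    refine max_le ?_ ?_
    · calc _ ≤ |q ξ| / 2 * (5 / 4) * (5 / 2 * (x - ξ)) + |q ξ| / 2 * (1 / 3) * 2 := by gcongr
        _ ≤ _ := by nlinarith [mul_nonneg hq0 hs]
    · calc _ ≤ |q ξ| / 2 * (5 / 4) * 2 + |q ξ| / 2 * (1 / 2 * (1 / 3)) * 2 := by gcongr
        _ ≤ _ := by nlinarith [mul_nonneg hq0 hs]

theorem tendsto_edgeKernel {q : ℝ → ℝ} (x ξ : ℝ) :
    Tendsto (fun μ => edgeKernel q μ x ξ) edgeFilter (𝓝 (edgeKernelOne q x ξ)) := by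
  have hμ : Tendsto (fun μ : ℂ => μ) edgeFilter (𝓝 1) := edgeFilter_le
  have hθ : Tendsto (fun μ => Complex.exp (2 * phaseCoeff μ * (x - ξ))) edgeFilter (𝓝 1) := by
    have := (((continuousAt_phaseCoeff one_ne_zero).tendsto.comp hμ).const_mul 2).mul_const
      ((x : ℂ) - ξ)
    have := this.cexp
    simpa [phaseCoeff] using this
  -- The quotient is minus the slope at 1 of the exponential, whose derivative there is i(x - ξ).
  have hF : Tendsto (fun μ => (1 - Complex.exp (2 * phaseCoeff μ * (x - ξ))) / (μ - 1)) edgeFilter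
      (𝓝 (-(Complex.I * (x - ξ)))) := by
    have hd : HasDerivAt (fun μ => Complex.exp (2 * phaseCoeff μ * (x - ξ)))
        (Complex.I * (x - ξ)) 1 := by
      have h1 : HasDerivAt phaseCoeff (Complex.I / 2) 1 := by
        unfold phaseCoeff
        have := ((((hasDerivAt_id (1 : ℂ)).pow 2).sub_const 1).const_mul Complex.I).div
          ((hasDerivAt_id (1 : ℂ)).const_mul 4) (by simp)
        refine this.congr_deriv ?_
        simp
        ring
      have := ((h1.const_mul 2).mul_const ((x : ℂ) - ξ)).cexp
      refine this.congr_deriv ?_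
      rw [show phaseCoeff 1 = 0 by simp [phaseCoeff], mul_zero, zero_mul, Complex.exp_zero]
      ring
    have h2 := (hasDerivAt_iff_tendsto_slope.1 hd).mono_left
      (nhdsWithin_mono 1 (fun μ (hμ : 0 ≤ μ.im ∧ μ ≠ 1) => hμ.2))
    refine (h2.neg).congr' ?_
    filter_upwards with μ
    rw [slope_def_field]
    simp [phaseCoeff]
    rw [← neg_div, neg_sub]
  have hI2 : Tendsto (fun μ : ℂ => Complex.I * (μ + 1) / 2) edgeFilter (𝓝 Complex.I) := by
    have := ((hμ.add_const 1).const_mul Complex.I).div_const 2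
    rwa [show Complex.I * (1 + 1) / 2 = Complex.I by ring] at this
  have hI4 : Tendsto (fun μ : ℂ => Complex.I / (2 * (μ + 1))) edgeFilter (𝓝 (Complex.I / 4)) := by
    have := (tendsto_const_nhds (x := Complex.I)).div ((hμ.add_const 1).const_mul 2) (by norm_num)
    rwa [show (2 : ℂ) * (1 + 1) = 4 by norm_num] at this
  have h1 := ((hI2.const_mul (q ξ / 2 : ℂ)).mul hF).neg
  have h2 := (hI4.const_mul (q ξ / 2 : ℂ)).mul (hθ.const_add 1)
  have h3 := ((hI2.const_mul (q ξ / 2 : ℂ)).mul (hθ.const_add 1)).neg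
  have h4 := (((hμ.sub_const 1).mul hI4).const_mul (q ξ / 2 : ℂ)).mul (hθ.const_sub 1)
  refine (tendsto_mat2 h1 h2 h3 h4).trans (le_of_eq ?_)
  rw [edgeKernelOne]
  congr 2
  · linear_combination (-(q ξ : ℂ) / 2 * (x - ξ)) * (-Complex.I_sq)
  · ring
  · ring
  · ring

/-- At `μ = 1` the Jost solution has at most a simple pole, with a coefficient of a special form. -/
theorem IsPotential.tendsto_edge {q : ℝ → ℝ} (hq : IsPotential q) (x : ℝ) :
    ∃ s : ℝ, Tendsto (fun μ => (μ - 1) • jost q μ x) edgeFilter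
      (𝓝 (Complex.I * s, Complex.I * s)) := by
  have hg := hq.isMajorant_moment (K := 3 * (1 + |x|)) (by positivity)
  -- The transformed Jost solution solves the regularized equation with constant term (1, μ - 1), so
  -- its limit as μ → 1 is the solution for the limiting kernel with constant term (1, 0).
  have hsum : ∀ᶠ μ in edgeFilter,
      edgeMap μ (jost q μ x) = volterraSum (edgeKernel q μ) (fun _ => (1, μ - 1)) x := by
    filter_upwards [eventually_edgeFilter] with μ ⟨him, h1, hμ, h0, h2⟩
    refine (isVolterraKernel_edge hq him h1 hμ h0 x).eq_volterraSum hg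
      (φ := fun y => edgeMap μ (jost q μ y)) (h := fun _ => (1, μ - 1)) continuousOn_const
      ⟨_, fun _ _ => le_rfl⟩ ((edgeMap μ).continuous.comp
        (hq.continuous_jost him h0)).continuousOn ?_ (fun y _ => ?_) le_rfl
    · obtain ⟨C, hC⟩ := hq.norm_jost_le him h0
      exact ⟨‖edgeMap μ‖ * C, fun ξ _ => ((edgeMap μ).le_opNorm _).trans
        (mul_le_mul_of_nonneg_left (hC ξ) (norm_nonneg _))⟩
    · simp_rw [← edgeMap_jostKernel h1 h2]
      rw [(edgeMap μ).integral_comp_comm (hq.integrableOn_kernel him h0 (hq.continuous_jost him h0)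
        (hq.norm_jost_le him h0) y)]
      conv_lhs => rw [hq.jost_eq him h0 y]
      rw [map_add]
      congr 1
      simp [edgeMap]
  have hlim := tendsto_volterraSum (l := edgeFilter) (x₀ := x) (B := 1) hg
    (k := edgeKernel q) (k' := edgeKernelOne q) (h := fun μ _ => ((1 : ℂ), μ - 1))
    (h' := fun _ => (1, 0)) ?_ ?_ (fun x _ ξ _ => tendsto_edgeKernel x ξ) ?_ le_rfl
  · set V := volterraSum (edgeKernelOne q) (fun _ => ((1 : ℂ), (0 : ℂ))) x with hV
    -- The limiting kernel inherits the reality symmetry, so the second component of V is purely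
    -- imaginary. Dividing (μ - 1)(f + g) and the vanishing (μ - 1)(f - g) by 2 then gives the same
    -- limit for both components.
    have hsym : V = IsPotential.conjFlip V := by
      refine map_volterraSum IsPotential.conjFlip (fun x ξ e => ?_) (fun _ => by simp) x
      simp only [edgeKernelOne, mat2_apply, IsPotential.conjFlip_apply, map_add, map_mul, map_neg,
        map_sub, map_div₀, Complex.conj_ofReal, Complex.conj_I, map_ofNat, map_zero]
      refine Prod.ext ?_ ?_ <;> simp only <;> ring
    have hre : V.2.re = 0 := by
      have := congrArg (fun e : ℂ × ℂ => e.2.re) hsym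
      simp only [IsPotential.conjFlip_apply, Complex.neg_re, Complex.conj_re] at this
      linarith
    refine ⟨V.2.im / 2, ?_⟩
    have hV2 : Complex.I * ((V.2.im / 2 : ℝ) : ℂ) = V.2 / 2 := by
      apply Complex.ext <;> simp [hre]
    rw [hV2]
    have hμ : Tendsto (fun μ : ℂ => μ - 1) edgeFilter (𝓝 0) := by
      have : Tendsto (fun μ : ℂ => μ - 1) edgeFilter (𝓝 (1 - 1)) :=
        (tendsto_id.mono_left edgeFilter_le).sub_const 1
      simpa using this
    have hlim' := hlim.congr' (hsum.mono fun μ h => h.symm)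
    have l1 := (continuous_fst.tendsto V).comp hlim'
    have l2 := (continuous_snd.tendsto V).comp hlim'
    have e1 := (l2.add (hμ.mul l1)).div_const 2
    have e2 := (l2.sub (hμ.mul l1)).div_const 2
    rw [zero_mul, add_zero] at e1
    rw [zero_mul, sub_zero] at e2
    refine (e1.prodMk_nhds e2).congr fun μ => ?_
    simp only [edgeMap, Function.comp, mat2_apply]
    refine Prod.ext ?_ ?_
    · simp only [Prod.smul_fst, smul_eq_mul]; ring
    · simp only [Prod.smul_snd, smul_eq_mul]; ring
  · filter_upwards [eventually_edgeFilter] with μ ⟨him, h1, hμ, h0, _⟩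
    exact isVolterraKernel_edge hq him h1 hμ h0 x
  · filter_upwards [eventually_edgeFilter] with μ ⟨_, _, hμ, _, _⟩
    refine ⟨continuousOn_const, fun _ _ => ?_⟩
    rw [Prod.norm_def, norm_one]
    exact max_le le_rfl (by linarith)
  · intro _ _
    refine tendsto_const_nhds.prodMk_nhds ?_
    have : Tendsto (fun μ : ℂ => μ - 1) edgeFilter (𝓝 (1 - 1)) :=
      (tendsto_id.mono_left edgeFilter_le).sub_const 1
    simpa using this

end MCH
end

noncomputable section
namespace MCH

/-! ### Complex analysis in the upper half-plane -/

/-- A continuous function that is holomorphic off the real line is holomorphic. -/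
theorem differentiableOn_of_continuousOn_of_off_real {f : ℂ → ℂ} {U : Set ℂ} (hU : IsOpen U)
    (hc : ContinuousOn f U) (hd : DifferentiableOn ℂ f (U \ {z | z.im = 0})) :
    DifferentiableOn ℂ f U := by
  refine (Complex.isConservativeOn_and_continuousOn_iff_isDifferentiableOn hU).1 ⟨?_, hc⟩
  intro z w hzw
  rw [← add_eq_zero_iff_eq_neg, Complex.wedgeIntegral_add_wedgeIntegral_eq]
  have hrect : ∀ x y : ℝ, x ∈ uIcc z.re w.re → y ∈ uIcc z.im w.im → (x + y * Complex.I : ℂ) ∈ U :=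
    fun x y hx hy => hzw (by simp [Complex.Rectangle, Complex.mem_reProdIm, hx, hy])
  -- A rectangle crossing the real line is cut along it. Each half has a holomorphic interior and
  -- continuous boundary values, so Cauchy's theorem applies; the two integrals over the cut cancel,
  -- and Morera's theorem concludes.
  by_cases h0 : (0 : ℝ) ∈ uIcc z.im w.im
  · have hsub1 : uIcc z.im 0 ⊆ uIcc z.im w.im := uIcc_subset_uIcc left_mem_uIcc h0
    have hsub2 : uIcc 0 w.im ⊆ uIcc z.im w.im := uIcc_subset_uIcc h0 right_mem_uIcc
    have hmem : ∀ v : ℂ, v.re ∈ uIcc z.re w.re → v.im ∈ uIcc z.im w.im → v ∈ U := fun v hx hy => by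
      simpa using hrect _ _ hx hy
    have e1 := Complex.integral_boundary_rect_eq_zero_of_continuousOn_of_differentiableOn f z
      ⟨w.re, 0⟩ (hc.mono fun v hv => hmem v hv.1 (hsub1 hv.2)) (hd.mono fun v hv =>
        ⟨hmem v (Ioo_subset_Icc_self hv.1) (hsub1 (Ioo_subset_Icc_self hv.2)), fun h => by
          have := hv.2
          simp only [mem_preimage, mem_ofPred_eq] at this h
          rw [h] at this
          rcases le_total z.im 0 with h' | h'
          · rw [max_eq_right h'] at this; exact lt_irrefl _ this.2
          · rw [min_eq_right h'] at this; exact lt_irrefl _ this.1⟩)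
    have e2 := Complex.integral_boundary_rect_eq_zero_of_continuousOn_of_differentiableOn f
      ⟨z.re, 0⟩ w (hc.mono fun v hv => hmem v hv.1 (hsub2 hv.2)) (hd.mono fun v hv =>
        ⟨hmem v (Ioo_subset_Icc_self hv.1) (hsub2 (Ioo_subset_Icc_self hv.2)), fun h => by
          have := hv.2
          simp only [mem_preimage, mem_ofPred_eq] at this h
          rw [h] at this
          rcases le_total w.im 0 with h' | h'
          · rw [max_eq_left h'] at this; exact lt_irrefl _ this.2
          · rw [min_eq_left h'] at this; exact lt_irrefl _ this.1⟩)
    have hii : ∀ x ∈ uIcc z.re w.re, ∀ a b, uIcc a b ⊆ uIcc z.im w.im →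
        IntervalIntegrable (fun y : ℝ => f (x + y * Complex.I)) volume a b := by
      intro x hx a b hab
      refine ContinuousOn.intervalIntegrable (hc.comp (by fun_prop) fun y hy => ?_)
      exact hrect x y hx (hab hy)
    simp only at e1 e2
    rw [← intervalIntegral.integral_add_adjacent_intervals
      (hii w.re right_mem_uIcc z.im 0 hsub1) (hii w.re right_mem_uIcc 0 w.im hsub2),
      ← intervalIntegral.integral_add_adjacent_intervals
      (hii z.re left_mem_uIcc z.im 0 hsub1) (hii z.re left_mem_uIcc 0 w.im hsub2), smul_add, smul_add]
    linear_combination e1 + e2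
  · refine Complex.integral_boundary_rect_eq_zero_of_differentiableOn f z w
      (hd.mono fun v hv => ⟨hzw hv, fun h => h0 ?_⟩)
    have := hv.2
    simp only [mem_preimage, mem_ofPred_eq] at this h
    rwa [h] at this

theorem isLittleO_of_tendsto_mul {f : ℂ → ℂ} {s : ℂ}
    (h : Tendsto (fun z => (z - s) * f z) (𝓝[≠] s) (𝓝 0)) :
    (fun z => f z - f s) =o[𝓝[≠] s] fun z => (z - s)⁻¹ := by
  have h1 : Tendsto (fun z => (z - s) * f s) (𝓝[≠] s) (𝓝 0) := by
    have : Tendsto (fun z => (z - s) * f s) (𝓝 s) (𝓝 ((s - s) * f s)) :=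
      (tendsto_id.sub_const s).mul_const _
    rw [sub_self, zero_mul] at this
    exact this.mono_left nhdsWithin_le_nhds
  refine (isLittleO_iff_tendsto' ?_).2 ?_
  · filter_upwards [self_mem_nhdsWithin] with z hz h
    exact absurd (inv_eq_zero.1 h) (sub_ne_zero.2 hz)
  · have := h.sub h1
    rw [sub_zero] at this
    refine this.congr fun z => ?_
    rw [div_inv_eq_mul]; ring

/-- Liouville's theorem for functions with finitely many removable singularities. -/
theorem eq_const_of_finite_singularities {f : ℂ → ℂ} {S : Set ℂ} (hS : S.Finite)
    (hf : DifferentiableOn ℂ f Sᶜ)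
    (hs : ∀ s ∈ S, Tendsto (fun z => (z - s) * f z) (𝓝[≠] s) (𝓝 0)) {C : ℂ}
    (hlim : Tendsto f (Bornology.cobounded ℂ ⊓ 𝓟 {z | z.im ≠ 0}) (𝓝 C)) {z : ℂ} (hz : z ∉ S) :
    f z = C := by
  classical
  set g : ℂ → ℂ := fun z => if z ∈ S then limUnder (𝓝[≠] z) f else f z with hg
  have hgf : ∀ z ∉ S, g z = f z := fun z hz => if_neg hz
  have hdiff : Differentiable ℂ g := by
    intro s
    by_cases h : s ∈ S
    · have hN : IsOpen (S \ {s})ᶜ := (hS.subset sdiff_subset).isClosed.isOpen_compl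
      have hNs : (S \ {s})ᶜ ∈ 𝓝 s := hN.mem_nhds (by simp)
      have hd := Complex.differentiableOn_update_limUnder_of_isLittleO hNs
        (hf.mono fun z hz => fun hzS => hz.1 ⟨hzS, hz.2⟩) (isLittleO_of_tendsto_mul (hs s h))
      refine (hd.differentiableAt hNs).congr_of_eventuallyEq ?_
      filter_upwards [hNs] with z hz
      by_cases hzs : z = s
      · subst hzs; simp [hg, h]
      · rw [Function.update_of_ne hzs, hgf z fun hzS => hz ⟨hzS, hzs⟩]
    · have hN : Sᶜ ∈ 𝓝 s := hS.isClosed.isOpen_compl.mem_nhds h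
      refine (hf.differentiableAt hN).congr_of_eventuallyEq ?_
      filter_upwards [hN] with z hz using hgf z hz
  have hSbd : ∀ᶠ z in Bornology.cobounded ℂ, z ∉ S :=
    Bornology.isBounded_def.1 hS.isBounded
  have htend : Tendsto g (cocompact ℂ) (𝓝 C) := by
    rw [← Metric.cobounded_eq_cocompact, Metric.tendsto_nhds]
    intro ε hε
    have h1 : ∀ᶠ z in Bornology.cobounded ℂ ⊓ 𝓟 {z : ℂ | z.im ≠ 0}, dist (f z) C < ε / 2 :=
      hlim (Metric.ball_mem_nhds C (by positivity))
    rw [eventually_inf_principal] at h1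
    have h2 := h1.and hSbd
    rw [(Metric.hasBasis_cobounded_compl_closedBall (0 : ℂ)).eventually_iff] at h2
    obtain ⟨R, -, hR⟩ := h2
    rw [(Metric.hasBasis_cobounded_compl_closedBall (0 : ℂ)).eventually_iff]
    refine ⟨R, trivial, fun z hz => ?_⟩
    -- The limit at infinity is assumed only off the real line. Density of that set and continuity
    -- of the extended function carry the estimate to real points, at the price of replacing < ε/2
    -- by ≤ ε/2.
    have hcl : z ∈ closure ({z : ℂ | z.im ≠ 0} ∩ (Metric.closedBall (0 : ℂ) R)ᶜ) := by
      have hdense : Dense {z : ℂ | z.im ≠ 0} := by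
        have : {z : ℂ | z.im ≠ 0} = Complex.im ⁻¹' ({0}ᶜ : Set ℝ) := rfl
        rw [this]
        exact (dense_compl_singleton (0 : ℝ)).preimage Complex.isOpenMap_im
      have := hdense.open_subset_closure_inter Metric.isClosed_closedBall.isOpen_compl hz
      rwa [inter_comm] at this
    have hle : dist (g z) C ≤ ε / 2 := by
      refine closure_minimal (s := {z : ℂ | z.im ≠ 0} ∩ (Metric.closedBall (0 : ℂ) R)ᶜ)
        (t := {z | dist (g z) C ≤ ε / 2}) ?_ ?_ hcl
      · intro w hw
        have := hR hw.2
        rw [mem_ofPred_eq, hgf w this.2]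
        exact (this.1 hw.1).le
      · exact isClosed_le (hdiff.continuous.dist continuous_const) continuous_const
    linarith
  rw [← hgf z hz]
  exact hdiff.apply_eq_of_tendsto_cocompact z htend

/-- The function (z - s)² f(z), extended by 0, is analytic at s by removability; its derivative
there is the required limit. Thus a singularity weaker than a double pole is at most a simple pole.
-/
theorem exists_tendsto_of_sq_mul_tendsto_zero {f : ℂ → ℂ} {s : ℂ}
    (hd : ∀ᶠ z in 𝓝[≠] s, DifferentiableAt ℂ f z)
    (h : Tendsto (fun z => (z - s) ^ 2 * f z) (𝓝[≠] s) (𝓝 0)) :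
    ∃ e, Tendsto (fun z => (z - s) * f z) (𝓝[≠] s) (𝓝 e) := by
  set H : ℂ → ℂ := fun z => (z - s) ^ 2 * f z with hH
  have hHs : H s = 0 := by simp [hH]
  have hc : ContinuousAt H s := by
    rw [← continuousWithinAt_compl_self, ContinuousWithinAt, hHs]
    exact h
  have ha := Complex.analyticAt_of_differentiable_on_punctured_nhds_of_continuousAt
    (hd.mono fun z hz => by
      exact ((differentiableAt_id.sub_const s).pow 2).mul hz) hc
  refine ⟨deriv H s, ?_⟩
  refine (hasDerivAt_iff_tendsto_slope.1 ha.differentiableAt.hasDerivAt).congr' ?_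
  filter_upwards [self_mem_nhdsWithin] with z hz
  have : z - s ≠ 0 := sub_ne_zero.2 hz
  rw [slope_def_field, hHs, hH]
  field_simp
  ring

/-- The extension by reflection of a function in the upper half-plane, with given values on the real
line. -/
def reflection (F : ℂ → ℂ) (Fb : ℝ → ℝ) (z : ℂ) : ℂ :=
  if 0 < z.im then F z else if z.im < 0 then starRingEnd ℂ (F (starRingEnd ℂ z)) else Fb z.re

theorem reflection_of_pos {F : ℂ → ℂ} {Fb : ℝ → ℝ} {z : ℂ} (h : 0 < z.im) :
    reflection F Fb z = F z := if_pos h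

theorem reflection_of_neg {F : ℂ → ℂ} {Fb : ℝ → ℝ} {z : ℂ} (h : z.im < 0) :
    reflection F Fb z = starRingEnd ℂ (F (starRingEnd ℂ z)) := by
  rw [reflection, if_neg (not_lt.2 h.le), if_pos h]

theorem reflection_ofReal {F : ℂ → ℂ} {Fb : ℝ → ℝ} (x : ℝ) : reflection F Fb x = Fb x := by
  simp [reflection]

instance neBot_nhdsWithin_upper (x : ℝ) : (𝓝[{z : ℂ | 0 < z.im}] (x : ℂ)).NeBot := by
  rw [← mem_closure_iff_nhdsWithin_neBot, Complex.closure_setOfPred_lt_im]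
  simp

/-- Limits of the reflected function at real points. -/
theorem tendsto_reflection {F φ : ℂ → ℂ} {Fb : ℝ → ℝ} {s c : ℝ} (hφ : Continuous φ)
    (hφc : ∀ z, φ (starRingEnd ℂ z) = starRingEnd ℂ (φ z))
    (hF : Tendsto (fun z => φ z * F z) (𝓝[{z : ℂ | 0 < z.im}] (s : ℂ)) (𝓝 (c : ℂ)))
    (hb : ∀ᶠ x : ℝ in 𝓝[≠] s, Tendsto F (𝓝[{z : ℂ | 0 < z.im}] (x : ℂ)) (𝓝 (Fb x : ℂ))) :
    Tendsto (fun z => φ z * reflection F Fb z) (𝓝[≠] (s : ℂ)) (𝓝 (c : ℂ)) := by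
  rw [Metric.tendsto_nhds]
  intro ε hε
  have h1 : ∀ᶠ z in 𝓝[{z : ℂ | 0 < z.im}] (s : ℂ), dist (φ z * F z) c < ε / 2 :=
    hF (Metric.ball_mem_nhds _ (by positivity))
  rw [eventually_nhdsWithin_iff, Metric.eventually_nhds_iff] at h1
  obtain ⟨δ, hδ, h1⟩ := h1
  rw [eventually_nhdsWithin_iff, Metric.eventually_nhds_iff] at hb
  obtain ⟨δ', hδ', hb⟩ := hb
  rw [eventually_nhdsWithin_iff, Metric.eventually_nhds_iff]
  refine ⟨min δ δ', lt_min hδ hδ', fun z hz hzs => ?_⟩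
  have hz1 := hz.trans_le (min_le_left _ _)
  have hz2 := hz.trans_le (min_le_right _ _)
  rcases lt_trichotomy z.im 0 with him | him | him
  · rw [reflection_of_neg him]
    have h2 : dist (starRingEnd ℂ z) (s : ℂ) < δ := by
      have := Complex.dist_conj_conj z (s : ℂ)
      rw [Complex.conj_ofReal] at this
      rwa [this]
    have h3 := h1 h2 (by simpa using him)
    rw [hφc] at h3
    have h4 : φ z * starRingEnd ℂ (F (starRingEnd ℂ z)) =
        starRingEnd ℂ (starRingEnd ℂ (φ z) * F (starRingEnd ℂ z)) := by simp
    rw [h4, ← Complex.conj_ofReal c, Complex.dist_conj_conj]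
    linarith
  · obtain ⟨x, rfl⟩ : ∃ x : ℝ, z = x := ⟨z.re, Complex.ext rfl (by simpa using him)⟩
    rw [reflection_ofReal]
    have hx : dist x s < δ' := by rwa [Complex.dist_eq, ← Complex.ofReal_sub, Complex.norm_real] at hz2
    have hne : x ≠ s := fun h => hzs (by simp [h])
    have h2 := hb hx hne
    have h3 : Tendsto (fun w => dist (φ w * F w) c) (𝓝[{z : ℂ | 0 < z.im}] (x : ℂ))
        (𝓝 (dist (φ x * Fb x) (c : ℂ))) :=
      (((hφ.tendsto (x : ℂ)).mono_left nhdsWithin_le_nhds).mul h2).dist tendsto_const_nhds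
    -- The boundary value at a real point close to s is itself a limit from the upper half-plane, so
    -- it inherits the estimate valid there.
    have h4 : dist (φ x * Fb x) (c : ℂ) ≤ ε / 2 := by
      refine le_of_tendsto h3 ?_
      have : Metric.ball (s : ℂ) δ ∈ 𝓝 (x : ℂ) := Metric.isOpen_ball.mem_nhds hz1
      filter_upwards [nhdsWithin_le_nhds this, self_mem_nhdsWithin] with w hw hw'
      exact (h1 hw hw').le
    linarith
  · rw [reflection_of_pos him]
    exact (h1 hz1 him).trans (by linarith)

theorem tendsto_neg_conj_upper : Tendsto (fun z : ℂ => -starRingEnd ℂ z)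
    (𝓝[{z : ℂ | 0 < z.im}] (-1)) (𝓝[{z : ℂ | 0 < z.im}] 1) := by
  refine tendsto_nhdsWithin_iff.2 ⟨?_, ?_⟩
  · have : Tendsto (fun z : ℂ => -starRingEnd ℂ z) (𝓝 (-1)) (𝓝 (-starRingEnd ℂ (-1))) :=
      (Complex.continuous_conj.neg).tendsto _
    simp only [map_neg, map_one, neg_neg] at this
    exact this.mono_left nhdsWithin_le_nhds
  · filter_upwards [self_mem_nhdsWithin] with z hz
    simpa using hz

theorem neg_inv_im_pos {z : ℂ} (hz : 0 < z.im) : 0 < (-z⁻¹).im := by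
  rw [Complex.neg_im, Complex.inv_im, neg_div, neg_neg]
  exact div_pos hz (Complex.normSq_pos.2 (ne_of_im_pos hz).1)

theorem tendsto_neg_inv_upper : Tendsto (fun z : ℂ => -z⁻¹)
    (𝓝[{z : ℂ | 0 < z.im}] 0) (Bornology.cobounded ℂ ⊓ 𝓟 {z : ℂ | 0 < z.im}) := by
  refine tendsto_inf.2 ⟨?_, tendsto_principal.2 ?_⟩
  · have h1 : Tendsto (fun z : ℂ => z⁻¹) (𝓝[{z : ℂ | 0 < z.im}] 0) (Bornology.cobounded ℂ) :=
      tendsto_inv₀_nhdsNE_zero.mono_left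
        (nhdsWithin_mono _ fun z (hz : 0 < z.im) => (ne_of_im_pos hz).1)
    rw [← tendsto_norm_atTop_iff_cobounded] at h1 ⊢
    simpa using h1
  · filter_upwards [self_mem_nhdsWithin] with z hz using neg_inv_im_pos hz

/-- A function in the upper half-plane that is real on the real line, regular at infinity and at the
points of `P`, has the symmetries of the spectral problem, and grows less than a double pole at `1`,
is an explicit rational function. -/
theorem eq_rational_of_symmetries {F : ℂ → ℂ} {P : Set ℂ} (hP : P.Finite)
    (hPu : ∀ p ∈ P, 0 < p.im) (hF : DifferentiableOn ℂ F ({z | 0 < z.im} \ P))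
    (hres : ∀ p ∈ P, Tendsto (fun z => (z - p) * F z) (𝓝[≠] p) (𝓝 0))
    (hb : ∀ x : ℝ, x ≠ 0 → x ≠ 1 → x ≠ -1 →
      ∃ r : ℝ, Tendsto F (𝓝[{z : ℂ | 0 < z.im}] (x : ℂ)) (𝓝 (r : ℂ)))
    {C : ℝ} (hinf : Tendsto F (Bornology.cobounded ℂ ⊓ 𝓟 {z : ℂ | 0 < z.im}) (𝓝 (C : ℂ)))
    (hone : Tendsto (fun z => (z - 1) ^ 2 * F z) (𝓝[{z : ℂ | 0 < z.im}] 1) (𝓝 0))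
    {ε ε' : ℝ} (hε' : ε' * ε' = 1)
    (hconj : ∀ z : ℂ, 0 < z.im → z ∉ P → F (-starRingEnd ℂ z) = ε * starRingEnd ℂ (F z))
    (hinv : ∀ z : ℂ, 0 < z.im → z ∉ P → F (-z⁻¹) = ε' * F z) :
    ∃ e : ℝ, (∀ z : ℂ, 0 < z.im → z ∉ P → F z = C + e / (z - 1) - ε * e / (z + 1)) ∧
      C - e - ε * e = ε' * C := by
  have hb' : ∀ x : ℝ, ∃ r : ℝ, (x ≠ 0 → x ≠ 1 → x ≠ -1 →
      Tendsto F (𝓝[{z : ℂ | 0 < z.im}] (x : ℂ)) (𝓝 (r : ℂ))) := by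
    intro x
    by_cases h : x ≠ 0 ∧ x ≠ 1 ∧ x ≠ -1
    · obtain ⟨r, hr⟩ := hb x h.1 h.2.1 h.2.2
      exact ⟨r, fun _ _ _ => hr⟩
    · exact ⟨0, fun h0 h1 h2 => absurd ⟨h0, h1, h2⟩ h⟩
  choose Fb hFb using hb'
  have hopen : IsOpen {z : ℂ | 0 < z.im} := isOpen_lt continuous_const Complex.continuous_im
  have hbev : ∀ s : ℝ, ∀ᶠ x : ℝ in 𝓝[≠] s,
      Tendsto F (𝓝[{z : ℂ | 0 < z.im}] (x : ℂ)) (𝓝 (Fb x : ℂ)) := by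
    intro s
    have hfin : ({0, 1, -1} \ {s} : Set ℝ).Finite := (Set.toFinite _).subset sdiff_subset
    have : ({0, 1, -1} \ {s} : Set ℝ)ᶜ ∈ 𝓝 s := hfin.isClosed.isOpen_compl.mem_nhds (by simp)
    filter_upwards [nhdsWithin_le_nhds this, self_mem_nhdsWithin] with x hx hxs
    refine hFb x ?_ ?_ ?_ <;>
    · rintro rfl
      exact hx ⟨by simp, hxs⟩
  set G := reflection F Fb with hG
  set S : Set ℂ := P ∪ (starRingEnd ℂ '' P) ∪ {0, 1, -1} with hS
  have hSfin : S.Finite := (hP.union (hP.image _)).union (Set.toFinite _)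
  have hSopen : IsOpen Sᶜ := hSfin.isClosed.isOpen_compl
  have hGup : ∀ z : ℂ, 0 < z.im → z ∉ P → DifferentiableAt ℂ G z := by
    intro z hz hzP
    have hN : {z : ℂ | 0 < z.im} \ P ∈ 𝓝 z :=
      (hopen.sdiff hP.isClosed).mem_nhds ⟨hz, hzP⟩
    refine (hF.differentiableAt hN).congr_of_eventuallyEq ?_
    filter_upwards [hN] with w hw using reflection_of_pos hw.1
  have hGlow : ∀ z : ℂ, z.im < 0 → starRingEnd ℂ z ∉ P → DifferentiableAt ℂ G z := by
    intro z hz hzP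
    have hN : {z : ℂ | 0 < z.im} \ P ∈ 𝓝 (starRingEnd ℂ z) :=
      (hopen.sdiff hP.isClosed).mem_nhds ⟨by simpa using hz, hzP⟩
    have h1 := (hF.differentiableAt hN).conj_conj
    rw [Complex.conj_conj] at h1
    refine h1.congr_of_eventuallyEq ?_
    filter_upwards [(isOpen_lt Complex.continuous_im continuous_const).mem_nhds hz] with w hw
    exact reflection_of_neg hw
  have hGdiff : DifferentiableOn ℂ G Sᶜ := by
    have hoff : ∀ z ∈ Sᶜ, z.im ≠ 0 → DifferentiableAt ℂ G z := by
      intro z hz him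
      rcases lt_or_gt_of_ne him with h | h
      · exact hGlow z h fun hc => hz (Or.inl (Or.inr ⟨_, hc, by simp⟩))
      · exact hGup z h fun hc => hz (Or.inl (Or.inl hc))
    refine differentiableOn_of_continuousOn_of_off_real hSopen (fun z hz => ?_)
      (fun z hz => (hoff z hz.1 hz.2).differentiableWithinAt)
    refine ContinuousAt.continuousWithinAt ?_
    by_cases him : z.im = 0
    · obtain ⟨x, rfl⟩ : ∃ x : ℝ, z = x := ⟨z.re, Complex.ext rfl (by simpa using him)⟩
      have hx : x ≠ 0 ∧ x ≠ 1 ∧ x ≠ -1 := by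
        refine ⟨?_, ?_, ?_⟩ <;> rintro rfl <;> exact hz (Or.inr (by simp))
      have := tendsto_reflection (φ := fun _ => 1) (Fb := Fb) (F := F) (s := x) (c := Fb x)
        continuous_const (by simp) (by simpa using hFb x hx.1 hx.2.1 hx.2.2) (hbev x)
      simp only [one_mul] at this
      rw [← continuousWithinAt_compl_self, ContinuousWithinAt, hG, reflection_ofReal]
      exact this
    · exact (hoff z hz him).continuousAt
  have hPne : ∀ p ∈ P, ∀ᶠ z in 𝓝 p, G z = F z := fun p hp => by
    filter_upwards [hopen.mem_nhds (hPu p hp)] with z hz using reflection_of_pos hz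
  have hGp : ∀ p ∈ P, Tendsto (fun z => (z - p) * G z) (𝓝[≠] p) (𝓝 0) := fun p hp => by
    refine (hres p hp).congr' ?_
    filter_upwards [nhdsWithin_le_nhds (hPne p hp)] with z hz
    rw [hz]
  have hGcp : ∀ p ∈ P, Tendsto (fun z => (z - starRingEnd ℂ p) * G z) (𝓝[≠] (starRingEnd ℂ p))
      (𝓝 0) := by
    intro p hp
    have hcl : Tendsto (starRingEnd ℂ) (𝓝[≠] (starRingEnd ℂ p)) (𝓝[≠] p) := by
      refine tendsto_nhdsWithin_iff.2 ⟨?_, ?_⟩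
      · have := Complex.continuous_conj.tendsto (starRingEnd ℂ p)
        rw [Complex.conj_conj] at this
        exact this.mono_left nhdsWithin_le_nhds
      · filter_upwards [self_mem_nhdsWithin] with z hz h
        exact hz (by rw [← show starRingEnd ℂ z = p from h]; simp)
    have h1 := (Complex.continuous_conj.tendsto _).comp ((hres p hp).comp hcl)
    rw [map_zero] at h1
    have hlow : {z : ℂ | z.im < 0} ∈ 𝓝 (starRingEnd ℂ p) :=
      (isOpen_lt Complex.continuous_im continuous_const).mem_nhds (by simpa using hPu p hp)
    refine h1.congr' ?_
    filter_upwards [nhdsWithin_le_nhds hlow] with z hz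
    simp only [Function.comp]
    rw [hG, reflection_of_neg hz]
    simp
  have hPnear : ∀ s : ℝ, ∀ᶠ z in 𝓝[{z : ℂ | 0 < z.im}] (s : ℂ), z ∉ P := fun s => by
    refine nhdsWithin_le_nhds (hP.isClosed.isOpen_compl.mem_nhds fun h => ?_)
    have := hPu _ h
    simp at this
  -- The symmetry z ↦ -1/z carries the normalization at infinity to the origin; ε' is its own
  -- inverse.
  have hzero : Tendsto F (𝓝[{z : ℂ | 0 < z.im}] ((0 : ℝ) : ℂ)) (𝓝 ((ε' * C : ℝ) : ℂ)) := by
    rw [Complex.ofReal_zero]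
    have h1 := (hinf.comp tendsto_neg_inv_upper).const_mul (ε' : ℂ)
    push_cast
    refine h1.congr' ?_
    have := hPnear 0
    rw [Complex.ofReal_zero] at this
    filter_upwards [this, self_mem_nhdsWithin] with z hz hz'
    rw [Function.comp, hinv z hz' hz, ← mul_assoc]
    rw [show (ε' : ℂ) * ε' = 1 by exact_mod_cast hε', one_mul]
  have hG0 : Tendsto G (𝓝[≠] (0 : ℂ)) (𝓝 ((ε' * C : ℝ) : ℂ)) := by
    have := tendsto_reflection (φ := fun _ => 1) (F := F) (Fb := Fb) (s := 0) (c := ε' * C)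
      continuous_const (by simp) (by simpa using hzero) (hbev 0)
    simpa using this
  have hG1sq : Tendsto (fun z => (z - 1) ^ 2 * G z) (𝓝[≠] (1 : ℂ)) (𝓝 0) := by
    have := tendsto_reflection (φ := fun z => (z - 1) ^ 2) (s := 1) (c := 0) (F := F) (Fb := Fb)
      (by fun_prop) (by simp) (by simpa using hone) (hbev 1)
    simpa using this
  have hd1 : ∀ᶠ z in 𝓝[≠] (1 : ℂ), DifferentiableAt ℂ G z := by
    have hfin : (S \ {1}).Finite := hSfin.subset sdiff_subset
    have : (S \ {1})ᶜ ∈ 𝓝 (1 : ℂ) := hfin.isClosed.isOpen_compl.mem_nhds (by simp)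
    filter_upwards [nhdsWithin_le_nhds this, self_mem_nhdsWithin] with z hz hz1
    exact hGdiff.differentiableAt (hSopen.mem_nhds fun h => hz ⟨h, hz1⟩)
  obtain ⟨e₀, he₀⟩ := exists_tendsto_of_sq_mul_tendsto_zero hd1 hG1sq
  -- The reflected function takes real values on the real line, so approaching 1 along it gives a
  -- real coefficient.
  have hreal : e₀.im = 0 := by
    have hcl : Tendsto (fun x : ℝ => (x : ℂ)) (𝓝[≠] 1) (𝓝[≠] (1 : ℂ)) := by
      refine tendsto_nhdsWithin_iff.2 ⟨?_, ?_⟩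
      · have := Complex.continuous_ofReal.tendsto 1
        rw [Complex.ofReal_one] at this
        exact this.mono_left nhdsWithin_le_nhds
      · filter_upwards [self_mem_nhdsWithin] with x hx h
        exact hx (by simpa using h)
    have h1 := (Complex.continuous_im.tendsto _).comp (he₀.comp hcl)
    refine tendsto_nhds_unique h1 (tendsto_const_nhds.congr fun x => ?_)
    simp only [Function.comp]
    rw [hG, reflection_ofReal, ← Complex.ofReal_one, ← Complex.ofReal_sub, ← Complex.ofReal_mul,
      Complex.ofReal_im]
  obtain ⟨e, rfl⟩ : ∃ e : ℝ, e₀ = e := ⟨e₀.re, Complex.ext rfl (by simpa using hreal)⟩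
  have hFone : Tendsto (fun z => (z - 1) * F z) (𝓝[{z : ℂ | 0 < z.im}] 1) (𝓝 (e : ℂ)) := by
    refine (he₀.mono_left (nhdsWithin_mono _ fun z (hz : 0 < z.im) =>
      (ne_of_im_pos hz).2.1)).congr' ?_
    filter_upwards [self_mem_nhdsWithin] with z hz
    rw [hG, reflection_of_pos hz]
  -- The symmetry z ↦ -z̄ exchanges 1 and -1, so the coefficient at -1 is determined by the one at
  -- 1.
  have hGm1 : Tendsto (fun z => (z + 1) * G z) (𝓝[≠] (-1 : ℂ)) (𝓝 ((-ε * e : ℝ) : ℂ)) := by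
    have h1 : Tendsto (fun z => (z + 1) * F z) (𝓝[{z : ℂ | 0 < z.im}] ((-1 : ℝ) : ℂ))
        (𝓝 ((-ε * e : ℝ) : ℂ)) := by
      have h2 := ((Complex.continuous_conj.tendsto _).comp
        (hFone.comp tendsto_neg_conj_upper)).const_mul (-ε : ℂ)
      rw [Complex.conj_ofReal] at h2
      push_cast
      refine h2.congr' ?_
      have := (tendsto_neg_conj_upper.eventually
        ((hPnear 1).filter_mono (by rw [Complex.ofReal_one])))
      filter_upwards [this, self_mem_nhdsWithin] with z hz hz'
      simp only [Function.comp]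
      have h3 := hconj (-starRingEnd ℂ z) (by simpa using hz') hz
      simp only [map_neg, Complex.conj_conj, neg_neg] at h3
      rw [h3]
      simp
      ring
    have := tendsto_reflection (φ := fun z => z + 1) (Fb := Fb) (by fun_prop) (by simp) h1 (hbev (-1))
    simpa using this
  -- After removal of the two polar parts all singularities are removable, and Liouville's theorem
  -- makes H constant.
  set H : ℂ → ℂ := fun z => G z - e / (z - 1) + ε * e / (z + 1) with hH
  have hrat : ∀ z : ℂ, z ≠ 1 → z ≠ -1 →
      DifferentiableAt ℂ (fun z : ℂ => (e : ℂ) / (z - 1)) z ∧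
        DifferentiableAt ℂ (fun z : ℂ => (ε * e : ℂ) / (z + 1)) z := fun z h1 h2 =>
    ⟨(differentiableAt_const _).div (by fun_prop) (sub_ne_zero.2 h1),
      (differentiableAt_const _).div (by fun_prop) fun h => h2 (eq_neg_of_add_eq_zero_left h)⟩
  have hSne : ∀ z ∈ Sᶜ, z ≠ 1 ∧ z ≠ -1 := fun z hz =>
    ⟨fun h => hz (Or.inr (by simp [h])), fun h => hz (Or.inr (by simp [h]))⟩
  have hHdiff : DifferentiableOn ℂ H Sᶜ := fun z hz => by
    have h1 := hrat z (hSne z hz).1 (hSne z hz).2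
    exact ((hGdiff z hz).sub h1.1.differentiableWithinAt).add h1.2.differentiableWithinAt
  have hHs : ∀ s : ℂ, s ≠ 1 → s ≠ -1 → Tendsto (fun z => (z - s) * G z) (𝓝[≠] s) (𝓝 0) →
      Tendsto (fun z => (z - s) * H z) (𝓝[≠] s) (𝓝 0) := by
    intro s h1 h2 h3
    have hr := hrat s h1 h2
    have h4 : Tendsto (fun z => (z - s) * (-(e / (z - 1)) + ε * e / (z + 1))) (𝓝[≠] s)
        (𝓝 ((s - s) * (-(e / (s - 1)) + ε * e / (s + 1)))) := by
      refine Tendsto.mono_left ?_ nhdsWithin_le_nhds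
      exact (tendsto_id.sub_const s).mul (hr.1.continuousAt.tendsto.neg.add hr.2.continuousAt.tendsto)
    rw [sub_self, zero_mul] at h4
    have := h3.add h4
    rw [add_zero] at this
    refine this.congr fun z => ?_
    rw [hH]; ring
  have hHone : Tendsto (fun z => (z - 1) * H z) (𝓝[≠] 1) (𝓝 0) := by
    have h4 : Tendsto (fun z : ℂ => (z - 1) * (ε * e / (z + 1))) (𝓝[≠] 1)
        (𝓝 ((1 - 1) * (ε * e / (1 + 1)))) := by
      refine Tendsto.mono_left ?_ nhdsWithin_le_nhds
      exact (tendsto_id.sub_const 1).mul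
        (tendsto_const_nhds.div (tendsto_id.add_const 1) (by norm_num))
    rw [sub_self, zero_mul] at h4
    have := (he₀.sub_const (e : ℂ)).add h4
    rw [sub_self, add_zero] at this
    refine this.congr' ?_
    filter_upwards [self_mem_nhdsWithin] with z hz
    have hz' : z - 1 ≠ 0 := sub_ne_zero.2 hz
    have : (z - 1) * (e / (z - 1)) = (e : ℂ) := mul_div_cancel₀ _ hz'
    rw [hH]
    linear_combination this
  have hHmone : Tendsto (fun z => (z - -1) * H z) (𝓝[≠] (-1)) (𝓝 0) := by
    have h4 : Tendsto (fun z : ℂ => (z + 1) * (e / (z - 1))) (𝓝[≠] (-1))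
        (𝓝 ((-1 + 1) * (e / (-1 - 1)))) := by
      refine Tendsto.mono_left ?_ nhdsWithin_le_nhds
      exact (tendsto_id.add_const 1).mul
        (tendsto_const_nhds.div (tendsto_id.sub_const 1) (by norm_num))
    rw [neg_add_cancel, zero_mul] at h4
    have := (hGm1.add_const (ε * e : ℂ)).sub h4
    rw [show ((-ε * e : ℝ) : ℂ) + ε * e - 0 = 0 by push_cast; ring] at this
    refine this.congr' ?_
    filter_upwards [self_mem_nhdsWithin] with z hz
    have hz' : z + 1 ≠ 0 := fun h => hz (eq_neg_of_add_eq_zero_left h)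
    have : (z + 1) * (ε * e / (z + 1)) = (ε * e : ℂ) := mul_div_cancel₀ _ hz'
    rw [hH]
    linear_combination -this
  have hHsing : ∀ s ∈ S, Tendsto (fun z => (z - s) * H z) (𝓝[≠] s) (𝓝 0) := by
    rintro s ((hs | ⟨p, hp, rfl⟩) | hs)
    · have := ne_of_im_pos (hPu s hs)
      exact hHs s this.2.1 this.2.2 (hGp s hs)
    · have := ne_of_im_pos (hPu p hp)
      refine hHs _ (fun h => this.2.1 ?_) (fun h => this.2.2 ?_) (hGcp p hp)
      · rw [← Complex.conj_conj p, h, map_one]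
      · rw [← Complex.conj_conj p, h, map_neg, map_one]
    · rcases hs with rfl | rfl | hs
      · refine hHs 0 zero_ne_one (by norm_num) ?_
        have h0 : Tendsto (fun z : ℂ => z - 0) (𝓝[≠] 0) (𝓝 (0 - 0)) :=
          (tendsto_id.sub_const 0).mono_left nhdsWithin_le_nhds
        have := h0.mul hG0
        rwa [sub_zero, zero_mul] at this
      · exact hHone
      · rw [mem_singleton_iff] at hs
        rw [hs]; exact hHmone
  have hratinf : Tendsto (fun z : ℂ => -((e : ℂ) / (z - 1)) + ε * e / (z + 1)) (Bornology.cobounded ℂ)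
      (𝓝 0) := by
    have h1 : Tendsto (fun z : ℂ => (z - 1)⁻¹) (Bornology.cobounded ℂ) (𝓝 0) :=
      tendsto_inv₀_cobounded.comp (tendsto_sub_const_cobounded 1)
    have h2 : Tendsto (fun z : ℂ => (z + 1)⁻¹) (Bornology.cobounded ℂ) (𝓝 0) :=
      tendsto_inv₀_cobounded.comp (tendsto_add_const_cobounded 1)
    have := ((h1.const_mul (e : ℂ)).neg).add (h2.const_mul (ε * e : ℂ))
    simpa [div_eq_mul_inv] using this
  have hHinf : Tendsto H (Bornology.cobounded ℂ ⊓ 𝓟 {z | z.im ≠ 0}) (𝓝 (C : ℂ)) := by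
    have hGinf : Tendsto G (Bornology.cobounded ℂ ⊓ 𝓟 {z | z.im ≠ 0}) (𝓝 (C : ℂ)) := by
      have hset : {z : ℂ | z.im ≠ 0} = {z | 0 < z.im} ∪ {z | z.im < 0} := by
        ext z
        simp only [mem_ofPred_eq, mem_union]
        rw [or_comm]
        exact lt_or_lt_iff_ne.symm
      rw [hset, ← sup_principal, inf_sup_left]
      refine tendsto_sup.2 ⟨?_, ?_⟩
      · refine hinf.congr' ?_
        filter_upwards [mem_inf_of_right (mem_principal_self _)] with z hz
        exact (reflection_of_pos hz).symm
      · have hcl : Tendsto (starRingEnd ℂ) (Bornology.cobounded ℂ ⊓ 𝓟 {z : ℂ | z.im < 0})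
            (Bornology.cobounded ℂ ⊓ 𝓟 {z : ℂ | 0 < z.im}) := by
          refine tendsto_inf.2 ⟨?_, tendsto_principal.2 ?_⟩
          · refine Tendsto.mono_left ?_ inf_le_left
            rw [← tendsto_norm_atTop_iff_cobounded]
            simpa using tendsto_norm_cobounded_atTop (E := ℂ)
          · filter_upwards [mem_inf_of_right (mem_principal_self _)] with z hz
            simpa using hz
        have h1 := (Complex.continuous_conj.tendsto _).comp (hinf.comp hcl)
        rw [Complex.conj_ofReal] at h1
        refine h1.congr' ?_
        filter_upwards [mem_inf_of_right (mem_principal_self _)] with z hz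
        exact (reflection_of_neg hz).symm
    have := hGinf.add (hratinf.mono_left (inf_le_left (b := 𝓟 {z : ℂ | z.im ≠ 0})))
    rw [add_zero] at this
    refine this.congr fun z => ?_
    rw [hH]; ring
  have hform : ∀ z : ℂ, 0 < z.im → z ∉ P → F z = C + e / (z - 1) - ε * e / (z + 1) := by
    intro z hz hzP
    have hzS : z ∉ S := by
      rintro ((h | ⟨p, hp, rfl⟩) | h)
      · exact hzP h
      · have := hPu p hp
        rw [Complex.conj_im] at hz
        linarith
      · have := ne_of_im_pos hz
        rcases h with rfl | rfl | h
        · exact this.1 rfl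
        · exact this.2.1 rfl
        · exact this.2.2 h
    have := eq_const_of_finite_singularities hSfin hHdiff hHsing hHinf hzS
    rw [hH] at this
    simp only [hG, reflection_of_pos hz] at this
    linear_combination this
  refine ⟨e, hform, ?_⟩
  -- Comparing the rational formula at z = 0 with the value forced there by the inversion symmetry
  -- gives the relation between C and e.
  have h1 : Tendsto (fun z : ℂ => (C : ℂ) + e / (z - 1) - ε * e / (z + 1))
      (𝓝[{z : ℂ | 0 < z.im}] ((0 : ℝ) : ℂ)) (𝓝 ((C : ℂ) + e / (0 - 1) - ε * e / (0 + 1))) := by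
    refine Tendsto.mono_left ?_ nhdsWithin_le_nhds
    rw [Complex.ofReal_zero]
    exact (tendsto_const_nhds.add (tendsto_const_nhds.div (tendsto_id.sub_const 1)
      (by norm_num))).sub (tendsto_const_nhds.div (tendsto_id.add_const 1) (by norm_num))
  have h2 : Tendsto F (𝓝[{z : ℂ | 0 < z.im}] ((0 : ℝ) : ℂ))
      (𝓝 ((C : ℂ) + e / (0 - 1) - ε * e / (0 + 1))) := by
    refine h1.congr' ?_
    filter_upwards [hPnear 0, self_mem_nhdsWithin] with z hz hz'
    exact (hform z hz' hz).symm
  have h3 := tendsto_nhds_unique h2 hzero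
  have h4 : ((C - e - ε * e : ℝ) : ℂ) = ((ε' * C : ℝ) : ℂ) := by
    rw [← h3]
    push_cast
    norm_num
    ring
  exact_mod_cast h4

end MCH
end

noncomputable section
namespace MCH

/-! ### Uniqueness for the Riemann–Hilbert problem -/

/-- The properties of a Jost solution as a function of the spectral parameter. -/
structure IsJostFamily (J : ℂ → ℂ × ℂ) : Prop where
  differentiableOn : DifferentiableOn ℂ J {μ | 0 < μ.im}
  continuousOn : ContinuousOn J spectralDomain
  tendsto_cobounded :
    Tendsto J (Bornology.cobounded ℂ ⊓ 𝓟 {μ : ℂ | 0 < μ.im}) (𝓝 (1, 0))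
  neg_inv : ∀ μ : ℂ, 0 < μ.im → J (-μ⁻¹) = ((J μ).1, -(J μ).2)
  neg_conj : ∀ μ : ℂ, J (-starRingEnd ℂ μ) = (starRingEnd ℂ (J μ).1, -starRingEnd ℂ (J μ).2)
  det_real : ∀ μ : ℝ, μ ≠ 0 →
    (J μ).1 * starRingEnd ℂ (J μ).1 - (J μ).2 * starRingEnd ℂ (J μ).2 = 1
  tendsto_edge : ∃ s : ℝ, Tendsto (fun μ => (μ - 1) • J μ) edgeFilter
    (𝓝 (Complex.I * s, Complex.I * s))

theorem IsPotential.isJostFamily {q : ℝ → ℝ} (hq : IsPotential q) (x : ℝ) :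
    IsJostFamily fun μ => jost q μ x where
  differentiableOn := hq.differentiableOn_jost x
  continuousOn := hq.continuousOn_jost x
  tendsto_cobounded := hq.tendsto_jost_cobounded x
  neg_inv _ h := IsPotential.jost_neg_inv (mem_spectralDomain_of_im_pos h) x
  neg_conj μ := IsPotential.jost_neg_conj μ x
  det_real _ h := hq.jost_det_real h x
  tendsto_edge := hq.tendsto_edge x

/-- The determinant of the columns `(J₁, J₂)` and `(K₂, K₁)`. -/
def wronskian (J K : ℂ → ℂ × ℂ) (μ : ℂ) : ℂ := (J μ).1 * (K μ).1 - (J μ).2 * (K μ).2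

/-- `D` are the scattering data of the Jost solutions `J = (J₁, J₂)` and `(K₂, K₁)`, at the
parameters `y` and `t`. -/
structure RHData.IsScattering (D : RHData) (y t : ℝ) (J K : ℂ → ℂ × ℂ) (b : ℝ → ℂ) : Prop where
  r_eq : ∀ μ : ℝ, μ ≠ 0 → μ ≠ 1 → μ ≠ -1 → D.r μ = b μ / starRingEnd ℂ (wronskian J K μ)
  fst_eq : ∀ μ : ℝ, μ ≠ 0 → μ ≠ 1 → μ ≠ -1 → (K μ).2 =
    b μ * Complex.exp (-2 * phaseHat y t μ) * (J μ).1 + wronskian J K μ * starRingEnd ℂ (J μ).2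
  snd_eq : ∀ μ : ℝ, μ ≠ 0 → μ ≠ 1 → μ ≠ -1 → (K μ).1 =
    b μ * Complex.exp (-2 * phaseHat y t μ) * (J μ).2 + wronskian J K μ * starRingEnd ℂ (J μ).1
  singular : IsSingularityConstant (wronskian J K) b D.c
  mem_range : ∀ μ : ℂ, μ ∈ range D.pole ↔ 0 < μ.im ∧ wronskian J K μ = 0
  residue : ∀ j, deriv (wronskian J K) (D.pole j) ≠ 0 ∧ ∃ δ : ℂ, δ ≠ 0 ∧
    D.ρ j = deriv (wronskian J K) (D.pole j) * δ ∧
    (K (D.pole j)).2 = δ * Complex.exp (-2 * phaseHat y t (D.pole j)) * (J (D.pole j)).1 ∧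
    (K (D.pole j)).1 = δ * Complex.exp (-2 * phaseHat y t (D.pole j)) * (J (D.pole j)).2

section Symmetries

variable {J K : ℂ → ℂ × ℂ}

theorem wronskian_neg_inv (hJ : IsJostFamily J) (hK : IsJostFamily K) {μ : ℂ} (h : 0 < μ.im) :
    wronskian J K (-μ⁻¹) = wronskian J K μ := by
  simp only [wronskian, hJ.neg_inv μ h, hK.neg_inv μ h]
  ring

theorem wronskian_neg_conj (hJ : IsJostFamily J) (hK : IsJostFamily K) (μ : ℂ) :
    wronskian J K (-starRingEnd ℂ μ) = starRingEnd ℂ (wronskian J K μ) := by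
  simp only [wronskian, hJ.neg_conj μ, hK.neg_conj μ, map_sub, map_mul]
  ring

theorem differentiableOn_wronskian (hJ : IsJostFamily J) (hK : IsJostFamily K) :
    DifferentiableOn ℂ (wronskian J K) {μ | 0 < μ.im} :=
  (hJ.differentiableOn.fst.mul hK.differentiableOn.fst).sub
    (hJ.differentiableOn.snd.mul hK.differentiableOn.snd)

end Symmetries

theorem conj_exp_phaseHat (y t : ℝ) {μ : ℝ} :
    starRingEnd ℂ (Complex.exp (-2 * phaseHat y t μ)) = Complex.exp (2 * phaseHat y t μ) := by
  rw [← Complex.exp_conj]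
  congr 1
  simp only [phaseHat, phaseCoeff, map_mul, map_neg, map_add, map_div₀, map_sub, map_pow, map_one,
    map_ofNat, Complex.conj_ofReal, Complex.conj_I]
  ring

theorem exp_phaseHat_mul (y t : ℝ) (μ : ℂ) :
    Complex.exp (-2 * phaseHat y t μ) * Complex.exp (2 * phaseHat y t μ) = 1 := by
  rw [← Complex.exp_add, neg_mul, neg_add_cancel, Complex.exp_zero]

theorem sigma1_conj (N : Matrix (Fin 2) (Fin 2) ℂ) :
    sigma1 * N * sigma1 = !![N 1 1, N 1 0; N 0 1, N 0 0] := by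
  rw [Matrix.eta_fin_two N]
  simp [sigma1]

theorem sigma2_conj (N : Matrix (Fin 2) (Fin 2) ℂ) :
    sigma2 * N * sigma2 = !![N 1 1, -N 1 0; -N 0 1, N 0 0] := by
  rw [Matrix.eta_fin_two N]
  simp only [sigma2, Matrix.mul_fin_two, Matrix.of_apply, Matrix.cons_val', Matrix.cons_val_zero,
    Matrix.cons_val_one, Matrix.cons_val_fin_one]
  congr 1
  ext i j
  fin_cases i <;> fin_cases j <;> simp <;> ring_nf <;> simp [Complex.I_sq]

/-- Limits from the upper half-plane determine the limits along the real line. -/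
theorem tendsto_ofReal_of_upper {F : ℂ → ℂ} {s : ℝ} {L : ℂ}
    (hF : Tendsto F (𝓝[{z : ℂ | 0 < z.im}] (s : ℂ)) (𝓝 L))
    (hb : ∀ᶠ x : ℝ in 𝓝[≠] s, Tendsto F (𝓝[{z : ℂ | 0 < z.im}] (x : ℂ)) (𝓝 (F x))) :
    Tendsto (fun x : ℝ => F x) (𝓝[≠] s) (𝓝 L) := by
  rw [Metric.tendsto_nhds]
  intro ε hε
  have h1 : ∀ᶠ z in 𝓝[{z : ℂ | 0 < z.im}] (s : ℂ), dist (F z) L < ε / 2 :=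
    hF (Metric.ball_mem_nhds _ (by positivity))
  rw [eventually_nhdsWithin_iff, Metric.eventually_nhds_iff] at h1
  obtain ⟨δ, hδ, h1⟩ := h1
  filter_upwards [hb, nhdsWithin_le_nhds (Metric.ball_mem_nhds s hδ)] with x hx hxs
  have hxs' : (x : ℂ) ∈ Metric.ball (s : ℂ) δ := by
    rw [Metric.mem_ball, Complex.dist_eq, ← Complex.ofReal_sub, Complex.norm_real]
    exact hxs
  have h2 : dist (F x) L ≤ ε / 2 := by
    refine le_of_tendsto (hx.dist tendsto_const_nhds) ?_
    filter_upwards [nhdsWithin_le_nhds (Metric.isOpen_ball.mem_nhds hxs'), self_mem_nhdsWithin]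
      with w hw hw'
    exact (h1 hw hw').le
  linarith

theorem upper_le_edgeFilter : 𝓝[{z : ℂ | 0 < z.im}] 1 ≤ edgeFilter :=
  nhdsWithin_mono _ fun _ hz => ⟨le_of_lt hz, (ne_of_im_pos hz).2.1⟩

theorem tendsto_ofReal_edgeFilter : Tendsto (fun x : ℝ => (x : ℂ)) (𝓝[≠] 1) edgeFilter := by
  refine tendsto_nhdsWithin_iff.2 ⟨?_, ?_⟩
  · have := Complex.continuous_ofReal.tendsto 1
    rw [Complex.ofReal_one] at this
    exact this.mono_left nhdsWithin_le_nhds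
  · filter_upwards [self_mem_nhdsWithin] with x hx
    exact ⟨by simp, fun h => hx (by simpa using h)⟩

theorem IsJostFamily.tendsto_ofReal {J : ℂ → ℂ × ℂ} (hJ : IsJostFamily J) {x : ℝ} (h0 : x ≠ 0)
    (h1 : x ≠ 1) (h2 : x ≠ -1) : Tendsto J (𝓝[{z : ℂ | 0 < z.im}] (x : ℂ)) (𝓝 (J x)) :=
  (hJ.continuousOn _ (mem_spectralDomain_ofReal h0 h1 h2)).mono_left
    (nhdsWithin_mono _ fun _ hz => mem_spectralDomain_of_im_pos hz)

theorem tendsto_wronskian_ofReal {J K : ℂ → ℂ × ℂ} (hJ : IsJostFamily J) (hK : IsJostFamily K)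
    {x : ℝ} (h0 : x ≠ 0) (h1 : x ≠ 1) (h2 : x ≠ -1) :
    Tendsto (wronskian J K) (𝓝[{z : ℂ | 0 < z.im}] (x : ℂ)) (𝓝 (wronskian J K x)) :=
  have hJ' := hJ.tendsto_ofReal h0 h1 h2
  have hK' := hK.tendsto_ofReal h0 h1 h2
  (hJ'.fst_nhds.mul hK'.fst_nhds).sub (hJ'.snd_nhds.mul hK'.snd_nhds)

theorem eventually_ne_one : ∀ᶠ x : ℝ in 𝓝[≠] 1, x ≠ 0 ∧ x ≠ 1 ∧ x ≠ -1 := by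
  filter_upwards [nhdsWithin_le_nhds (Ioi_mem_nhds (zero_lt_one' ℝ)), self_mem_nhdsWithin]
    with x hx hx1
  have hx : 0 < x := hx
  exact ⟨hx.ne', hx1, by linarith⟩

theorem tendsto_phaseHat_one (y t : ℝ) : Tendsto (phaseHat y t) (𝓝 1) (𝓝 0) := by
  have h1 : ContinuousAt (phaseHat y t) 1 := by
    have h2 : ContinuousAt (fun μ : ℂ => 8 * μ ^ 2 / (μ ^ 2 + 1) ^ 2) 1 :=
      ContinuousAt.div (by fun_prop) (by fun_prop) (by norm_num)
    exact (continuousAt_phaseCoeff one_ne_zero).neg.mul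
      (continuousAt_const.add (h2.mul continuousAt_const))
  have h2 : phaseHat y t 1 = 0 := by simp [phaseHat, phaseCoeff]
  rw [← h2]
  exact h1

theorem tendsto_sub_one_mul {f g : ℂ → ℂ} {w : ℂ}
    (h : (fun μ => f μ - g μ) =O[𝓝[{μ : ℂ | 0 < μ.im}] 1] fun _ => (1 : ℂ))
    (hg : ∀ μ, μ ≠ 1 → (μ - 1) * g μ = w) :
    Tendsto (fun μ => (μ - 1) * f μ) (𝓝[{μ : ℂ | 0 < μ.im}] 1) (𝓝 w) := by
  have h1 : Tendsto (fun μ : ℂ => μ - 1) (𝓝[{μ : ℂ | 0 < μ.im}] 1) (𝓝 0) := by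
    have : Tendsto (fun μ : ℂ => μ - 1) (𝓝 1) (𝓝 (1 - 1)) := tendsto_id.sub_const 1
    rw [sub_self] at this
    exact this.mono_left nhdsWithin_le_nhds
  have h2 := (h1.zero_mul_isBoundedUnder_le h.isBoundedUnder_le).add_const w
  rw [zero_add] at h2
  refine h2.congr' ?_
  filter_upwards [self_mem_nhdsWithin] with μ hμ
  rw [← hg μ (ne_of_im_pos hμ).2.1]
  ring

namespace RHData

variable {D : RHData} {y t : ℝ} {J K : ℂ → ℂ × ℂ} {b : ℝ → ℂ} {M : ℂ → Matrix (Fin 2) (Fin 2) ℂ}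

/-- Both J and K satisfy |f|² - |g|² = 1 on the real line; inserting the expression of K through J
leaves |a|² - |b|² = 1. It follows that a has no zeros on the line away from 0 and ±1. -/
theorem IsScattering.unitarity (h : D.IsScattering y t J K b) (hJ : IsJostFamily J)
    (hK : IsJostFamily K) {μ : ℝ} (h0 : μ ≠ 0) (h1 : μ ≠ 1) (h2 : μ ≠ -1) :
    wronskian J K μ * starRingEnd ℂ (wronskian J K μ) - b μ * starRingEnd ℂ (b μ) = 1 := by
  have hJd := hJ.det_real μ h0
  have hKd := hK.det_real μ h0
  have he := exp_phaseHat_mul y t (μ : ℂ)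
  rw [h.fst_eq μ h0 h1 h2, h.snd_eq μ h0 h1 h2] at hKd
  simp only [map_add, map_mul, Complex.conj_conj, conj_exp_phaseHat] at hKd
  generalize Complex.exp (-2 * phaseHat y t μ) = e at *
  generalize Complex.exp (2 * phaseHat y t μ) = e' at *
  generalize (J μ).1 = f at *
  generalize (J μ).2 = g at *
  generalize starRingEnd ℂ f = f' at *
  generalize starRingEnd ℂ g = g' at *
  linear_combination hKd - (wronskian J K μ * starRingEnd ℂ (wronskian J K μ) -
    b μ * starRingEnd ℂ (b μ)) * hJd + b μ * starRingEnd ℂ (b μ) * (f * f' - g * g') * he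

theorem IsScattering.wronskian_ne_zero (h : D.IsScattering y t J K b) (hJ : IsJostFamily J)
    (hK : IsJostFamily K) {μ : ℝ} (h0 : μ ≠ 0) (h1 : μ ≠ 1) (h2 : μ ≠ -1) :
    wronskian J K μ ≠ 0 := by
  intro hw
  have := h.unitarity hJ hK h0 h1 h2
  rw [hw, zero_mul, zero_sub, Complex.mul_conj] at this
  have h3 : -Complex.normSq (b μ) = 1 := by exact_mod_cast this
  linarith [Complex.normSq_nonneg (b μ)]

/-- The poles off the real line are symmetric. -/
theorem IsScattering.notMem_poles (h : D.IsScattering y t J K b) {μ : ℂ} (hμ : 0 < μ.im)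
    (hP : μ ∉ range D.pole) : μ ∉ D.poles ∧ starRingEnd ℂ μ ∉ D.poles := by
  have himp : ∀ j, 0 < (D.pole j).im := fun j => ((h.mem_range _).1 ⟨j, rfl⟩).1
  refine ⟨?_, ?_⟩
  · rintro (hj | ⟨j, hj⟩)
    · exact hP hj
    · have := himp j
      rw [← hj] at hμ
      simp only [Complex.conj_im] at hμ
      linarith
  · rintro (⟨j, hj⟩ | ⟨j, hj⟩)
    · have := himp j
      rw [hj, Complex.conj_im] at this
      linarith
    · exact hP ⟨j, (starRingEnd ℂ).injective hj⟩

/-- The zero set of a is invariant under μ ↦ -1/μ and μ ↦ -μ̄, hence under μ ↦ 1/μ̄. The point 1/μ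
lies in the lower half-plane, where the excluded points are the conjugates of these zeros. -/
theorem IsScattering.notMem_poles_inv (h : D.IsScattering y t J K b) (hJ : IsJostFamily J)
    (hK : IsJostFamily K) {μ : ℂ} (hμ : 0 < μ.im) (hP : μ ∉ range D.pole) : μ⁻¹ ∉ D.poles := by
  have hν : 0 < (starRingEnd ℂ μ⁻¹).im := by
    rw [Complex.conj_im, ← Complex.neg_im]
    exact neg_inv_im_pos hμ
  have hw : starRingEnd ℂ μ⁻¹ ∉ range D.pole := by
    intro hc
    rw [h.mem_range] at hc
    refine hP ((h.mem_range μ).2 ⟨hμ, ?_⟩)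
    have h1 := wronskian_neg_conj hJ hK (-μ⁻¹)
    rw [map_neg, neg_neg, hc.2, wronskian_neg_inv hJ hK hμ] at h1
    exact (map_eq_zero _).1 h1.symm
  have := (h.notMem_poles hν hw).2
  rwa [Complex.conj_conj] at this

theorem IsSolution.neg_conj (hM : D.IsSolution y t M) (h : D.IsScattering y t J K b)
    {μ : ℂ} (hμ : 0 < μ.im) (hP : μ ∉ range D.pole) :
    M (-starRingEnd ℂ μ) = !![starRingEnd ℂ (M μ 0 0), -starRingEnd ℂ (M μ 0 1);
      -starRingEnd ℂ (M μ 1 0), starRingEnd ℂ (M μ 1 1)] := by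
  have hp := h.notMem_poles hμ hP
  rw [hM.symm_neg _ (by simpa using hμ.ne') hp.2, hM.symm_conj _ hμ.ne' hp.1]
  rw [sigma1_conj, sigma2_conj]
  simp

/-- Two of the prescribed symmetries are composed to obtain a map of the upper half-plane into
itself, so that everything can be argued there. -/
theorem IsSolution.neg_inv (hM : D.IsSolution y t M) (h : D.IsScattering y t J K b)
    (hJ : IsJostFamily J) (hK : IsJostFamily K) {μ : ℂ} (hμ : 0 < μ.im) (hP : μ ∉ range D.pole) :
    M (-μ⁻¹) = !![M μ 0 0, -M μ 0 1; -M μ 1 0, M μ 1 1] := by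
  have him : (μ⁻¹).im ≠ 0 := by
    have := neg_inv_im_pos hμ
    rw [Complex.neg_im] at this
    linarith
  rw [hM.symm_neg _ him (h.notMem_poles_inv hJ hK hμ hP),
    hM.symm_inv _ hμ.ne' (h.notMem_poles hμ hP).1]
  rw [sigma1_conj, sigma2_conj]
  simp

/-- The behaviour at `μ = 1` of the Jost solutions matches the singularity condition. -/
theorem IsScattering.edge (h : D.IsScattering y t J K b) (hJ : IsJostFamily J)
    (hK : IsJostFamily K) {s s' : ℝ}
    (hs : Tendsto (fun μ => (μ - 1) • J μ) edgeFilter (𝓝 (Complex.I * s, Complex.I * s)))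
    (hs' : Tendsto (fun μ => (μ - 1) • K μ) edgeFilter (𝓝 (Complex.I * s', Complex.I * s'))) :
    ∃ d : ℂ, Tendsto (fun μ => (wronskian J K μ)⁻¹) (𝓝[{z : ℂ | 0 < z.im}] 1) (𝓝 d) ∧
      (D.c : ℂ) * s' + d * s = 0 := by
  obtain ⟨γ, hγ, ⟨hγ0, hc⟩ | ⟨-, a₁, b₁, ha, hb, hc⟩⟩ := h.singular
  · refine ⟨0, ?_, by simp [hc]⟩
    have h1 : Tendsto (fun μ : ℂ => -2 * Complex.I * (μ - 1)) (𝓝[{z : ℂ | 0 < z.im}] 1) (𝓝 0) := by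
      have : Tendsto (fun μ : ℂ => -2 * Complex.I * (μ - 1)) (𝓝 1) (𝓝 (-2 * Complex.I * (1 - 1))) :=
        (tendsto_id.sub_const 1).const_mul _
      rw [sub_self, mul_zero] at this
      exact this.mono_left nhdsWithin_le_nhds
    have h2 := h1.div hγ (by exact_mod_cast hγ0)
    rw [zero_div] at h2
    refine h2.congr' ?_
    filter_upwards [self_mem_nhdsWithin] with μ hμ
    have h3 : -2 * Complex.I * (μ - 1) ≠ 0 :=
      mul_ne_zero (by simp) (sub_ne_zero.2 (ne_of_im_pos hμ).2.1)
    simp only [Pi.div_apply]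
    rw [← mul_assoc, div_mul_eq_div_div, div_self h3, one_div]
  · have har : Tendsto (fun x : ℝ => wronskian J K x) (𝓝[≠] 1) (𝓝 (a₁ : ℂ)) := by
      refine tendsto_ofReal_of_upper (by simpa using ha) ?_
      filter_upwards [eventually_ne_one] with x hx
      exact tendsto_wronskian_ofReal hJ hK hx.1 hx.2.1 hx.2.2
    have hconj : ∀ {f : ℝ → ℂ} {c : ℂ}, Tendsto f (𝓝[≠] 1) (𝓝 c) →
        Tendsto (fun x => starRingEnd ℂ (f x)) (𝓝[≠] 1) (𝓝 (starRingEnd ℂ c)) :=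
      fun hf => (Complex.continuous_conj.tendsto _).comp hf
    -- The unitarity relation in the limit μ → 1, where a and b are real. With it, c s' + s/a₁ = 0
    -- becomes an identity once s' is known.
    have huni : a₁ * a₁ - b₁ * b₁ = 1 := by
      have h1 := (har.mul (hconj har)).sub (hb.mul (hconj hb))
      have h2 : Tendsto (fun _ : ℝ => (1 : ℂ)) (𝓝[≠] 1)
          (𝓝 (a₁ * starRingEnd ℂ a₁ - b₁ * starRingEnd ℂ b₁)) := by
        refine h1.congr' ?_
        filter_upwards [eventually_ne_one] with x hx
        exact h.unitarity hJ hK hx.1 hx.2.1 hx.2.2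
      have h3 := tendsto_nhds_unique h2 tendsto_const_nhds
      simp only [Complex.conj_ofReal] at h3
      exact_mod_cast h3
    have ha0 : a₁ ≠ 0 := by
      rintro rfl
      nlinarith [mul_self_nonneg b₁]
    -- The scattering relation multiplied by μ - 1, in the limit along the real line: the phase
    -- tends to 0, and conjugation turns i s into -i s.
    have hsr : (s' : ℂ) = b₁ * s - a₁ * s := by
      have h1 := (hs.comp tendsto_ofReal_edgeFilter)
      have h2 := (hs'.comp tendsto_ofReal_edgeFilter)
      have he : Tendsto (fun x : ℝ => Complex.exp (-2 * phaseHat y t x)) (𝓝[≠] 1) (𝓝 1) := by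
        have := (((tendsto_phaseHat_one y t).comp
          (tendsto_ofReal_edgeFilter.mono_right edgeFilter_le)).const_mul (-2)).cexp
        simpa using this
      have h3 := ((hb.mul he).mul h1.fst_nhds).add (har.mul (hconj h1.snd_nhds))
      have h4 : Tendsto (fun x : ℝ => (((x : ℂ) - 1) • K x).2) (𝓝[≠] 1)
          (𝓝 (b₁ * 1 * (Complex.I * s) + a₁ * starRingEnd ℂ (Complex.I * s))) := by
        refine h3.congr' ?_
        filter_upwards [eventually_ne_one] with x hx
        simp only [Function.comp, Prod.smul_fst, Prod.smul_snd, smul_eq_mul,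
          h.fst_eq x hx.1 hx.2.1 hx.2.2, map_mul, map_sub, Complex.conj_ofReal, map_one]
        ring
      have h5 := tendsto_nhds_unique h2.snd_nhds h4
      simp only [map_mul, Complex.conj_I, Complex.conj_ofReal] at h5
      linear_combination (-Complex.I) * h5 + ((s' : ℂ) - b₁ * s + a₁ * s) * Complex.I_mul_I
    refine ⟨(a₁ : ℂ)⁻¹, ha.inv₀ (by exact_mod_cast ha0), ?_⟩
    rw [hsr, hc]
    have ha0' : (a₁ : ℂ) ≠ 0 := by exact_mod_cast ha0
    have huni' : (a₁ * a₁ - b₁ * b₁ : ℂ) = 1 := by exact_mod_cast huni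
    push_cast
    field_simp
    linear_combination (-(s : ℂ)) * huni'

end RHData

end MCH
end

/-! ### The quotient of a solution of the RH problem by the matrix of Jost solutions -/

noncomputable section
namespace MCH
namespace RHData

variable {D : RHData} {y t : ℝ} {J K : ℂ → ℂ × ℂ} {b : ℝ → ℂ} {M : ℂ → Matrix (Fin 2) (Fin 2) ℂ}

/-- The entry `(i, 0)` of the quotient of `M` by the matrix of Jost solutions. -/
def quotFst (M : ℂ → Matrix (Fin 2) (Fin 2) ℂ) (J K : ℂ → ℂ × ℂ) (i : Fin 2) (z : ℂ) : ℂ :=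
  M z i 0 * (K z).1 - M z i 1 * ((J z).2 * (wronskian J K z)⁻¹)

/-- The entry `(i, 1)` of the quotient of `M` by the matrix of Jost solutions. -/
def quotSnd (M : ℂ → Matrix (Fin 2) (Fin 2) ℂ) (J K : ℂ → ℂ × ℂ) (i : Fin 2) (z : ℂ) : ℂ :=
  M z i 1 * ((J z).1 * (wronskian J K z)⁻¹) - M z i 0 * (K z).2

theorem IsSolution.differentiableOn_quot (hM : D.IsSolution y t M) (h : D.IsScattering y t J K b)
    (hJ : IsJostFamily J) (hK : IsJostFamily K) (i : Fin 2) :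
    DifferentiableOn ℂ (quotFst M J K i) ({z | 0 < z.im} \ range D.pole) ∧
      DifferentiableOn ℂ (quotSnd M J K i) ({z | 0 < z.im} \ range D.pole) := by
  have hw : DifferentiableOn ℂ (fun z => (wronskian J K z)⁻¹) ({z | 0 < z.im} \ range D.pole) :=
    ((differentiableOn_wronskian hJ hK).mono sdiff_subset).inv fun z hz hz0 =>
      hz.2 ((h.mem_range z).2 ⟨hz.1, hz0⟩)
  have h1 := (hM.analytic_fst i).mono (s := {z : ℂ | 0 < z.im} \ range D.pole)
    fun z hz => ⟨ne_of_gt hz.1, hz.2⟩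
  have h2 := (hM.analytic_snd i).mono (s := {z : ℂ | 0 < z.im} \ range D.pole)
    fun z hz => ⟨ne_of_gt hz.1, fun hc => (h.notMem_poles hz.1 hz.2).1 (Or.inr hc)⟩
  have hJ' := hJ.differentiableOn.mono (s := {z : ℂ | 0 < z.im} \ range D.pole) sdiff_subset
  have hK' := hK.differentiableOn.mono (s := {z : ℂ | 0 < z.im} \ range D.pole) sdiff_subset
  exact ⟨(h1.mul hK'.fst).sub (h2.mul (hJ'.snd.mul hw)), (h2.mul (hJ'.fst.mul hw)).sub (h1.mul hK'.snd)⟩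

/-- Two simple poles cancel: the one of the first column of M, with factor 1/ϰ̂_j, and the one of
1/a, with factor 1/a'(μ_j). The factors match because the two Jost solutions are proportional at μ_j
and ρ_j = a'(μ_j) δ_j. -/
theorem IsSolution.residue_quot (hM : D.IsSolution y t M) (h : D.IsScattering y t J K b)
    (hJ : IsJostFamily J) (hK : IsJostFamily K) (i : Fin 2) (j : Fin D.N) :
    Tendsto (fun z => (z - D.pole j) * quotFst M J K i z) (𝓝[≠] (D.pole j)) (𝓝 0) ∧
      Tendsto (fun z => (z - D.pole j) * quotSnd M J K i z) (𝓝[≠] (D.pole j)) (𝓝 0) := by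
  set p := D.pole j with hp
  obtain ⟨hpim, hp0⟩ := (h.mem_range p).1 ⟨j, rfl⟩
  obtain ⟨hder, δ, hδ, hρ, hK2, hK1⟩ := h.residue j
  rw [← hp] at hder hρ hK2 hK1
  have hnhds : {z : ℂ | 0 < z.im} ∈ 𝓝 p := IsPotential.isOpen_upper.mem_nhds hpim
  have hJc := ((hJ.differentiableOn.differentiableAt hnhds).continuousAt.tendsto).mono_left
    (nhdsWithin_le_nhds (s := {p}ᶜ))
  have hKc := ((hK.differentiableOn.differentiableAt hnhds).continuousAt.tendsto).mono_left
    (nhdsWithin_le_nhds (s := {p}ᶜ))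
  have hw : Tendsto (fun z => (z - p) * (wronskian J K z)⁻¹) (𝓝[≠] p)
      (𝓝 (deriv (wronskian J K) p)⁻¹) := by
    have h1 := hasDerivAt_iff_tendsto_slope.1
      ((differentiableOn_wronskian hJ hK).differentiableAt hnhds).hasDerivAt
    refine (h1.inv₀ hder).congr fun z => ?_
    rw [slope_def_field, hp0, sub_zero, inv_div, div_eq_mul_inv]
  have h1 := hM.residue_fst j i
  have h2 : Tendsto (fun z => M z i 1) (𝓝[≠] p) (𝓝 (M p i 1)) := by
    have hopen : {z : ℂ | z.im ≠ 0} \ range (fun j => starRingEnd ℂ (D.pole j)) ∈ 𝓝 p := by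
      refine IsOpen.mem_nhds (IsOpen.sdiff (isOpen_ne_fun Complex.continuous_im continuous_const)
        (Set.finite_range _).isClosed) ⟨hpim.ne', ?_⟩
      rintro ⟨k, hk⟩
      have := ((h.mem_range _).1 ⟨k, rfl⟩).1
      rw [← hk] at hpim
      simp only [Complex.conj_im] at hpim
      linarith
    exact (((hM.analytic_snd i).differentiableAt hopen).continuousAt.tendsto).mono_left
      nhdsWithin_le_nhds
  rw [← hp] at h1
  have hk : (D.kappa y t j)⁻¹ * (δ * Complex.exp (-2 * phaseHat y t p)) =
      (deriv (wronskian J K) p)⁻¹ := by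
    rw [kappa, ← hp, hρ]
    have := Complex.exp_ne_zero (-2 * phaseHat y t p)
    field_simp
  constructor
  · have h3 := (h1.mul hKc.fst_nhds).sub (h2.mul (hJc.snd_nhds.mul hw))
    have h4 : (D.kappa y t j)⁻¹ * M p i 1 * (K p).1 -
        M p i 1 * ((J p).2 * (deriv (wronskian J K) p)⁻¹) = 0 := by
      rw [hK1, ← hk]; ring
    rw [h4] at h3
    refine h3.congr fun z => ?_
    rw [quotFst]; ring
  · have h3 := (h2.mul (hJc.fst_nhds.mul hw)).sub (h1.mul hKc.snd_nhds)
    have h4 : M p i 1 * ((J p).1 * (deriv (wronskian J K) p)⁻¹) -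
        (D.kappa y t j)⁻¹ * M p i 1 * (K p).2 = 0 := by
      rw [hK2, ← hk]; ring
    rw [h4] at h3
    refine h3.congr fun z => ?_
    rw [quotSnd]; ring

theorem tendsto_entry {ι : Type*} {l : Filter ι} {A : ι → Matrix (Fin 2) (Fin 2) ℂ}
    {B : Matrix (Fin 2) (Fin 2) ℂ} (h : Tendsto A l (𝓝 B)) (i j : Fin 2) :
    Tendsto (fun z => A z i j) l (𝓝 (B i j)) :=
  tendsto_pi_nhds.1 (tendsto_pi_nhds.1 h i) j

theorem tendsto_conj_lower (x : ℝ) : Tendsto (starRingEnd ℂ) (𝓝[{z : ℂ | z.im < 0}] (x : ℂ))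
    (𝓝[{z : ℂ | 0 < z.im}] (x : ℂ)) := by
  refine tendsto_nhdsWithin_iff.2 ⟨?_, ?_⟩
  · have := Complex.continuous_conj.tendsto (x : ℂ)
    rw [Complex.conj_ofReal] at this
    exact this.mono_left nhdsWithin_le_nhds
  · filter_upwards [self_mem_nhdsWithin] with z hz
    simpa using hz

theorem neBot_nhdsWithin_lower (x : ℝ) : (𝓝[{z : ℂ | z.im < 0}] (x : ℂ)).NeBot := by
  rw [← mem_closure_iff_nhdsWithin_neBot, Complex.closure_setOfPred_im_lt]
  simp

/-- The boundary values of `M` on the real line. -/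
theorem IsSolution.exists_boundary (hM : D.IsSolution y t M) (h : D.IsScattering y t J K b)
    {x : ℝ} (h0 : x ≠ 0) (h1 : x ≠ 1) (h2 : x ≠ -1) :
    ∃ N : Matrix (Fin 2) (Fin 2) ℂ, Tendsto M (𝓝[{z : ℂ | 0 < z.im}] (x : ℂ)) (𝓝 N) ∧
      !![starRingEnd ℂ (N 1 1), starRingEnd ℂ (N 1 0); starRingEnd ℂ (N 0 1),
        starRingEnd ℂ (N 0 0)] = N * D.jump y t x := by
  obtain ⟨N, N', hN, hN', hj⟩ := hM.jump x h0 h1 h2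
  refine ⟨N, hN, ?_⟩
  rw [← hj]
  have := neBot_nhdsWithin_lower x
  have hfin : ∀ᶠ z in 𝓝[{z : ℂ | 0 < z.im}] (x : ℂ), z ∉ range D.pole := by
    refine nhdsWithin_le_nhds ((Set.finite_range _).isClosed.isOpen_compl.mem_nhds ?_)
    rintro ⟨k, hk⟩
    have := ((h.mem_range _).1 ⟨k, rfl⟩).1
    rw [hk] at this
    simp at this
  refine tendsto_nhds_unique ?_ hN'
  have hc := hN.comp (tendsto_conj_lower x)
  have h3 : Tendsto (fun z => sigma1 * (M (starRingEnd ℂ z)).map (starRingEnd ℂ) * sigma1)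
      (𝓝[{z : ℂ | z.im < 0}] (x : ℂ)) (𝓝 (sigma1 * N.map (starRingEnd ℂ) * sigma1)) := by
    have hcont : Continuous fun A : Matrix (Fin 2) (Fin 2) ℂ =>
        sigma1 * A.map (starRingEnd ℂ) * sigma1 :=
      (continuous_const.matrix_mul (continuous_id.matrix_map Complex.continuous_conj)).matrix_mul
        continuous_const
    exact (hcont.tendsto N).comp hc
  rw [sigma1_conj] at h3
  refine h3.congr' ?_
  filter_upwards [(tendsto_conj_lower x).eventually hfin, self_mem_nhdsWithin] with z hz hz'
  have him : 0 < (starRingEnd ℂ z).im := by simpa using hz'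
  have := hM.symm_conj (starRingEnd ℂ z) him.ne' (h.notMem_poles him hz).1
  rw [Complex.conj_conj] at this
  exact this.symm

theorem jump_eq (D : RHData) (y t : ℝ) (x : ℝ) :
    D.jump y t x = !![1, -(D.r x * Complex.exp (-2 * phaseHat y t x));
      starRingEnd ℂ (D.r x) * Complex.exp (2 * phaseHat y t x),
      1 - D.r x * starRingEnd ℂ (D.r x)] := by
  have e1 : Complex.exp (-phaseHat y t x) * Complex.exp (phaseHat y t x) = 1 := by
    rw [← Complex.exp_add, neg_add_cancel, Complex.exp_zero]
  have e2 : Complex.exp (-2 * phaseHat y t x) =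
      Complex.exp (-phaseHat y t x) * Complex.exp (-phaseHat y t x) := by
    rw [← Complex.exp_add]; congr 1; ring
  have e3 : Complex.exp (2 * phaseHat y t x) =
      Complex.exp (phaseHat y t x) * Complex.exp (phaseHat y t x) := by
    rw [← Complex.exp_add]; congr 1; ring
  rw [jump, e2, e3]
  simp only [expSigma3, neg_neg, Matrix.mul_fin_two]
  congr 1
  ext i j
  fin_cases i <;> fin_cases j <;> simp
  · linear_combination e1
  · ring
  · ring
  · linear_combination (1 - D.r x * starRingEnd ℂ (D.r x)) * e1

/-- The jump condition together with the conjugation symmetry expresses the conjugate of M₊ through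
M₊, and the scattering relation does the same for the Jost matrix. For the quotient E the jump
disappears and only reality remains: E₁₁ is the conjugate of E₀₀ and E₁₀ the conjugate of E₀₁. -/
theorem IsSolution.boundary_quot (hM : D.IsSolution y t M) (h : D.IsScattering y t J K b)
    (hJ : IsJostFamily J) (hK : IsJostFamily K) {x : ℝ} (h0 : x ≠ 0) (h1 : x ≠ 1) (h2 : x ≠ -1) :
    ∃ e e' : ℂ, Tendsto (quotFst M J K 0) (𝓝[{z : ℂ | 0 < z.im}] (x : ℂ)) (𝓝 e) ∧
      Tendsto (quotSnd M J K 1) (𝓝[{z : ℂ | 0 < z.im}] (x : ℂ)) (𝓝 (starRingEnd ℂ e)) ∧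
      Tendsto (quotSnd M J K 0) (𝓝[{z : ℂ | 0 < z.im}] (x : ℂ)) (𝓝 e') ∧
      Tendsto (quotFst M J K 1) (𝓝[{z : ℂ | 0 < z.im}] (x : ℂ)) (𝓝 (starRingEnd ℂ e')) := by
  obtain ⟨N, hN, hj⟩ := hM.exists_boundary h h0 h1 h2
  have hw0 := h.wronskian_ne_zero hJ hK h0 h1 h2
  have hw := (tendsto_wronskian_ofReal hJ hK h0 h1 h2).inv₀ hw0
  have hJ' := hJ.tendsto_ofReal h0 h1 h2
  have hK' := hK.tendsto_ofReal h0 h1 h2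
  have hl1 : ∀ i, Tendsto (quotFst M J K i) (𝓝[{z : ℂ | 0 < z.im}] (x : ℂ))
      (𝓝 (N i 0 * (K x).1 - N i 1 * ((J x).2 * (wronskian J K x)⁻¹))) := fun i =>
    ((tendsto_entry hN i 0).mul hK'.fst_nhds).sub
      ((tendsto_entry hN i 1).mul (hJ'.snd_nhds.mul hw))
  have hl2 : ∀ i, Tendsto (quotSnd M J K i) (𝓝[{z : ℂ | 0 < z.im}] (x : ℂ))
      (𝓝 (N i 1 * ((J x).1 * (wronskian J K x)⁻¹) - N i 0 * (K x).2)) := fun i =>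
    ((tendsto_entry hN i 1).mul (hJ'.fst_nhds.mul hw)).sub
      ((tendsto_entry hN i 0).mul hK'.snd_nhds)
  have hw0' : starRingEnd ℂ (wronskian J K x) ≠ 0 := (map_ne_zero _).2 hw0
  have hu := h.unitarity hJ hK h0 h1 h2
  have he := exp_phaseHat_mul y t (x : ℂ)
  rw [jump_eq, h.r_eq x h0 h1 h2, Matrix.eta_fin_two N, Matrix.mul_fin_two] at hj
  have hj' := fun i j => congrFun (congrFun hj i) j
  have j00 := hj' 0 0
  have j01 := hj' 0 1
  have j10 := hj' 1 0
  have j11 := hj' 1 1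
  simp only [Matrix.of_apply, Matrix.cons_val', Matrix.cons_val_zero, Matrix.cons_val_one,
    Matrix.cons_val_fin_one, map_div₀, Complex.conj_conj] at j00 j01 j10 j11
  have hK2 := h.fst_eq x h0 h1 h2
  have hK1 := h.snd_eq x h0 h1 h2
  have hec := conj_exp_phaseHat y t (μ := x)
  have hec' : starRingEnd ℂ (Complex.exp (2 * phaseHat y t x)) = Complex.exp (-2 * phaseHat y t x) := by
    rw [← hec, Complex.conj_conj]
  refine ⟨_, _, hl1 0, ?_, hl2 0, ?_⟩
  · convert hl2 1 using 2
    rw [hK2, hK1]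
    simp only [map_sub, map_mul, map_add, map_inv₀, Complex.conj_conj, hec, j10, j11]
    generalize Complex.exp (-2 * phaseHat y t x) = E at *
    generalize Complex.exp (2 * phaseHat y t x) = E' at *
    generalize starRingEnd ℂ (wronskian J K x) = W' at *
    generalize wronskian J K x = W at *
    generalize starRingEnd ℂ (b x) = B' at *
    generalize b x = B at *
    generalize starRingEnd ℂ (J x).1 = f' at *
    generalize starRingEnd ℂ (J x).2 = g' at *
    generalize (J x).1 = f at *
    generalize (J x).2 = g at *
    field_simp
    -- The identity needs only |a|² - |b|² = 1 and the fact that the two phase exponentials are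
    -- inverse to each other.
    linear_combination N 1 1 * (B' * E' * g' + W' * f) * hu + N 1 0 * W * g' * (hu - B * B' * he)
  · convert hl1 1 using 2
    rw [hK2, hK1]
    simp only [map_sub, map_mul, map_add, map_inv₀, Complex.conj_conj, hec, j10, j11]
    generalize Complex.exp (-2 * phaseHat y t x) = E at *
    generalize Complex.exp (2 * phaseHat y t x) = E' at *
    generalize starRingEnd ℂ (wronskian J K x) = W' at *
    generalize wronskian J K x = W at *
    generalize starRingEnd ℂ (b x) = B' at *
    generalize b x = B at *
    generalize starRingEnd ℂ (J x).1 = f' at *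
    generalize starRingEnd ℂ (J x).2 = g' at *
    generalize (J x).1 = f at *
    generalize (J x).2 = g at *
    field_simp
    linear_combination -(N 1 1 * (B' * E' * f' + W' * g) * hu) - N 1 0 * W * f' * (hu - B * B' * he)

theorem IsSolution.tendsto_quot_cobounded (hM : D.IsSolution y t M) (hJ : IsJostFamily J)
    (hK : IsJostFamily K) :
    Tendsto (quotFst M J K 0) (Bornology.cobounded ℂ ⊓ 𝓟 {z : ℂ | 0 < z.im}) (𝓝 1) ∧
      Tendsto (quotSnd M J K 1) (Bornology.cobounded ℂ ⊓ 𝓟 {z : ℂ | 0 < z.im}) (𝓝 1) ∧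
      Tendsto (quotSnd M J K 0) (Bornology.cobounded ℂ ⊓ 𝓟 {z : ℂ | 0 < z.im}) (𝓝 0) ∧
      Tendsto (quotFst M J K 1) (Bornology.cobounded ℂ ⊓ 𝓟 {z : ℂ | 0 < z.im}) (𝓝 0) := by
  have hN := hM.normalization.mono_left (inf_le_inf_left (Bornology.cobounded ℂ)
    (principal_mono.2 fun z (hz : 0 < z.im) => hz.ne'))
  have hJ' := hJ.tendsto_cobounded
  have hK' := hK.tendsto_cobounded
  have hw : Tendsto (fun z => (wronskian J K z)⁻¹)
      (Bornology.cobounded ℂ ⊓ 𝓟 {z : ℂ | 0 < z.im}) (𝓝 1) := by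
    have := ((hJ'.fst_nhds.mul hK'.fst_nhds).sub (hJ'.snd_nhds.mul hK'.snd_nhds)).inv₀ (by simp)
    simp only [mul_one, mul_zero, sub_zero, inv_one] at this
    exact this
  have h1 := fun i => ((tendsto_entry hN i 0).mul hK'.fst_nhds).sub
      ((tendsto_entry hN i 1).mul (hJ'.snd_nhds.mul hw))
  have h2 := fun i => ((tendsto_entry hN i 1).mul (hJ'.fst_nhds.mul hw)).sub
      ((tendsto_entry hN i 0).mul hK'.snd_nhds)
  have h3 := h1 0
  have h4 := h1 1
  have h5 := h2 0
  have h6 := h2 1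
  simp only [Matrix.one_apply_eq, Matrix.one_apply_ne zero_ne_one,
    Matrix.one_apply_ne one_ne_zero, mul_one, mul_zero, sub_zero] at h3 h4 h5 h6
  exact ⟨h3, h6, h5, h4⟩

/-- The singular part of `M` at `μ = 1`. -/
theorem IsSolution.tendsto_edge (hM : D.IsSolution y t M) :
    ∃ κ : ℂ, ∀ i, Tendsto (fun z => (z - 1) * M z i 0) (𝓝[{z : ℂ | 0 < z.im}] 1) (𝓝 (-D.c * κ)) ∧
      Tendsto (fun z => (z - 1) * M z i 1) (𝓝[{z : ℂ | 0 < z.im}] 1) (𝓝 κ) := by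
  obtain ⟨α, hα, -⟩ := hM.singularity
  refine ⟨Complex.I * α / 2, fun i => ⟨?_, ?_⟩⟩
  · refine tendsto_sub_one_mul (hα i 0) fun μ hμ => ?_
    have : μ - 1 ≠ 0 := sub_ne_zero.2 hμ
    fin_cases i <;> simp <;> field_simp
  · refine tendsto_sub_one_mul (hα i 1) fun μ hμ => ?_
    have : μ - 1 ≠ 0 := sub_ne_zero.2 hμ
    fin_cases i <;> simp <;> field_simp

/-- Both factors may have a simple pole at 1. The coefficient of the resulting double pole is a
multiple of c s' + d s, which is zero by `IsScattering.edge`; this is the purpose of the constant c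
in the singularity condition. -/
theorem IsSolution.tendsto_quot_edge (hM : D.IsSolution y t M) (h : D.IsScattering y t J K b)
    (hJ : IsJostFamily J) (hK : IsJostFamily K) (i : Fin 2) :
    Tendsto (fun z => (z - 1) ^ 2 * quotFst M J K i z) (𝓝[{z : ℂ | 0 < z.im}] 1) (𝓝 0) ∧
      Tendsto (fun z => (z - 1) ^ 2 * quotSnd M J K i z) (𝓝[{z : ℂ | 0 < z.im}] 1) (𝓝 0) := by
  obtain ⟨κ, hκ⟩ := hM.tendsto_edge
  obtain ⟨s, hs⟩ := hJ.tendsto_edge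
  obtain ⟨s', hs'⟩ := hK.tendsto_edge
  obtain ⟨d, hd, hrel⟩ := h.edge hJ hK hs hs'
  have hs := hs.mono_left upper_le_edgeFilter
  have hs' := hs'.mono_left upper_le_edgeFilter
  constructor
  · have h1 := ((hκ i).1.mul hs'.fst_nhds).sub ((hκ i).2.mul (hs.snd_nhds.mul hd))
    have h2 : -D.c * κ * (Complex.I * s') - κ * (Complex.I * s * d) = 0 := by
      linear_combination (-(Complex.I * κ)) * hrel
    rw [h2] at h1
    refine h1.congr fun z => ?_
    simp only [quotFst, Prod.smul_fst, Prod.smul_snd, smul_eq_mul]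
    ring
  · have h1 := ((hκ i).2.mul (hs.fst_nhds.mul hd)).sub ((hκ i).1.mul hs'.snd_nhds)
    have h2 : κ * (Complex.I * s * d) - -D.c * κ * (Complex.I * s') = 0 := by
      linear_combination (Complex.I * κ) * hrel
    rw [h2] at h1
    refine h1.congr fun z => ?_
    simp only [quotSnd, Prod.smul_fst, Prod.smul_snd, smul_eq_mul]
    ring

/-- The polar part of M at 1 has equal rows, hence rank at most one, so the double pole of the
determinant cancels. -/
theorem IsSolution.tendsto_det_edge (hM : D.IsSolution y t M) :
    Tendsto (fun z => (z - 1) ^ 2 * (M z 0 0 * M z 1 1 - M z 0 1 * M z 1 0))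
      (𝓝[{z : ℂ | 0 < z.im}] 1) (𝓝 0) := by
  obtain ⟨κ, hκ⟩ := hM.tendsto_edge
  have h1 := ((hκ 0).1.mul (hκ 1).2).sub ((hκ 0).2.mul (hκ 1).1)
  rw [show -D.c * κ * κ - κ * (-D.c * κ) = 0 by ring] at h1
  refine h1.congr fun z => ?_
  ring

theorem IsSolution.quot_neg_conj (hM : D.IsSolution y t M) (h : D.IsScattering y t J K b)
    (hJ : IsJostFamily J) (hK : IsJostFamily K) {z : ℂ} (hz : 0 < z.im) (hP : z ∉ range D.pole) :
    quotFst M J K 0 (-starRingEnd ℂ z) = starRingEnd ℂ (quotFst M J K 0 z) ∧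
      quotSnd M J K 1 (-starRingEnd ℂ z) = starRingEnd ℂ (quotSnd M J K 1 z) ∧
      quotSnd M J K 0 (-starRingEnd ℂ z) = -starRingEnd ℂ (quotSnd M J K 0 z) ∧
      quotFst M J K 1 (-starRingEnd ℂ z) = -starRingEnd ℂ (quotFst M J K 1 z) := by
  simp only [quotFst, quotSnd, hM.neg_conj h hz hP, hJ.neg_conj, hK.neg_conj,
    wronskian_neg_conj hJ hK, map_sub, map_mul, map_inv₀]
  refine ⟨?_, ?_, ?_, ?_⟩ <;> simp <;> ring

theorem IsSolution.quot_neg_inv (hM : D.IsSolution y t M) (h : D.IsScattering y t J K b)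
    (hJ : IsJostFamily J) (hK : IsJostFamily K) {z : ℂ} (hz : 0 < z.im) (hP : z ∉ range D.pole) :
    quotFst M J K 0 (-z⁻¹) = quotFst M J K 0 z ∧
      quotSnd M J K 1 (-z⁻¹) = quotSnd M J K 1 z ∧
      quotSnd M J K 0 (-z⁻¹) = -quotSnd M J K 0 z ∧
      quotFst M J K 1 (-z⁻¹) = -quotFst M J K 1 z := by
  simp only [quotFst, quotSnd, hM.neg_inv h hJ hK hz hP, hJ.neg_inv z hz, hK.neg_inv z hz,
    wronskian_neg_inv hJ hK hz]
  refine ⟨?_, ?_, ?_, ?_⟩ <;> simp <;> ring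

theorem exists_ofReal_eq {w : ℂ} (h : starRingEnd ℂ w = w) : ∃ r : ℝ, w = r :=
  ⟨w.re, (Complex.conj_eq_iff_re.1 h).symm⟩

/-- The quotient of a solution by the matrix of Jost solutions is the identity. -/
theorem IsSolution.quot_eq_one (hM : D.IsSolution y t M) (h : D.IsScattering y t J K b)
    (hJ : IsJostFamily J) (hK : IsJostFamily K) (hI : Complex.I ∉ range D.pole)
    {z : ℂ} (hz : 0 < z.im) (hP : z ∉ range D.pole) :
    quotFst M J K 0 z = 1 ∧ quotSnd M J K 1 z = 1 ∧ quotSnd M J K 0 z = 0 ∧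
      quotFst M J K 1 z = 0 := by
  have hPf : (range D.pole).Finite := Set.finite_range _
  have hPu : ∀ p ∈ range D.pole, 0 < p.im := fun p hp => ((h.mem_range p).1 hp).1
  have hd := fun i => hM.differentiableOn_quot h hJ hK i
  have hres := fun i j => hM.residue_quot h hJ hK i j
  have hinf := hM.tendsto_quot_cobounded hJ hK
  have hedge := fun i => hM.tendsto_quot_edge h hJ hK i
  -- Since E₁₁ and E₁₀ are the boundary conjugates of E₀₀ and E₀₁, the sums are real on the line and
  -- so are i times the differences. Each of the four combinations is therefore rational with one
  -- unknown constant. The factor i reverses the sign ε of the conjugation symmetry; the inversion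
  -- symmetry has ε' = 1 on the diagonal and ε' = -1 off it.
  obtain ⟨e₁, hS, he₁⟩ := eq_rational_of_symmetries (C := 2) (ε := 1) (ε' := 1)
    (F := fun z => quotFst M J K 0 z + quotSnd M J K 1 z) hPf hPu ((hd 0).1.add (hd 1).2)
    (by
      rintro _ ⟨j, rfl⟩
      simpa [mul_add] using (hres 0 j).1.add (hres 1 j).2)
    (fun x h0 h1 h2 => by
      obtain ⟨e, e', l1, l2, -, -⟩ := hM.boundary_quot h hJ hK h0 h1 h2
      obtain ⟨r, hr⟩ := exists_ofReal_eq (w := e + starRingEnd ℂ e) (by simp [add_comm])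
      exact ⟨r, hr ▸ l1.add l2⟩)
    (by
      have := hinf.1.add hinf.2.1
      norm_num at this ⊢
      exact this)
    (by simpa [mul_add] using (hedge 0).1.add (hedge 1).2) (by norm_num)
    (fun z hz hP => by
      have := hM.quot_neg_conj h hJ hK hz hP
      simp [this.1, this.2.1])
    (fun z hz hP => by
      have := hM.quot_neg_inv h hJ hK hz hP
      simp [this.1, this.2.1])
  obtain ⟨e₂, hD, he₂⟩ := eq_rational_of_symmetries (C := 0) (ε := -1) (ε' := 1)
    (F := fun z => Complex.I * (quotFst M J K 0 z - quotSnd M J K 1 z)) hPf hPu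
    (((hd 0).1.sub (hd 1).2).const_mul _)
    (by
      rintro _ ⟨j, rfl⟩
      have := ((hres 0 j).1.sub (hres 1 j).2).const_mul Complex.I
      rw [sub_zero, mul_zero] at this
      exact this.congr fun z => by ring)
    (fun x h0 h1 h2 => by
      obtain ⟨e, e', l1, l2, -, -⟩ := hM.boundary_quot h hJ hK h0 h1 h2
      obtain ⟨r, hr⟩ := exists_ofReal_eq (w := Complex.I * (e - starRingEnd ℂ e))
        (by simp only [map_mul, map_sub, Complex.conj_conj, Complex.conj_I]; ring)
      exact ⟨r, hr ▸ (l1.sub l2).const_mul Complex.I⟩)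
    (by
      have := (hinf.1.sub hinf.2.1).const_mul Complex.I
      simpa using this)
    (by
      have := ((hedge 0).1.sub (hedge 1).2).const_mul Complex.I
      rw [sub_zero, mul_zero] at this
      exact this.congr fun z => by ring)
    (by norm_num)
    (fun z hz hP => by
      have := hM.quot_neg_conj h hJ hK hz hP
      simp only [this.1, this.2.1, map_mul, map_sub, Complex.conj_I]
      push_cast
      ring)
    (fun z hz hP => by
      have := hM.quot_neg_inv h hJ hK hz hP
      simp [this.1, this.2.1])
  obtain ⟨e₃, hO₁, he₃⟩ := eq_rational_of_symmetries (C := 0) (ε := -1) (ε' := -1)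
    (F := fun z => quotSnd M J K 0 z + quotFst M J K 1 z) hPf hPu ((hd 0).2.add (hd 1).1)
    (by
      rintro _ ⟨j, rfl⟩
      simpa [mul_add] using (hres 0 j).2.add (hres 1 j).1)
    (fun x h0 h1 h2 => by
      obtain ⟨e, e', -, -, l1, l2⟩ := hM.boundary_quot h hJ hK h0 h1 h2
      obtain ⟨r, hr⟩ := exists_ofReal_eq (w := e' + starRingEnd ℂ e') (by simp [add_comm])
      exact ⟨r, hr ▸ l1.add l2⟩)
    (by simpa using hinf.2.2.1.add hinf.2.2.2)
    (by simpa [mul_add] using (hedge 0).2.add (hedge 1).1) (by norm_num)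
    (fun z hz hP => by
      have := hM.quot_neg_conj h hJ hK hz hP
      simp only [this.2.2.1, this.2.2.2, map_add]
      push_cast
      ring)
    (fun z hz hP => by
      have := hM.quot_neg_inv h hJ hK hz hP
      simp only [this.2.2.1, this.2.2.2]
      push_cast
      ring)
  obtain ⟨e₄, hO₂, he₄⟩ := eq_rational_of_symmetries (C := 0) (ε := 1) (ε' := -1)
    (F := fun z => Complex.I * (quotSnd M J K 0 z - quotFst M J K 1 z)) hPf hPu
    (((hd 0).2.sub (hd 1).1).const_mul _)
    (by
      rintro _ ⟨j, rfl⟩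
      have := ((hres 0 j).2.sub (hres 1 j).1).const_mul Complex.I
      rw [sub_zero, mul_zero] at this
      exact this.congr fun z => by ring)
    (fun x h0 h1 h2 => by
      obtain ⟨e, e', -, -, l1, l2⟩ := hM.boundary_quot h hJ hK h0 h1 h2
      obtain ⟨r, hr⟩ := exists_ofReal_eq (w := Complex.I * (e' - starRingEnd ℂ e'))
        (by simp only [map_mul, map_sub, Complex.conj_conj, Complex.conj_I]; ring)
      exact ⟨r, hr ▸ (l1.sub l2).const_mul Complex.I⟩)
    (by
      have := (hinf.2.2.1.sub hinf.2.2.2).const_mul Complex.I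
      simpa using this)
    (by
      have := ((hedge 0).2.sub (hedge 1).1).const_mul Complex.I
      rw [sub_zero, mul_zero] at this
      exact this.congr fun z => by ring)
    (by norm_num)
    (fun z hz hP => by
      have := hM.quot_neg_conj h hJ hK hz hP
      simp only [this.2.2.1, this.2.2.2, map_mul, map_sub, Complex.conj_I]
      push_cast
      ring)
    (fun z hz hP => by
      have := hM.quot_neg_inv h hJ hK hz hP
      simp only [this.2.2.1, this.2.2.2]
      push_cast
      ring)
  -- For ε = 1 the relation C - e - εe = ε'C forces e = 0. For ε = -1 it says nothing about e, so e₂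
  -- and e₃ need separate arguments.
  have h1 : e₁ = 0 := by linarith
  have h4 : e₄ = 0 := by linarith
  -- The point i is fixed by z ↦ -1/z, and the off-diagonal entries change sign under this map, so
  -- they vanish at i. On the other hand 1/(i - 1) + 1/(i + 1) = -i is not zero.
  have h3 : e₃ = 0 := by
    have hi := hM.quot_neg_inv h hJ hK (z := Complex.I) (by simp) hI
    have hi' := hO₁ Complex.I (by simp) hI
    rw [Complex.inv_I, neg_neg] at hi
    have h5 : quotSnd M J K 0 Complex.I = 0 := by linear_combination hi.2.2.1 / 2
    have h6 : quotFst M J K 1 Complex.I = 0 := by linear_combination hi.2.2.2 / 2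
    rw [h5, h6] at hi'
    have hne1 : Complex.I - 1 ≠ 0 := sub_ne_zero.2 (ne_of_im_pos (by simp)).2.1
    have hne2 : Complex.I + 1 ≠ 0 := fun hc =>
      (ne_of_im_pos (μ := Complex.I) (by simp)).2.2 (eq_neg_of_add_eq_zero_left hc)
    push_cast at hi'
    field_simp at hi'
    have h7 : (e₃ : ℂ) = 0 := by
      linear_combination (Complex.I / 2) * hi' + (e₃ : ℂ) * Complex.I_mul_I
    exact_mod_cast h7
  subst h1 h3 h4
  have hfar : ∀ᶠ z in 𝓝[{z : ℂ | 0 < z.im}] (1 : ℂ), z ∉ range D.pole := by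
    refine nhdsWithin_le_nhds (hPf.isClosed.isOpen_compl.mem_nhds fun hc => ?_)
    have := hPu _ hc
    simp at this
  have hvals : ∀ z : ℂ, 0 < z.im → z ∉ range D.pole →
      quotFst M J K 0 z + quotSnd M J K 1 z = 2 ∧
      Complex.I * (quotFst M J K 0 z - quotSnd M J K 1 z) = e₂ / (z - 1) + e₂ / (z + 1) ∧
      quotSnd M J K 0 z = 0 ∧ quotFst M J K 1 z = 0 := by
    intro z hz hP
    have a1 := hS z hz hP
    have a2 := hD z hz hP
    have a3 := hO₁ z hz hP
    have a4 := hO₂ z hz hP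
    push_cast at a1 a2 a3 a4
    simp only [zero_div, mul_zero, sub_zero, add_zero, zero_add] at a1 a2 a3 a4
    have a5 := (mul_eq_zero.1 a4).resolve_left Complex.I_ne_zero
    refine ⟨a1, ?_, ?_, ?_⟩
    · rw [a2]; ring
    · linear_combination (a3 + a5) / 2
    · linear_combination (a3 - a5) / 2
  -- The Jost matrix has determinant 1, by the definition of a as a Wronskian.
  have hdet : ∀ z : ℂ, 0 < z.im → z ∉ range D.pole →
      quotFst M J K 0 z * quotSnd M J K 1 z - quotSnd M J K 0 z * quotFst M J K 1 z =
        M z 0 0 * M z 1 1 - M z 0 1 * M z 1 0 := by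
    intro z hz hP
    have hw : wronskian J K z * (wronskian J K z)⁻¹ = 1 :=
      mul_inv_cancel₀ fun h0 => hP ((h.mem_range z).2 ⟨hz, h0⟩)
    simp only [quotFst, quotSnd]
    conv at hw => lhs; lhs; rw [wronskian]
    linear_combination (M z 0 0 * M z 1 1 - M z 0 1 * M z 1 0) * hw
  -- Now E is diagonal with trace 2 and determinant 1 + (e₂/(z - 1) + e₂/(z + 1))²/4. Multiplied by
  -- (z - 1)² this tends to e₂²/4 at z = 1, while the determinant of M has no double pole there.
  have h2 : e₂ = 0 := by
    have l1 := hM.tendsto_det_edge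
    have l2 : Tendsto (fun z : ℂ => (z - 1) ^ 2 + (e₂ + e₂ * (z - 1) / (z + 1)) ^ 2 / 4)
        (𝓝[{z : ℂ | 0 < z.im}] 1) (𝓝 ((1 - 1) ^ 2 + ((e₂ : ℂ) + e₂ * (1 - 1) / (1 + 1)) ^ 2 / 4)) := by
      refine Tendsto.mono_left ?_ nhdsWithin_le_nhds
      have hid : Tendsto (fun z : ℂ => z) (𝓝 1) (𝓝 1) := tendsto_id
      exact ((hid.sub_const 1).pow 2).add ((((((hid.sub_const 1).const_mul (e₂ : ℂ)).div
        (hid.add_const 1) (by norm_num)).const_add (e₂ : ℂ)).pow 2).div_const 4)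
    have l3 : Tendsto (fun z : ℂ => (z - 1) ^ 2 + (e₂ + e₂ * (z - 1) / (z + 1)) ^ 2 / 4)
        (𝓝[{z : ℂ | 0 < z.im}] 1) (𝓝 0) := by
      refine l1.congr' ?_
      filter_upwards [self_mem_nhdsWithin, hfar] with z hz hP
      obtain ⟨v1, v2, v3, v4⟩ := hvals z hz hP
      rw [← hdet z hz hP, v3, zero_mul, sub_zero]
      have hne1 : z - 1 ≠ 0 := sub_ne_zero.2 (ne_of_im_pos hz).2.1
      have v5 : e₂ + e₂ * (z - 1) / (z + 1) =
          (z - 1) * (Complex.I * (quotFst M J K 0 z - quotSnd M J K 1 z)) := by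
        rw [v2, mul_add, mul_div_cancel₀ _ hne1]; ring
      rw [v5, show quotSnd M J K 1 z = 2 - quotFst M J K 0 z by linear_combination v1]
      linear_combination (-(z - 1) ^ 2 * (quotFst M J K 0 z - 1) ^ 2) * Complex.I_mul_I
    have nb : (𝓝[{z : ℂ | 0 < z.im}] (1 : ℂ)).NeBot := by
      have := neBot_nhdsWithin_upper 1
      rwa [Complex.ofReal_one] at this
    have l4 := tendsto_nhds_unique l2 l3
    simp only [sub_self, mul_zero, zero_div, add_zero] at l4
    have l5 : (e₂ : ℂ) = 0 := by
      have : (e₂ : ℂ) ^ 2 = 0 := by linear_combination 4 * l4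
      exact pow_eq_zero_iff two_ne_zero |>.1 this
    exact_mod_cast l5
  subst h2
  obtain ⟨v1, v2, v3, v4⟩ := hvals z hz hP
  simp only [Complex.ofReal_zero, zero_div, add_zero] at v2
  have v5 := (mul_eq_zero.1 v2).resolve_left Complex.I_ne_zero
  exact ⟨by linear_combination (v1 + v5) / 2, by linear_combination (v1 - v5) / 2, v3, v4⟩

/-- Uniqueness: the solution is the matrix of Jost solutions. -/
theorem IsSolution.eq_jost (hM : D.IsSolution y t M) (h : D.IsScattering y t J K b)
    (hJ : IsJostFamily J) (hK : IsJostFamily K) (hI : Complex.I ∉ range D.pole)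
    {z : ℂ} (hz : 0 < z.im) (hP : z ∉ range D.pole) :
    M z = !![(J z).1 * (wronskian J K z)⁻¹, (K z).2; (J z).2 * (wronskian J K z)⁻¹, (K z).1] := by
  obtain ⟨v1, v2, v3, v4⟩ := hM.quot_eq_one h hJ hK hI hz hP
  have hw : wronskian J K z * (wronskian J K z)⁻¹ = 1 :=
    mul_inv_cancel₀ fun h0 => hP ((h.mem_range z).2 ⟨hz, h0⟩)
  conv at hw => lhs; lhs; rw [wronskian]
  simp only [quotFst, quotSnd] at v1 v2 v3 v4
  generalize (wronskian J K z)⁻¹ = w at *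
  rw [Matrix.eta_fin_two (M z)]
  congr 1
  ext i j
  fin_cases i <;> fin_cases j <;> simp
  · linear_combination (J z).1 * w * v1 + (J z).2 * w * v3 - M z 0 0 * hw
  · linear_combination (K z).2 * v1 + (K z).1 * v3 - M z 0 1 * hw
  · linear_combination (J z).1 * w * v4 + (J z).2 * w * v2 - M z 1 0 * hw
  · linear_combination (K z).2 * v4 + (K z).1 * v2 - M z 1 1 * hw

end RHData
end MCH
end

noncomputable section
namespace MCH

/-! ### Time evolution of the Jost solutions -/

/-- The spectral parameter `λ` as a function of the uniformizing parameter `μ`. -/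
def timeCoef (μ : ℂ) : ℂ := -2 * μ / (μ ^ 2 + 1)

/-- The coefficient matrix of the temporal Lax equation. -/
def laxTime (μ : ℂ) (û w : ℝ) : ℂ × ℂ →L[ℂ] ℂ × ℂ :=
  mat2 (2 * timeCoef μ ^ 2 * (-((1 - û) * coefB μ) + û * phaseCoeff μ))
    (2 * timeCoef μ ^ 2 * (1 - û) * coefA μ + timeCoef μ * w)
    (-(2 * timeCoef μ ^ 2 * (1 - û) * coefA μ) + timeCoef μ * w)
    (-(2 * timeCoef μ ^ 2 * (-((1 - û) * coefB μ) + û * phaseCoeff μ)))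

/-- The evolution of the potential in the coordinate `y`; `ε = 1` for the equation itself and
`ε = -1` for the equation reflected in `y`. -/
structure IsEvolution (ε : ℝ) (q û w : ℝ → ℝ → ℝ) : Prop where
  contDiff : ∀ t, 0 ≤ t → ContDiff ℝ 1 (q t)
  bound : ∀ T, 0 < T → ∃ C, ∀ t ∈ Icc 0 T, ∀ y, (1 + |y|) * |q t y| ≤ C * (1 + y ^ 2)⁻¹ ∧
    |û t y - 1| ≤ C * (1 + y ^ 2)⁻¹ ∧ |w t y| ≤ C * (1 + y ^ 2)⁻¹
  hasDerivAt_u : ∀ t, 0 ≤ t → ∀ y, HasDerivAt (û t) ((1 - q t y) * w t y) y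
  hasDerivAt_w : ∀ t, 0 ≤ t → ∀ y, HasDerivAt (w t) ((1 - q t y) * û t y - 1) y
  hasDerivAt_q : ∀ t, 0 < t → ∀ y, HasDerivAt (fun s => q s y) (-2 * ε * w t y) t
  tendsto_q : ∀ y, Tendsto (fun s => q s y) (𝓝[>] 0) (𝓝 (q 0 y))

/-- This identity and the next two are the only facts about the spectral parameter that enter the
zero curvature computation; μ = ±i are excluded as poles of the temporal coefficient. -/
theorem timeCoef_mul_coefA {μ : ℂ} (hμ : μ ∈ spectralDomain) (hi : μ ^ 2 + 1 ≠ 0) :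
    timeCoef μ * coefA μ = -coefB μ := by
  have := sq_sub_one_ne_zero hμ.2.2.1 hμ.2.2.2
  rw [timeCoef, coefA, coefB]
  field_simp

theorem timeCoef_mul_add {μ : ℂ} (hμ : μ ∈ spectralDomain) (hi : μ ^ 2 + 1 ≠ 0) :
    timeCoef μ * (coefB μ + phaseCoeff μ) = -coefA μ := by
  have := sq_sub_one_ne_zero hμ.2.2.1 hμ.2.2.2
  have := hμ.2.1
  rw [timeCoef, coefA, coefB, phaseCoeff]
  field_simp
  ring

theorem phaseCoeff_mul_coefB {μ : ℂ} (hμ : μ ∈ spectralDomain) :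
    phaseCoeff μ * coefB μ = -1 / 4 := by
  have := sq_sub_one_ne_zero hμ.2.2.1 hμ.2.2.2
  have := hμ.2.1
  rw [coefB, phaseCoeff]
  field_simp
  linear_combination Complex.I_mul_I

namespace IsEvolution

variable {ε : ℝ} {q û w : ℝ → ℝ → ℝ}

theorem isPotential (h : IsEvolution ε q û w) {t : ℝ} (ht : 0 ≤ t) : IsPotential (q t) where
  contDiff := h.contDiff t ht
  decay := by
    obtain ⟨C, hC⟩ := h.bound (t + 1) (by linarith)
    exact ⟨C, fun y => (hC t ⟨ht, by linarith⟩ y).1⟩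

/-- The equation reflected in `y`. -/
theorem reflect (h : IsEvolution ε q û w) :
    IsEvolution (-ε) (fun t y => q t (-y)) (fun t y => û t (-y)) (fun t y => -w t (-y)) where
  contDiff t ht := (h.contDiff t ht).comp contDiff_neg
  bound T hT := by
    obtain ⟨C, hC⟩ := h.bound T hT
    refine ⟨C, fun t ht y => ?_⟩
    have := hC t ht (-y)
    rwa [abs_neg y, neg_sq, ← abs_neg (w t (-y))] at this
  hasDerivAt_u t ht y := by
    have := (h.hasDerivAt_u t ht (-y)).scomp y (hasDerivAt_neg y)
    refine this.congr_deriv (by simp)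
  hasDerivAt_w t ht y := by
    have := ((h.hasDerivAt_w t ht (-y)).scomp y (hasDerivAt_neg y)).neg
    refine this.congr_deriv (by simp)
  hasDerivAt_q t ht y := (h.hasDerivAt_q t ht (-y)).congr_deriv (by ring)
  tendsto_q y := h.tendsto_q (-y)

end IsEvolution

/-- The zero curvature equation, for the first component. -/
theorem hasDerivAt_laxTime_fst {μ : ℂ} (hμ : μ ∈ spectralDomain) (hi : μ ^ 2 + 1 ≠ 0) {ε y : ℝ}
    {û w : ℝ → ℝ} {q : ℝ} {f g : ℝ → ℂ} (hu : HasDerivAt û ((1 - q) * w y) y)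
    (hw : HasDerivAt w ((1 - q) * û y - 1) y)
    (hf : HasDerivAt f (q * (coefA μ * g y - coefB μ * f y)) y)
    (hg : HasDerivAt g (2 * phaseCoeff μ * g y + q * (coefB μ * g y - coefA μ * f y)) y) :
    HasDerivAt (fun y => ε * ((laxTime μ (û y) (w y) (f y, g y)).1 -
        2 * timeCoef μ ^ 2 * phaseCoeff μ * f y))
      (q * (coefA μ * (ε * ((laxTime μ (û y) (w y) (f y, g y)).2 -
        2 * timeCoef μ ^ 2 * phaseCoeff μ * g y)) - coefB μ *
        (ε * ((laxTime μ (û y) (w y) (f y, g y)).1 - 2 * timeCoef μ ^ 2 * phaseCoeff μ * f y))) +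
        ((-2 * ε * w y : ℝ) : ℂ) * (coefA μ * g y - coefB μ * f y)) y := by
  have hu' := hu.ofReal_comp
  have hw' := hw.ofReal_comp
  have h1 := hu'.const_sub 1
  have d1 := (((h1.mul_const (coefB μ)).fun_neg.fun_add (hu'.mul_const (phaseCoeff μ))).const_mul
    (2 * timeCoef μ ^ 2)).fun_mul hf
  have d2 := (((h1.const_mul (2 * timeCoef μ ^ 2)).mul_const (coefA μ)).fun_add
    (hw'.const_mul (timeCoef μ))).fun_mul hg
  have d3 := ((d1.fun_add d2).fun_sub (hf.const_mul (2 * timeCoef μ ^ 2 * phaseCoeff μ))).const_mul (ε : ℂ)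
  refine d3.congr_deriv ?_
  have r1 := timeCoef_mul_coefA hμ hi
  have r2 := timeCoef_mul_add hμ hi
  have r3 := phaseCoeff_mul_coefB hμ
  simp only [laxTime, mat2_apply]
  push_cast
  generalize timeCoef μ = l at *
  generalize coefA μ = A at *
  generalize coefB μ = B at *
  generalize phaseCoeff μ = θ at *
  generalize f y = F at *
  generalize g y = G at *
  generalize (û y : ℂ) = U at *
  generalize (w y : ℂ) = W at *
  linear_combination (ε : ℂ) * F * (W * (2 * l * (1 - q) * r2 - 2 * r1)) +
    ε * G * (l * (1 - (1 - q) * U) * (4 * θ * r1 - 4 * r3)) +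
    ε * G * (W * (-2 * l * r1 + 2 * r2 + 2 * q * l * r1))

/-- The zero curvature equation, for the second component. -/
theorem hasDerivAt_laxTime_snd {μ : ℂ} (hμ : μ ∈ spectralDomain) (hi : μ ^ 2 + 1 ≠ 0) {ε y : ℝ}
    {û w : ℝ → ℝ} {q : ℝ} {f g : ℝ → ℂ} (hu : HasDerivAt û ((1 - q) * w y) y)
    (hw : HasDerivAt w ((1 - q) * û y - 1) y)
    (hf : HasDerivAt f (q * (coefA μ * g y - coefB μ * f y)) y)
    (hg : HasDerivAt g (2 * phaseCoeff μ * g y + q * (coefB μ * g y - coefA μ * f y)) y) :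
    HasDerivAt (fun y => ε * ((laxTime μ (û y) (w y) (f y, g y)).2 -
        2 * timeCoef μ ^ 2 * phaseCoeff μ * g y))
      (2 * phaseCoeff μ * (ε * ((laxTime μ (û y) (w y) (f y, g y)).2 -
        2 * timeCoef μ ^ 2 * phaseCoeff μ * g y)) +
      (q * (coefB μ * (ε * ((laxTime μ (û y) (w y) (f y, g y)).2 -
        2 * timeCoef μ ^ 2 * phaseCoeff μ * g y)) - coefA μ *
        (ε * ((laxTime μ (û y) (w y) (f y, g y)).1 - 2 * timeCoef μ ^ 2 * phaseCoeff μ * f y))) +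
        ((-2 * ε * w y : ℝ) : ℂ) * (coefB μ * g y - coefA μ * f y))) y := by
  have hu' := hu.ofReal_comp
  have hw' := hw.ofReal_comp
  have h1 := hu'.const_sub 1
  have d1 := ((h1.const_mul (2 * timeCoef μ ^ 2)).mul_const (coefA μ)).fun_neg.fun_add
    (hw'.const_mul (timeCoef μ)) |>.fun_mul hf
  have d2 := (((h1.mul_const (coefB μ)).fun_neg.fun_add (hu'.mul_const (phaseCoeff μ))).const_mul
    (2 * timeCoef μ ^ 2)).fun_neg.fun_mul hg
  have d3 := ((d1.fun_add d2).fun_sub (hg.const_mul (2 * timeCoef μ ^ 2 * phaseCoeff μ))).const_mul (ε : ℂ)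
  refine d3.congr_deriv ?_
  have r1 := timeCoef_mul_coefA hμ hi
  have r2 := timeCoef_mul_add hμ hi
  have r3 := phaseCoeff_mul_coefB hμ
  simp only [laxTime, mat2_apply]
  push_cast
  generalize timeCoef μ = l at *
  generalize coefA μ = A at *
  generalize coefB μ = B at *
  generalize phaseCoeff μ = θ at *
  generalize f y = F at *
  generalize g y = G at *
  generalize (û y : ℂ) = U at *
  generalize (w y : ℂ) = W at *
  linear_combination (ε : ℂ) * F * (l * (1 - (1 - q) * U) * (4 * θ * r1 - 4 * r3)) -
    ε * F * (W * (-2 * l * r1 + 2 * r2 + 2 * q * l * r1)) -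
    ε * G * (W * (2 * l * (1 - q) * r2 - 2 * r1))

theorem exists_norm_laxTime_le (μ : ℂ) (C : ℝ) : ∃ K, ∀ û w : ℝ, |û - 1| ≤ C → |w| ≤ C →
    ‖laxTime μ û w‖ ≤ K := by
  refine ⟨‖2 * timeCoef μ ^ 2‖ * (C * ‖coefB μ‖ + (C + 1) * ‖phaseCoeff μ‖) +
    (‖2 * timeCoef μ ^ 2‖ * C * ‖coefA μ‖ + ‖timeCoef μ‖ * C), fun û w hu hw => ?_⟩
  have hu1 : ‖(1 - û : ℂ)‖ ≤ C := by
    rw [← Complex.ofReal_one, ← Complex.ofReal_sub, Complex.norm_real, Real.norm_eq_abs, abs_sub_comm]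
    exact hu
  have hu2 : ‖(û : ℂ)‖ ≤ C + 1 := by
    rw [Complex.norm_real, Real.norm_eq_abs]
    have := abs_sub_abs_le_abs_sub û 1
    rw [abs_one] at this
    linarith
  have hw' : ‖(w : ℂ)‖ ≤ C := by rwa [Complex.norm_real, Real.norm_eq_abs]
  have h1 : ‖2 * timeCoef μ ^ 2 * (-((1 - û) * coefB μ) + û * phaseCoeff μ)‖ ≤
      ‖2 * timeCoef μ ^ 2‖ * (C * ‖coefB μ‖ + (C + 1) * ‖phaseCoeff μ‖) := by
    rw [norm_mul]
    refine mul_le_mul_of_nonneg_left ((norm_add_le _ _).trans ?_) (norm_nonneg _)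
    rw [norm_neg, norm_mul, norm_mul]
    gcongr
  have h2 : ‖2 * timeCoef μ ^ 2 * (1 - û) * coefA μ‖ ≤ ‖2 * timeCoef μ ^ 2‖ * C * ‖coefA μ‖ := by
    rw [norm_mul, norm_mul]
    gcongr
  have h3 : ‖timeCoef μ * w‖ ≤ ‖timeCoef μ‖ * C := by
    rw [norm_mul]
    gcongr
  refine (norm_mat2_le _ _ _ _).trans (max_le ?_ ?_)
  · exact add_le_add h1 ((norm_add_le _ _).trans (add_le_add h2 h3))
  · rw [add_comm, norm_neg]
    refine add_le_add h1 ((norm_add_le _ _).trans (add_le_add ?_ h3))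
    rwa [norm_neg]

theorem norm_le_const_mul_weight {E : Type*} [NormedAddCommGroup E] {g : ℝ → ℝ} (hg : IsMajorant g)
    {φ : ℝ → E} {C : ℝ} (hC : ∀ x, ‖φ x‖ ≤ C) (x : ℝ) : ‖φ x‖ ≤ C * weight g x :=
  (hC x).trans (le_mul_of_one_le_right ((norm_nonneg _).trans (hC x)) (hg.one_le_weight x))

theorem jostKernel_sub_smul (q₁ q₂ : ℝ → ℝ) (c : ℝ) (μ : ℂ) (x ξ : ℝ) (e : ℂ × ℂ) :
    jostKernel (fun ξ => c * (q₁ ξ - q₂ ξ)) μ x ξ e =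
      c • (jostKernel q₁ μ x ξ e - jostKernel q₂ μ x ξ e) := by
  refine Prod.ext ?_ ?_ <;> simp [jostKernel] <;> ring

theorem jostKernel_smul_sub (q : ℝ → ℝ) (c : ℝ) (μ : ℂ) (x ξ : ℝ) (e₁ e₂ : ℂ × ℂ) :
    jostKernel q μ x ξ (c • (e₁ - e₂)) = c • (jostKernel q μ x ξ e₁ - jostKernel q μ x ξ e₂) := by
  refine Prod.ext ?_ ?_ <;> simp [jostKernel] <;> ring

namespace IsEvolution

variable {ε : ℝ} {q û w : ℝ → ℝ → ℝ}

theorem exists_bound (h : IsEvolution ε q û w) {T : ℝ} (hT : 0 < T) :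
    ∃ C, 0 ≤ C ∧ ∀ t ∈ Icc 0 T, ∀ y, |q t y| ≤ C * (1 + y ^ 2)⁻¹ ∧
      |û t y - 1| ≤ C * (1 + y ^ 2)⁻¹ ∧ |w t y| ≤ C * (1 + y ^ 2)⁻¹ := by
  obtain ⟨C, hC⟩ := h.bound T hT
  have hC0 : 0 ≤ C := by
    have := (abs_nonneg _).trans (hC 0 ⟨le_rfl, hT.le⟩ 0).2.2
    simpa using this
  refine ⟨C, hC0, fun t ht y => ⟨le_trans ?_ (hC t ht y).1, (hC t ht y).2⟩⟩
  nlinarith [abs_nonneg y, abs_nonneg (q t y), mul_nonneg (abs_nonneg y) (abs_nonneg (q t y))]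

/-- A majorant of the potentials that is uniform on [0, t + 1] lets their pointwise convergence pass
to the Jost solutions. -/
theorem tendsto_jost (h : IsEvolution ε q û w) {μ : ℂ} (hμ : μ ∈ spectralDomain) {t : ℝ} {l : Filter ℝ}
    [l.IsCountablyGenerated] (hl : ∀ᶠ s in l, s ∈ Icc 0 (t + 1)) (ht : 0 ≤ t)
    (hq : ∀ y, Tendsto (fun s => q s y) l (𝓝 (q t y))) (y : ℝ) :
    Tendsto (fun s => jost (q s) μ y) l (𝓝 (jost (q t) μ y)) := by
  obtain ⟨C, hC0, hC⟩ := h.exists_bound (T := t + 1) (by linarith)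
  refine tendsto_volterraSum (x₀ := y) (B := 1)
    (isMajorant_const_mul (C := (‖coefA μ‖ + ‖coefB μ‖) * C) (by positivity)) ?_
    (Eventually.of_forall fun _ => ⟨continuousOn_const, by simp⟩) ?_
    (fun _ _ => tendsto_const_nhds) le_rfl
  · filter_upwards [hl] with s hs
    refine isVolterraKernel_jost (h.isPotential hs.1).continuous hμ.1 hμ.2.1 (fun ξ => ?_) y
    rw [mul_assoc]
    exact mul_le_mul_of_nonneg_left (hC s hs ξ).1 (by positivity)
  · exact fun x _ ξ _ => IsPotential.tendsto_jostKernel hμ tendsto_const_nhds (hq ξ) x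

theorem tendsto_q_of_pos (h : IsEvolution ε q û w) {t : ℝ} (ht : 0 < t) (y : ℝ) :
    Tendsto (fun s => q s y) (𝓝 t) (𝓝 (q t y)) := (h.hasDerivAt_q t ht y).continuousAt

/-- The candidate for the time derivative of the Jost solution solves the linearized Volterra
equation. -/
theorem laxTime_eq_integral (h : IsEvolution ε q û w) {μ : ℂ} (hμ : μ ∈ spectralDomain)
    (hi : μ ^ 2 + 1 ≠ 0) {t : ℝ} (ht : 0 < t) :
    let G : ℝ → ℂ × ℂ := fun y => (ε : ℂ) • (laxTime μ (û t y) (w t y) (jost (q t) μ y) -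
      (2 * timeCoef μ ^ 2 * phaseCoeff μ) • jost (q t) μ y)
    Continuous G ∧ (∃ C, ∀ y, ‖G y‖ ≤ C) ∧ ∀ y, G y =
      (∫ ξ in Iic y, jostKernel (fun ξ => -2 * ε * w t ξ) μ y ξ (jost (q t) μ ξ)) +
        ∫ ξ in Iic y, jostKernel (q t) μ y ξ (G ξ) := by
  intro G
  have hq := h.isPotential ht.le
  obtain ⟨C, hC0, hC⟩ := h.exists_bound ht
  have hC := hC t ⟨ht.le, le_rfl⟩
  have hJ := hq.continuous_jost hμ.1 hμ.2.1
  obtain ⟨CJ, hCJ⟩ := hq.norm_jost_le hμ.1 hμ.2.1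
  have huc : Continuous (û t) := continuous_iff_continuousAt.2 fun y =>
    (h.hasDerivAt_u t ht.le y).continuousAt
  have hwc : Continuous (w t) := continuous_iff_continuousAt.2 fun y =>
    (h.hasDerivAt_w t ht.le y).continuousAt
  have huc' : Continuous fun y => (û t y : ℂ) := Complex.continuous_ofReal.comp huc
  have hwc' : Continuous fun y => (w t y : ℂ) := Complex.continuous_ofReal.comp hwc
  have hlim0 : Tendsto (fun y : ℝ => C * (1 + y ^ 2)⁻¹) atBot (𝓝 0) := by
    have h1 : Tendsto (fun y : ℝ => 1 + y ^ 2) atBot atTop :=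
      tendsto_atTop_add_const_left _ _ (((tendsto_pow_atTop two_ne_zero).comp
        tendsto_abs_atBot_atTop).congr fun y => sq_abs y)
    simpa using h1.inv_tendsto_atTop.const_mul C
  have hu1 : Tendsto (fun y => (û t y : ℂ)) atBot (𝓝 1) := by
    have : Tendsto (û t) atBot (𝓝 1) := by
      rw [tendsto_iff_norm_sub_tendsto_zero]
      exact squeeze_zero (fun _ => norm_nonneg _) (fun y => (hC y).2.1) hlim0
    exact_mod_cast (Complex.continuous_ofReal.tendsto 1).comp this
  have hw1 : Tendsto (fun y => (w t y : ℂ)) atBot (𝓝 0) := by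
    have : Tendsto (w t) atBot (𝓝 0) :=
      squeeze_zero_norm (fun y => (hC y).2.2) hlim0
    exact_mod_cast (Complex.continuous_ofReal.tendsto 0).comp this
  have hC1 : ∀ y : ℝ, C * (1 + y ^ 2)⁻¹ ≤ C := fun y =>
    mul_le_of_le_one_right hC0 (inv_le_one_of_one_le₀ (by nlinarith [sq_nonneg y]))
  have hJl := hq.tendsto_jost_atBot hμ.1 hμ.2.1
  have hGc : Continuous G := by
    simp only [G, laxTime, mat2_apply]
    fun_prop
  -- As y → -∞, û → 1 and w → 0, and the temporal matrix becomes 2λ²θσ₃ with λ = `timeCoef μ`.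
  -- Subtracting 2λ²θ annihilates the limit (1, 0) of the Jost solution, so G has no constant term
  -- in its Volterra equation.
  have hGl : Tendsto G atBot (𝓝 0) := by
    have hL : Tendsto (fun y => laxTime μ (û t y) (w t y)) atBot (𝓝 (laxTime μ 1 0)) := by
      have a1 := ((((hu1.const_sub 1).mul_const (coefB μ)).neg.add
        (hu1.mul_const (phaseCoeff μ))).const_mul (2 * timeCoef μ ^ 2))
      have a2 := ((hu1.const_sub 1).const_mul (2 * timeCoef μ ^ 2)).mul_const (coefA μ)
      have a3 := hw1.const_mul (timeCoef μ)
      have := tendsto_mat2 a1 (a2.add a3) (a2.neg.add a3) a1.neg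
      simpa [laxTime] using this
    have hLJ : Tendsto (fun y => laxTime μ (û t y) (w t y) (jost (q t) μ y)) atBot
        (𝓝 (laxTime μ 1 0 (1, 0))) :=
      ((isBoundedBilinearMap_apply (𝕜 := ℂ) (E := ℂ × ℂ) (F := ℂ × ℂ)).continuous.tendsto
        (laxTime μ 1 0, (1, 0))).comp (hL.prodMk_nhds hJl)
    have := ((hLJ.sub (hJl.const_smul (2 * timeCoef μ ^ 2 * phaseCoeff μ))).const_smul
      (ε : ℂ))
    have h0 : (ε : ℂ) • (laxTime μ 1 0 (1, 0) - (2 * timeCoef μ ^ 2 * phaseCoeff μ) • ((1, 0) : ℂ × ℂ)) = 0 := by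
      simp [laxTime]
    rw [h0] at this
    exact this
  have hGb : ∃ C, ∀ y, ‖G y‖ ≤ C := by
    obtain ⟨K, hK⟩ := exists_norm_laxTime_le μ C
    refine ⟨‖(ε : ℂ)‖ * (K * CJ + ‖2 * timeCoef μ ^ 2 * phaseCoeff μ‖ * CJ), fun y => ?_⟩
    rw [norm_smul]
    refine mul_le_mul_of_nonneg_left ((norm_sub_le _ _).trans (add_le_add ?_ ?_)) (norm_nonneg _)
    · have hK' := hK _ _ ((hC y).2.1.trans (hC1 y)) ((hC y).2.2.trans (hC1 y))
      exact ((laxTime μ (û t y) (w t y)).le_opNorm _).trans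
        (mul_le_mul hK' (hCJ y) (norm_nonneg _) ((norm_nonneg _).trans hK'))
    · rw [norm_smul]
      exact mul_le_mul_of_nonneg_left (hCJ y) (norm_nonneg _)
  refine ⟨hGc, hGb, fun y => ?_⟩
  have hJ1 := hJ.fst
  have hJ2 := hJ.snd
  have hInt : ∀ a b : ℂ, Integrable fun ξ => ((-2 * ε * w t ξ : ℝ) : ℂ) *
      (a * (jost (q t) μ ξ).2 - b * (jost (q t) μ ξ).1) := by
    intro a b
    obtain ⟨B, hB⟩ := (hq.jost_bounds hμ.1 hμ.2.1 a b).2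
    refine (((isMajorant_const_mul hC0).int.const_mul (2 * |ε|)).mul_const B).mono'
      (Continuous.aestronglyMeasurable (by fun_prop)) (Eventually.of_forall fun ξ => ?_)
    rw [norm_mul, Complex.norm_real, Real.norm_eq_abs, abs_mul, abs_mul, abs_neg, abs_two]
    exact mul_le_mul (mul_le_mul_of_nonneg_left (hC ξ).2.2 (by positivity)) (hB ξ) (norm_nonneg _)
      (by positivity)
  have key := hq.eq_integral_of_ode hμ.1 hμ.2.1 (f := fun y => (G y).1) (g := fun y => (G y).2)
    (f₀ := 0) (hInt (coefA μ) (coefB μ)) (by fun_prop) (hInt (coefB μ) (coefA μ))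
    (fun y => hasDerivAt_laxTime_fst hμ hi (h.hasDerivAt_u t ht.le y) (h.hasDerivAt_w t ht.le y)
      (hq.hasDerivAt_jost_fst hμ.1 hμ.2.1 y) (hq.hasDerivAt_jost_snd hμ.1 hμ.2.1 y))
    (fun y => hasDerivAt_laxTime_snd hμ hi (h.hasDerivAt_u t ht.le y) (h.hasDerivAt_w t ht.le y)
      (hq.hasDerivAt_jost_fst hμ.1 hμ.2.1 y) (hq.hasDerivAt_jost_snd hμ.1 hμ.2.1 y))
    hGb hGl.fst_nhds hGl.snd_nhds y
  have hk : IntegrableOn (fun ξ => jostKernel (fun ξ => -2 * ε * w t ξ) μ y ξ (jost (q t) μ ξ))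
      (Iic y) := by
    have hM := isMajorant_const_mul (C := (‖coefA μ‖ + ‖coefB μ‖) * (2 * |ε| * C)) (by positivity)
    refine (isVolterraKernel_jost (q := fun ξ => -2 * ε * w t ξ) (by fun_prop) hμ.1 hμ.2.1
      (fun ξ => ?_) y).integrableOn hM hJ.continuousOn
      (fun ξ _ => norm_le_const_mul_weight hM hCJ ξ) le_rfl
    rw [abs_mul, abs_mul, abs_neg, abs_two, mul_assoc (‖coefA μ‖ + ‖coefB μ‖), mul_assoc (2 * |ε|)]
    exact mul_le_mul_of_nonneg_left (mul_le_mul_of_nonneg_left (hC ξ).2.2 (by positivity))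
      (by positivity)
  have hpair : (∫ ξ in Iic y, jostKernel (fun ξ => -2 * ε * w t ξ) μ y ξ (jost (q t) μ ξ)) =
      (∫ ξ in Iic y, ((-2 * ε * w t ξ : ℝ) : ℂ) *
        (coefA μ * (jost (q t) μ ξ).2 - coefB μ * (jost (q t) μ ξ).1),
       ∫ ξ in Iic y, Complex.exp (2 * phaseCoeff μ * (y - ξ)) * (((-2 * ε * w t ξ : ℝ) : ℂ) *
        (coefB μ * (jost (q t) μ ξ).2 - coefA μ * (jost (q t) μ ξ).1))) := by
    refine Prod.ext ?_ ?_
    · rw [fst_integral hk]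
      refine integral_congr_ae (Eventually.of_forall fun ξ => ?_)
      simp only [jostKernel, mat2_apply]
      ring
    · rw [snd_integral hk]
      refine integral_congr_ae (Eventually.of_forall fun ξ => ?_)
      simp only [jostKernel, mat2_apply]
      ring
  rw [hpair]
  have hz : ((0, 0) : ℂ × ℂ) = 0 := rfl
  rw [hz, zero_add] at key
  exact key

/-- The time derivative of the Jost solution. -/
theorem hasDerivAt_jost (h : IsEvolution ε q û w) {μ : ℂ} (hμ : μ ∈ spectralDomain)
    (hi : μ ^ 2 + 1 ≠ 0) {t : ℝ} (ht : 0 < t) (y : ℝ) :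
    HasDerivAt (fun s => jost (q s) μ y) ((ε : ℂ) • (laxTime μ (û t y) (w t y) (jost (q t) μ y) -
      (2 * timeCoef μ ^ 2 * phaseCoeff μ) • jost (q t) μ y)) t := by
  obtain ⟨hGc, hGb, hGeq⟩ := h.laxTime_eq_integral hμ hi ht
  set G : ℝ → ℂ × ℂ := fun y => (ε : ℂ) • (laxTime μ (û t y) (w t y) (jost (q t) μ y) -
    (2 * timeCoef μ ^ 2 * phaseCoeff μ) • jost (q t) μ y) with hG
  have hq := h.isPotential ht.le
  have hJ := hq.continuous_jost hμ.1 hμ.2.1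
  obtain ⟨CJ, hCJ⟩ := hq.norm_jost_le hμ.1 hμ.2.1
  have hCJ0 : 0 ≤ CJ := (norm_nonneg _).trans (hCJ 0)
  obtain ⟨C, hC0, hC⟩ := h.exists_bound (T := t + 1) (by linarith)
  have hwc : Continuous (w t) := continuous_iff_continuousAt.2 fun y =>
    (h.hasDerivAt_w t ht.le y).continuousAt
  -- The factor 2|ε| + 1 lets one majorant serve the potentials, their time derivative -2εw and the
  -- difference quotients in time.
  have hM := isMajorant_const_mul (C := (‖coefA μ‖ + ‖coefB μ‖) * ((2 * |ε| + 1) * C)) (by positivity)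
  have hMle : ∀ {a : ℝ} (ξ : ℝ), |a| ≤ (2 * |ε| + 1) * (C * (1 + ξ ^ 2)⁻¹) →
      (‖coefA μ‖ + ‖coefB μ‖) * |a| ≤
        (‖coefA μ‖ + ‖coefB μ‖) * ((2 * |ε| + 1) * C) * (1 + ξ ^ 2)⁻¹ := fun ξ ha => by
    rw [mul_assoc, mul_assoc (2 * |ε| + 1)]
    exact mul_le_mul_of_nonneg_left ha (by positivity)
  have hnear : ∀ᶠ s in 𝓝[≠] t, s ∈ Ioo 0 (t + 1) ∧ s ≠ t := by
    filter_upwards [nhdsWithin_le_nhds (Ioo_mem_nhds ht (lt_add_one t)), self_mem_nhdsWithin]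
      with s hs hs' using ⟨hs, hs'⟩
  have hquot : ∀ s ∈ Ioo 0 (t + 1), ∀ ξ, |(s - t)⁻¹ * (q s ξ - q t ξ)| ≤
      (2 * |ε| + 1) * (C * (1 + ξ ^ 2)⁻¹) := by
    intro s hs ξ
    have hpos : 0 ≤ C * (1 + ξ ^ 2)⁻¹ := by positivity
    have hmv := (convex_Ioo (0 : ℝ) (t + 1)).norm_image_sub_le_of_norm_hasDerivWithin_le
      (f := fun s => q s ξ) (C := 2 * |ε| * (C * (1 + ξ ^ 2)⁻¹))
      (fun r hr => (h.hasDerivAt_q r hr.1 ξ).hasDerivWithinAt) (fun r hr => by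
        rw [Real.norm_eq_abs, abs_mul, abs_mul, abs_neg, abs_two]
        exact mul_le_mul_of_nonneg_left (hC r ⟨hr.1.le, hr.2.le⟩ ξ).2.2 (by positivity))
      ⟨ht, lt_add_one t⟩ hs
    rw [Real.norm_eq_abs, Real.norm_eq_abs] at hmv
    rw [abs_mul, abs_inv]
    rcases eq_or_ne s t with rfl | hst
    · simp; positivity
    · have : 0 < |s - t| := abs_pos.2 (sub_ne_zero.2 hst)
      rw [inv_mul_le_iff₀ this]
      nlinarith
  have hqc : ∀ s ∈ Ioo 0 (t + 1), Continuous (q s) := fun s hs => (h.isPotential hs.1.le).continuous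
  have hkq : ∀ s ∈ Ioo 0 (t + 1), IsVolterraKernel y
      (fun ξ => (‖coefA μ‖ + ‖coefB μ‖) * ((2 * |ε| + 1) * C) * (1 + ξ ^ 2)⁻¹)
      (jostKernel (q s) μ) := fun s hs =>
    isVolterraKernel_jost (hqc s hs) hμ.1 hμ.2.1 (fun ξ => hMle ξ (by
      have h1 := (hC s ⟨hs.1.le, hs.2.le⟩ ξ).1
      have hpos : 0 ≤ C * (1 + ξ ^ 2)⁻¹ := by positivity
      nlinarith [abs_nonneg ε, mul_nonneg (abs_nonneg ε) hpos])) y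
  have hkd : ∀ s ∈ Ioo 0 (t + 1), IsVolterraKernel y
      (fun ξ => (‖coefA μ‖ + ‖coefB μ‖) * ((2 * |ε| + 1) * C) * (1 + ξ ^ 2)⁻¹)
      (jostKernel (fun ξ => (s - t)⁻¹ * (q s ξ - q t ξ)) μ) := fun s hs =>
    isVolterraKernel_jost (continuous_const.mul ((hqc s hs).sub hq.continuous)) hμ.1 hμ.2.1
      (fun ξ => hMle ξ (hquot s hs ξ)) y
  have hkt : IsVolterraKernel y
      (fun ξ => (‖coefA μ‖ + ‖coefB μ‖) * ((2 * |ε| + 1) * C) * (1 + ξ ^ 2)⁻¹)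
      (jostKernel (fun ξ => -2 * ε * w t ξ) μ) :=
    isVolterraKernel_jost (q := fun ξ => -2 * ε * w t ξ) (by fun_prop) hμ.1 hμ.2.1
      (fun ξ => hMle ξ (by
      have h1 := (hC t ⟨ht.le, by linarith⟩ ξ).2.2
      have hpos : 0 ≤ C * (1 + ξ ^ 2)⁻¹ := by positivity
      rw [abs_mul, abs_mul, abs_neg, abs_two]
      nlinarith [abs_nonneg ε, mul_le_mul_of_nonneg_left h1 (abs_nonneg ε)])) y
  have hforce : ∀ {k : ℝ → ℝ → ℂ × ℂ →L[ℂ] ℂ × ℂ}, IsVolterraKernel y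
      (fun ξ => (‖coefA μ‖ + ‖coefB μ‖) * ((2 * |ε| + 1) * C) * (1 + ξ ^ 2)⁻¹) k →
      ContinuousOn (fun x => ∫ ξ in Iic x, k x ξ (jost (q t) μ ξ)) (Iic y) ∧
      ∀ x ≤ y, ‖∫ ξ in Iic x, k x ξ (jost (q t) μ ξ)‖ ≤ CJ / 2 * Real.exp (2 * ∫ ξ,
        (‖coefA μ‖ + ‖coefB μ‖) * ((2 * |ε| + 1) * C) * (1 + ξ ^ 2)⁻¹) := fun hk =>
    ⟨hk.continuousOn_integral hM hJ.continuousOn fun ξ _ => norm_le_const_mul_weight hM hCJ ξ,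
      fun x hx => (hk.norm_integral_le hM hCJ0 (fun ξ _ => norm_le_const_mul_weight hM hCJ ξ) hx).trans
        (mul_le_mul_of_nonneg_left (hM.weight_le x) (by positivity))⟩
  -- By uniqueness, G is the solution of the linearized equation, to which the difference quotients
  -- will be shown to converge.
  have hGsum : G y = volterraSum (jostKernel (q t) μ)
      (fun x => ∫ ξ in Iic x, jostKernel (fun ξ => -2 * ε * w t ξ) μ x ξ (jost (q t) μ ξ)) y :=
    (hkq t ⟨ht, lt_add_one t⟩).eq_volterraSum hM (hforce hkt).1 ⟨_, (hforce hkt).2⟩ hGc.continuousOn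
      (hGb.imp fun _ hc ξ _ => hc ξ) (fun x _ => hGeq x) le_rfl
  -- Subtracting the Volterra equations at times s and t and dividing by s - t gives an exact
  -- equation for the quotient: the kernel is that of q_s, and the forcing is the kernel of (q_s -
  -- q_t)/(s - t) applied to the Jost solution at time t.
  have hsum : ∀ s, s ∈ Ioo 0 (t + 1) ∧ s ≠ t →
      volterraSum (jostKernel (q s) μ) (fun x => ∫ ξ in Iic x,
        jostKernel (fun ξ => (s - t)⁻¹ * (q s ξ - q t ξ)) μ x ξ (jost (q t) μ ξ)) y =
      (s - t)⁻¹ • (jost (q s) μ y - jost (q t) μ y) := by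
    rintro s ⟨hs, hst⟩
    have hqs := h.isPotential hs.1.le
    have hJs := hqs.continuous_jost hμ.1 hμ.2.1
    obtain ⟨CJ', hCJ'⟩ := hqs.norm_jost_le hμ.1 hμ.2.1
    symm
    refine (hkq s hs).eq_volterraSum hM (hforce (hkd s hs)).1 ⟨_, (hforce (hkd s hs)).2⟩
      (φ := fun x => (s - t)⁻¹ • (jost (q s) μ x - jost (q t) μ x)) (by fun_prop)
      ⟨|(s - t)⁻¹| * (CJ' + CJ), fun ξ _ => ?_⟩ (fun x hx => ?_) le_rfl
    · rw [norm_smul, Real.norm_eq_abs]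
      exact mul_le_mul_of_nonneg_left ((norm_sub_le _ _).trans (add_le_add (hCJ' ξ) (hCJ ξ)))
        (abs_nonneg _)
    · have i1 := hqs.integrableOn_kernel hμ.1 hμ.2.1 hJs ⟨CJ', hCJ'⟩ x
      have i2 := hq.integrableOn_kernel hμ.1 hμ.2.1 hJ ⟨CJ, hCJ⟩ x
      have i3 := hqs.integrableOn_kernel hμ.1 hμ.2.1 hJ ⟨CJ, hCJ⟩ x
      conv_lhs => rw [hqs.jost_eq hμ.1 hμ.2.1 x, hq.jost_eq hμ.1 hμ.2.1 x]
      rw [add_sub_add_left_eq_sub]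
      simp only [jostKernel_sub_smul, jostKernel_smul_sub]
      rw [integral_smul, integral_smul, integral_sub i3 i2, integral_sub i1 i3, ← smul_add]
      congr 1
      abel
  rw [hasDerivAt_iff_tendsto_slope]
  rw [show ((ε : ℂ) • (laxTime μ (û t y) (w t y) (jost (q t) μ y) -
      (2 * timeCoef μ ^ 2 * phaseCoeff μ) • jost (q t) μ y)) = G y from rfl, hGsum]
  have hlim := tendsto_volterraSum (l := 𝓝[≠] t) (x₀ := y) hM
    (k := fun s => jostKernel (q s) μ)
    (h := fun s x => ∫ ξ in Iic x,
        jostKernel (fun ξ => (s - t)⁻¹ * (q s ξ - q t ξ)) μ x ξ (jost (q t) μ ξ))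
    (k' := jostKernel (q t) μ) (h' := fun x => ∫ ξ in Iic x,
      jostKernel (fun ξ => -2 * ε * w t ξ) μ x ξ (jost (q t) μ ξ))
    (hnear.mono fun s hs => hkq s hs.1) (hnear.mono fun s hs => hforce (hkd s hs.1))
    (fun x _ ξ _ => IsPotential.tendsto_jostKernel hμ tendsto_const_nhds
      ((h.tendsto_q_of_pos ht ξ).mono_left nhdsWithin_le_nhds) x)
    (fun x hx => tendsto_integral_kernel hM (k := fun s => jostKernel (fun ξ =>
        (s - t)⁻¹ * (q s ξ - q t ξ)) μ) (φ := fun _ => jost (q t) μ)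
      (hnear.mono fun s hs => hkd s hs.1)
      (Eventually.of_forall fun _ => ⟨hJ.continuousOn, fun ξ _ => norm_le_const_mul_weight hM hCJ ξ⟩)
      hx fun ξ _ => by
        have hq' : Tendsto (fun s => (s - t)⁻¹ * (q s ξ - q t ξ)) (𝓝[≠] t)
            (𝓝 (-2 * ε * w t ξ)) := by
          refine (hasDerivAt_iff_tendsto_slope.1 (h.hasDerivAt_q t ht ξ)).congr fun s => ?_
          rw [slope_def_field, div_eq_inv_mul]
        exact ((ContinuousLinearMap.apply ℂ (ℂ × ℂ) (jost (q t) μ ξ)).continuous.tendsto _).comp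
          (IsPotential.tendsto_jostKernel (Q := fun s ξ => (s - t)⁻¹ * (q s ξ - q t ξ))
            (q := fun ξ => -2 * ε * w t ξ) hμ tendsto_const_nhds hq' x))
    le_rfl
  refine hlim.congr' ?_
  filter_upwards [hnear] with s hs
  rw [hsum s hs, slope_def_module]

end IsEvolution

end MCH
end

noncomputable section
namespace MCH

/-! ### Time evolution of the scattering data -/

/-- A solution of a linear differential equation with zero initial value vanishes. -/
theorem eq_zero_of_linear_ode {E : Type*} [NormedAddCommGroup E] [NormedSpace ℂ E] {Z : ℝ → E}
    {L : ℝ → E →L[ℂ] E} (hZ : ∀ t, 0 < t → HasDerivAt Z (L t (Z t)) t)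
    (h0 : Tendsto Z (𝓝[>] 0) (𝓝 0)) (hL : ∀ T, 0 < T → ∃ K, ∀ t ∈ Ioc 0 T, ‖L t‖ ≤ K) {t : ℝ}
    (ht : 0 < t) : Z t = 0 := by
  obtain ⟨K, hK⟩ := hL t ht
  -- Gronwall's inequality on [s, t]. The equation is available for positive times only, so the
  -- initial value enters through the limit s ↓ 0.
  have hb : ∀ᶠ s in 𝓝[>] (0 : ℝ), ‖Z t‖ ≤ ‖Z s‖ * Real.exp (K * (t - s)) := by
    filter_upwards [Ioo_mem_nhdsGT ht] with s hs
    have := norm_le_gronwallBound_of_norm_deriv_right_le (f := Z) (f' := fun r => L r (Z r))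
      (δ := ‖Z s‖) (K := K) (ε := 0) (a := s) (b := t)
      (fun r hr => (hZ r (hs.1.trans_le hr.1)).continuousAt.continuousWithinAt)
      (fun r hr => (hZ r (hs.1.trans_le hr.1)).hasDerivWithinAt) le_rfl
      (fun r hr => by
        rw [add_zero]
        exact ((L r).le_opNorm _).trans (mul_le_mul_of_nonneg_right
          (hK r ⟨hs.1.trans_le hr.1, hr.2.le⟩) (norm_nonneg _))) t ⟨hs.2.le, le_rfl⟩
    rwa [gronwallBound_ε0] at this
  have hlim : Tendsto (fun s => ‖Z s‖ * Real.exp (K * (t - s))) (𝓝[>] 0) (𝓝 0) := by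
    have h2 : Tendsto (fun s : ℝ => Real.exp (K * (t - s))) (𝓝[>] 0) (𝓝 (Real.exp (K * (t - 0)))) :=
      (Continuous.tendsto (by fun_prop) 0).mono_left nhdsWithin_le_nhds
    simpa using h0.norm.mul h2
  exact norm_le_zero_iff.1 (ge_of_tendsto hlim hb)

/-- The time derivative of p̂ is -2λ²θ. A factor e^{∓p̂} therefore absorbs the scalar correction in
the evolution of the Jost solutions, and the rescaled solutions obey the temporal Lax equation
itself. -/
theorem hasDerivAt_exp_phaseHat {μ : ℂ} (y t : ℝ) (c : ℂ) :
    HasDerivAt (fun t : ℝ => Complex.exp (c * phaseHat y t μ))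
      (-(c * (2 * timeCoef μ ^ 2 * phaseCoeff μ)) * Complex.exp (c * phaseHat y t μ)) t := by
  have h1 : HasDerivAt (fun t : ℝ => c * phaseHat y t μ)
      (c * (-(phaseCoeff μ) * (8 * μ ^ 2 / (μ ^ 2 + 1) ^ 2 * 1))) t :=
    (((((hasDerivAt_id t).ofReal_comp).const_mul (8 * μ ^ 2 / (μ ^ 2 + 1) ^ 2)).const_add
      (-(y : ℂ))).const_mul (-(phaseCoeff μ))).const_mul c
  refine h1.cexp.congr_deriv ?_
  rw [timeCoef, div_pow]
  ring

/-- Reflection in y reverses the signs of w and of the evolution. Exchanging the components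
compensates for both, so the solution normalized at +∞ obeys the same temporal equation as the one
normalized at -∞. -/
theorem laxTime_swap (μ : ℂ) (û w : ℝ) (e : ℂ × ℂ) :
    laxTime μ û w e.swap = -(laxTime μ û (-w) e).swap := by
  refine Prod.ext ?_ ?_ <;> simp [laxTime] <;> ring

/-- Complex conjugation and exchange of the components. -/
def conjSwap (e : ℂ × ℂ) : ℂ × ℂ := (starRingEnd ℂ e.2, starRingEnd ℂ e.1)

/-- For real μ this produces a second solution of the temporal equation from each solution, as
needed for the relation defining a and b. -/
theorem laxTime_conjSwap (μ û w : ℝ) (e : ℂ × ℂ) :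
    laxTime μ û w (conjSwap e) = conjSwap (laxTime μ û w e) := by
  have hA : starRingEnd ℂ (coefA μ) = -coefA μ := by simp [coefA, div_eq_mul_inv, map_ofNat]
  have hB : starRingEnd ℂ (coefB μ) = -coefB μ := by simp [coefB, div_eq_mul_inv]
  have hθ : starRingEnd ℂ (phaseCoeff μ) = -phaseCoeff μ := by
    simp [phaseCoeff, div_eq_mul_inv, map_ofNat]
  have hl : starRingEnd ℂ (timeCoef μ) = timeCoef μ := by
    simp [timeCoef, div_eq_mul_inv, map_ofNat]
  refine Prod.ext ?_ ?_ <;> simp [laxTime, conjSwap, hA, hB, hθ, hl, map_ofNat] <;> ring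

theorem hasDerivAt_swap {f : ℝ → ℂ × ℂ} {f' : ℂ × ℂ} {t : ℝ} (h : HasDerivAt f f' t) :
    HasDerivAt (fun t => (f t).swap) f'.swap t :=
  (ContinuousLinearEquiv.prodComm ℝ ℂ ℂ : ℂ × ℂ →L[ℝ] ℂ × ℂ).hasFDerivAt.comp_hasDerivAt t h

theorem hasDerivAt_conjSwap {f : ℝ → ℂ × ℂ} {f' : ℂ × ℂ} {t : ℝ} (h : HasDerivAt f f' t) :
    HasDerivAt (fun t => conjSwap (f t)) (conjSwap f') t :=
  ((((Complex.conjCLE : ℂ →L[ℝ] ℂ).comp (ContinuousLinearMap.snd ℝ ℂ ℂ)).prod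
    ((Complex.conjCLE : ℂ →L[ℝ] ℂ).comp (ContinuousLinearMap.fst ℝ ℂ ℂ))).hasFDerivAt
    ).comp_hasDerivAt t h

theorem continuous_conjSwap : Continuous conjSwap :=
  (Complex.continuous_conj.comp continuous_snd).prodMk (Complex.continuous_conj.comp continuous_fst)

/-- The Jost solution normalized at `+∞`, with exchanged components. -/
def jostRight (q : ℝ → ℝ) (μ : ℂ) (y : ℝ) : ℂ × ℂ := jost (fun y => q (-y)) μ (-y)

namespace IsEvolution

variable {q û w : ℝ → ℝ → ℝ}

theorem hasDerivAt_exp_smul_jost (h : IsEvolution 1 q û w) {μ : ℂ} (hμ : μ ∈ spectralDomain)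
    (hi : μ ^ 2 + 1 ≠ 0) (y : ℝ) {t : ℝ} (ht : 0 < t) :
    HasDerivAt (fun t => Complex.exp (-1 * phaseHat y t μ) • jost (q t) μ y)
      (laxTime μ (û t y) (w t y) (Complex.exp (-1 * phaseHat y t μ) • jost (q t) μ y)) t := by
  refine ((hasDerivAt_exp_phaseHat y t (-1)).smul (h.hasDerivAt_jost hμ hi ht y)).congr_deriv ?_
  rw [map_smul, Complex.ofReal_one, one_smul]
  module

theorem hasDerivAt_exp_smul_jostRight (h : IsEvolution 1 q û w) {μ : ℂ} (hμ : μ ∈ spectralDomain)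
    (hi : μ ^ 2 + 1 ≠ 0) (y : ℝ) {t : ℝ} (ht : 0 < t) :
    HasDerivAt (fun t => Complex.exp (1 * phaseHat y t μ) • (jostRight (q t) μ y).swap)
      (laxTime μ (û t y) (w t y) (Complex.exp (1 * phaseHat y t μ) • (jostRight (q t) μ y).swap))
      t := by
  have h1 := hasDerivAt_swap (h.reflect.hasDerivAt_jost hμ hi ht (-y))
  refine ((hasDerivAt_exp_phaseHat y t 1).smul h1).congr_deriv ?_
  rw [map_smul, laxTime_swap]
  simp only [neg_neg, jostRight, Complex.ofReal_neg, Complex.ofReal_one]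
  refine Prod.ext ?_ ?_ <;> simp <;> ring

theorem hasDerivAt_exp_smul_conjSwap (h : IsEvolution 1 q û w) {μ : ℝ} (h0 : μ ≠ 0) (h1 : μ ≠ 1)
    (h2 : μ ≠ -1) (y : ℝ) {t : ℝ} (ht : 0 < t) :
    HasDerivAt (fun t => Complex.exp (1 * phaseHat y t μ) • conjSwap (jost (q t) μ y))
      (laxTime μ (û t y) (w t y) (Complex.exp (1 * phaseHat y t μ) • conjSwap (jost (q t) μ y)))
      t := by
  have hi : (μ : ℂ) ^ 2 + 1 ≠ 0 := by
    have : μ ^ 2 + 1 ≠ 0 := by positivity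
    exact_mod_cast this
  have h3 := hasDerivAt_conjSwap
    (h.hasDerivAt_exp_smul_jost (mem_spectralDomain_ofReal h0 h1 h2) hi y ht)
  have hc : ∀ t : ℝ, ∀ e : ℂ × ℂ, conjSwap (Complex.exp (-1 * phaseHat y t μ) • e) =
      Complex.exp (1 * phaseHat y t μ) • conjSwap e := by
    intro t e
    have : starRingEnd ℂ (Complex.exp (-1 * phaseHat y t μ)) = Complex.exp (1 * phaseHat y t μ) := by
      rw [← Complex.exp_conj]
      congr 1
      simp only [phaseHat, phaseCoeff, map_mul, map_neg, map_add, map_div₀, map_sub, map_pow,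
        map_one, map_ofNat, Complex.conj_ofReal, Complex.conj_I]
      ring
    rw [← this]
    refine Prod.ext ?_ ?_ <;> simp [conjSwap]
  rw [← laxTime_conjSwap, hc] at h3
  simpa only [hc] using h3

theorem tendsto_jost_zero (h : IsEvolution 1 q û w) {μ : ℂ} (hμ : μ ∈ spectralDomain) (y : ℝ) :
    Tendsto (fun t => jost (q t) μ y) (𝓝[>] 0) (𝓝 (jost (q 0) μ y)) := by
  refine h.tendsto_jost hμ (t := 0) ?_ le_rfl h.tendsto_q y
  filter_upwards [Ioo_mem_nhdsGT (zero_lt_one' ℝ)] with s hs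
  exact ⟨hs.1.le, by linarith [hs.2]⟩

theorem tendsto_jostRight_zero (h : IsEvolution 1 q û w) {μ : ℂ} (hμ : μ ∈ spectralDomain) (y : ℝ) :
    Tendsto (fun t => jostRight (q t) μ y) (𝓝[>] 0) (𝓝 (jostRight (q 0) μ y)) := by
  refine h.reflect.tendsto_jost hμ (t := 0) ?_ le_rfl h.reflect.tendsto_q (-y)
  filter_upwards [Ioo_mem_nhdsGT (zero_lt_one' ℝ)] with s hs
  exact ⟨hs.1.le, by linarith [hs.2]⟩

theorem tendsto_exp_phaseHat_zero (μ : ℂ) (y : ℝ) (c : ℂ) :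
    Tendsto (fun t : ℝ => Complex.exp (c * phaseHat y t μ)) (𝓝[>] 0)
      (𝓝 (Complex.exp (c * phaseHat y 0 μ))) :=
  (hasDerivAt_exp_phaseHat y 0 c).continuousAt.tendsto.mono_left nhdsWithin_le_nhds

theorem exists_laxTime_le (h : IsEvolution 1 q û w) (μ : ℂ) (y T : ℝ) (hT : 0 < T) :
    ∃ K, ∀ t ∈ Ioc 0 T, ‖laxTime μ (û t y) (w t y)‖ ≤ K := by
  obtain ⟨C, hC0, hC⟩ := h.exists_bound hT
  obtain ⟨K, hK⟩ := exists_norm_laxTime_le μ C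
  have hC1 : C * (1 + y ^ 2)⁻¹ ≤ C :=
    mul_le_of_le_one_right hC0 (inv_le_one_of_one_le₀ (by nlinarith [sq_nonneg y]))
  exact ⟨K, fun t ht => hK _ _ ((hC t ⟨ht.1.le, ht.2⟩ y).2.1.trans hC1)
    ((hC t ⟨ht.1.le, ht.2⟩ y).2.2.trans hC1)⟩

/-- Linear relations between the Jost solutions on the real line are preserved. -/
theorem scattering_real (h : IsEvolution 1 q û w) {μ : ℝ} (h0 : μ ≠ 0) (h1 : μ ≠ 1) (h2 : μ ≠ -1)
    (y : ℝ) {a b : ℂ} (hrel : (jostRight (q 0) μ y).swap =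
      (b * Complex.exp (-2 * phaseHat y 0 μ)) • jost (q 0) μ y + a • conjSwap (jost (q 0) μ y))
    {t : ℝ} (ht : 0 < t) : (jostRight (q t) μ y).swap =
      (b * Complex.exp (-2 * phaseHat y t μ)) • jost (q t) μ y + a • conjSwap (jost (q t) μ y) := by
  have hμ := mem_spectralDomain_ofReal h0 h1 h2
  have hi : (μ : ℂ) ^ 2 + 1 ≠ 0 := by
    have : μ ^ 2 + 1 ≠ 0 := by positivity
    exact_mod_cast this
  have he : ∀ t : ℝ, Complex.exp (1 * phaseHat y t μ) * Complex.exp (-2 * phaseHat y t μ) =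
      Complex.exp (-1 * phaseHat y t μ) := fun t => by
    rw [← Complex.exp_add]; congr 1; ring
  have hform : ∀ t : ℝ, Complex.exp (1 * phaseHat y t μ) • (jostRight (q t) μ y).swap -
      (b • Complex.exp (-1 * phaseHat y t μ) • jost (q t) μ y +
        a • Complex.exp (1 * phaseHat y t μ) • conjSwap (jost (q t) μ y)) =
      Complex.exp (1 * phaseHat y t μ) • ((jostRight (q t) μ y).swap -
        ((b * Complex.exp (-2 * phaseHat y t μ)) • jost (q t) μ y +
          a • conjSwap (jost (q t) μ y))) := fun t => by
    rw [← he t]; module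
  -- All three rescaled terms solve the same linear equation, and the coefficients a and b do not
  -- depend on t. Their combination tends to zero as t ↓ 0, so it is zero for every t > 0.
  have key := eq_zero_of_linear_ode (L := fun t => laxTime μ (û t y) (w t y))
    (Z := fun t => Complex.exp (1 * phaseHat y t μ) • (jostRight (q t) μ y).swap -
      (b • Complex.exp (-1 * phaseHat y t μ) • jost (q t) μ y +
        a • Complex.exp (1 * phaseHat y t μ) • conjSwap (jost (q t) μ y)))
    (fun t ht => by
      refine ((h.hasDerivAt_exp_smul_jostRight hμ hi y ht).fun_sub
        (((h.hasDerivAt_exp_smul_jost hμ hi y ht).fun_const_smul b).fun_add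
        ((h.hasDerivAt_exp_smul_conjSwap h0 h1 h2 y ht).fun_const_smul a))).congr_deriv ?_
      simp only [map_sub, map_add, map_smul])
    (by
      have l1 := (h.tendsto_jost_zero hμ y)
      have l2 := (continuous_swap.tendsto _).comp (h.tendsto_jostRight_zero hμ y)
      have l3 := (continuous_conjSwap.tendsto _).comp l1
      have e1 := tendsto_exp_phaseHat_zero (μ : ℂ) y 1
      have e2 := tendsto_exp_phaseHat_zero (μ : ℂ) y (-1)
      have := (e1.smul l2).sub (((e2.smul l1).const_smul b).add ((e1.smul l3).const_smul a))
      rw [hform 0, hrel, sub_self, smul_zero] at this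
      exact this)
    (fun T hT => h.exists_laxTime_le μ y T hT) ht
  simp only [hform] at key
  exact sub_eq_zero.1 ((smul_eq_zero.1 key).resolve_left (Complex.exp_ne_zero _))

/-- Proportionality of the Jost solutions is preserved. -/
theorem scattering_pole (h : IsEvolution 1 q û w) {μ : ℂ} (hμ : μ ∈ spectralDomain)
    (hi : μ ^ 2 + 1 ≠ 0) (y : ℝ) {δ : ℂ} (hrel : (jostRight (q 0) μ y).swap =
      (δ * Complex.exp (-2 * phaseHat y 0 μ)) • jost (q 0) μ y)
    {t : ℝ} (ht : 0 < t) : (jostRight (q t) μ y).swap =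
      (δ * Complex.exp (-2 * phaseHat y t μ)) • jost (q t) μ y := by
  have he : ∀ t : ℝ, Complex.exp (1 * phaseHat y t μ) * Complex.exp (-2 * phaseHat y t μ) =
      Complex.exp (-1 * phaseHat y t μ) := fun t => by
    rw [← Complex.exp_add]; congr 1; ring
  have hform : ∀ t : ℝ, Complex.exp (1 * phaseHat y t μ) • (jostRight (q t) μ y).swap -
      δ • Complex.exp (-1 * phaseHat y t μ) • jost (q t) μ y =
      Complex.exp (1 * phaseHat y t μ) • ((jostRight (q t) μ y).swap -
        (δ * Complex.exp (-2 * phaseHat y t μ)) • jost (q t) μ y) := fun t => by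
    rw [← he t]; module
  have key := eq_zero_of_linear_ode (L := fun t => laxTime μ (û t y) (w t y))
    (Z := fun t => Complex.exp (1 * phaseHat y t μ) • (jostRight (q t) μ y).swap -
      δ • Complex.exp (-1 * phaseHat y t μ) • jost (q t) μ y)
    (fun t ht => by
      refine ((h.hasDerivAt_exp_smul_jostRight hμ hi y ht).fun_sub
        ((h.hasDerivAt_exp_smul_jost hμ hi y ht).fun_const_smul δ)).congr_deriv ?_
      simp only [map_sub, map_smul])
    (by
      have l1 := (h.tendsto_jost_zero hμ y)
      have l2 := (continuous_swap.tendsto _).comp (h.tendsto_jostRight_zero hμ y)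
      have e1 := tendsto_exp_phaseHat_zero (μ : ℂ) y 1
      have e2 := tendsto_exp_phaseHat_zero (μ : ℂ) y (-1)
      have := (e1.smul l2).sub ((e2.smul l1).const_smul δ)
      rw [hform 0, hrel, sub_self, smul_zero] at this
      exact this)
    (fun T hT => h.exists_laxTime_le μ y T hT) ht
  simp only [hform] at key
  exact sub_eq_zero.1 ((smul_eq_zero.1 key).resolve_left (Complex.exp_ne_zero _))

/-- The Wronskian of the Jost solutions does not depend on time. -/
theorem wronskian_eq (h : IsEvolution 1 q û w) {μ : ℂ} (hμ : μ ∈ spectralDomain)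
    (hi : μ ^ 2 + 1 ≠ 0) (y : ℝ) {t : ℝ} (ht : 0 < t) :
    wronskian (fun μ => jost (q t) μ y) (fun μ => jostRight (q t) μ y) μ =
      wronskian (fun μ => jost (q 0) μ y) (fun μ => jostRight (q 0) μ y) μ := by
  set W : ℝ → ℂ := fun t => wronskian (fun μ => jost (q t) μ y) (fun μ => jostRight (q t) μ y) μ
    with hW
  have he : ∀ t : ℝ, Complex.exp (-1 * phaseHat y t μ) * Complex.exp (1 * phaseHat y t μ) = 1 :=
    fun t => by rw [← Complex.exp_add, neg_one_mul, one_mul, neg_add_cancel, Complex.exp_zero]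
  have hWe : ∀ t, W t =
      (Complex.exp (-1 * phaseHat y t μ) • jost (q t) μ y).1 *
        (Complex.exp (1 * phaseHat y t μ) • (jostRight (q t) μ y).swap).2 -
      (Complex.exp (-1 * phaseHat y t μ) • jost (q t) μ y).2 *
        (Complex.exp (1 * phaseHat y t μ) • (jostRight (q t) μ y).swap).1 := fun t => by
    simp only [hW, wronskian, Prod.smul_fst, Prod.smul_snd, smul_eq_mul, Prod.fst_swap, Prod.snd_swap]
    linear_combination (-((jost (q t) μ y).1 * (jostRight (q t) μ y).1 -
      (jost (q t) μ y).2 * (jostRight (q t) μ y).2)) * he t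
  have hfst : ∀ {f : ℝ → ℂ × ℂ} {f' : ℂ × ℂ} {t : ℝ}, HasDerivAt f f' t →
      HasDerivAt (fun t => (f t).1) f'.1 t := fun hf =>
    (ContinuousLinearMap.fst ℝ ℂ ℂ).hasFDerivAt.comp_hasDerivAt _ hf
  have hsnd : ∀ {f : ℝ → ℂ × ℂ} {f' : ℂ × ℂ} {t : ℝ}, HasDerivAt f f' t →
      HasDerivAt (fun t => (f t).2) f'.2 t := fun hf =>
    (ContinuousLinearMap.snd ℝ ℂ ℂ).hasFDerivAt.comp_hasDerivAt _ hf
  have hd : ∀ t, 0 < t → HasDerivAt W 0 t := by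
    intro t ht
    have d1 := h.hasDerivAt_exp_smul_jost hμ hi y ht
    have d2 := h.hasDerivAt_exp_smul_jostRight hμ hi y ht
    rw [funext hWe]
    refine (((hfst d1).fun_mul (hsnd d2)).fun_sub ((hsnd d1).fun_mul (hfst d2))).congr_deriv ?_
    -- The temporal matrix has trace zero, so the determinant of two solutions is constant.
    simp only [laxTime, mat2_apply]
    ring
  have hlim : Tendsto W (𝓝[>] 0) (𝓝 (W 0)) := by
    have l1 := h.tendsto_jost_zero hμ y
    have l2 := h.tendsto_jostRight_zero hμ y
    exact (l1.fst_nhds.mul l2.fst_nhds).sub (l1.snd_nhds.mul l2.snd_nhds)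
  have key := eq_zero_of_linear_ode (L := fun _ => (0 : ℂ →L[ℂ] ℂ)) (Z := fun s => W s - W 0)
    (fun s hs => by simpa using (hd s hs).sub_const (W 0))
    (by simpa using hlim.sub_const (W 0)) (fun _ _ => ⟨0, by simp⟩) ht
  exact sub_eq_zero.1 key

theorem isJostFamily (h : IsEvolution 1 q û w) {t : ℝ} (ht : 0 ≤ t) (y : ℝ) :
    IsJostFamily (fun μ => jost (q t) μ y) ∧ IsJostFamily (fun μ => jostRight (q t) μ y) :=
  ⟨(h.isPotential ht).isJostFamily y, (h.isPotential ht).reflect.isJostFamily (-y)⟩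

/-- The only exceptional point of the domain is μ = i, where the temporal equation is singular;
there the equality follows by continuity in μ. -/
theorem wronskian_eq_of_mem (h : IsEvolution 1 q û w) {μ : ℂ} (hμ : μ ∈ spectralDomain) (y : ℝ)
    {t : ℝ} (ht : 0 < t) :
    wronskian (fun μ => jost (q t) μ y) (fun μ => jostRight (q t) μ y) μ =
      wronskian (fun μ => jost (q 0) μ y) (fun μ => jostRight (q 0) μ y) μ := by
  by_cases hi : μ ^ 2 + 1 = 0
  · have hI : μ = Complex.I := by
      have h1 : (μ - Complex.I) * (μ + Complex.I) = 0 := by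
        linear_combination hi - Complex.I_mul_I
      rcases mul_eq_zero.1 h1 with h2 | h2
      · exact sub_eq_zero.1 h2
      · have h3 := hμ.1
        rw [eq_neg_of_add_eq_zero_left h2] at h3
        simp only [Complex.neg_im, Complex.I_im] at h3
        linarith
    have hup : {z : ℂ | 0 < z.im} ∈ 𝓝 Complex.I :=
      IsPotential.isOpen_upper.mem_nhds (by simp)
    have hc : ∀ s, 0 ≤ s → ContinuousAt (wronskian (fun μ => jost (q s) μ y)
        (fun μ => jostRight (q s) μ y)) Complex.I := fun s hs =>
      ((differentiableOn_wronskian (h.isJostFamily hs y).1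
        (h.isJostFamily hs y).2).differentiableAt hup).continuousAt
    subst hI
    refine tendsto_nhds_unique ((hc t ht.le).tendsto.mono_left (nhdsWithin_le_nhds (s := {Complex.I}ᶜ)))
      (((hc 0 le_rfl).tendsto.mono_left nhdsWithin_le_nhds).congr' ?_)
    filter_upwards [nhdsWithin_le_nhds hup, self_mem_nhdsWithin] with z hz hz'
    refine (h.wronskian_eq (mem_spectralDomain_of_im_pos hz) (fun hc => hz' ?_) y ht).symm
    have h1 : (z - Complex.I) * (z + Complex.I) = 0 := by
      linear_combination hc - Complex.I_mul_I
    rcases mul_eq_zero.1 h1 with h2 | h2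
    · exact sub_eq_zero.1 h2
    · have h3 : 0 < z.im := hz
      rw [eq_neg_of_add_eq_zero_left h2] at h3
      simp only [Complex.neg_im, Complex.I_im] at h3
      linarith
  · exact h.wronskian_eq hμ hi y ht

/-- Both Jost solutions are explicit at i, and their Wronskian is a product of exponentials. Hence i
is never one of the points μ_j. -/
theorem wronskian_I_ne_zero (h : IsEvolution 1 q û w) {t : ℝ} (ht : 0 ≤ t) (y : ℝ) :
    wronskian (fun μ => jost (q t) μ y) (fun μ => jostRight (q t) μ y) Complex.I ≠ 0 := by
  simp only [wronskian, jostRight, (h.isPotential ht).jost_I, (h.isPotential ht).reflect.jost_I,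
    mul_zero, sub_zero]
  exact mul_ne_zero (Complex.exp_ne_zero _) (Complex.exp_ne_zero _)

/-- The scattering data are preserved by the evolution. -/
theorem isScattering (h : IsEvolution 1 q û w) {D : RHData} {b : ℝ → ℂ} {y : ℝ}
    (h0 : D.IsScattering y 0 (fun μ => jost (q 0) μ y) (fun μ => jostRight (q 0) μ y) b) {t : ℝ}
    (ht : 0 ≤ t) :
    D.IsScattering y t (fun μ => jost (q t) μ y) (fun μ => jostRight (q t) μ y) b := by
  rcases ht.eq_or_lt with rfl | ht'
  · exact h0
  have hW : ∀ μ ∈ spectralDomain,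
      wronskian (fun μ => jost (q t) μ y) (fun μ => jostRight (q t) μ y) μ =
      wronskian (fun μ => jost (q 0) μ y) (fun μ => jostRight (q 0) μ y) μ := fun μ hμ =>
    h.wronskian_eq_of_mem hμ y ht'
  have hrel := fun μ : ℝ => fun (n0 : μ ≠ 0) (n1 : μ ≠ 1) (n2 : μ ≠ -1) =>
    h.scattering_real n0 n1 n2 y (b := b μ) (Prod.ext (h0.fst_eq μ n0 n1 n2) (h0.snd_eq μ n0 n1 n2)) ht'
  have hWev : ∀ μ : ℂ, 0 < μ.im →
      wronskian (fun μ => jost (q t) μ y) (fun μ => jostRight (q t) μ y) =ᶠ[𝓝 μ]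
      wronskian (fun μ => jost (q 0) μ y) (fun μ => jostRight (q 0) μ y) := fun μ hμ => by
    filter_upwards [IsPotential.isOpen_upper.mem_nhds hμ] with z hz
    exact hW z (mem_spectralDomain_of_im_pos hz)
  have hWup : wronskian (fun μ => jost (q 0) μ y) (fun μ => jostRight (q 0) μ y)
      =ᶠ[𝓝[{μ : ℂ | 0 < μ.im}] 1]
      wronskian (fun μ => jost (q t) μ y) (fun μ => jostRight (q t) μ y) := by
    filter_upwards [self_mem_nhdsWithin] with z hz
    exact (hW z (mem_spectralDomain_of_im_pos hz)).symm
  refine ⟨fun μ n0 n1 n2 => ?_, fun μ n0 n1 n2 => ?_, fun μ n0 n1 n2 => ?_, ?_, fun μ => ?_,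
    fun j => ?_⟩
  · rw [hW _ (mem_spectralDomain_ofReal n0 n1 n2)]
    exact h0.r_eq μ n0 n1 n2
  · rw [hW _ (mem_spectralDomain_ofReal n0 n1 n2)]
    exact congrArg Prod.fst (hrel μ n0 n1 n2)
  · rw [hW _ (mem_spectralDomain_ofReal n0 n1 n2)]
    exact congrArg Prod.snd (hrel μ n0 n1 n2)
  · obtain ⟨γ, hγ, hc⟩ := h0.singular
    refine ⟨γ, hγ.congr' (hWup.mono fun z hz => by simp only [hz]), hc.imp id ?_⟩
    rintro ⟨hγ0, a₁, b₁, ha, hb⟩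
    exact ⟨hγ0, a₁, b₁, ha.congr' hWup, hb⟩
  · rw [h0.mem_range]
    exact and_congr_right fun hμ => by rw [hW μ (mem_spectralDomain_of_im_pos hμ)]
  · obtain ⟨hpim, hp0⟩ := (h0.mem_range (D.pole j)).1 ⟨j, rfl⟩
    obtain ⟨hder, δ, hδ, hρ, hK2, hK1⟩ := h0.residue j
    rw [(hWev _ hpim).deriv_eq]
    have hi : D.pole j ^ 2 + 1 ≠ 0 := by
      intro hc
      have h1 : (D.pole j - Complex.I) * (D.pole j + Complex.I) = 0 := by
        linear_combination hc - Complex.I_mul_I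
      rcases mul_eq_zero.1 h1 with h2 | h2
      · rw [sub_eq_zero.1 h2] at hp0
        exact h.wronskian_I_ne_zero le_rfl y hp0
      · rw [eq_neg_of_add_eq_zero_left h2] at hpim
        simp only [Complex.neg_im, Complex.I_im] at hpim
        linarith
    have hr := h.scattering_pole (mem_spectralDomain_of_im_pos hpim) hi y (δ := δ)
      (Prod.ext hK2 hK1) ht'
    exact ⟨hder, δ, hδ, hρ, congrArg Prod.fst hr, congrArg Prod.snd hr⟩

/-- The quantity read off from the solution of the Riemann–Hilbert problem at `μ = i`. -/
theorem ratio_eq (h : IsEvolution 1 q û w) {D : RHData} {b : ℝ → ℂ} {y : ℝ}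
    (h0 : D.IsScattering y 0 (fun μ => jost (q 0) μ y) (fun μ => jostRight (q 0) μ y) b) {t : ℝ}
    (ht : 0 ≤ t) {M : ℂ → Matrix (Fin 2) (Fin 2) ℂ} (hM : D.IsSolution y t M) :
    (M Complex.I 0 0 + M Complex.I 1 0) / (M Complex.I 0 1 + M Complex.I 1 1) =
      (Real.exp (∫ ξ in Ioi y, q t ξ) : ℝ) := by
  have hs := h.isScattering h0 ht
  have hJ := h.isJostFamily ht y
  have hI : Complex.I ∉ range D.pole := fun hc =>
    h.wronskian_I_ne_zero ht y ((hs.mem_range _).1 hc).2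
  rw [hM.eq_jost hs hJ.1 hJ.2 hI (by simp) hI]
  simp only [wronskian, jostRight, (h.isPotential ht).jost_I, (h.isPotential ht).reflect.jost_I,
    mul_zero, sub_zero, Matrix.of_apply, Matrix.cons_val', Matrix.cons_val_zero,
    Matrix.cons_val_one, Matrix.cons_val_fin_one, zero_mul, add_zero, zero_add]
  have hInt : (∫ ξ in Iic (-y), q t (-ξ)) = ∫ ξ in Ioi y, q t ξ := by
    rw [integral_comp_neg_Iic (-y) (q t), neg_neg]
  rw [hInt, mul_inv, ← mul_assoc, mul_inv_cancel₀ (Complex.exp_ne_zero _), one_mul, ← Complex.exp_neg,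
    ← Complex.exp_sub, Complex.ofReal_exp]
  congr 1
  ring

end IsEvolution

end MCH
end

noncomputable section
namespace MCH

/-! ### Decay and positivity for the Cauchy problem -/

/-- A positive second derivative would make the point a local minimum as well, hence f locally
constant and the second derivative zero. -/
theorem second_deriv_nonpos_of_isLocalMax {f f' : ℝ → ℝ} {c x₀ : ℝ}
    (hf : ∀ x, HasDerivAt f (f' x) x) (hf' : HasDerivAt f' c x₀) (hmax : IsLocalMax f x₀) :
    c ≤ 0 := by
  by_contra! hc
  have hd : deriv f = f' := funext fun x => (hf x).deriv
  have h0 : deriv f x₀ = 0 := hmax.deriv_eq_zero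
  have hmin := isLocalMin_of_deriv_deriv_pos (f := f) (x₀ := x₀) (by rwa [hd, hf'.deriv]) h0
    (hf x₀).continuousAt
  have hconst : f =ᶠ[𝓝 x₀] fun _ => f x₀ := by
    filter_upwards [hmax, hmin] with x h1 h2 using le_antisymm h1 h2
  have hz : f' =ᶠ[𝓝 x₀] fun _ => 0 := by
    filter_upwards [hconst.eventuallyEq_nhds] with x hx
    rw [← hd, hx.deriv_eq, deriv_const]
  have := hf'.unique ((hasDerivAt_const x₀ (0 : ℝ)).congr_of_eventuallyEq hz)
  exact hc.ne' this

theorem hasDerivAt_barrier (K x : ℝ) : HasDerivAt (fun x : ℝ => K / (x ^ 2 + 4))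
    (-(2 * K * x) / (x ^ 2 + 4) ^ 2) x := by
  have h : x ^ 2 + 4 ≠ 0 := by positivity
  refine ((hasDerivAt_const x K).fun_div (((hasDerivAt_id x).fun_pow 2).add_const 4) h).congr_deriv ?_
  simp
  ring

theorem hasDerivAt_barrier_deriv (K x : ℝ) : HasDerivAt (fun x : ℝ => -(2 * K * x) / (x ^ 2 + 4) ^ 2)
    (K * (6 * x ^ 2 - 8) / (x ^ 2 + 4) ^ 3) x := by
  have h : x ^ 2 + 4 ≠ 0 := by positivity
  refine ((((hasDerivAt_id x).const_mul (2 * K)).fun_neg).fun_div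
    ((((hasDerivAt_id x).fun_pow 2).add_const 4).fun_pow 2) (pow_ne_zero 2 h)).congr_deriv ?_
  simp
  field_simp
  ring

/-- Maximum principle for `f - f''`. -/
theorem le_barrier {f f' f'' : ℝ → ℝ} {C : ℝ} (hf : ∀ x, HasDerivAt f (f' x) x)
    (hf' : ∀ x, HasDerivAt f' (f'' x) x) (hC : 0 ≤ C)
    (hn : ∀ x, f x - f'' x ≤ C / (x ^ 2 + 4)) (hlim : Tendsto f (cocompact ℝ) (𝓝 0)) (x : ℝ) :
    f x ≤ 2 * C / (x ^ 2 + 4) := by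
  by_contra! hx
  set h : ℝ → ℝ := fun x => f x - 2 * C / (x ^ 2 + 4) with hh
  have hd : ∀ x, HasDerivAt h (f' x - -(2 * (2 * C) * x) / (x ^ 2 + 4) ^ 2) x := fun x =>
    (hf x).fun_sub (hasDerivAt_barrier _ x)
  have hd' : ∀ x, HasDerivAt (fun x => f' x - -(2 * (2 * C) * x) / (x ^ 2 + 4) ^ 2)
      (f'' x - 2 * C * (6 * x ^ 2 - 8) / (x ^ 2 + 4) ^ 3) x := fun x =>
    (hf' x).fun_sub (hasDerivAt_barrier_deriv _ x)
  have hc : Continuous h := continuous_iff_continuousAt.2 fun x => (hd x).continuousAt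
  have hpos : 0 < h x := sub_pos.2 hx
  have hev : ∀ᶠ z in cocompact ℝ, h z ≤ h x := by
    filter_upwards [hlim.eventually (gt_mem_nhds hpos)] with z hz
    have : 0 ≤ 2 * C / (z ^ 2 + 4) := by positivity
    exact (sub_le_self _ this).trans hz.le
  obtain ⟨x₀, hx₀⟩ := hc.exists_forall_ge' x hev
  have h2 := second_deriv_nonpos_of_isLocalMax hd (hd' x₀) (Eventually.of_forall hx₀)
  have h3 : 0 < h x₀ := hpos.trans_le (hx₀ x)
  have h4 := hn x₀
  have hq : 0 < x₀ ^ 2 + 4 := by positivity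
  -- The barrier 2C/(x² + 4) is a supersolution. After clearing denominators this says x⁴ - 4x² + 32
  -- ≥ 0; with x² + 1 in place of x² + 4 the corresponding inequality fails.
  have h5 : C / (x₀ ^ 2 + 4) ≤ 2 * C / (x₀ ^ 2 + 4) - 2 * C * (6 * x₀ ^ 2 - 8) / (x₀ ^ 2 + 4) ^ 3 := by
    rw [div_sub_div _ _ hq.ne' (by positivity), div_le_div_iff₀ hq (by positivity)]
    have : 0 ≤ C * (x₀ ^ 2 + 4) ^ 2 * (x₀ ^ 4 - 4 * x₀ ^ 2 + 32) := by
      have : 0 ≤ x₀ ^ 4 - 4 * x₀ ^ 2 + 32 := by nlinarith [sq_nonneg (x₀ ^ 2 - 2)]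
      positivity
    nlinarith
  simp only [hh] at h3
  linarith

theorem abs_le_barrier {f f' f'' : ℝ → ℝ} {C : ℝ} (hf : ∀ x, HasDerivAt f (f' x) x)
    (hf' : ∀ x, HasDerivAt f' (f'' x) x) (hC : 0 ≤ C)
    (hn : ∀ x, |f x - f'' x| ≤ C / (x ^ 2 + 4)) (hlim : Tendsto f (cocompact ℝ) (𝓝 0)) (x : ℝ) :
    |f x| ≤ 2 * C / (x ^ 2 + 4) := by
  refine abs_le.2 ⟨?_, le_barrier hf hf' hC (fun x => (le_abs_self _).trans (hn x)) hlim x⟩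
  have := le_barrier (f := fun x => -f x) (fun x => (hf x).fun_neg) (fun x => (hf' x).fun_neg) hC
    (fun x => by
      have := (neg_le_abs _).trans (hn x)
      linarith) (by simpa using hlim.neg) x
  linarith

theorem barrier_shift {x s : ℝ} (h : |s - x| ≤ 1) : (s ^ 2 + 4)⁻¹ ≤ 2 * (x ^ 2 + 4)⁻¹ := by
  have h1 : x ^ 2 + 4 ≤ 2 * (s ^ 2 + 4) := by
    have := abs_le.1 h
    nlinarith [sq_nonneg (x - 2 * s)]
  rw [← div_eq_mul_inv, inv_le_comm₀ (by positivity) (by positivity), inv_div]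
  linarith

/-- Interpolation on [x, x + 1]: f' equals the increment of f at some intermediate point and varies
by at most the bound on f''. Shifting the barrier by at most 1 costs a factor 2, which gives 12 = 6
+ 4 + 2. -/
theorem abs_deriv_le_barrier {f f' f'' : ℝ → ℝ} {C : ℝ} (hf : ∀ x, HasDerivAt f (f' x) x)
    (hf' : ∀ x, HasDerivAt f' (f'' x) x) (hC : 0 ≤ C)
    (hn : ∀ x, |f x - f'' x| ≤ C / (x ^ 2 + 4)) (hlim : Tendsto f (cocompact ℝ) (𝓝 0)) (x : ℝ) :
    |f' x| ≤ 12 * C / (x ^ 2 + 4) := by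
  have h0 := abs_le_barrier hf hf' hC hn hlim
  have h2 : ∀ s, |f'' s| ≤ 3 * C / (s ^ 2 + 4) := fun s => by
    have h3 := abs_sub (f s) (f s - f'' s)
    rw [sub_sub_cancel] at h3
    have : 3 * C / (s ^ 2 + 4) = 2 * C / (s ^ 2 + 4) + C / (s ^ 2 + 4) := by ring
    linarith [h0 s, hn s]
  obtain ⟨ξ, hξ, hξ'⟩ := exists_hasDerivAt_eq_slope f f' (lt_add_one x)
    (fun s _ => (hf s).continuousAt.continuousWithinAt) (fun s _ => hf s)
  rw [add_sub_cancel_left, div_one] at hξ'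
  have h4 : |f' ξ - f' x| ≤ 6 * C / (x ^ 2 + 4) := by
    have := (convex_Icc x (x + 1)).norm_image_sub_le_of_norm_hasDerivWithin_le (f := f')
      (C := 6 * C / (x ^ 2 + 4)) (fun s _ => (hf' s).hasDerivWithinAt) (fun s hs => by
        rw [Real.norm_eq_abs]
        refine (h2 s).trans ?_
        have := barrier_shift (x := x) (s := s) (abs_le.2 ⟨by linarith [hs.1], by linarith [hs.2]⟩)
        rw [div_eq_mul_inv, div_eq_mul_inv]
        nlinarith) (left_mem_Icc.2 (by linarith)) (Ioo_subset_Icc_self hξ)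
    rw [Real.norm_eq_abs, Real.norm_eq_abs] at this
    refine this.trans (mul_le_of_le_one_right (by positivity) ?_)
    rw [abs_of_nonneg (by linarith [hξ.1])]
    linarith [hξ.2]
  have h5 : |f (x + 1)| ≤ 4 * C / (x ^ 2 + 4) := by
    refine (h0 (x + 1)).trans ?_
    have := barrier_shift (x := x) (s := x + 1) (by simp)
    rw [div_eq_mul_inv, div_eq_mul_inv]
    nlinarith
  have h6 := h0 x
  have h7 : |f' x| ≤ |f' ξ - f' x| + |f (x + 1)| + |f x| := by
    have e1 : f' x = f (x + 1) - f x - (f' ξ - f' x) := by rw [← hξ']; ring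
    have e2 := abs_sub (f (x + 1) - f x) (f' ξ - f' x)
    rw [← e1] at e2
    have e3 := abs_sub (f (x + 1)) (f x)
    linarith
  have h8 : 12 * C / (x ^ 2 + 4) = 6 * C / (x ^ 2 + 4) + 4 * C / (x ^ 2 + 4) + 2 * C / (x ^ 2 + 4) := by
    ring
  linarith

/-- The space derivative of the momentum. -/
def momentumDx (u : ℝ → ℝ → ℝ) (x t : ℝ) : ℝ :=
  dx u x t - iteratedDeriv 3 (fun z => u z t) x

/-- The speed `u² - u_x²`. -/
def speed (u : ℝ → ℝ → ℝ) (x t : ℝ) : ℝ := u x t ^ 2 - dx u x t ^ 2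

namespace IsCauchySolution

variable {u₀ : ℝ → ℝ} {u : ℝ → ℝ → ℝ}

theorem hasDerivAt_iteratedDeriv (hu : IsCauchySolution u₀ u) {t : ℝ} (ht : 0 ≤ t) {k : ℕ}
    (hk : k < 3) (x : ℝ) : HasDerivAt (iteratedDeriv k fun z => u z t)
      (iteratedDeriv (k + 1) (fun z => u z t) x) x := by
  have h1 : DifferentiableAt ℝ (iteratedDeriv k fun z => u z t) x :=
    (hu.contDiff t ht).differentiable_iteratedDeriv k (by exact_mod_cast hk) x
  rw [iteratedDeriv_succ]
  exact h1.hasDerivAt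

theorem hasDerivAt_u (hu : IsCauchySolution u₀ u) {t : ℝ} (ht : 0 ≤ t) (x : ℝ) :
    HasDerivAt (fun z => u z t) (dx u x t) x := by
  have := hu.hasDerivAt_iteratedDeriv ht (k := 0) (by norm_num) x
  rwa [iteratedDeriv_zero, iteratedDeriv_one] at this

theorem hasDerivAt_dx (hu : IsCauchySolution u₀ u) {t : ℝ} (ht : 0 ≤ t) (x : ℝ) :
    HasDerivAt (fun z => dx u z t) (u x t - momentum u x t) x := by
  have := hu.hasDerivAt_iteratedDeriv ht (k := 1) (by norm_num) x
  rw [iteratedDeriv_one] at this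
  refine this.congr_deriv ?_
  rw [momentum, sub_sub_cancel]

theorem hasDerivAt_momentum (hu : IsCauchySolution u₀ u) {t : ℝ} (ht : 0 ≤ t) (x : ℝ) :
    HasDerivAt (fun z => momentum u z t) (momentumDx u x t) x :=
  (hu.hasDerivAt_u ht x).fun_sub (hu.hasDerivAt_iteratedDeriv ht (k := 2) (by norm_num) x)

theorem hasDerivAt_speed (hu : IsCauchySolution u₀ u) {t : ℝ} (ht : 0 ≤ t) (x : ℝ) :
    HasDerivAt (fun z => speed u z t) (2 * dx u x t * momentum u x t) x := by
  refine (((hu.hasDerivAt_u ht x).fun_pow 2).fun_sub ((hu.hasDerivAt_dx ht x).fun_pow 2)).congr_deriv ?_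
  simp only [Nat.cast_ofNat, Nat.add_one_sub_one, pow_one]
  ring

theorem hasDerivAt_speed_mul (hu : IsCauchySolution u₀ u) {t : ℝ} (ht : 0 ≤ t) (x : ℝ) :
    HasDerivAt (fun z => speed u z t * momentum u z t)
      (2 * dx u x t * momentum u x t ^ 2 + speed u x t * momentumDx u x t) x :=
  ((hu.hasDerivAt_speed ht x).fun_mul (hu.hasDerivAt_momentum ht x)).congr_deriv (by ring)

theorem hasDerivAt_momentum_time (hu : IsCauchySolution u₀ u) {t : ℝ} (ht : 0 < t) (x : ℝ) :
    HasDerivAt (fun s => momentum u x s)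
      (-(2 * dx u x t * momentum u x t ^ 2 + speed u x t * momentumDx u x t)) t := by
  have h1 := hu.equation x t ht
  have h2 : deriv (fun z => (u z t ^ 2 - dx u z t ^ 2) * momentum u z t) x = _ :=
    (hu.hasDerivAt_speed_mul ht.le x).deriv
  rwa [h2] at h1

theorem continuousOn_u (hu : IsCauchySolution u₀ u) :
    ContinuousOn (fun p : ℝ × ℝ => u p.1 p.2) (univ ×ˢ Ici 0) := by
  simpa using hu.continuousOn 0 (by norm_num)

theorem continuousOn_dx (hu : IsCauchySolution u₀ u) :
    ContinuousOn (fun p : ℝ × ℝ => dx u p.1 p.2) (univ ×ˢ Ici 0) := by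
  have := hu.continuousOn 1 (by norm_num)
  simp only [iteratedDeriv_one] at this
  exact this

theorem continuousOn_momentum (hu : IsCauchySolution u₀ u) :
    ContinuousOn (fun p : ℝ × ℝ => momentum u p.1 p.2) (univ ×ˢ Ici 0) :=
  hu.continuousOn_u.sub (hu.continuousOn 2 (by norm_num))

theorem continuousOn_momentumDx (hu : IsCauchySolution u₀ u) :
    ContinuousOn (fun p : ℝ × ℝ => momentumDx u p.1 p.2) (univ ×ˢ Ici 0) :=
  hu.continuousOn_dx.sub (hu.continuousOn 3 le_rfl)

theorem continuousOn_speed (hu : IsCauchySolution u₀ u) :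
    ContinuousOn (fun p : ℝ × ℝ => speed u p.1 p.2) (univ ×ˢ Ici 0) :=
  (hu.continuousOn_u.pow 2).sub (hu.continuousOn_dx.pow 2)

/-- Decay of m = u - u_xx passes to u and u_x by the maximum principle. The constant 48 is 4 · 12:
the factor 4 compares (1 + |x|)⁻⁴ with 1/(x² + 4), the factor 12 is the loss for the derivative. -/
theorem exists_decay (hu : IsCauchySolution u₀ u) {T : ℝ} (hT : 0 < T) :
    ∃ C, 0 ≤ C ∧ ∀ t ∈ Icc 0 T, ∀ x, |momentum u x t - 1| ≤ C / (1 + |x|) ^ 4 ∧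
      |u x t - 1| ≤ C / (x ^ 2 + 4) ∧ |dx u x t| ≤ C / (x ^ 2 + 4) := by
  obtain ⟨C, hC⟩ := hu.decay T hT
  have hC0 : 0 ≤ C := by
    have := (abs_nonneg _).trans (hC 0 ⟨le_rfl, hT.le⟩ 0)
    simpa using this
  refine ⟨48 * C, by positivity, fun t ht x => ?_⟩
  have hn : ∀ x, |(u x t - 1) - (u x t - momentum u x t)| ≤ 4 * C / (x ^ 2 + 4) := fun x => by
    have e : (u x t - 1) - (u x t - momentum u x t) = momentum u x t - 1 := by ring
    rw [e]
    refine (hC t ht x).trans ?_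
    rw [div_le_div_iff₀ (by positivity) (by positivity)]
    have h1 : x ^ 2 + 4 ≤ 4 * (1 + |x|) ^ 4 := by
      have h2 := abs_nonneg x
      rw [← sq_abs x]
      nlinarith [pow_nonneg h2 3, pow_nonneg h2 4, sq_nonneg |x|]
    nlinarith
  have hlim : Tendsto (fun x => u x t - 1) (cocompact ℝ) (𝓝 0) := by
    rw [cocompact_eq_atBot_atTop]
    have h1 := (hu.tendsto_atTop t ht.1).sub_const 1
    have h2 := (hu.tendsto_atBot t ht.1).sub_const 1
    rw [sub_self] at h1 h2
    exact tendsto_sup.2 ⟨h2, h1⟩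
  have hd := fun x => (hu.hasDerivAt_u ht.1 x).sub_const 1
  have a1 := abs_le_barrier hd (hu.hasDerivAt_dx ht.1) (by positivity) hn hlim x
  have a2 := abs_deriv_le_barrier hd (hu.hasDerivAt_dx ht.1) (by positivity) hn hlim x
  refine ⟨(hC t ht x).trans ?_, a1.trans ?_, a2.trans ?_⟩
  · exact div_le_div_of_nonneg_right (by linarith) (by positivity)
  · exact div_le_div_of_nonneg_right (by linarith) (by positivity)
  · exact div_le_div_of_nonneg_right (by linarith) (by positivity)

/-- The momentum stays positive, uniformly on bounded time intervals. -/
theorem exists_momentum_ge (hu : IsCauchySolution u₀ u)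
    (hpos : ∀ x, 0 < u₀ x - iteratedDeriv 2 u₀ x) {T : ℝ} (hT : 0 < T) :
    ∃ δ, 0 < δ ∧ ∀ t ∈ Icc 0 T, ∀ x, δ ≤ momentum u x t := by
  obtain ⟨C, hC0, hC⟩ := hu.exists_decay hT
  have hpos0 : ∀ x, 0 < momentum u x 0 := fun x => by
    have h1 : (fun z => u z 0) = u₀ := funext hu.initial
    rw [momentum, h1, hu.initial]
    exact hpos x
  have hfar : ∀ t ∈ Icc 0 T, ∀ x, 2 * C ≤ |x| → 1 / 2 ≤ momentum u x t := by
    intro t ht x hx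
    have h1 := (abs_le.1 (hC t ht x).1).1
    have h2 : C / (1 + |x|) ^ 4 ≤ 1 / 2 := by
      rw [div_le_div_iff₀ (by positivity) (by norm_num)]
      have h3 := abs_nonneg x
      nlinarith [pow_nonneg h3 3, pow_nonneg h3 4, sq_nonneg |x|]
    linarith
  have hmb : ∀ t ∈ Icc 0 T, ∀ x, |momentum u x t| ≤ C + 1 := by
    intro t ht x
    have h1 : C / (1 + |x|) ^ 4 ≤ C := div_le_self hC0 (one_le_pow₀ (by linarith [abs_nonneg x]))
    have h2 := abs_sub_abs_le_abs_sub (momentum u x t) 1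
    rw [abs_one] at h2
    linarith [(hC t ht x).1]
  have hdb : ∀ t ∈ Icc 0 T, ∀ x, |dx u x t| ≤ C := by
    intro t ht x
    exact ((hC t ht x).2.2).trans (div_le_self hC0 (by nlinarith [sq_nonneg x]))
  obtain ⟨δ, hδ, hδ0⟩ : ∃ δ, 0 < δ ∧ ∀ x, δ < momentum u x 0 := by
    have hc : Continuous fun x => momentum u x 0 := continuous_iff_continuousAt.2 fun x =>
      (hu.hasDerivAt_momentum le_rfl x).continuousAt
    obtain ⟨x₁, -, hx₁⟩ := (isCompact_Icc (a := -(2 * C)) (b := 2 * C)).exists_isMinOn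
      (nonempty_Icc.2 (by linarith)) hc.continuousOn
    refine ⟨min (momentum u x₁ 0) (1 / 2) / 2, by have := hpos0 x₁; positivity, fun x => ?_⟩
    have hm : 0 < min (momentum u x₁ 0) (1 / 2) := lt_min (hpos0 x₁) (by norm_num)
    rcases le_or_gt |x| (2 * C) with h | h
    · have := hx₁ (abs_le.1 h)
      have h2 := min_le_left (momentum u x₁ 0) (1 / 2)
      simp only [mem_ofPred_eq] at this
      linarith
    · have := hfar 0 ⟨le_rfl, hT.le⟩ x h.le
      have h2 := min_le_right (momentum u x₁ 0) (1 / 2)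
      linarith
  -- At a spatial minimum m_t = -2 u_x m² ≥ -2C(C + 1) m, so the comparison function δ' e^{-Kt}
  -- decreases strictly faster than m can. The cap 1/4 on δ' keeps it below the values m ≥ 1/2 far
  -- out.
  set K : ℝ := 2 * C * (C + 1) + 1 with hK
  have hK0 : 0 < K := by positivity
  set δ' : ℝ := min δ (1 / 4) with hδ'
  have hδ'0 : 0 < δ' := lt_min hδ (by norm_num)
  set n : ℝ × ℝ → ℝ := fun p => momentum u p.1 p.2 - δ' * Real.exp (-K * p.2) with hn
  have hexp : ∀ t, 0 ≤ t → Real.exp (-K * t) ≤ 1 := fun t ht =>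
    Real.exp_le_one_iff.2 (by nlinarith)
  have hnc : ContinuousOn n (univ ×ˢ Ici 0) :=
    hu.continuousOn_momentum.sub (by fun_prop)
  suffices hmain : ∀ t ∈ Icc 0 T, ∀ x, 0 < n (x, t) by
    refine ⟨δ' * Real.exp (-K * T), by positivity, fun t ht x => ?_⟩
    have h1 := hmain t ht x
    have h2 : Real.exp (-K * T) ≤ Real.exp (-K * t) := Real.exp_le_exp.2 (by nlinarith [ht.2])
    simp only [hn] at h1
    nlinarith
  by_contra! hcon
  obtain ⟨t₁, ht₁, x₁, hx₁⟩ := hcon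
  set S : Set (ℝ × ℝ) := {p | p ∈ (Icc (-(2 * C)) (2 * C)) ×ˢ Icc 0 T ∧ n p ≤ 0} with hS
  have hin : ∀ t ∈ Icc 0 T, ∀ x, n (x, t) ≤ 0 → (x, t) ∈ S := by
    intro t ht x hx
    refine ⟨⟨?_, ht⟩, hx⟩
    by_contra hcon
    have hbig : 2 * C ≤ |x| := by
      by_contra! hlt
      exact hcon (abs_le.1 hlt.le)
    have h1 := hfar t ht x hbig
    have h2 := hexp t ht.1
    have h3 := min_le_right δ (1 / 4)
    simp only [hn] at hx
    nlinarith
  have hScomp : IsCompact S := by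
    have hK : IsCompact ((Icc (-(2 * C)) (2 * C)) ×ˢ Icc 0 T) := isCompact_Icc.prod isCompact_Icc
    have hsub : (Icc (-(2 * C)) (2 * C)) ×ˢ Icc 0 T ⊆ (univ : Set ℝ) ×ˢ Ici 0 :=
      fun p hp => ⟨mem_univ _, hp.2.1⟩
    have hcl := (hnc.mono hsub).preimage_isClosed_of_isClosed hK.isClosed (isClosed_Iic (a := 0))
    exact hK.of_isClosed_subset hcl inter_subset_left
  -- The first time at which m reaches the comparison function; it exists because contact is
  -- confined to a compact set. At that point the difference has a spatial minimum with value 0.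
  obtain ⟨⟨x₀, t₀⟩, hp₀, hmin⟩ := hScomp.exists_isMinOn ⟨_, hin t₁ ht₁ x₁ hx₁⟩
    continuous_snd.continuousOn
  have ht₀ : t₀ ∈ Icc 0 T := hp₀.1.2
  have hbefore : ∀ t, 0 ≤ t → t < t₀ → ∀ x, 0 < n (x, t) := by
    intro t h0 hlt x
    by_contra! hc
    have : t₀ ≤ t := hmin (hin t ⟨h0, hlt.le.trans ht₀.2⟩ x hc)
    linarith
  have ht₀pos : 0 < t₀ := by
    rcases ht₀.1.eq_or_lt with h | h
    · exfalso
      have h1 := hp₀.2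
      have h2 := hδ0 x₀
      simp only [hn, ← h, mul_zero, Real.exp_zero, mul_one] at h1
      linarith [min_le_left δ (1 / 4)]
    · exact h
  have hnonneg : ∀ x, 0 ≤ n (x, t₀) := by
    intro x
    have h1 : Tendsto (fun t => n (x, t)) (𝓝[<] t₀) (𝓝 (n (x, t₀))) := by
      have h2 := hnc (x, t₀) ⟨mem_univ _, ht₀.1⟩
      refine h2.tendsto.comp (tendsto_nhdsWithin_iff.2 ⟨?_, ?_⟩)
      · exact (Continuous.tendsto (by fun_prop) t₀).mono_left nhdsWithin_le_nhds
      · filter_upwards [Ioo_mem_nhdsLT ht₀pos] with t ht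
        exact ⟨mem_univ _, ht.1.le⟩
    refine ge_of_tendsto h1 ?_
    filter_upwards [Ioo_mem_nhdsLT ht₀pos] with t ht
    exact (hbefore t ht.1.le ht.2 x).le
  have hzero : n (x₀, t₀) = 0 := le_antisymm hp₀.2 (hnonneg x₀)
  have hdx : momentumDx u x₀ t₀ = 0 := by
    have h1 : IsLocalMin (fun x => n (x, t₀)) x₀ := Eventually.of_forall fun x => by
      simp only [hzero]; exact hnonneg x
    exact h1.hasDerivAt_eq_zero
      ((hu.hasDerivAt_momentum ht₀.1 x₀).sub_const (δ' * Real.exp (-K * t₀)))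
  have hdt : HasDerivAt (fun t => n (x₀, t))
      (-(2 * dx u x₀ t₀ * momentum u x₀ t₀ ^ 2 + speed u x₀ t₀ * momentumDx u x₀ t₀) -
        δ' * (Real.exp (-K * t₀) * (-K * 1))) t₀ :=
    (hu.hasDerivAt_momentum_time ht₀pos x₀).fun_sub
      ((((hasDerivAt_id t₀).const_mul (-K)).exp).const_mul δ')
  -- The difference is positive before t₀ and zero at t₀, so its time derivative there is
  -- nonpositive; the choice of K contradicts this.
  have hle : -(2 * dx u x₀ t₀ * momentum u x₀ t₀ ^ 2 + speed u x₀ t₀ * momentumDx u x₀ t₀) -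
        δ' * (Real.exp (-K * t₀) * (-K * 1)) ≤ 0 := by
    have h1 := (hasDerivAt_iff_tendsto_slope.1 hdt).mono_left
      (nhdsWithin_mono t₀ (s := Iio t₀) (fun t (ht : t < t₀) => ht.ne))
    refine le_of_tendsto h1 ?_
    filter_upwards [Ioo_mem_nhdsLT ht₀pos] with t ht
    rw [slope_def_field, hzero, sub_zero]
    exact div_nonpos_of_nonneg_of_nonpos (hbefore t ht.1.le ht.2 x₀).le (by linarith [ht.2])
  have hm : momentum u x₀ t₀ = δ' * Real.exp (-K * t₀) := by
    simp only [hn] at hzero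
    linarith
  have hmp : 0 < momentum u x₀ t₀ := by rw [hm]; positivity
  rw [hdx] at hle
  have h1 : 2 * dx u x₀ t₀ * momentum u x₀ t₀ ≤ 2 * C * (C + 1) := by
    have a1 := hdb t₀ ht₀ x₀
    have a2 := hmb t₀ ht₀ x₀
    rw [abs_of_pos hmp] at a2
    have a3 := (le_abs_self _).trans a1
    nlinarith
  have h2 : momentum u x₀ t₀ * (K - 2 * dx u x₀ t₀ * momentum u x₀ t₀) ≤ 0 := by
    have e : δ' * (Real.exp (-K * t₀) * (-K * 1)) = -K * momentum u x₀ t₀ := by rw [hm]; ring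
    rw [e] at hle
    nlinarith
  nlinarith

theorem momentum_pos (hu : IsCauchySolution u₀ u) (hpos : ∀ x, 0 < u₀ x - iteratedDeriv 2 u₀ x)
    {t : ℝ} (ht : 0 ≤ t) (x : ℝ) : 0 < momentum u x t := by
  obtain ⟨δ, hδ, h⟩ := hu.exists_momentum_ge hpos (T := t + 1) (by linarith)
  exact hδ.trans_le (h t ⟨ht, by linarith⟩ x)

end IsCauchySolution

end MCH
end

noncomputable section
namespace MCH

/-! ### Lagrangian coordinates -/

/-- The Lagrangian label `x - t - ∫_x^∞ (m - 1)` of the point `x` at time `t`. -/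
def label (u : ℝ → ℝ → ℝ) (x t : ℝ) : ℝ := x - t - ∫ ξ in Ioi x, (momentum u ξ t - 1)

/-- The position at time `t` of the point with label `y`. -/
def position (u : ℝ → ℝ → ℝ) (y t : ℝ) : ℝ := Function.invFun (fun x => label u x t) y

theorem inv_one_add_abs_pow_le (x : ℝ) : 1 / (1 + |x|) ^ 4 ≤ (1 + x ^ 2)⁻¹ := by
  rw [one_div]
  refine inv_anti₀ (by positivity) ?_
  have h := abs_nonneg x
  rw [← sq_abs]
  nlinarith [pow_nonneg h 3, pow_nonneg h 4, pow_nonneg h 2]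

theorem hasDerivAt_integral_Ioi {f : ℝ → ℝ} (hf : Continuous f) (hi : Integrable f) (x : ℝ) :
    HasDerivAt (fun x => ∫ ξ in Ioi x, f ξ) (-f x) x := by
  have h : (fun x => ∫ ξ in Ioi x, f ξ) = fun x => (∫ ξ in Ioi 0, f ξ) - ∫ ξ in (0 : ℝ)..x, f ξ := by
    funext x
    rw [← intervalIntegral.integral_Ioi_sub_Ioi' hi.integrableOn hi.integrableOn, sub_sub_cancel]
  rw [h]
  exact (hf.integral_hasStrictDerivAt 0 x).hasDerivAt.const_sub _

theorem tendsto_integral_Ioi_atTop {f : ℝ → ℝ} (hi : Integrable f) :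
    Tendsto (fun x => ∫ ξ in Ioi x, f ξ) atTop (𝓝 0) := by
  have h : (fun x => ∫ ξ in Ioi x, f ξ) = fun x => (∫ ξ in Ioi 0, f ξ) - ∫ ξ in (0 : ℝ)..x, f ξ := by
    funext x
    rw [← intervalIntegral.integral_Ioi_sub_Ioi' hi.integrableOn hi.integrableOn, sub_sub_cancel]
  rw [h]
  have := (intervalIntegral_tendsto_integral_Ioi 0 hi.integrableOn tendsto_id).const_sub
    (∫ ξ in Ioi 0, f ξ)
  simpa using this

namespace IsCauchySolution

variable {u₀ : ℝ → ℝ} {u : ℝ → ℝ → ℝ}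

theorem continuous_momentum (hu : IsCauchySolution u₀ u) {t : ℝ} (ht : 0 ≤ t) :
    Continuous fun x => momentum u x t :=
  continuous_iff_continuousAt.2 fun x => (hu.hasDerivAt_momentum ht x).continuousAt

theorem exists_abs_momentum_sub_one_le (hu : IsCauchySolution u₀ u) {T : ℝ} (hT : 0 < T) :
    ∃ C, 0 ≤ C ∧ ∀ t ∈ Icc 0 T, ∀ x, |momentum u x t - 1| ≤ C * (1 + x ^ 2)⁻¹ := by
  obtain ⟨C, hC0, hC⟩ := hu.exists_decay hT
  refine ⟨C, hC0, fun t ht x => (hC t ht x).1.trans ?_⟩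
  have := mul_le_mul_of_nonneg_left (inv_one_add_abs_pow_le x) hC0
  rwa [mul_one_div] at this

theorem integrable_momentum_sub_one (hu : IsCauchySolution u₀ u) {t : ℝ} (ht : 0 ≤ t) :
    Integrable fun x => momentum u x t - 1 := by
  obtain ⟨C, -, hC⟩ := hu.exists_abs_momentum_sub_one_le (T := t + 1) (by linarith)
  exact (integrable_inv_one_add_sq.const_mul C).mono'
    ((hu.continuous_momentum ht).sub continuous_const).aestronglyMeasurable
    (Eventually.of_forall fun x => hC t ⟨ht, by linarith⟩ x)

theorem hasDerivAt_label (hu : IsCauchySolution u₀ u) {t : ℝ} (ht : 0 ≤ t) (x : ℝ) :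
    HasDerivAt (fun x => label u x t) (momentum u x t) x := by
  have h := hasDerivAt_integral_Ioi (f := fun x => momentum u x t - 1)
    ((hu.continuous_momentum ht).sub continuous_const) (hu.integrable_momentum_sub_one ht) x
  refine (((hasDerivAt_id x).sub_const t).fun_sub h).congr_deriv ?_
  ring

theorem exists_abs_label_sub_le (hu : IsCauchySolution u₀ u) {T : ℝ} (hT : 0 < T) :
    ∃ K, 0 ≤ K ∧ ∀ t ∈ Icc 0 T, ∀ x, |label u x t - x| ≤ K := by
  obtain ⟨C, hC0, hC⟩ := hu.exists_abs_momentum_sub_one_le hT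
  refine ⟨T + ∫ x, C * (1 + x ^ 2)⁻¹, by positivity, fun t ht x => ?_⟩
  have h1 : |∫ ξ in Ioi x, (momentum u ξ t - 1)| ≤ ∫ x, C * (1 + x ^ 2)⁻¹ := by
    have hi : Integrable fun x : ℝ => C * (1 + x ^ 2)⁻¹ := integrable_inv_one_add_sq.const_mul C
    refine (norm_integral_le_of_norm_le (f := fun ξ => momentum u ξ t - 1) hi.integrableOn
      (Eventually.of_forall fun ξ => hC t ht ξ)).trans ?_
    exact setIntegral_le_integral hi (Eventually.of_forall fun ξ => by positivity)
  have h2 : label u x t - x = -(t + ∫ ξ in Ioi x, (momentum u ξ t - 1)) := by rw [label]; ring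
  rw [h2, abs_neg]
  refine (abs_add_le _ _).trans (add_le_add ?_ h1)
  rw [abs_of_nonneg ht.1]
  exact ht.2

theorem strictMono_label (hu : IsCauchySolution u₀ u) (hpos : ∀ x, 0 < u₀ x - iteratedDeriv 2 u₀ x)
    {t : ℝ} (ht : 0 ≤ t) : StrictMono fun x => label u x t :=
  strictMono_of_deriv_pos fun x => by
    rw [(hu.hasDerivAt_label ht x).deriv]
    exact hu.momentum_pos hpos ht x

theorem continuous_label (hu : IsCauchySolution u₀ u) {t : ℝ} (ht : 0 ≤ t) :
    Continuous fun x => label u x t :=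
  continuous_iff_continuousAt.2 fun x => (hu.hasDerivAt_label ht x).continuousAt

theorem tendsto_label_atTop (hu : IsCauchySolution u₀ u) {t : ℝ} (ht : 0 ≤ t) :
    Tendsto (fun x => label u x t) atTop atTop := by
  obtain ⟨K, -, hK⟩ := hu.exists_abs_label_sub_le (T := t + 1) (by linarith)
  refine tendsto_atTop_mono (f := fun x => x + -K) (fun x => ?_)
    (tendsto_atTop_add_const_right _ _ tendsto_id)
  linarith [(abs_le.1 (hK t ⟨ht, by linarith⟩ x)).1]

theorem tendsto_label_atBot (hu : IsCauchySolution u₀ u) {t : ℝ} (ht : 0 ≤ t) :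
    Tendsto (fun x => label u x t) atBot atBot := by
  obtain ⟨K, -, hK⟩ := hu.exists_abs_label_sub_le (T := t + 1) (by linarith)
  refine tendsto_atBot_mono (fun x => ?_) (tendsto_atBot_add_const_right _ K tendsto_id)
  rw [id]
  linarith [(abs_le.1 (hK t ⟨ht, by linarith⟩ x)).2]

theorem bijective_label (hu : IsCauchySolution u₀ u) (hpos : ∀ x, 0 < u₀ x - iteratedDeriv 2 u₀ x)
    {t : ℝ} (ht : 0 ≤ t) : Function.Bijective fun x => label u x t :=
  ⟨(hu.strictMono_label hpos ht).injective,
    (hu.continuous_label ht).surjective (hu.tendsto_label_atTop ht) (hu.tendsto_label_atBot ht)⟩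

theorem label_position (hu : IsCauchySolution u₀ u) (hpos : ∀ x, 0 < u₀ x - iteratedDeriv 2 u₀ x)
    {t : ℝ} (ht : 0 ≤ t) (y : ℝ) : label u (position u y t) t = y :=
  Function.invFun_eq ((hu.bijective_label hpos ht).2 y)

theorem position_label (hu : IsCauchySolution u₀ u) (hpos : ∀ x, 0 < u₀ x - iteratedDeriv 2 u₀ x)
    {t : ℝ} (ht : 0 ≤ t) (x : ℝ) : position u (label u x t) t = x :=
  Function.leftInverse_invFun (hu.bijective_label hpos ht).1 x

theorem bijective_position (hu : IsCauchySolution u₀ u)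
    (hpos : ∀ x, 0 < u₀ x - iteratedDeriv 2 u₀ x) {t : ℝ} (ht : 0 ≤ t) :
    Function.Bijective fun y => position u y t :=
  Function.bijective_iff_has_inverse.2 ⟨fun x => label u x t, hu.label_position hpos ht,
    hu.position_label hpos ht⟩

theorem continuous_position (hu : IsCauchySolution u₀ u)
    (hpos : ∀ x, 0 < u₀ x - iteratedDeriv 2 u₀ x) {t : ℝ} (ht : 0 ≤ t) :
    Continuous fun y => position u y t := by
  have hm : StrictMono fun y => position u y t := fun a b hab => by
    rw [← (hu.strictMono_label hpos ht).lt_iff_lt]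
    simpa only [hu.label_position hpos ht] using hab
  exact hm.monotone.continuous_of_surjective (hu.bijective_position hpos ht).2

theorem hasDerivAt_position (hu : IsCauchySolution u₀ u)
    (hpos : ∀ x, 0 < u₀ x - iteratedDeriv 2 u₀ x) {t : ℝ} (ht : 0 ≤ t) (y : ℝ) :
    HasDerivAt (fun y => position u y t) (momentum u (position u y t) t)⁻¹ y :=
  HasDerivAt.of_local_left_inverse (hu.continuous_position hpos ht).continuousAt
    (hu.hasDerivAt_label ht _) (hu.momentum_pos hpos ht _).ne'
    (Eventually.of_forall (hu.label_position hpos ht))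

theorem continuousOn_momentum_time (hu : IsCauchySolution u₀ u) (x : ℝ) :
    ContinuousOn (fun t => momentum u x t) (Ici 0) :=
  hu.continuousOn_momentum.comp (f := fun t : ℝ => (x, t)) (by fun_prop) fun t ht => ⟨mem_univ _, ht⟩

theorem continuousOn_label_time (hu : IsCauchySolution u₀ u) (x : ℝ) :
    ContinuousOn (fun t => label u x t) (Ici 0) := by
  intro t ht
  refine (continuousWithinAt_const.sub continuousWithinAt_id).sub ?_
  obtain ⟨C, -, hC⟩ := hu.exists_abs_momentum_sub_one_le (T := t + 1) (by linarith [mem_Ici.1 ht])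
  have hev : ∀ᶠ s in 𝓝[Ici 0] t, s ∈ Icc 0 (t + 1) := by
    filter_upwards [self_mem_nhdsWithin, mem_nhdsWithin_of_mem_nhds (Iic_mem_nhds (lt_add_one t))]
      with s h1 h2 using ⟨h1, h2⟩
  refine continuousWithinAt_of_dominated (bound := fun ξ => C * (1 + ξ ^ 2)⁻¹) ?_ ?_
    (integrable_inv_one_add_sq.const_mul C).integrableOn ?_
  · filter_upwards [hev] with s hs
    exact ((hu.continuous_momentum hs.1).sub continuous_const).aestronglyMeasurable
  · filter_upwards [hev] with s hs
    exact Eventually.of_forall fun ξ => hC s hs ξ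
  · exact Eventually.of_forall fun ξ =>
      ((hu.continuousOn_momentum_time ξ) t ht).sub continuousWithinAt_const

/-- Monotonicity in x turns inequalities for the position into inequalities for the label at a fixed
x, and the latter is continuous in t. -/
theorem continuousOn_position_time (hu : IsCauchySolution u₀ u)
    (hpos : ∀ x, 0 < u₀ x - iteratedDeriv 2 u₀ x) (y : ℝ) :
    ContinuousOn (fun t => position u y t) (Ici 0) := by
  intro t ht
  have ht' : 0 ≤ t := ht
  have key : ∀ x s, 0 ≤ s → (label u x s < y ↔ x < position u y s) := fun x s hs => by
    rw [← (hu.strictMono_label hpos hs).lt_iff_lt (a := x), hu.label_position hpos hs]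
  have key' : ∀ x s, 0 ≤ s → (y < label u x s ↔ position u y s < x) := fun x s hs => by
    rw [← (hu.strictMono_label hpos hs).lt_iff_lt (b := x), hu.label_position hpos hs]
  refine tendsto_order.2 ⟨fun x hx => ?_, fun x hx => ?_⟩
  · have h1 := (hu.continuousOn_label_time x t ht).eventually (gt_mem_nhds ((key x t ht').2 hx))
    filter_upwards [h1, self_mem_nhdsWithin] with s h2 h3 using (key x s h3).1 h2
  · have h1 := (hu.continuousOn_label_time x t ht).eventually (lt_mem_nhds ((key' x t ht').2 hx))
    filter_upwards [h1, self_mem_nhdsWithin] with s h2 h3 using (key' x s h3).1 h2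

theorem continuousAt_position_time (hu : IsCauchySolution u₀ u)
    (hpos : ∀ x, 0 < u₀ x - iteratedDeriv 2 u₀ x) (y : ℝ) {t : ℝ} (ht : 0 < t) :
    ContinuousAt (fun t => position u y t) t :=
  (hu.continuousOn_position_time hpos y).continuousAt (Ici_mem_nhds ht)

/-- Continuity of the time derivative of the momentum. -/
theorem continuousOn_momentumDt (hu : IsCauchySolution u₀ u) :
    ContinuousOn (fun p : ℝ × ℝ => -(2 * dx u p.1 p.2 * momentum u p.1 p.2 ^ 2 +
      speed u p.1 p.2 * momentumDx u p.1 p.2)) (univ ×ˢ Ici 0) :=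
  (((continuousOn_const.mul hu.continuousOn_dx).mul (hu.continuousOn_momentum.pow 2)).add
    (hu.continuousOn_speed.mul hu.continuousOn_momentumDx)).neg

theorem hasDerivAt_integral_momentum_time (hu : IsCauchySolution u₀ u) (a b : ℝ) {t : ℝ}
    (ht : 0 < t) : HasDerivAt (fun s => ∫ ξ in a..b, (momentum u ξ s - 1))
      (speed u a t * momentum u a t - speed u b t * momentum u b t) t := by
  set F' : ℝ → ℝ → ℝ := fun s ξ => -(2 * dx u ξ s * momentum u ξ s ^ 2 +
      speed u ξ s * momentumDx u ξ s) with hF'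
  have hc : ∀ s, 0 ≤ s → Continuous (F' s) := fun s hs => by
    rw [← continuousOn_univ]
    exact hu.continuousOn_momentumDt.comp (f := fun ξ : ℝ => (ξ, s)) (by fun_prop)
      fun ξ _ => ⟨mem_univ _, hs⟩
  obtain ⟨C, hC⟩ := (isCompact_uIcc.prod (isCompact_Icc (a := t / 2) (b := t + 1))).exists_bound_of_continuousOn
    (hu.continuousOn_momentumDt.mono (t := uIcc a b ×ˢ Icc (t / 2) (t + 1))
      fun p hp => ⟨mem_univ _, (half_pos ht).le.trans hp.2.1⟩)
  have h := intervalIntegral.hasDerivAt_integral_of_dominated_loc_of_deriv_le (a := a) (b := b)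
    (μ := volume) (F := fun s ξ => momentum u ξ s - 1) (F' := F') (x₀ := t)
    (s := Icc (t / 2) (t + 1)) (bound := fun _ => C)
    (Icc_mem_nhds (by linarith) (by linarith))
    (by
      filter_upwards [lt_mem_nhds ht] with s hs
      exact ((hu.continuous_momentum (le_of_lt hs)).sub continuous_const).aestronglyMeasurable)
    (((hu.continuous_momentum ht.le).sub continuous_const).intervalIntegrable _ _)
    (hc t ht.le).aestronglyMeasurable
    (Eventually.of_forall fun ξ hξ s hs => hC (ξ, s) ⟨uIoc_subset_uIcc hξ, hs⟩)
    intervalIntegrable_const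
    (Eventually.of_forall fun ξ hξ s hs =>
      (hu.hasDerivAt_momentum_time (lt_of_lt_of_le (by linarith) hs.1) ξ).sub_const 1)
  refine h.2.congr_deriv ?_
  rw [intervalIntegral.integral_eq_sub_of_hasDerivAt
    (f := fun ξ => -(speed u ξ t * momentum u ξ t))
    (fun ξ _ => (hu.hasDerivAt_speed_mul ht.le ξ).fun_neg) ((hc t ht.le).intervalIntegrable _ _)]
  ring

theorem exists_abs_speed_mul_sub_one_le (hu : IsCauchySolution u₀ u) {T : ℝ} (hT : 0 < T) :
    ∃ K, ∀ t ∈ Icc 0 T, ∀ x, |speed u x t * momentum u x t - 1| ≤ K / (x ^ 2 + 4) := by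
  obtain ⟨C, hC0, hC⟩ := hu.exists_decay hT
  refine ⟨4 * C * ((2 + 2 * C) * (1 + C) + 1), fun t ht x => ?_⟩
  obtain ⟨h1, h2, h3⟩ := hC t ht x
  set e := 4 * C / (x ^ 2 + 4) with he
  have hx : (0 : ℝ) < x ^ 2 + 4 := by positivity
  have heC : e ≤ C := by
    rw [he, div_le_iff₀ hx]
    nlinarith [mul_nonneg hC0 (sq_nonneg x)]
  have he0 : 0 ≤ e := by positivity
  have h2' : |u x t - 1| ≤ e := h2.trans (by rw [he]; gcongr; linarith)
  have h3' : |dx u x t| ≤ e := h3.trans (by rw [he]; gcongr; linarith)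
  have h1' : |momentum u x t - 1| ≤ e := h1.trans (by
    rw [he, div_le_div_iff₀ (by positivity) hx]
    have h := abs_nonneg x
    have : x ^ 2 + 4 ≤ 4 * (1 + |x|) ^ 4 := by
      rw [← sq_abs]
      nlinarith [pow_nonneg h 3, pow_nonneg h 4, pow_nonneg h 2]
    nlinarith)
  have e1 : speed u x t * momentum u x t - 1 =
      ((u x t - 1) * (2 + (u x t - 1)) - dx u x t * dx u x t) * (1 + (momentum u x t - 1)) +
        (momentum u x t - 1) := by
    rw [speed]; ring
  have e2 : |(u x t - 1) * (2 + (u x t - 1))| ≤ e * (2 + C) := by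
    rw [abs_mul]
    refine mul_le_mul h2' ((abs_add_le _ _).trans ?_) (abs_nonneg _) he0
    rw [abs_two]
    linarith
  have e3 : |dx u x t * dx u x t| ≤ e * C := by
    rw [abs_mul]
    exact mul_le_mul h3' (h3'.trans heC) (abs_nonneg _) he0
  have e4 : |1 + (momentum u x t - 1)| ≤ 1 + C := (abs_add_le _ _).trans (by
    rw [abs_one]; linarith)
  rw [e1]
  calc _ ≤ (e * (2 + C) + e * C) * (1 + C) + e := by
        refine (abs_add_le _ _).trans (add_le_add ?_ h1')
        rw [abs_mul]
        exact mul_le_mul ((abs_sub _ _).trans (add_le_add e2 e3)) e4 (abs_nonneg _) (by positivity)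
    _ = _ := by rw [he]; ring

/-- No decay of m_t is assumed, so differentiation takes place over [x, R], where the conservation
law leaves only boundary terms. These converge uniformly in time as R → ∞, since the flux tends to
1; the term -t in the label cancels this limit. -/
theorem hasDerivAt_label_time (hu : IsCauchySolution u₀ u) (x : ℝ) {t : ℝ} (ht : 0 < t) :
    HasDerivAt (fun s => label u x s) (-(speed u x t * momentum u x t)) t := by
  obtain ⟨K, hK⟩ := hu.exists_abs_speed_mul_sub_one_le (T := t + 1) (by linarith)
  have hunif : TendstoUniformlyOn
      (fun R s => speed u x s * momentum u x s - speed u R s * momentum u R s)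
      (fun s => speed u x s * momentum u x s - 1) atTop (Ioo 0 (t + 1)) := by
    rw [Metric.tendstoUniformlyOn_iff]
    intro ε hε
    have hlim : Tendsto (fun R : ℝ => K / (R ^ 2 + 4)) atTop (𝓝 0) :=
      tendsto_const_nhds.div_atTop
        (tendsto_atTop_add_const_right _ _ (tendsto_pow_atTop two_ne_zero))
    filter_upwards [hlim.eventually (gt_mem_nhds hε)] with R hR s hs
    rw [Real.dist_eq, sub_sub_sub_cancel_left]
    exact (hK s ⟨hs.1.le, hs.2.le⟩ R).trans_lt hR
  have h := hasDerivAt_of_tendstoUniformlyOn (g := fun s => ∫ ξ in Ioi x, (momentum u ξ s - 1))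
    (f := fun R s => ∫ ξ in x..R, (momentum u ξ s - 1)) isOpen_Ioo hunif
    (Eventually.of_forall fun R s hs => hu.hasDerivAt_integral_momentum_time x R hs.1)
    (fun s hs => intervalIntegral_tendsto_integral_Ioi x
      (hu.integrable_momentum_sub_one hs.1.le).integrableOn tendsto_id)
    (x := t) ⟨ht, by linarith⟩
  refine (((hasDerivAt_id t).const_sub x).fun_sub h).congr_deriv ?_
  ring

end IsCauchySolution

end MCH
end

/-! ### Time derivatives along Lagrangian trajectories and the evolution of the potential -/

noncomputable section
namespace MCH

theorem hasFDerivAt_of_partial {f f₁ f₂ : ℝ → ℝ → ℝ}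
    (h₁ : ∀ x t, 0 < t → HasDerivAt (fun z => f z t) (f₁ x t) x)
    (h₂ : ∀ x t, 0 < t → HasDerivAt (fun s => f x s) (f₂ x t) t)
    (c₁ : ContinuousOn (fun p : ℝ × ℝ => f₁ p.1 p.2) (univ ×ˢ Ici 0))
    (c₂ : ContinuousOn (fun p : ℝ × ℝ => f₂ p.1 p.2) (univ ×ˢ Ici 0)) (x : ℝ) {t : ℝ} (ht : 0 < t) :
    HasFDerivAt (fun p : ℝ × ℝ => f p.1 p.2)
      (f₁ x t • ContinuousLinearMap.fst ℝ ℝ ℝ + f₂ x t • ContinuousLinearMap.snd ℝ ℝ ℝ) (x, t) := by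
  have hn : ∀ᶠ p : ℝ × ℝ in 𝓝 (x, t), 0 < p.2 := continuous_snd.continuousAt.eventually (lt_mem_nhds ht)
  have hm : (univ ×ˢ Ici 0 : Set (ℝ × ℝ)) ∈ 𝓝 (x, t) := by
    filter_upwards [hn] with p hp using ⟨mem_univ _, hp.le⟩
  have h := hasStrictFDerivAt_uncurry_coprod (u := (x, t)) (f := f)
    (f₁ := fun x t => ContinuousLinearMap.toSpanSingleton ℝ (f₁ x t))
    (f₂ := fun x t => ContinuousLinearMap.toSpanSingleton ℝ (f₂ x t))
    (by filter_upwards [hn] with p hp using (h₁ p.1 p.2 hp).hasFDerivAt)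
    (by filter_upwards [hn] with p hp using (h₂ p.1 p.2 hp).hasFDerivAt)
    ((ContinuousLinearMap.toSpanSingletonCLE (𝕜 := ℝ) (E := ℝ)).continuous.continuousAt.comp
      (c₁.continuousAt hm))
    ((ContinuousLinearMap.toSpanSingletonCLE (𝕜 := ℝ) (E := ℝ)).continuous.continuousAt.comp
      (c₂.continuousAt hm))
  refine h.hasFDerivAt.congr_fderiv ?_
  ext <;> simp [Function.HasUncurry.uncurry]

namespace IsCauchySolution

variable {u₀ : ℝ → ℝ} {u : ℝ → ℝ → ℝ}

/-- The map (x, t) ↦ (Y(x, t), t) is differentiable with invertible derivative, and its inverse is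
already known to be continuous along the trajectory. Hence X_t = -Y_t/Y_x, which is u² - u_x². -/
theorem hasDerivAt_position_time (hu : IsCauchySolution u₀ u)
    (hpos : ∀ x, 0 < u₀ x - iteratedDeriv 2 u₀ x) (y : ℝ) {t : ℝ} (ht : 0 < t) :
    HasDerivAt (fun s => position u y s) (speed u (position u y t) t) t := by
  set x := position u y t with hx
  have hm : momentum u x t ≠ 0 := (hu.momentum_pos hpos ht.le x).ne'
  have h1 := hasFDerivAt_of_partial (fun x t ht => hu.hasDerivAt_label ht.le x)
    (fun x t ht => hu.hasDerivAt_label_time x ht) hu.continuousOn_momentum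
    (hu.continuousOn_speed.mul hu.continuousOn_momentum).neg x ht
  have h2 := h1.prodMk (hasFDerivAt_snd (𝕜 := ℝ) (p := (x, t)))
  have h3 : HasFDerivAt (fun s : ℝ => (y, s)) (ContinuousLinearMap.inr ℝ ℝ ℝ) t :=
    hasFDerivAt_prodMk_right y t
  have h4 := HasFDerivAt.of_comp_of_leftInverse (g := fun s => (position u y s, s)) (a := t)
    (f'symm := ((momentum u x t)⁻¹ • ContinuousLinearMap.fst ℝ ℝ ℝ +
      speed u x t • ContinuousLinearMap.snd ℝ ℝ ℝ).prod (ContinuousLinearMap.snd ℝ ℝ ℝ))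
    ((hu.continuousAt_position_time hpos y ht).prodMk continuousAt_id) h2 h3
    (by
      filter_upwards [lt_mem_nhds ht] with s hs
      simp only [Function.comp_apply, hu.label_position hpos (le_of_lt hs)])
    (fun p => by
      refine Prod.ext ?_ ?_
      · simp
        field_simp
        ring
      · simp)
  exact (HasFDerivAt.fst h4).hasDerivAt.congr_deriv (by simp)

/-- The transport term (u² - u_x²) m_x is cancelled by the motion of the point; only -m (u² -
u_x²)_x remains. -/
theorem hasDerivAt_momentum_position (hu : IsCauchySolution u₀ u)
    (hpos : ∀ x, 0 < u₀ x - iteratedDeriv 2 u₀ x) (y : ℝ) {t : ℝ} (ht : 0 < t) :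
    HasDerivAt (fun s => momentum u (position u y s) s)
      (-2 * dx u (position u y t) t * momentum u (position u y t) t ^ 2) t := by
  have h1 := hasFDerivAt_of_partial (fun x t ht => hu.hasDerivAt_momentum ht.le x)
    (fun x t ht => hu.hasDerivAt_momentum_time ht x) hu.continuousOn_momentumDx
    hu.continuousOn_momentumDt (position u y t) ht
  have h2 := h1.comp_hasDerivAt (f := fun s => (position u y s, s)) t ((hu.hasDerivAt_position_time hpos y ht).prodMk
    (hasDerivAt_id' t))
  refine h2.congr_deriv ?_
  simp
  ring

end IsCauchySolution

/-- The potential of the spatial Lax equation in Lagrangian coordinates. -/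
def potential (u : ℝ → ℝ → ℝ) (t y : ℝ) : ℝ := 1 - (momentum u (position u y t) t)⁻¹

/-- The label stays at bounded distance from the position, so decay in x becomes decay in y.
Fourth-order decay of m - 1 is more than enough for the weight (1 + |y|)(1 + y²). -/
theorem one_add_sq_le {x y K : ℝ} (hK : 0 ≤ K) (h : |y - x| ≤ K) :
    1 + y ^ 2 ≤ 2 * (1 + K) ^ 3 * (x ^ 2 + 4) ∧
      (1 + |y|) * (1 + y ^ 2) ≤ 2 * (1 + K) ^ 3 * (1 + |x|) ^ 4 := by
  have hx := abs_nonneg x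
  have hy := abs_nonneg y
  have h1 : 1 + |y| ≤ (1 + K) * (1 + |x|) := by
    have : |y| ≤ |y - x| + |x| := by simpa using abs_add_le (y - x) x
    nlinarith
  have h2 : (1 + |y|) ^ 2 ≤ ((1 + K) * (1 + |x|)) ^ 2 := by gcongr
  have h3 : (1 + |y|) ^ 3 ≤ ((1 + K) * (1 + |x|)) ^ 3 := by gcongr
  have h4 : (1 + K) ^ 2 ≤ (1 + K) ^ 3 := pow_le_pow_right₀ (by linarith) (by norm_num)
  have h5 : (1 + |x|) ^ 3 ≤ (1 + |x|) ^ 4 := pow_le_pow_right₀ (by linarith) (by norm_num)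
  rw [← sq_abs y, ← sq_abs x]
  constructor
  · calc 1 + |y| ^ 2 ≤ (1 + |y|) ^ 2 := by nlinarith
      _ ≤ ((1 + K) * (1 + |x|)) ^ 2 := h2
      _ = (1 + K) ^ 2 * (1 + |x|) ^ 2 := by ring
      _ ≤ (1 + K) ^ 3 * (2 * (|x| ^ 2 + 4)) := by
        gcongr
        nlinarith [sq_nonneg (|x| - 1)]
      _ = _ := by ring
  · calc (1 + |y|) * (1 + |y| ^ 2) ≤ (1 + |y|) ^ 3 := by nlinarith
      _ ≤ ((1 + K) * (1 + |x|)) ^ 3 := h3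
      _ = (1 + K) ^ 3 * (1 + |x|) ^ 3 := by ring
      _ ≤ (1 + K) ^ 3 * (1 + |x|) ^ 4 := by gcongr
      _ ≤ _ := by nlinarith [show 0 ≤ (1 + K) ^ 3 * (1 + |x|) ^ 4 by positivity]

namespace IsCauchySolution

variable {u₀ : ℝ → ℝ} {u : ℝ → ℝ → ℝ}

theorem contDiff_potential (hu : IsCauchySolution u₀ u)
    (hpos : ∀ x, 0 < u₀ x - iteratedDeriv 2 u₀ x) {t : ℝ} (ht : 0 ≤ t) :
    ContDiff ℝ 1 (potential u t) := by
  have hd : ∀ y, HasDerivAt (potential u t) (momentumDx u (position u y t) t *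
      (momentum u (position u y t) t)⁻¹ / momentum u (position u y t) t ^ 2) y := fun y => by
    have h1 : HasDerivAt (fun y => momentum u (position u y t) t) _ y :=
      (hu.hasDerivAt_momentum ht (position u y t)).comp y (hu.hasDerivAt_position hpos ht y)
    refine ((h1.fun_inv (hu.momentum_pos hpos ht _).ne').const_sub 1).congr_deriv ?_
    ring
  have hX := hu.continuous_position hpos ht
  have hm : Continuous fun y => momentum u (position u y t) t := (hu.continuous_momentum ht).comp hX
  have hm' : Continuous fun y => momentumDx u (position u y t) t := by
    rw [← continuousOn_univ]
    exact hu.continuousOn_momentumDx.comp (f := fun y : ℝ => (position u y t, t))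
      (by fun_prop) fun ξ _ => ⟨mem_univ _, ht⟩
  have hne : ∀ y, momentum u (position u y t) t ≠ 0 := fun y => (hu.momentum_pos hpos ht _).ne'
  rw [contDiff_one_iff_deriv]
  refine ⟨fun y => (hd y).differentiableAt, ?_⟩
  rw [funext fun y => (hd y).deriv]
  exact (hm'.mul (hm.inv₀ hne)).div (hm.pow 2) fun y => pow_ne_zero 2 (hne y)

theorem isEvolution (hu : IsCauchySolution u₀ u) (hpos : ∀ x, 0 < u₀ x - iteratedDeriv 2 u₀ x) :
    IsEvolution 1 (potential u) (fun t y => u (position u y t) t)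
      (fun t y => dx u (position u y t) t) where
  contDiff t ht := hu.contDiff_potential hpos ht
  bound T hT := by
    obtain ⟨C, hC0, hC⟩ := hu.exists_decay hT
    obtain ⟨δ, hδ, hm⟩ := hu.exists_momentum_ge hpos hT
    obtain ⟨K, hK0, hK⟩ := hu.exists_abs_label_sub_le hT
    refine ⟨C * (1 + δ⁻¹) * (2 * (1 + K) ^ 3), fun t ht y => ?_⟩
    set x := position u y t with hx
    have hyx : |y - x| ≤ K := by
      have := hK t ht x
      rwa [hx, hu.label_position hpos ht.1] at this
    obtain ⟨g1, g2⟩ := one_add_sq_le hK0 hyx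
    obtain ⟨d1, d2, d3⟩ := hC t ht x
    have hmx := hm t ht x
    have key : ∀ a, |a| ≤ C / (x ^ 2 + 4) →
        |a| ≤ C * (1 + δ⁻¹) * (2 * (1 + K) ^ 3) * (1 + y ^ 2)⁻¹ := fun a ha => by
      refine ha.trans ?_
      rw [← div_eq_mul_inv, div_le_div_iff₀ (by positivity) (by positivity)]
      calc C * (1 + y ^ 2) ≤ C * (2 * (1 + K) ^ 3 * (x ^ 2 + 4)) := by gcongr
        _ = C * 1 * (2 * (1 + K) ^ 3) * (x ^ 2 + 4) := by ring
        _ ≤ _ := by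
          gcongr
          exact le_add_of_nonneg_right (by positivity)
    refine ⟨?_, key _ d2, key _ d3⟩
    have e1 : potential u t y = (momentum u x t - 1) * (momentum u x t)⁻¹ := by
      rw [potential, ← hx, sub_mul, mul_inv_cancel₀ (hδ.trans_le hmx).ne', one_mul]
    have e2 : |potential u t y| ≤ C / (1 + |x|) ^ 4 * δ⁻¹ := by
      rw [e1, abs_mul, abs_inv, abs_of_pos (hδ.trans_le hmx)]
      have : 0 ≤ (momentum u x t)⁻¹ := (inv_pos.2 (hδ.trans_le hmx)).le
      gcongr
    rw [← div_eq_mul_inv, le_div_iff₀ (by positivity)]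
    calc (1 + |y|) * |potential u t y| * (1 + y ^ 2)
        = (1 + |y|) * (1 + y ^ 2) * |potential u t y| := by ring
      _ ≤ 2 * (1 + K) ^ 3 * (1 + |x|) ^ 4 * (C / (1 + |x|) ^ 4 * δ⁻¹) := by gcongr
      _ = C * δ⁻¹ * (2 * (1 + K) ^ 3) := by field_simp
      _ ≤ _ := by
        gcongr
        linarith
  hasDerivAt_u t ht y := by
    refine ((hu.hasDerivAt_u ht (position u y t)).comp y
      (hu.hasDerivAt_position hpos ht y)).congr_deriv ?_
    rw [potential]
    ring
  hasDerivAt_w t ht y := by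
    refine ((hu.hasDerivAt_dx ht (position u y t)).comp y
      (hu.hasDerivAt_position hpos ht y)).congr_deriv ?_
    rw [potential, sub_mul, mul_inv_cancel₀ (hu.momentum_pos hpos ht _).ne']
    ring
  hasDerivAt_q t ht y := by
    have hm := (hu.momentum_pos hpos ht.le (position u y t)).ne'
    refine (((hu.hasDerivAt_momentum_position hpos y ht).fun_inv hm).const_sub 1).congr_deriv ?_
    field_simp
  tendsto_q y := by
    have h1 : ContinuousWithinAt (fun s => momentum u (position u y s) s) (Ici 0) 0 :=
      hu.continuousOn_momentum.comp (f := fun s : ℝ => (position u y s, s))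
        ((hu.continuousOn_position_time hpos y).prodMk continuousOn_id)
        (fun s hs => ⟨mem_univ _, hs⟩) 0 self_mem_Ici
    exact ((h1.inv₀ (hu.momentum_pos hpos le_rfl _).ne').const_sub 1).mono_left
      (nhdsWithin_mono _ Ioi_subset_Ici_self)

/-- Both sides have y-derivative -q and vanish as y → ∞. -/
theorem position_sub_eq (hu : IsCauchySolution u₀ u)
    (hpos : ∀ x, 0 < u₀ x - iteratedDeriv 2 u₀ x) {t : ℝ} (ht : 0 ≤ t) (y : ℝ) :
    position u y t - t - y = ∫ η in Ioi y, potential u t η := by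
  have hq := (hu.isEvolution hpos).isPotential ht
  set G : ℝ → ℝ := fun y => position u y t - t - y - ∫ η in Ioi y, potential u t η with hG
  have hd : ∀ y, HasDerivAt G 0 y := fun y => by
    refine ((((hu.hasDerivAt_position hpos ht y).sub_const t).fun_sub (hasDerivAt_id y)).fun_sub
      (hasDerivAt_integral_Ioi hq.contDiff.continuous hq.integrable y)).congr_deriv ?_
    rw [potential]
    ring
  have hconst : ∀ z, G z = G y := fun z => is_const_of_deriv_eq_zero
    (fun y => (hd y).differentiableAt) (fun y => (hd y).deriv) z y
  have hX : Tendsto (fun y => position u y t) atTop atTop := by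
    obtain ⟨K, -, hK⟩ := hu.exists_abs_label_sub_le (T := t + 1) (by linarith)
    refine tendsto_atTop_mono (f := fun x => x + -K) (fun y => ?_)
      (tendsto_atTop_add_const_right _ _ tendsto_id)
    have := hK t ⟨ht, by linarith⟩ (position u y t)
    rw [hu.label_position hpos ht] at this
    linarith [(abs_le.1 this).2]
  have h1 : ∀ z, position u z t - t - z = ∫ ξ in Ioi (position u z t), (momentum u ξ t - 1) :=
    fun z => by
      have := hu.label_position hpos ht z
      rw [label] at this
      linarith
  have hlim : Tendsto G atTop (𝓝 (0 - 0)) := by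
    refine Tendsto.sub ?_ (tendsto_integral_Ioi_atTop hq.integrable)
    simp only [h1]
    exact (tendsto_integral_Ioi_atTop (hu.integrable_momentum_sub_one ht)).comp hX
  have h2 : G y = 0 := by
    rw [sub_zero, tendsto_congr hconst] at hlim
    exact tendsto_nhds_unique tendsto_const_nhds hlim
  exact sub_eq_zero.1 h2

end IsCauchySolution

end MCH
end

noncomputable section
namespace MCH

/-! ### Jost solutions in Lagrangian coordinates -/

/-- Substituting z = Z(ξ) turns the Volterra equation in x into the one in the Lagrangian
coordinate, and uniqueness applies. Only |Z'| = m is required, so that Z can be Y for solutions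
normalized at -∞ and -Y for those at +∞. The image is prescribed up to a null set because -Y maps
Ioi x onto an open half-line. -/
theorem IsPotential.eq_jost_of_change {p m : ℝ → ℝ} (hp : IsPotential p) {μ : ℂ} (h : 0 ≤ μ.im)
    (h0 : μ ≠ 0) {Z Z' W : ℝ → ℝ} (hZ : ∀ x, HasDerivAt Z (Z' x) x) (hm : ∀ x, |Z' x| = m x)
    (hW : Continuous W) (hZW : ∀ z, Z (W z) = z) (hWZ : ∀ x, W (Z x) = x) {s : ℝ → Set ℝ}
    (hs : ∀ x, MeasurableSet (s x)) (himage : ∀ x, Z '' s x =ᵐ[volume] Iic (Z x)) {φ : ℝ → ℂ × ℂ}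
    (hφ : Continuous φ) (hb : ∃ C, ∀ x, ‖φ x‖ ≤ C)
    (heq : ∀ x, φ x = (1, 0) + ∫ ξ in s x, m ξ • jostKernel p μ (Z x) (Z ξ) (φ ξ)) (x : ℝ) :
    φ x = jost p μ (Z x) := by
  obtain ⟨C, hC⟩ := hb
  have key : ∀ x, (∫ ξ in Iic (Z x), jostKernel p μ (Z x) ξ (φ (W ξ))) =
      ∫ ξ in s x, m ξ • jostKernel p μ (Z x) (Z ξ) (φ ξ) := fun x => by
    rw [← setIntegral_congr_set (himage x), integral_image_eq_integral_abs_deriv_smul (hs x)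
      (fun ξ _ => (hZ ξ).hasDerivWithinAt) (Function.LeftInverse.injective hWZ).injOn]
    simp only [hm, hWZ]
  have := hp.eq_jost h h0 (φ := fun z => φ (W z)) (x₀ := Z x) (x := Z x) (hφ.comp hW).continuousOn
    ⟨C, fun ξ _ => hC _⟩ (fun z _ => by
      have h1 := heq (W z)
      rwa [← key, hZW] at h1) le_rfl
  rwa [hWZ] at this

/-- The momentum profile `m` corresponds to the potential `q` under the change of variables `Y`
with inverse `X`. -/
structure IsLagrangian (m q Y X : ℝ → ℝ) : Prop where
  isPotential : IsPotential q
  pos : ∀ x, 0 < m x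
  continuous : Continuous m
  hasDerivAt : ∀ x, HasDerivAt Y (m x) x
  continuous_inv : Continuous X
  right_inv : ∀ y, Y (X y) = y
  left_inv : ∀ x, X (Y x) = x
  potential_eq : ∀ x, q (Y x) = 1 - (m x)⁻¹

namespace IsLagrangian

variable {m q Y X : ℝ → ℝ}

theorem strictMono (h : IsLagrangian m q Y X) : StrictMono Y :=
  strictMono_of_deriv_pos fun x => by
    rw [(h.hasDerivAt x).deriv]
    exact h.pos x

theorem phaseDiff_eq (h : IsLagrangian m q Y X) (μ : ℂ) (x ξ : ℝ) :
    phaseDiff m μ x ξ = phaseCoeff μ * ((Y ξ : ℂ) - Y x) := by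
  rw [phaseDiff, intervalIntegral.integral_eq_sub_of_hasDerivAt (fun x _ => h.hasDerivAt x)
    (h.continuous.intervalIntegrable _ _), Complex.ofReal_sub]

/-- The factor m is the Jacobian of the change of variables; what is left of m - 1 is the potential
q. -/
theorem sub_one_eq (h : IsLagrangian m q Y X) (x : ℝ) : (m x : ℂ) - 1 = m x * q (Y x) := by
  rw [h.potential_eq]
  have := (h.pos x).ne'
  push_cast
  rw [mul_sub, mul_inv_cancel₀ (by exact_mod_cast this), mul_one]

theorem volterraIntegrand_zero (h : IsLagrangian m q Y X) (μ : ℂ) (φ : ℝ → Fin 2 → ℂ) (x ξ : ℝ) :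
    volterraIntegrand m μ 0 φ x ξ =
      ![m ξ * q (Y ξ) * (-coefB μ * φ ξ 0 + coefA μ * φ ξ 1),
        m ξ * q (Y ξ) * (Complex.exp (2 * phaseCoeff μ * ((Y x : ℂ) - Y ξ)) *
          (-coefA μ * φ ξ 0 + coefB μ * φ ξ 1))] := by
  have e1 : Complex.exp (2 * phaseCoeff μ * ((Y x : ℂ) - Y ξ)) =
      Complex.exp (-(phaseDiff m μ x ξ)) * Complex.exp (-(phaseDiff m μ x ξ)) := by
    rw [← Complex.exp_add, h.phaseDiff_eq]
    ring_nf
  have e2 : Complex.exp (-(phaseDiff m μ x ξ)) * Complex.exp (phaseDiff m μ x ξ) = 1 := by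
    rw [← Complex.exp_add, neg_add_cancel, Complex.exp_zero]
  rw [e1, ← h.sub_one_eq]
  funext i
  fin_cases i
  · simp [volterraIntegrand, expSigma3, lax, coefA, coefB, dotProduct]
    linear_combination (Complex.I * (μ ^ 2 + 1) * ((m ξ : ℂ) - 1) / (2 * (μ ^ 2 - 1)) * φ ξ 1 -
      (Complex.I * μ * ((m ξ : ℂ) - 1) / (μ ^ 2 - 1)) * φ ξ 0) * e2
  · simp [volterraIntegrand, expSigma3, lax, coefA, coefB, dotProduct]
    ring

theorem volterraIntegrand_one (h : IsLagrangian m q Y X) (μ : ℂ) (φ : ℝ → Fin 2 → ℂ) (x ξ : ℝ) :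
    volterraIntegrand m μ 1 φ x ξ =
      ![m ξ * q (Y ξ) * (Complex.exp (2 * phaseCoeff μ * ((Y ξ : ℂ) - Y x)) *
          (-coefB μ * φ ξ 0 + coefA μ * φ ξ 1)),
        m ξ * q (Y ξ) * (-coefA μ * φ ξ 0 + coefB μ * φ ξ 1)] := by
  have e1 : Complex.exp (2 * phaseCoeff μ * ((Y ξ : ℂ) - Y x)) =
      Complex.exp (phaseDiff m μ x ξ) * Complex.exp (phaseDiff m μ x ξ) := by
    rw [← Complex.exp_add, h.phaseDiff_eq]
    ring_nf
  have e2 : Complex.exp (-(phaseDiff m μ x ξ)) * Complex.exp (phaseDiff m μ x ξ) = 1 := by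
    rw [← Complex.exp_add, neg_add_cancel, Complex.exp_zero]
  rw [e1, ← h.sub_one_eq]
  funext i
  fin_cases i
  · simp [volterraIntegrand, expSigma3, lax, coefA, coefB, dotProduct]
    ring
  · simp [volterraIntegrand, expSigma3, lax, coefA, coefB, dotProduct]
    linear_combination (-(Complex.I * (μ ^ 2 + 1) * ((m ξ : ℂ) - 1) / (2 * (μ ^ 2 - 1))) * φ ξ 0 +
      (Complex.I * μ * ((m ξ : ℂ) - 1) / (μ ^ 2 - 1)) * φ ξ 1) * e2

theorem image_Iic (h : IsLagrangian m q Y X) (x : ℝ) : Y '' Iic x = Iic (Y x) := by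
  ext y
  constructor
  · rintro ⟨ξ, hξ, rfl⟩
    exact h.strictMono.monotone hξ
  · intro hy
    refine ⟨X y, ?_, h.right_inv y⟩
    rw [mem_Iic, ← h.strictMono.le_iff_le, h.right_inv]
    exact hy

theorem image_neg_Ioi (h : IsLagrangian m q Y X) (x : ℝ) : (fun ξ => -Y ξ) '' Ioi x = Iio (-Y x) := by
  ext y
  constructor
  · rintro ⟨ξ, hξ, rfl⟩
    exact neg_lt_neg (h.strictMono hξ)
  · intro hy
    refine ⟨X (-y), ?_, by simp only [h.right_inv, neg_neg]⟩
    rw [mem_Ioi, ← h.strictMono.lt_iff_lt, h.right_inv]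
    exact lt_neg.1 hy

/-- The real-linear equivalence e brings the column to the normalization (1, 0). Real linearity is
all that is required, so that e may include complex conjugation, as for the second column at real μ.
-/
theorem eq_jost_of_minus (h : IsLagrangian m q Y X) {μ : ℂ} (hμ : 0 ≤ μ.im) (h0 : μ ≠ 0) {j : Fin 2}
    {φ : ℝ → Fin 2 → ℂ} (hφ : IsJostMinus m μ j φ) (e : (Fin 2 → ℂ) ≃L[ℝ] ℂ × ℂ)
    (he : e (Pi.single j 1) = (1, 0))
    (hInt : ∀ x ξ, e (volterraIntegrand m μ j φ x ξ) =
      m ξ • jostKernel q μ (Y x) (Y ξ) (e (φ ξ))) (x : ℝ) : e (φ x) = jost q μ (Y x) := by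
  obtain ⟨hc, ⟨C, hC⟩, heq⟩ := hφ
  refine h.isPotential.eq_jost_of_change hμ h0 (φ := fun x => e (φ x)) (m := m) h.hasDerivAt
    (fun x => abs_of_pos (h.pos x)) h.continuous_inv h.right_inv h.left_inv (s := fun x => Iic x)
    (fun x => measurableSet_Iic) (fun x => (h.image_Iic x).eventuallyEq) (e.continuous.comp hc)
    ⟨‖(e : (Fin 2 → ℂ) →L[ℝ] ℂ × ℂ)‖ * C, fun x =>
      ((e : (Fin 2 → ℂ) →L[ℝ] ℂ × ℂ).le_opNorm _).trans
        (mul_le_mul_of_nonneg_left (hC x) (norm_nonneg _))⟩ (fun x => ?_) x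
  simp only [← hInt]
  rw [e.integral_comp_comm, ← he, ← map_add, ← heq]

theorem eq_jostRight_of_plus (h : IsLagrangian m q Y X) {μ : ℂ} (hμ : 0 ≤ μ.im) (h0 : μ ≠ 0)
    {j : Fin 2} {φ : ℝ → Fin 2 → ℂ} (hφ : IsJostPlus m μ j φ) (e : (Fin 2 → ℂ) ≃L[ℝ] ℂ × ℂ)
    (he : e (Pi.single j 1) = (1, 0))
    (hInt : ∀ x ξ, e (volterraIntegrand m μ j φ x ξ) =
      -(m ξ • jostKernel (fun y => q (-y)) μ (-Y x) (-Y ξ) (e (φ ξ)))) (x : ℝ) :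
    e (φ x) = jostRight q μ (Y x) := by
  obtain ⟨hc, ⟨C, hC⟩, heq⟩ := hφ
  refine h.isPotential.reflect.eq_jost_of_change hμ h0 (φ := fun x => e (φ x)) (m := m)
    (W := fun y => X (-y)) (fun x => (h.hasDerivAt x).fun_neg)
    (fun x => by rw [abs_neg, abs_of_pos (h.pos x)]) (h.continuous_inv.comp continuous_neg)
    (fun y => by simp only [h.right_inv, neg_neg]) (fun x => by simp only [h.left_inv, neg_neg])
    (s := fun x => Ioi x) (fun x => measurableSet_Ioi)
    (fun x => by rw [h.image_neg_Ioi]; exact Iio_ae_eq_Iic) (e.continuous.comp hc)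
    ⟨‖(e : (Fin 2 → ℂ) →L[ℝ] ℂ × ℂ)‖ * C, fun x =>
      ((e : (Fin 2 → ℂ) →L[ℝ] ℂ × ℂ).le_opNorm _).trans
        (mul_le_mul_of_nonneg_left (hC x) (norm_nonneg _))⟩ (fun x => ?_) x
  have h1 : ∀ ξ, m ξ • jostKernel (fun y => q (-y)) μ (-Y x) (-Y ξ) (e (φ ξ)) =
      -e (volterraIntegrand m μ j φ x ξ) := fun ξ => by rw [hInt, neg_neg]
  simp only [h1]
  rw [integral_neg, e.integral_comp_comm, ← he, ← sub_eq_add_neg, ← map_sub, ← heq]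

/-- The components as a pair. -/
def pairEquiv : (Fin 2 → ℂ) ≃L[ℝ] ℂ × ℂ := ContinuousLinearEquiv.finTwoArrow ℝ ℂ

/-- The components in reverse order as a pair. -/
def swapEquiv : (Fin 2 → ℂ) ≃L[ℝ] ℂ × ℂ := pairEquiv.trans (ContinuousLinearEquiv.prodComm ℝ ℂ ℂ)

/-- The conjugate components in reverse order as a pair. -/
def conjSwapEquiv : (Fin 2 → ℂ) ≃L[ℝ] ℂ × ℂ :=
  swapEquiv.trans (Complex.conjCLE.prodCongr Complex.conjCLE)

theorem pairEquiv_apply (f : Fin 2 → ℂ) : pairEquiv f = (f 0, f 1) := rfl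

theorem swapEquiv_apply (f : Fin 2 → ℂ) : swapEquiv f = (f 1, f 0) := rfl

theorem conjSwapEquiv_apply (f : Fin 2 → ℂ) :
    conjSwapEquiv f = (starRingEnd ℂ (f 1), starRingEnd ℂ (f 0)) := rfl

theorem jostMinus_zero (h : IsLagrangian m q Y X) {μ : ℂ} (hμ : 0 ≤ μ.im) (h0 : μ ≠ 0)
    {φ : ℝ → Fin 2 → ℂ} (hφ : IsJostMinus m μ 0 φ) (x : ℝ) :
    φ x 0 = (jost q μ (Y x)).1 ∧ φ x 1 = (jost q μ (Y x)).2 := by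
  rw [← h.eq_jost_of_minus hμ h0 hφ pairEquiv (by simp [pairEquiv_apply]) (fun x ξ => by
    rw [h.volterraIntegrand_zero]
    refine Prod.ext ?_ ?_ <;> simp [pairEquiv_apply, jostKernel] <;> ring) x]
  exact ⟨rfl, rfl⟩

theorem jostPlus_one (h : IsLagrangian m q Y X) {μ : ℂ} (hμ : 0 ≤ μ.im) (h0 : μ ≠ 0)
    {φ : ℝ → Fin 2 → ℂ} (hφ : IsJostPlus m μ 1 φ) (x : ℝ) :
    φ x 0 = (jostRight q μ (Y x)).2 ∧ φ x 1 = (jostRight q μ (Y x)).1 := by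
  rw [← h.eq_jostRight_of_plus hμ h0 hφ swapEquiv (by simp [swapEquiv_apply]) (fun x ξ => by
    have e1 : Complex.exp (2 * phaseCoeff μ * (-(Y x : ℂ) - -(Y ξ : ℂ))) =
        Complex.exp (2 * phaseCoeff μ * ((Y ξ : ℂ) - Y x)) := by ring_nf
    rw [h.volterraIntegrand_one, ← e1]
    refine Prod.ext ?_ ?_ <;> simp [swapEquiv_apply, jostKernel] <;> ring) x]
  exact ⟨rfl, rfl⟩

theorem jostMinus_one (h : IsLagrangian m q Y X) {μ : ℝ} (h0 : μ ≠ 0)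
    {φ : ℝ → Fin 2 → ℂ} (hφ : IsJostMinus m μ 1 φ) (x : ℝ) :
    φ x 0 = starRingEnd ℂ (jost q μ (Y x)).2 ∧ φ x 1 = starRingEnd ℂ (jost q μ (Y x)).1 := by
  have hA : starRingEnd ℂ (coefA μ) = -coefA μ := by simp [coefA, div_eq_mul_inv, map_ofNat]
  have hB : starRingEnd ℂ (coefB μ) = -coefB μ := by simp [coefB, div_eq_mul_inv]
  have hθ : starRingEnd ℂ (phaseCoeff μ) = -phaseCoeff μ := by
    simp [phaseCoeff, div_eq_mul_inv, map_ofNat]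
  rw [← h.eq_jost_of_minus (μ := μ) (by simp) (by exact_mod_cast h0) hφ conjSwapEquiv
    (by simp [conjSwapEquiv_apply]) (fun x ξ => by
    have e1 : starRingEnd ℂ (Complex.exp (2 * phaseCoeff μ * ((Y ξ : ℂ) - Y x))) =
        Complex.exp (2 * phaseCoeff μ * ((Y x : ℂ) - Y ξ)) := by
      rw [← Complex.exp_conj]
      simp only [map_mul, map_sub, map_ofNat, hθ, Complex.conj_ofReal]
      ring_nf
    rw [h.volterraIntegrand_one]
    refine Prod.ext ?_ ?_ <;>
      simp only [conjSwapEquiv_apply, jostKernel, Matrix.cons_val_zero, Matrix.cons_val_one, map_mul,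
        map_add, map_neg, hA, hB, e1, Complex.conj_ofReal, mat2_apply, Prod.smul_mk,
        Complex.real_smul] <;> ring) x]
  simp [conjSwapEquiv_apply]

end IsLagrangian

end MCH
end

noncomputable section
namespace MCH

/-! ### Scattering data of the initial profile -/

theorem IsSingularityConstant.congr {a a' : ℂ → ℂ} {b : ℝ → ℂ} {c : ℝ}
    (h : IsSingularityConstant a b c) (ha : ∀ μ : ℂ, 0 < μ.im → a μ = a' μ) :
    IsSingularityConstant a' b c := by
  have hev : a =ᶠ[𝓝[{μ : ℂ | 0 < μ.im}] 1] a' := by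
    filter_upwards [self_mem_nhdsWithin] with μ hμ using ha μ hμ
  obtain ⟨γ, h1, h2⟩ := h
  refine ⟨γ, h1.congr' ?_, h2.imp id ?_⟩
  · filter_upwards [hev] with μ hμ
    rw [hμ]
  · rintro ⟨hγ, a₁, b₁, h3, h4, h5⟩
    exact ⟨hγ, a₁, b₁, h3.congr' hev, h4, h5⟩

/-- The inhomogeneous term of the Volterra equation rules out the zero solution. This yields δ_j ≠
0. -/
theorem IsJostPlus.ne_zero {m : ℝ → ℝ} {μ : ℂ} {j : Fin 2} {φ : ℝ → Fin 2 → ℂ}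
    (h : IsJostPlus m μ j φ) : φ ≠ 0 := by
  rintro rfl
  have h1 := congrFun (h.2.2 0) j
  have h2 : ∀ ξ, volterraIntegrand m μ j (0 : ℝ → Fin 2 → ℂ) 0 ξ = 0 := fun ξ => by
    simp [volterraIntegrand]
  simp [h2] at h1

theorem phaseHat_zero (y : ℝ) (μ : ℂ) : phaseHat y 0 μ = phaseCoeff μ * y := by
  simp [phaseHat]

namespace IsLagrangian

variable {m q Y X : ℝ → ℝ}

theorem wronskian_eq (h : IsLagrangian m q Y X) {a : ℂ → ℂ} {b : ℝ → ℂ} (hs : IsSpectralPair m a b)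
    (y : ℝ) {μ : ℂ} (hμ : 0 < μ.im) :
    a μ = wronskian (fun μ => jost q μ y) (fun μ => jostRight q μ y) μ := by
  obtain ⟨φm, φp, hm, hp, ha⟩ := hs.upper μ hμ
  obtain ⟨h1, h2⟩ := h.jostMinus_zero hμ.le (ne_of_im_pos hμ).1 hm (X y)
  obtain ⟨h3, h4⟩ := h.jostPlus_one hμ.le (ne_of_im_pos hμ).1 hp (X y)
  rw [ha (X y), Matrix.det_fin_two_of, h1, h2, h3, h4, h.right_inv, wronskian]
  ring

/-- The initial phase is θ times the label, that is p₀(X(y), μ) = p̂(y, 0, μ). The second column of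
the scattering relation at x = X(y) is then the asserted pair of equations. -/
theorem scattering_real (h : IsLagrangian m q Y X)
    (hY : ∀ x, Y x = x - ∫ ξ in Ioi x, (m ξ - 1)) {a : ℂ → ℂ} {b : ℝ → ℂ}
    (hs : IsSpectralPair m a b) (y : ℝ) {μ : ℝ} (h0 : μ ≠ 0) (h1 : μ ≠ 1) (h2 : μ ≠ -1) :
    (jostRight q μ y).2 = b μ * Complex.exp (-2 * phaseHat y 0 μ) * (jost q μ y).1 +
        a μ * starRingEnd ℂ (jost q μ y).2 ∧
      (jostRight q μ y).1 = b μ * Complex.exp (-2 * phaseHat y 0 μ) * (jost q μ y).2 +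
        a μ * starRingEnd ℂ (jost q μ y).1 := by
  obtain ⟨Φp, Φm, hp, hm, hsc⟩ := hs.scattering μ h0 h1 h2
  have h0' : (μ : ℂ) ≠ 0 := by exact_mod_cast h0
  obtain ⟨e1, e2⟩ := h.jostMinus_zero (μ := μ) (by simp) h0' (hm 0) (X y)
  obtain ⟨e3, e4⟩ := h.jostMinus_one h0 (hm 1) (X y)
  obtain ⟨e5, e6⟩ := h.jostPlus_one (μ := μ) (by simp) h0' (hp 1) (X y)
  have hph : phaseZero m (X y) μ = phaseHat y 0 μ := by
    rw [phaseHat_zero, phaseZero, ← hY, h.right_inv]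
  rw [h.right_inv] at e1 e2 e3 e4 e5 e6
  have g := hsc (X y)
  rw [hph] at g
  have g0 := congrFun (congrFun g 0) 1
  have g1 := congrFun (congrFun g 1) 1
  have x1 : Complex.exp (-2 * phaseHat y 0 μ) =
      Complex.exp (-phaseHat y 0 μ) * Complex.exp (-phaseHat y 0 μ) := by
    rw [← Complex.exp_add]
    ring_nf
  have x2 : Complex.exp (-phaseHat y 0 μ) * Complex.exp (phaseHat y 0 μ) = 1 := by
    rw [← Complex.exp_add, neg_add_cancel, Complex.exp_zero]
  simp only [Matrix.mul_apply, Fin.sum_univ_two, expSigma3, Matrix.of_apply, Matrix.cons_val',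
    Matrix.cons_val_zero, Matrix.cons_val_one, Matrix.cons_val_fin_one, neg_neg] at g0 g1
  rw [e5, e1, e3] at g0
  rw [e6, e2, e4] at g1
  rw [x1]
  constructor
  · rw [g0]
    linear_combination (starRingEnd ℂ (jost q μ y).2 * a μ) * x2
  · rw [g1]
    linear_combination (starRingEnd ℂ (jost q μ y).1 * a μ) * x2

/-- On the real line a enters only through the scattering relation. Inserting that relation into the
Wronskian cancels the terms with b and leaves a (|J₁|² - |J₂|²) = a. -/
theorem wronskian_eq_real (h : IsLagrangian m q Y X)
    (hY : ∀ x, Y x = x - ∫ ξ in Ioi x, (m ξ - 1)) {a : ℂ → ℂ} {b : ℝ → ℂ}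
    (hs : IsSpectralPair m a b) (y : ℝ) {μ : ℝ} (h0 : μ ≠ 0) (h1 : μ ≠ 1) (h2 : μ ≠ -1) :
    a μ = wronskian (fun μ => jost q μ y) (fun μ => jostRight q μ y) μ := by
  obtain ⟨e1, e2⟩ := h.scattering_real hY hs y h0 h1 h2
  have hd := h.isPotential.jost_det_real h0 y
  rw [wronskian, e1, e2]
  linear_combination (-a μ) * hd

theorem isScattering (h : IsLagrangian m q Y X) (hY : ∀ x, Y x = x - ∫ ξ in Ioi x, (m ξ - 1))
    {D : RHData} {u₀ : ℝ → ℝ} (hm : m = fun x => u₀ x - iteratedDeriv 2 u₀ x)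
    (hD : D.IsAssociatedWith u₀) (y : ℝ) :
    ∃ b, D.IsScattering y 0 (fun μ => jost q μ y) (fun μ => jostRight q μ y) b := by
  subst hm
  obtain ⟨a, b, hs, hr, hc, -, hrange, hres⟩ := hD
  have hup : ∀ μ : ℂ, 0 < μ.im → a μ = wronskian (fun μ => jost q μ y) (fun μ => jostRight q μ y) μ :=
    fun μ => h.wronskian_eq hs y
  refine ⟨b, ?_, ?_, ?_, hc.congr hup, ?_, ?_⟩
  · intro μ h0 h1 h2
    rw [hr μ h0 h1 h2, h.wronskian_eq_real hY hs y h0 h1 h2]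
  · intro μ h0 h1 h2
    rw [← h.wronskian_eq_real hY hs y h0 h1 h2]
    exact (h.scattering_real hY hs y h0 h1 h2).1
  · intro μ h0 h1 h2
    rw [← h.wronskian_eq_real hY hs y h0 h1 h2]
    exact (h.scattering_real hY hs y h0 h1 h2).2
  · intro μ
    rw [hrange]
    exact and_congr_right fun hμ => by rw [hup μ hμ]
  · intro j
    obtain ⟨hd, δ, hρ, φm, φp, hjm, hjp, hφ⟩ := hres j
    have him : 0 < (D.pole j).im := ((hrange _).1 (mem_range_self j)).1
    have hderiv : deriv a (D.pole j) =
        deriv (wronskian (fun μ => jost q μ y) (fun μ => jostRight q μ y)) (D.pole j) := by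
      refine Filter.EventuallyEq.deriv_eq ?_
      filter_upwards [Complex.continuous_im.continuousAt.eventually (lt_mem_nhds him)] with μ hμ
        using hup μ hμ
    have hδ : δ ≠ 0 := by
      rintro rfl
      exact hjp.ne_zero (funext fun x => by rw [hφ x, zero_mul, zero_smul, Pi.zero_apply])
    have hph : phaseZero (fun x => u₀ x - iteratedDeriv 2 u₀ x) (X y) (D.pole j) =
        phaseHat y 0 (D.pole j) := by
      rw [phaseHat_zero, phaseZero, ← hY, h.right_inv]
    obtain ⟨e1, e2⟩ := h.jostMinus_zero him.le (ne_of_im_pos him).1 hjm (X y)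
    obtain ⟨e3, e4⟩ := h.jostPlus_one him.le (ne_of_im_pos him).1 hjp (X y)
    rw [h.right_inv] at e1 e2 e3 e4
    have g := hφ (X y)
    rw [hph] at g
    rw [← hderiv]
    refine ⟨hd, δ, hδ, hρ, ?_, ?_⟩
    · rw [← e3, ← e1, g, Pi.smul_apply, smul_eq_mul]
    · rw [← e4, ← e2, g, Pi.smul_apply, smul_eq_mul]

end IsLagrangian

namespace IsCauchySolution

variable {u₀ : ℝ → ℝ} {u : ℝ → ℝ → ℝ}

theorem momentum_zero (hu : IsCauchySolution u₀ u) :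
    (fun x => momentum u x 0) = fun x => u₀ x - iteratedDeriv 2 u₀ x := by
  have h1 : (fun z => u z 0) = u₀ := funext hu.initial
  funext x
  rw [momentum, h1, hu.initial]

theorem isLagrangian (hu : IsCauchySolution u₀ u) (hpos : ∀ x, 0 < u₀ x - iteratedDeriv 2 u₀ x) :
    IsLagrangian (fun x => momentum u x 0) (potential u 0) (fun x => label u x 0)
      (fun y => position u y 0) where
  isPotential := (hu.isEvolution hpos).isPotential le_rfl
  pos := hu.momentum_pos hpos le_rfl
  continuous := hu.continuous_momentum le_rfl
  hasDerivAt := hu.hasDerivAt_label le_rfl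
  continuous_inv := hu.continuous_position hpos le_rfl
  right_inv := hu.label_position hpos le_rfl
  left_inv := hu.position_label hpos le_rfl
  potential_eq x := by rw [potential, hu.position_label hpos le_rfl]

theorem ratio_eq (hu : IsCauchySolution u₀ u) (hpos : ∀ x, 0 < u₀ x - iteratedDeriv 2 u₀ x)
    {D : RHData} (hD : D.IsAssociatedWith u₀) {M : ℝ → ℝ → ℂ → Matrix (Fin 2) (Fin 2) ℂ}
    (hM : ∀ y t : ℝ, 0 ≤ t → D.IsSolution y t (M y t)) (y : ℝ) {t : ℝ} (ht : 0 ≤ t) :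
    muHat₁ M y t / muHat₂ M y t = ((Real.exp (position u y t - t - y) : ℝ) : ℂ) := by
  obtain ⟨b, hb⟩ := (hu.isLagrangian hpos).isScattering (fun x => by rw [label, sub_zero])
    hu.momentum_zero hD y
  rw [hu.position_sub_eq hpos ht]
  exact (hu.isEvolution hpos).ratio_eq hb ht (hM y t ht)

theorem logRatio_eq (hu : IsCauchySolution u₀ u) (hpos : ∀ x, 0 < u₀ x - iteratedDeriv 2 u₀ x)
    {D : RHData} (hD : D.IsAssociatedWith u₀) {M : ℝ → ℝ → ℂ → Matrix (Fin 2) (Fin 2) ℂ}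
    (hM : ∀ y t : ℝ, 0 ≤ t → D.IsSolution y t (M y t)) (y : ℝ) {t : ℝ} (ht : 0 ≤ t) :
    logRatio M y t = position u y t - t - y := by
  rw [logRatio, hu.ratio_eq hpos hD hM y ht, Complex.ofReal_re, Real.log_exp]

theorem xOf_eq (hu : IsCauchySolution u₀ u) (hpos : ∀ x, 0 < u₀ x - iteratedDeriv 2 u₀ x)
    {D : RHData} (hD : D.IsAssociatedWith u₀) {M : ℝ → ℝ → ℂ → Matrix (Fin 2) (Fin 2) ℂ}
    (hM : ∀ y t : ℝ, 0 ≤ t → D.IsSolution y t (M y t)) (y : ℝ) {t : ℝ} (ht : 0 ≤ t) :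
    xOf M y t = position u y t - t := by
  rw [xOf, hu.logRatio_eq hpos hD hM y ht]
  ring

end IsCauchySolution

end MCH
end

/-! ### The parametric representation of the solution -/

theorem mainTheorem2 (u₀ : ℝ → ℝ) (u : ℝ → ℝ → ℝ)
    (hu : MCH.IsCauchySolution u₀ u)
    (hpos : ∀ x, 0 < u₀ x - iteratedDeriv 2 u₀ x)
    (D : MCH.RHData) (hD : D.IsAssociatedWith u₀)
    (M : ℝ → ℝ → ℂ → Matrix (Fin 2) (Fin 2) ℂ)
    (hM : ∀ y t : ℝ, 0 ≤ t → D.IsSolution y t (M y t)) :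
    -- the quotient is a positive real number, so that its logarithm makes sense
    (∀ y t : ℝ, 0 ≤ t →
      (MCH.muHat₁ M y t / MCH.muHat₂ M y t).im = 0 ∧
      0 < (MCH.muHat₁ M y t / MCH.muHat₂ M y t).re) ∧
    -- the parameter `y` covers the whole line exactly once
    (∀ t : ℝ, 0 ≤ t → Function.Bijective (fun y => MCH.xOf M y t)) ∧
    -- `u_x(x(y,t) + t, t) = ½ ∂_t ∂_y ln (μ̂₁ / μ̂₂) = ½ ∂_y ∂_t ln (μ̂₁ / μ̂₂)`
    (∀ y t : ℝ, 0 < t →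
      DifferentiableAt ℝ (fun z => MCH.logRatio M z t) y ∧
      DifferentiableAt ℝ (fun s => MCH.logRatio M y s) t ∧
      HasDerivAt (fun s => (1 / 2) * deriv (fun z => MCH.logRatio M z s) y)
        (MCH.dx u (MCH.xOf M y t + t) t) t ∧
      HasDerivAt (fun z => (1 / 2) * deriv (fun s => MCH.logRatio M z s) t)
        (MCH.dx u (MCH.xOf M y t + t) t) y) := by
  have hlog := fun y {t} => hu.logRatio_eq hpos hD hM y (t := t)
  have hy : ∀ t, 0 ≤ t → ∀ y, HasDerivAt (fun z => MCH.logRatio M z t) (-MCH.potential u t y) y := by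
    intro t ht y
    rw [funext fun z => hlog z ht]
    refine (((hu.hasDerivAt_position hpos ht y).sub_const t).fun_sub (hasDerivAt_id y)).congr_deriv ?_
    rw [MCH.potential, neg_sub]
  have ht : ∀ y t, 0 < t → HasDerivAt (fun s => MCH.logRatio M y s)
      (MCH.speed u (MCH.position u y t) t - 1) t := by
    intro y t ht
    refine HasDerivAt.congr_of_eventuallyEq (((hu.hasDerivAt_position_time hpos y ht).fun_sub
      (hasDerivAt_id t)).sub_const y) ?_
    filter_upwards [lt_mem_nhds ht] with s hs using hlog y (le_of_lt hs)
  refine ⟨fun y t h => ?_, fun t h => ?_, fun y t h => ⟨(hy t h.le y).differentiableAt,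
    (ht y t h).differentiableAt, ?_, ?_⟩⟩
  · rw [hu.ratio_eq hpos hD hM y h, Complex.ofReal_im, Complex.ofReal_re]
    exact ⟨rfl, Real.exp_pos _⟩
  · have h1 : (fun y => MCH.xOf M y t) = (fun x => x - t) ∘ fun y => MCH.position u y t :=
      funext fun y => hu.xOf_eq hpos hD hM y h
    rw [h1]
    exact (Equiv.subRight t).bijective.comp (hu.bijective_position hpos h)
  -- The y-derivative of the logarithm is -q, and along the flow q_t = -2 u_x.
  · rw [hu.xOf_eq hpos hD hM y h.le, sub_add_cancel]
    have h1 := ((hu.isEvolution hpos).hasDerivAt_q t h y).fun_neg.const_mul (1 / 2)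
    refine (h1.congr_of_eventuallyEq ?_).congr_deriv (by ring)
    filter_upwards [lt_mem_nhds h] with s hs
    rw [(hy s (le_of_lt hs) y).deriv]
  -- The t-derivative is u² - u_x² - 1; its y-derivative is 2 u_x m times X_y = 1/m.
  · rw [hu.xOf_eq hpos hD hM y h.le, sub_add_cancel]
    have h1 := ((((hu.hasDerivAt_speed h.le (MCH.position u y t)).comp y
      (hu.hasDerivAt_position hpos h.le y))).sub_const 1).const_mul (1 / 2)
    rw [funext fun z => congrArg (fun a => 1 / 2 * a) (ht z t h).deriv]
    refine h1.congr_deriv ?_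
    have := (hu.momentum_pos hpos h.le (MCH.position u y t)).ne'
    field_simp
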